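/- Let $R$ be a commutative ring; $\otimes=\otimes_R$, and all gradings are indexed by the non-negative integers. Signs in front of homogeneous elements are written with their degrees $|c|$. **Categorical coalgebras.** A categorical coalgebra is a graded, $R$-flat, coassociative counital coalgebra $C=\bigoplus_{n\ge 0}C_n$ (coproduct $\Delta(c)=\sum c'\otimes c''$, counit $\varepsilon$, both of degree $0$) with a map $\partial:C\to C$ of degree $-1$ satisfying $\Delta\partial=(\partial\otimes\mathrm{id}+\mathrm{id}\otimes\partial)\Delta$ (Koszul signs) and a map $h:C\to R$ of degree $-2$ (so $h$ vanishes outside $C_2$), such that: $h\partial=0$ and $\partial^2=(h\otimes \mathrm{id})(\Delta-\Delta^{op})$, where $\Delta^{op}$ is $\Delta$ followed by the signed flip; the set $S(C)$ of set-like elements ($x\in C_0$, $\Delta x=x\otimes x$, $\varepsilon(x)=1$) is non-empty and is an $R$-basis of $C_0$; and $\partial$ followed by the projection $C\to C_0$ is zero. For $x,y\in S(C)$ let $C(x,y)=R_x\square_{C_0}C\,\square_{C_0}R_y$ be the part of $C$ on which the left coaction of $C_0$ is $c\mapsto x\otimes c$ and the right coaction is $c\mapsto c\otimes y$. A morphism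 $C\to C'$ is a pair $(f_0,f_1)$, where $f_0:C\to C'$ is a degree $0$ morphism of counital coalgebras and $f_1:C\to C'_0$ is a map of $C'_0$-bicomodules of degree $-1$, such that, with $\bar f_1=\varepsilon' f_1$, $$f_0\partial=\partial' f_0+(\bar f_1\otimes f_0)(\Delta-\Delta^{op}),\qquad h'(f_0c)=h(c)-\bar f_1(\partial c)+\sum\bar f_1(c')\bar f_1(c'').$$ **Cobar construction.** $\mathbf\Omega C$ is the dg category whose objects are the elements of $S(C)$ and whose morphisms $x\to y$ are the linear combinations of words $\{c_1|\cdots|c_p\}$, $p\ge 0$, with $c_i\in C(x_{i-1},x_i)$ homogeneous of positive degree, $x_0=x$, $x_p=y$ (multilinear in the letters); its degree is $\sum(|c_i|-1)$. Composition is concatenation (in diagrammatic order), the empty word at $x$ is $\mathrm{id}_x$, and the differential $D$ is the derivation of degree $-1$ with $$D\{c\}=h(c)\,\mathrm{id}-\{\partial c\}-\sum(-1)^{|c'|}\{c'|c''\},$$ letters of degree $0$ being read as zero. A morphism $f=(f_0,f_1)$ induces the dg functor $\mathbf\Omega f$ that is $f_0$ on objects and satisfies $\{c\}\mapsto\{f_0c\}+\bar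 f_1(c)\,\mathrm{id}$. **Hochschild complex.** For a dg category $A$, $\mathrm{Hoch}_\bullet(A)$ is the module of linear combinations of the $[a_1|\cdots|a_p]a$, $p\ge0$, with $a_1,\dots,a_p,a$ cyclically composable homogeneous morphisms (multilinear in all entries), in degree $|a|+\sum(|a_i|+1)$, modulo those in which some $a_i$ with $1\le i\le p$ is an identity. Put $\epsilon_i=\sum_{j\le i}(|a_j|+1)$. The differential $\delta$ sends $[a_1|\cdots|a_p]a$ to $$\sum_{i=1}^p(-1)^{\epsilon_{i-1}+1}[\cdots|da_i|\cdots]a+(-1)^{\epsilon_p}[a_1|\cdots|a_p]da+\sum_{i=1}^{p-1}(-1)^{\epsilon_{i-1}+|a_i|}[\cdots|a_ia_{i+1}|\cdots]a$$ $$+(-1)^{\epsilon_{p-1}}[a_1|\cdots|a_{p-1}]a_pa-(-1)^{|a_1|(|a|+\epsilon_p-\epsilon_1)}[a_2|\cdots|a_p]aa_1,$$ the last two terms being present only for $p\ge1$. Connes' operator is, with $a_{p+1}=a$, $$B([a_1|\cdots|a_p]a)=(-1)^{\epsilon_p}\sum_{i=1}^{p+1}\pm[a_i|\cdots|a_{p+1}|a_1|\cdots|a_{i-1}]\,\mathrm{id},$$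 where $\mathrm{id}$ is the identity of the source of $a_i$ and $\pm$ is the Koszul sign of the rotation, each $a_j$ being counted in degree $|a_j|+1$. **CoHochschild complex.** $\mathrm{coHoch}_\bullet(C)$ is the module of linear combinations of the $c_0\{w\}$, where $c_0\in C(x,y)$ is homogeneous and $w=\{c_1|\cdots|c_p\}$ is a word that is a morphism $y\to x$ of $\mathbf\Omega C$, in degree $|c_0|+|w|$, where $|w|=\sum_{i\ge1}(|c_i|-1)$. Its differential is $$d(c\{w\})=\partial c\,\{w\}+(-1)^{|c|}c\{Dw\}+\sum(-1)^{|c'|}c'\{c''|w\}-\sum(-1)^{(|c'|-1)(|c''|+|w|)}c''\{w|c'\},$$ terms with a letter of degree $0$ inside the braces being zero, and $$P(c_0\{c_1|\cdots|c_p\})=\sum_{i=1}^p\pm\varepsilon(c_0)\,c_i\{c_{i+1}|\cdots|c_p|c_1|\cdots|c_{i-1}\},$$ where $\pm$ is the Koszul sign of the rotation, each $c_j$ being counted in degree $|c_j|-1$. A morphism $f$ induces $\mathrm{coHoch}(f): c_0\{w\}\mapsto f_0(c_0)\{(\mathbf\Omega f)(w)\}$. **The comparison map.** $\overline\pi:\mathrm{Hoch}_\bullet(\mathbf\Omega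 C)\to\mathrm{coHoch}_\bullet(C)$ is the linear map given by $\overline\pi([\,]b)=x\{b\}$ for $b\in\mathbf\Omega C(x,x)$, by $$\overline\pi([\{c_1|\cdots|c_q\}]b)=\sum_{i=1}^q\pm c_i\{c_{i+1}|\cdots|c_q|\,b\,|c_1|\cdots|c_{i-1}\},$$ where $\pm$ is the sign $(-1)^{m_in_i}$ with $m_i=\sum_{j<i}(|c_j|-1)$ and $n_i=\sum_{j\ge i}(|c_j|-1)+|b|$, and by $\overline\pi([a_1|\cdots|a_p]b)=0$ for $p\ge2$. A mixed complex is a non-negatively graded module with operators $b$ of degree $-1$ and $B$ of degree $+1$ such that $b^2=0$, $B^2=0$ and $bB+Bb=0$; a morphism is a degree $0$ linear map commuting with both operators; it is a quasi-isomorphism if it induces an isomorphism on the homology with respect to $b$ in every degree. **Proposition.** For every categorical coalgebra $C$, $(\mathrm{Hoch}_\bullet(\mathbf\Omega C),\delta,B)$ and $(\mathrm{coHoch}_\bullet(C),d,P)$ are mixed complexes, and $\overline\pi$ is a quasi-isomorphism of mixed complexes between them: $\overline\pi\delta=d\overline\pi$, $\overline\pi B=P\overline\pi$, and $\overline\pi$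 induces an isomorphism $H_n(\mathrm{Hoch}_\bullet(\mathbf\Omega C),\delta)\to H_n(\mathrm{coHoch}_\bullet(C),d)$ for every $n\ge0$. Moreover $\overline\pi$ is natural: for every morphism $f:C\to C'$ of categorical coalgebras, $\mathrm{Hoch}(\mathbf\Omega f)$ (entrywise application of $\mathbf\Omega f$) and $\mathrm{coHoch}(f)$ are morphisms of mixed complexes and $\mathrm{coHoch}(f)\circ\overline\pi_C=\overline\pi_{C'}\circ\mathrm{Hoch}(\mathbf\Omega f)$. -/

import Mathlib

open scoped TensorProduct DirectSum

universe u v w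

noncomputable section

namespace CobarHoch

/-! ### Graded modules and the Koszul sign rule -/

section Graded

variable {R : Type u} [CommRing R] {M : Type v} [AddCommGroup M] [Module R M]
variable (𝒜 : ℕ → Submodule R M) [DirectSum.Decomposition 𝒜]

/-- The operator multiplying the degree `n` component of a graded module by the scalar `s n`. -/
def gradedScale (s : ℕ → R) : M →ₗ[R] M :=
  DirectSum.toModule R ℕ M (fun n => s n • (𝒜 n).subtype) ∘ₗ
    (DirectSum.decomposeLinearEquiv 𝒜).toLinearMap

/-- The grading involution `c ↦ (-1) ^ |c| c`. -/
def gradedSign : M →ₗ[R] M := gradedScale 𝒜 (fun n => (-1) ^ n)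

/-- The projection onto the part of odd degree. -/
def oddPart : M →ₗ[R] M := gradedScale 𝒜 (fun n => if Odd n then 1 else 0)

/-- The projection onto the part of even degree. -/
def evenPart : M →ₗ[R] M := gradedScale 𝒜 (fun n => if Even n then 1 else 0)

/-- The projection onto the component of degree `0`. -/
def projZero : M →ₗ[R] M := gradedScale 𝒜 (fun n => if n = 0 then 1 else 0)

/-- The projection onto the sum of the components of positive degree. -/
def projPos : M →ₗ[R] M := gradedScale 𝒜 (fun n => if n = 0 then 0 else 1)

/-- The symmetry `t (c ⊗ c') = (-1) ^ (|c| |c'|) c' ⊗ c`. -/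
def koszulSwap : M ⊗[R] M →ₗ[R] M ⊗[R] M :=
  (TensorProduct.comm R M M).toLinearMap ∘ₗ
    (TensorProduct.map (evenPart 𝒜) LinearMap.id +
      TensorProduct.map (oddPart 𝒜) (gradedSign 𝒜))

theorem gradedScale_mem (s : ℕ → R) {n : ℕ} {c : M} (hc : c ∈ 𝒜 n) :
    gradedScale 𝒜 s c = s n • c := by
  lift c to 𝒜 n using hc
  simp only [gradedScale, LinearMap.comp_apply, LinearEquiv.coe_coe,
    DirectSum.decomposeLinearEquiv_apply, DirectSum.decompose_coe]
  exact DirectSum.toModule_lof (M := fun i => 𝒜 i) R (φ := fun n => s n • (𝒜 n).subtype) n c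

theorem graded_induction {p : M → Prop} (h0 : p 0) (hadd : ∀ a b, p a → p b → p (a + b))
    (hmem : ∀ n, ∀ c ∈ 𝒜 n, p c) (c : M) : p c :=
  DirectSum.Decomposition.inductionOn 𝒜 h0 (fun {n} m => hmem n m m.2) hadd c

theorem graded_hom_ext {N : Type w} [AddCommGroup N] [Module R N] {f g : M →ₗ[R] N}
    (h : ∀ n, ∀ c ∈ 𝒜 n, f c = g c) : f = g := by
  ext c
  refine graded_induction 𝒜 (p := fun c => f c = g c) (by simp) ?_ h c
  intro a b ha hb
  simp [ha, hb]

/-- The degree `n` component of the tensor square of a graded module. -/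
def tensorDegree (n : ℕ) : Submodule R (M ⊗[R] M) :=
  Submodule.span R {t | ∃ i j : ℕ, i + j = n ∧ ∃ a ∈ 𝒜 i, ∃ b ∈ 𝒜 j, t = a ⊗ₜ[R] b}

end Graded


/-! ### Words: operations on tensor algebras -/

section Words

variable {R : Type u} [CommRing R] {V : Type v} [AddCommGroup V] [Module R V]

theorem word_induction {p : TensorAlgebra R V → Prop} (one : p 1)
    (add : ∀ a b, p a → p b → p (a + b)) (smul : ∀ (r : R) a, p a → p (r • a))
    (cons : ∀ v w, p w → p (TensorAlgebra.ι R v * w)) (w : TensorAlgebra R V) : p w := by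
  have key : ∀ s : TensorAlgebra R V, ∀ t, p t → p (s * t) := by
    intro s
    induction s using TensorAlgebra.induction with
    | algebraMap r =>
      intro t ht
      rw [← Algebra.smul_def]
      exact smul r t ht
    | ι v => exact fun t ht => cons v t ht
    | mul a b ha hb =>
      intro t ht
      rw [mul_assoc]
      exact ha _ (hb t ht)
    | add a b ha hb =>
      intro t ht
      rw [add_mul]
      exact add _ _ (ha t ht) (hb t ht)
  simpa using key w 1 one

theorem word_hom_ext {X : Type w} [AddCommGroup X] [Module R X]
    {f g : TensorAlgebra R V →ₗ[R] X} (one : f 1 = g 1)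
    (cons : ∀ v w, f w = g w → f (TensorAlgebra.ι R v * w) = g (TensorAlgebra.ι R v * w)) :
    f = g := by
  ext w
  refine word_induction (p := fun w => f w = g w) one ?_ ?_ cons w
  · intro a b ha hb
    simp [ha, hb]
  · intro r a ha
    simp [ha]

theorem ιInv_one : TensorAlgebra.ιInv (1 : TensorAlgebra R V) = 0 := by
  let _ : Module Rᵐᵒᵖ V := Module.compHom _ ((RingHom.id R).fromOpposite mul_comm)
  have _ : IsCentralScalar R V := ⟨fun r m => rfl⟩
  have h : (TensorAlgebra.toTrivSqZeroExt (1 : TensorAlgebra R V)).snd = 0 := by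
    rw [map_one, TrivSqZeroExt.snd_one]
  exact h

theorem ιInv_cons_cons (a a' : V) (t : TensorAlgebra R V) :
    TensorAlgebra.ιInv (TensorAlgebra.ι R a * (TensorAlgebra.ι R a' * t)) = 0 := by
  let _ : Module Rᵐᵒᵖ V := Module.compHom _ ((RingHom.id R).fromOpposite mul_comm)
  have _ : IsCentralScalar R V := ⟨fun r m => rfl⟩
  have h : (TensorAlgebra.toTrivSqZeroExt
      (TensorAlgebra.ι R a * (TensorAlgebra.ι R a' * t))).snd = 0 := by
    rw [map_mul, map_mul, TensorAlgebra.toTrivSqZeroExt_ι, TensorAlgebra.toTrivSqZeroExt_ι,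
      ← mul_assoc, TrivSqZeroExt.inr_mul_inr, zero_mul, TrivSqZeroExt.snd_zero]
  exact h

/-- Recursion on words: the linear map with `F 1 = x₀` and `F (v w) = f v (F w)`. -/
def wordFold {X : Type w} [AddCommGroup X] [Module R X] (f : V →ₗ[R] Module.End R X) (x₀ : X) :
    TensorAlgebra R V →ₗ[R] X :=
  LinearMap.applyₗ x₀ ∘ₗ (TensorAlgebra.lift R f).toLinearMap

@[simp]
theorem wordFold_one {X : Type w} [AddCommGroup X] [Module R X] (f : V →ₗ[R] Module.End R X)
    (x₀ : X) : wordFold f x₀ 1 = x₀ := by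
  simp [wordFold]

@[simp]
theorem wordFold_cons {X : Type w} [AddCommGroup X] [Module R X] (f : V →ₗ[R] Module.End R X)
    (x₀ : X) (v : V) (t : TensorAlgebra R V) :
    wordFold f x₀ (TensorAlgebra.ι R v * t) = f v (wordFold f x₀ t) := by
  simp [wordFold]

/-- The recursion step for `pick`. -/
def pickStep : V →ₗ[R] Module.End R (TensorAlgebra R V ×
    (TensorAlgebra R V ⊗[R] (V ⊗[R] TensorAlgebra R V))) :=
  LinearMap.mk₂ R (fun v p => (TensorAlgebra.ι R v * p.1,
      1 ⊗ₜ (v ⊗ₜ p.1) +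
        TensorProduct.map (LinearMap.mulLeft R (TensorAlgebra.ι R v)) LinearMap.id p.2))
    (fun v v' p => by
      have h : LinearMap.mulLeft R (TensorAlgebra.ι R (v + v')) =
          LinearMap.mulLeft R (TensorAlgebra.ι R v) +
            LinearMap.mulLeft R (TensorAlgebra.ι R v') := by
        ext; simp [add_mul]
      ext
      · simp [add_mul]
      · simp only [h, TensorProduct.map_add_left, TensorProduct.add_tmul,
          TensorProduct.tmul_add, LinearMap.add_apply, Prod.snd_add]
        abel)
    (fun r v p => by
      have h : LinearMap.mulLeft R (TensorAlgebra.ι R (r • v)) =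
          r • LinearMap.mulLeft R (TensorAlgebra.ι R v) := by
        ext; simp
      ext
      · simp
      · simp only [h, TensorProduct.map_smul_left, ← TensorProduct.smul_tmul',
          LinearMap.smul_apply, TensorProduct.tmul_smul, Prod.smul_snd, smul_add])
    (fun v p q => by
      ext
      · simp [mul_add]
      · simp only [Prod.fst_add, Prod.snd_add, TensorProduct.tmul_add, map_add]
        abel)
    (fun r v p => by
      ext <;> simp)

theorem pickStep_apply (v : V) (p : TensorAlgebra R V ×
    (TensorAlgebra R V ⊗[R] (V ⊗[R] TensorAlgebra R V))) :
    pickStep v p = (TensorAlgebra.ι R v * p.1, 1 ⊗ₜ (v ⊗ₜ p.1) +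
      TensorProduct.map (LinearMap.mulLeft R (TensorAlgebra.ι R v)) LinearMap.id p.2) := rfl

/-- The sum `∑ u ⊗ (v ⊗ w)` over all ways of writing a word as `u v w` with `v` a letter. -/
def pick : TensorAlgebra R V →ₗ[R] TensorAlgebra R V ⊗[R] (V ⊗[R] TensorAlgebra R V) :=
  LinearMap.snd R _ _ ∘ₗ wordFold pickStep (1, 0)

@[simp]
theorem pick_one : pick (1 : TensorAlgebra R V) = 0 := by simp [pick]

@[simp]
theorem pick_cons (v : V) (t : TensorAlgebra R V) :
    pick (TensorAlgebra.ι R v * t) = 1 ⊗ₜ (v ⊗ₜ t) +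
      TensorProduct.map (LinearMap.mulLeft R (TensorAlgebra.ι R v)) LinearMap.id (pick t) := by
  have h : ∀ t : TensorAlgebra R V, (wordFold pickStep (1, 0) t).1 = t := by
    intro t
    refine word_induction (p := fun t => (wordFold pickStep (1, 0) t).1 = t) (by simp) ?_ ?_ ?_ t
    · intro a b ha hb
      simp [ha, hb]
    · intro r a ha
      simp [ha]
    · intro v w hw
      simp [pickStep_apply, hw]
  simp [pick, pickStep_apply, h t]

/-- Split off the first letter of a word: `v w ↦ v ⊗ w`, and `1 ↦ 0`. -/
def uncons : TensorAlgebra R V →ₗ[R] V ⊗[R] TensorAlgebra R V :=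
  (TensorProduct.lid R _).toLinearMap ∘ₗ
    TensorProduct.map TensorAlgebra.algebraMapInv.toLinearMap LinearMap.id ∘ₗ pick

@[simp]
theorem uncons_one : uncons (1 : TensorAlgebra R V) = 0 := by simp [uncons]

@[simp]
theorem uncons_cons (v : V) (t : TensorAlgebra R V) :
    uncons (TensorAlgebra.ι R v * t) = v ⊗ₜ t := by
  have h : ∀ z : TensorAlgebra R V ⊗[R] (V ⊗[R] TensorAlgebra R V),
      TensorProduct.map TensorAlgebra.algebraMapInv.toLinearMap LinearMap.id
        (TensorProduct.map (LinearMap.mulLeft R (TensorAlgebra.ι R v)) LinearMap.id z) = 0 := by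
    intro z
    induction z with
    | zero => simp
    | tmul a b => simp [TensorAlgebra.algebraMapInv]
    | add a b ha hb => simp only [map_add, ha, hb, add_zero]
  rw [uncons, LinearMap.comp_apply, LinearMap.comp_apply, pick_cons, map_add, h]
  simp

/-- The linear map `v ⊗ w ↦ f(v) w`. -/
def consMap (f : V →ₗ[R] V) : V ⊗[R] TensorAlgebra R V →ₗ[R] TensorAlgebra R V :=
  LinearMap.mul' R _ ∘ₗ TensorProduct.map (TensorAlgebra.ι R ∘ₗ f) LinearMap.id

@[simp]
theorem consMap_tmul (f : V →ₗ[R] V) (v : V) (t : TensorAlgebra R V) :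
    consMap f (v ⊗ₜ t) = TensorAlgebra.ι R (f v) * t := by
  simp [consMap]

theorem consMap_add (f g : V →ₗ[R] V) : consMap (f + g) = consMap f + consMap g := by
  refine TensorProduct.ext' fun v t => ?_
  simp [add_mul]

theorem consMap_smul (r : R) (f : V →ₗ[R] V) : consMap (r • f) = r • consMap f := by
  refine TensorProduct.ext' fun v t => ?_
  simp

/-! In the rest of this section `e` and `o` are the projections of the module of letters onto
its parts of even and of odd degree. -/

variable (e o : V →ₗ[R] V)

/-- The grading involution `w ↦ (-1) ^ |w| w` of the tensor algebra. -/
def wordSign : TensorAlgebra R V →ₐ[R] TensorAlgebra R V :=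
  TensorAlgebra.lift R (TensorAlgebra.ι R ∘ₗ (e - o))

@[simp]
theorem wordSign_ι (v : V) : wordSign e o (TensorAlgebra.ι R v) = TensorAlgebra.ι R (e v - o v) := by
  simp [wordSign]

/-- The recursion step for `wordParity`. -/
def parityStep : V →ₗ[R] Module.End R (TensorAlgebra R V × TensorAlgebra R V) :=
  LinearMap.mk₂ R (fun v p =>
      (TensorAlgebra.ι R (e v) * p.1 + TensorAlgebra.ι R (o v) * p.2,
        TensorAlgebra.ι R (e v) * p.2 + TensorAlgebra.ι R (o v) * p.1))
    (fun v v' p => by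
      ext <;> simp only [map_add, add_mul, Prod.fst_add, Prod.snd_add] <;> abel)
    (fun r v p => by
      ext <;> simp)
    (fun v p q => by
      ext <;> simp only [mul_add, Prod.fst_add, Prod.snd_add] <;> abel)
    (fun r v p => by
      ext <;> simp)

/-- The pair (part of even degree, part of odd degree) of an element of the tensor algebra. -/
def wordParity : TensorAlgebra R V →ₗ[R] TensorAlgebra R V × TensorAlgebra R V :=
  wordFold (parityStep e o) (1, 0)

/-- The part of even degree of an element of the tensor algebra. -/
def wordEven : TensorAlgebra R V →ₗ[R] TensorAlgebra R V := LinearMap.fst R _ _ ∘ₗ wordParity e o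

/-- The part of odd degree of an element of the tensor algebra. -/
def wordOdd : TensorAlgebra R V →ₗ[R] TensorAlgebra R V := LinearMap.snd R _ _ ∘ₗ wordParity e o

@[simp]
theorem wordEven_one : wordEven e o 1 = 1 := by simp [wordEven, wordParity]

@[simp]
theorem wordOdd_one : wordOdd e o 1 = 0 := by simp [wordOdd, wordParity]

@[simp]
theorem wordEven_cons (v : V) (t : TensorAlgebra R V) :
    wordEven e o (TensorAlgebra.ι R v * t) = TensorAlgebra.ι R (e v) * wordEven e o t +
      TensorAlgebra.ι R (o v) * wordOdd e o t := by
  simp [wordEven, wordOdd, wordParity, parityStep]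

@[simp]
theorem wordOdd_cons (v : V) (t : TensorAlgebra R V) :
    wordOdd e o (TensorAlgebra.ι R v * t) = TensorAlgebra.ι R (e v) * wordOdd e o t +
      TensorAlgebra.ι R (o v) * wordEven e o t := by
  simp [wordEven, wordOdd, wordParity, parityStep]

/-- The linear map `u ⊗ (v ⊗ w) ↦ (-1) ^ (|u| (|v| + |w|)) v ⊗ w u`. -/
def moveToEnd : TensorAlgebra R V ⊗[R] (V ⊗[R] TensorAlgebra R V) →ₗ[R]
    V ⊗[R] TensorAlgebra R V :=
  TensorProduct.map LinearMap.id (LinearMap.mul' R _) ∘ₗ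
    (TensorProduct.assoc R _ _ _).toLinearMap ∘ₗ (TensorProduct.comm R _ _).toLinearMap ∘ₗ
      (TensorProduct.map (wordEven e o) LinearMap.id +
        TensorProduct.map (wordOdd e o)
          (TensorProduct.map (e - o) (wordSign e o).toLinearMap))

theorem moveToEnd_tmul (u : TensorAlgebra R V) (v : V) (t : TensorAlgebra R V) :
    moveToEnd e o (u ⊗ₜ (v ⊗ₜ t)) = v ⊗ₜ (t * wordEven e o u) +
      (e v - o v) ⊗ₜ (wordSign e o t * wordOdd e o u) := by
  simp [moveToEnd]

/-- The sum `∑ ± v ⊗ w u` over all ways of writing a word as `u v w` with `v` a letter, with the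
sign `(-1) ^ (|u| (|v| + |w|))`. -/
def rotations : TensorAlgebra R V →ₗ[R] V ⊗[R] TensorAlgebra R V := moveToEnd e o ∘ₗ pick

end Words

/-! ### Mixed complexes -/

section Mixed

/-- The data underlying a mixed complex: modules `X n` for `n ≥ 0` with operators `b` of
degree `-1` and `B` of degree `1`. -/
structure PreMixedComplex (R : Type u) [CommRing R] where
  X : ℕ → Type v
  [addCommGroup : ∀ n, AddCommGroup (X n)]
  [module : ∀ n, Module R (X n)]
  b : ∀ n, X (n + 1) →ₗ[R] X n
  B : ∀ n, X n →ₗ[R] X (n + 1)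

attribute [instance] PreMixedComplex.addCommGroup PreMixedComplex.module

namespace PreMixedComplex

variable {R : Type u} [CommRing R]

/-- The equations `b² = 0`, `B² = 0` and `b B + B b = 0` of a mixed complex. -/
structure IsMixedComplex (M : PreMixedComplex.{u, v} R) : Prop where
  b_b : ∀ n, M.b n ∘ₗ M.b (n + 1) = 0
  B_B : ∀ n, M.B (n + 1) ∘ₗ M.B n = 0
  b_B_zero : M.b 0 ∘ₗ M.B 0 = 0
  b_B : ∀ n, M.b (n + 1) ∘ₗ M.B (n + 1) + M.B n ∘ₗ M.b n = 0

/-- Degree-preserving linear maps. -/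
abbrev GradedMap (M N : PreMixedComplex.{u, v} R) : Type _ := ∀ n, M.X n →ₗ[R] N.X n

/-- A morphism of mixed complexes: a degree-preserving linear map that commutes with both
operators. -/
structure IsMorphism {M N : PreMixedComplex.{u, v} R} (f : GradedMap M N) : Prop where
  comm_b : ∀ n, f n ∘ₗ M.b n = N.b n ∘ₗ f (n + 1)
  comm_B : ∀ n, f (n + 1) ∘ₗ M.B n = N.B n ∘ₗ f n

/-- The cycles of degree `n` for the operator `b`. -/
def cycles (M : PreMixedComplex.{u, v} R) : ∀ n, Submodule R (M.X n)
  | 0 => ⊤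
  | n + 1 => LinearMap.ker (M.b n)

/-- The boundaries of degree `n` for the operator `b`. -/
def boundaries (M : PreMixedComplex.{u, v} R) (n : ℕ) : Submodule R (M.X n) :=
  LinearMap.range (M.b n)

/-- The homology in degree `n` with respect to the operator `b`. -/
abbrev homology (M : PreMixedComplex.{u, v} R) (n : ℕ) : Type v :=
  ↥(M.cycles n) ⧸ (M.boundaries n).submoduleOf (M.cycles n)

theorem map_cycles {M N : PreMixedComplex.{u, v} R} {f : GradedMap M N} (hf : IsMorphism f)
    (n : ℕ) : ∀ z ∈ M.cycles n, f n z ∈ N.cycles n := by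
  cases n with
  | zero => exact fun _ _ => Submodule.mem_top
  | succ n =>
    intro z hz
    have h := LinearMap.congr_fun (hf.comm_b n) z
    have hz' : M.b n z = 0 := hz
    simp only [LinearMap.comp_apply, hz', map_zero] at h
    exact h.symm

theorem map_boundaries {M N : PreMixedComplex.{u, v} R} {f : GradedMap M N} (hf : IsMorphism f)
    (n : ℕ) : ∀ z ∈ M.boundaries n, f n z ∈ N.boundaries n := by
  rintro _ ⟨y, rfl⟩
  exact ⟨f (n + 1) y, (LinearMap.congr_fun (hf.comm_b n) y).symm⟩

/-- The map induced on homology by a morphism of mixed complexes. -/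
def homologyMap {M N : PreMixedComplex.{u, v} R} (f : GradedMap M N) (hf : IsMorphism f)
    (n : ℕ) : M.homology n →ₗ[R] N.homology n :=
  Submodule.mapQ _ _ ((f n).restrict (map_cycles hf n)) (fun z hz => map_boundaries hf n z hz)

/-- A quasi-isomorphism of mixed complexes: a morphism of mixed complexes that induces an
isomorphism on the homology with respect to `b`. -/
def IsQuasiIso {M N : PreMixedComplex.{u, v} R} (f : GradedMap M N) : Prop :=
  ∃ hf : IsMorphism f, ∀ n, Function.Bijective (homologyMap f hf n)

end PreMixedComplex

/-- The quotient of the submodule `P` by its intersection with the submodule `Q`. -/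
def Subquotient {R : Type u} [CommRing R] {X : Type v} [AddCommGroup X] [Module R X]
    (P Q : Submodule R X) : Type v := ↥P ⧸ Q.submoduleOf P

instance {R : Type u} [CommRing R] {X : Type v} [AddCommGroup X] [Module R X]
    (P Q : Submodule R X) : AddCommGroup (Subquotient P Q) :=
  inferInstanceAs (AddCommGroup (↥P ⧸ Q.submoduleOf P))

instance {R : Type u} [CommRing R] {X : Type v} [AddCommGroup X] [Module R X]
    (P Q : Submodule R X) : Module R (Subquotient P Q) :=
  inferInstanceAs (Module R (↥P ⧸ Q.submoduleOf P))

/-- The map induced on subquotients by a linear map. -/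
def subquotientMap {R : Type u} [CommRing R] {X : Type v} [AddCommGroup X] [Module R X]
    {Y : Type w} [AddCommGroup Y] [Module R Y] {P Q : Submodule R X} {P' Q' : Submodule R Y}
    (f : X →ₗ[R] Y) (hP : ∀ z ∈ P, f z ∈ P') (hQ : ∀ z ∈ Q, f z ∈ Q') :
    Subquotient P Q →ₗ[R] Subquotient P' Q' :=
  Submodule.mapQ (Q.submoduleOf P) (Q'.submoduleOf P') (f.restrict hP) (fun z hz => hQ z hz)

/-- The map induced on a subquotient by a linear map that vanishes on the smaller submodule. -/
def subquotientLift {R : Type u} [CommRing R] {X : Type v} [AddCommGroup X] [Module R X]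
    {Y : Type w} [AddCommGroup Y] [Module R Y] {P Q : Submodule R X} {P' : Submodule R Y}
    (f : X →ₗ[R] Y) (hP : ∀ z ∈ P, f z ∈ P') (hQ : ∀ z ∈ Q, f z = 0) :
    Subquotient P Q →ₗ[R] ↥P' :=
  Submodule.liftQ (Q.submoduleOf P) (f.restrict hP) (fun z hz => Subtype.ext (hQ z hz))

end Mixed

/-! ### Differential graded categories and their Hochschild complexes -/

/-- The data underlying a non-negatively graded dg category. Composition is written in
diagrammatic order. -/
structure PreDGCat (R : Type u) [CommRing R] where
  Obj : Type v
  Hom : Obj → Obj → ℕ → Type w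
  [addCommGroup : ∀ x y n, AddCommGroup (Hom x y n)]
  [module : ∀ x y n, Module R (Hom x y n)]
  one : ∀ x, Hom x x 0
  comp : ∀ x y z m n, Hom x y m →ₗ[R] Hom y z n →ₗ[R] Hom x z (m + n)
  d : ∀ x y n, Hom x y (n + 1) →ₗ[R] Hom x y n

attribute [instance] PreDGCat.addCommGroup PreDGCat.module

namespace PreDGCat

variable {R : Type u} [CommRing R] (A : PreDGCat.{u, v, w} R)

/-- The direct sum of all the morphism modules. -/
abbrev Tot : Type (max v w) := ⨁ i : A.Obj × A.Obj × ℕ, A.Hom i.1 i.2.1 i.2.2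

/-- The inclusion of a morphism module. -/
def of (x y : A.Obj) (n : ℕ) : A.Hom x y n →ₗ[R] A.Tot :=
  open Classical in
  DirectSum.lof R (A.Obj × A.Obj × ℕ) (fun i => A.Hom i.1 i.2.1 i.2.2) (x, y, n)

/-- The linear map with prescribed restrictions to the morphism modules. -/
def lift {X : Type*} [AddCommMonoid X] [Module R X] (f : ∀ x y n, A.Hom x y n →ₗ[R] X) :
    A.Tot →ₗ[R] X :=
  open Classical in
  DirectSum.toModule R (A.Obj × A.Obj × ℕ) X (fun i => f i.1 i.2.1 i.2.2)

variable {A} in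
@[simp]
theorem lift_of {X : Type*} [AddCommMonoid X] [Module R X] (f : ∀ x y n, A.Hom x y n →ₗ[R] X)
    (x y : A.Obj) (n : ℕ) (a : A.Hom x y n) : A.lift f (A.of x y n a) = f x y n a := by
  classical
  exact DirectSum.toModule_lof (M := fun i : A.Obj × A.Obj × ℕ => A.Hom i.1 i.2.1 i.2.2) R
    (φ := fun i => f i.1 i.2.1 i.2.2) (x, y, n) a

variable {A} in
theorem tot_hom_ext {X : Type*} [AddCommMonoid X] [Module R X] {f g : A.Tot →ₗ[R] X}
    (h : ∀ x y n a, f (A.of x y n a) = g (A.of x y n a)) : f = g := by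
  classical
  refine DirectSum.linearMap_ext R fun i => ?_
  ext a
  exact h i.1 i.2.1 i.2.2 a

variable {A} in
theorem tot_induction {p : A.Tot → Prop} (zero : p 0) (add : ∀ a b, p a → p b → p (a + b))
    (of : ∀ x y n a, p (A.of x y n a)) (a : A.Tot) : p a := by
  classical
  induction a using DirectSum.induction_on with
  | zero => exact zero
  | of i a => exact of i.1 i.2.1 i.2.2 a
  | add a b ha hb => exact add a b ha hb

open Classical in
/-- The composite of two morphisms if they are composable, and zero otherwise. -/
def compOrZero (x y : A.Obj) (m : ℕ) (y' z : A.Obj) (n : ℕ) :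
    A.Hom x y m →ₗ[R] A.Hom y' z n →ₗ[R] A.Tot :=
  if h : y = y' then
    (h ▸ A.comp x y z m n : A.Hom x y m →ₗ[R] A.Hom y' z n →ₗ[R] A.Hom x z (m + n)).compr₂
      (A.of x z (m + n))
  else 0

/-- The multiplication on the direct sum of all the morphism modules. -/
def mul : A.Tot →ₗ[R] A.Tot →ₗ[R] A.Tot :=
  A.lift fun x y m => (A.lift fun y' z n => (A.compOrZero x y m y' z n).flip).flip

@[simp]
theorem mul_of_of {x y z : A.Obj} {m n : ℕ} (a : A.Hom x y m) (b : A.Hom y z n) :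
    A.mul (A.of x y m a) (A.of y z n b) = A.of x z (m + n) (A.comp x y z m n a b) := by
  simp [mul, compOrZero]

theorem mul_of_of_ne {x y y' z : A.Obj} (h : y ≠ y') {m n : ℕ} (a : A.Hom x y m)
    (b : A.Hom y' z n) : A.mul (A.of x y m a) (A.of y' z n b) = 0 := by
  simp [mul, compOrZero, h]

/-- The differential on the direct sum of all the morphism modules. -/
def dTot : A.Tot →ₗ[R] A.Tot :=
  A.lift fun x y n =>
    match n with
    | 0 => 0
    | n + 1 => A.of x y n ∘ₗ A.d x y n

@[simp]
theorem dTot_of_zero {x y : A.Obj} (a : A.Hom x y 0) : A.dTot (A.of x y 0 a) = 0 := by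
  simp [dTot]

@[simp]
theorem dTot_of_succ {x y : A.Obj} {n : ℕ} (a : A.Hom x y (n + 1)) :
    A.dTot (A.of x y (n + 1) a) = A.of x y n (A.d x y n a) := by
  simp [dTot]

/-- The grading involution `a ↦ (-1) ^ |a| a`. -/
def sgn : A.Tot →ₗ[R] A.Tot := A.lift fun x y n => (-1 : R) ^ n • A.of x y n

@[simp]
theorem sgn_of {x y : A.Obj} {n : ℕ} (a : A.Hom x y n) :
    A.sgn (A.of x y n a) = (-1 : R) ^ n • A.of x y n a := by
  simp [sgn]

/-- The projection onto the morphisms of even degree. -/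
def even : A.Tot →ₗ[R] A.Tot := A.lift fun x y n => if Even n then A.of x y n else 0

/-- The projection onto the morphisms of odd degree. -/
def odd : A.Tot →ₗ[R] A.Tot := A.lift fun x y n => if Odd n then A.of x y n else 0

end PreDGCat

/-- A (small) non-negatively graded dg category. -/
structure DGCat (R : Type u) [CommRing R] extends PreDGCat.{u, v, w} R where
  one_comp : ∀ x y n (a : Hom x y n),
    toPreDGCat.mul (toPreDGCat.of x x 0 (one x)) (toPreDGCat.of x y n a) = toPreDGCat.of x y n a
  comp_one : ∀ x y n (a : Hom x y n),
    toPreDGCat.mul (toPreDGCat.of x y n a) (toPreDGCat.of y y 0 (one y)) = toPreDGCat.of x y n a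
  comp_assoc : ∀ a b c, toPreDGCat.mul (toPreDGCat.mul a b) c =
    toPreDGCat.mul a (toPreDGCat.mul b c)
  d_d : toPreDGCat.dTot ∘ₗ toPreDGCat.dTot = 0
  leibniz : ∀ a b, toPreDGCat.dTot (toPreDGCat.mul a b) =
    toPreDGCat.mul (toPreDGCat.dTot a) b + toPreDGCat.mul (toPreDGCat.sgn a) (toPreDGCat.dTot b)

namespace DGCat

variable {R : Type u} [CommRing R]

/-- A functor of dg categories. -/
structure Functor (A A' : DGCat.{u, v, w} R) where
  obj : A.Obj → A'.Obj
  map : ∀ x y n, A.Hom x y n →ₗ[R] A'.Hom (obj x) (obj y) n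
  map_one : ∀ x, map x x 0 (A.one x) = A'.one (obj x)
  map_comp : ∀ x y z m n a b, map x z (m + n) (A.comp x y z m n a b) =
    A'.comp _ _ _ _ _ (map x y m a) (map y z n b)
  map_d : ∀ x y n a, map x y n (A.d x y n a) = A'.d _ _ _ (map x y (n + 1) a)

variable (A : DGCat.{u, v, w} R)

/-! A monomial `[a₁ | ⋯ | aₚ] a` is represented by `(a₁ ⋯ aₚ) ⊗ a`, where the first factor is a
word in the morphisms of `A`. The letters of that word are suspended, so that `aᵢ` contributes
`|aᵢ| + 1` to the degree. -/

/-- The tensor algebra on the suspension of the direct sum of all the morphism modules. -/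
abbrev Words : Type _ := TensorAlgebra R A.Tot

/-- The module of all monomials `[a₁ | ⋯ | aₚ] a`, composable or not. -/
abbrev Monomials : Type _ := A.Words ⊗[R] A.Tot

/-- The grading involution of `Words`. -/
def wsgn : A.Words →ₗ[R] A.Words := (wordSign A.odd A.even).toLinearMap

/-- The map `[a₁ | ⋯ | aₚ] a ↦ [b | a₁ | ⋯ | aₚ] a`. -/
def cons (b : A.Tot) : A.Monomials →ₗ[R] A.Monomials :=
  TensorProduct.map (LinearMap.mulLeft R (TensorAlgebra.ι R b)) LinearMap.id

/-- Multiplication of the first letter with `b`: this sends `[a₁ | ⋯ | aₚ] a` to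
`(-1) ^ |b| [b a₁ | a₂ | ⋯ | aₚ] a` if `p > 0`, and `[] a` to `[] b a`. -/
def mergeFirst (b : A.Tot) : A.Monomials →ₗ[R] A.Monomials :=
  TensorProduct.map (consMap (A.mul (A.sgn b)) ∘ₗ uncons) LinearMap.id +
    TensorProduct.map (Algebra.linearMap R A.Words ∘ₗ TensorAlgebra.algebraMapInv.toLinearMap)
      (A.mul b)

theorem cons_tmul (b : A.Tot) (t : A.Words) (a : A.Tot) :
    A.cons b (t ⊗ₜ a) = (TensorAlgebra.ι R b * t) ⊗ₜ a := by
  simp [cons]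

theorem mergeFirst_nil (b a : A.Tot) : A.mergeFirst b (1 ⊗ₜ a) = 1 ⊗ₜ A.mul b a := by
  simp [mergeFirst]

theorem mergeFirst_cons (b c : A.Tot) (t : A.Words) (a : A.Tot) :
    A.mergeFirst b ((TensorAlgebra.ι R c * t) ⊗ₜ a) =
      (TensorAlgebra.ι R (A.mul (A.sgn b) c) * t) ⊗ₜ a := by
  simp [mergeFirst, TensorAlgebra.algebraMapInv]

theorem cons_add (b c : A.Tot) : A.cons (b + c) = A.cons b + A.cons c := by
  refine TensorProduct.ext' fun t a => ?_
  simp [cons_tmul, add_mul, TensorProduct.add_tmul]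

theorem cons_smul (r : R) (b : A.Tot) : A.cons (r • b) = r • A.cons b := by
  refine TensorProduct.ext' fun t a => ?_
  simp [cons_tmul, TensorProduct.smul_tmul']

theorem mergeFirst_add (b c : A.Tot) :
    A.mergeFirst (b + c) = A.mergeFirst b + A.mergeFirst c := by
  refine TensorProduct.ext' fun t a => ?_
  simp only [mergeFirst, map_add, consMap_add, LinearMap.add_apply, TensorProduct.map_tmul,
    LinearMap.comp_apply, TensorProduct.add_tmul, TensorProduct.tmul_add, LinearMap.id_apply]
  abel

theorem mergeFirst_smul (r : R) (b : A.Tot) : A.mergeFirst (r • b) = r • A.mergeFirst b := by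
  refine TensorProduct.ext' fun t a => ?_
  simp only [mergeFirst, map_smul, consMap_smul, LinearMap.add_apply, TensorProduct.map_tmul,
    LinearMap.comp_apply, LinearMap.smul_apply, TensorProduct.tmul_smul, LinearMap.id_apply,
    smul_add, TensorProduct.smul_tmul']

/-- The recursion step for `barDiff`. -/
def barStep : A.Tot →ₗ[R] Module.End R (A.Monomials × A.Monomials) :=
  LinearMap.mk₂ R (fun b p => (A.cons b p.1,
      A.mergeFirst b p.1 - A.cons (A.dTot b) p.1 - A.cons (A.sgn b) p.2))
    (fun b c p => by
      ext
      · simp [cons_add]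
      · simp only [map_add, cons_add, mergeFirst_add, LinearMap.add_apply, Prod.snd_add]
        abel)
    (fun r b p => by
      ext
      · simp [cons_smul]
      · simp only [map_smul, cons_smul, mergeFirst_smul, LinearMap.smul_apply, Prod.smul_snd,
          smul_sub])
    (fun b p q => by
      ext
      · simp
      · simp only [map_add, Prod.fst_add, Prod.snd_add]
        abel)
    (fun r b p => by
      ext
      · simp
      · simp only [map_smul, Prod.smul_fst, Prod.smul_snd, smul_sub])

theorem barStep_apply (b : A.Tot) (p : A.Monomials × A.Monomials) :
    A.barStep b p = (A.cons b p.1,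
      A.mergeFirst b p.1 - A.cons (A.dTot b) p.1 - A.cons (A.sgn b) p.2) := rfl

/-- The differential of the one-sided bar construction: the sum of the terms
`(-1) ^ (εᵢ₋₁ + 1) [⋯ | d aᵢ | ⋯] a` and `(-1) ^ εₚ [⋯] d a`, of the terms
`(-1) ^ (εᵢ₋₁ + |aᵢ|) [⋯ | aᵢ aᵢ₊₁ | ⋯] a`, and of `(-1) ^ εₚ₋₁ [a₁ | ⋯ | aₚ₋₁] aₚ a`, where
`εᵢ = ∑_{j ≤ i} (|aⱼ| + 1)`. -/
def barDiff : A.Monomials →ₗ[R] A.Monomials :=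
  TensorProduct.lift
    (((TensorAlgebra.lift R A.barStep).toLinearMap.compl₂
      ((TensorProduct.mk R A.Words A.Tot 1).prod
        (TensorProduct.mk R A.Words A.Tot 1 ∘ₗ A.dTot))).compr₂ (LinearMap.snd R _ _))

theorem barDiff_nil (a : A.Tot) : A.barDiff (1 ⊗ₜ a) = 1 ⊗ₜ A.dTot a := by
  simp [barDiff]

theorem barDiff_cons (b : A.Tot) (z : A.Monomials) : A.barDiff (A.cons b z) =
    A.mergeFirst b z - A.cons (A.dTot b) z - A.cons (A.sgn b) (A.barDiff z) := by
  have h : ∀ (t : A.Words) (a : A.Tot), (TensorAlgebra.lift R A.barStep t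
      ((1 : A.Words) ⊗ₜ[R] a, (1 : A.Words) ⊗ₜ[R] A.dTot a)).1 = t ⊗ₜ a := by
    intro t a
    refine word_induction (p := fun t => (TensorAlgebra.lift R A.barStep t
      ((1 : A.Words) ⊗ₜ[R] a, (1 : A.Words) ⊗ₜ[R] A.dTot a)).1 = t ⊗ₜ a) (by simp) ?_ ?_ ?_ t
    · intro t t' h h'
      simp [h, h', TensorProduct.add_tmul]
    · intro r t h
      simp [h, TensorProduct.smul_tmul']
    · intro v t h
      simp [barStep_apply, h, cons_tmul]
  induction z using TensorProduct.induction_on with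
  | zero => simp
  | tmul t a =>
    rw [cons_tmul]
    simp [barDiff, barStep_apply, h t a]
  | add x y hx hy =>
    simp only [map_add, hx, hy]
    abel

/-- The last cyclic term of the Hochschild differential: this sends `[a₁ | ⋯ | aₚ] a` to
`-(-1) ^ (|a₁| (|a| + (|a₂| + 1) + ⋯ + (|aₚ| + 1))) [a₂ | ⋯ | aₚ] a a₁` if `p > 0`, and `[] a`
to zero. -/
def wrap : A.Monomials →ₗ[R] A.Monomials :=
  -((TensorProduct.map LinearMap.id
        (TensorProduct.lift A.mul ∘ₗ TensorProduct.map LinearMap.id A.even) +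
      TensorProduct.map A.wsgn
        (TensorProduct.lift A.mul ∘ₗ TensorProduct.map A.sgn A.odd)) ∘ₗ
    TensorProduct.map LinearMap.id (TensorProduct.comm R _ _).toLinearMap ∘ₗ
    (TensorProduct.assoc R _ _ _).toLinearMap ∘ₗ
    TensorProduct.map (TensorProduct.comm R _ _).toLinearMap LinearMap.id ∘ₗ
    TensorProduct.map uncons LinearMap.id)

theorem wrap_nil (a : A.Tot) : A.wrap (1 ⊗ₜ a) = 0 := by
  simp [wrap]

theorem wrap_cons (b : A.Tot) (t : A.Words) (a : A.Tot) :
    A.wrap ((TensorAlgebra.ι R b * t) ⊗ₜ a) =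
      -(t ⊗ₜ A.mul a (A.even b) + A.wsgn t ⊗ₜ A.mul (A.sgn a) (A.odd b)) := by
  simp [wrap]

/-- The Hochschild differential on monomials. -/
def hochDiff : A.Monomials →ₗ[R] A.Monomials := A.barDiff + A.wrap

/-- Insertion of an identity in the last place: the map sending `a ⊗ w` to `[a w] id`, where `id`
is the identity of the source of `a`. -/
def cap : A.Tot ⊗[R] A.Words →ₗ[R] A.Monomials :=
  TensorProduct.lift (A.lift fun x y n =>
    ((LinearMap.mul R A.Words).comp (TensorAlgebra.ι R ∘ₗ A.of x y n)).compr₂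
      ((TensorProduct.mk R A.Words A.Tot).flip (A.of x x 0 (A.one x))))

theorem cap_tmul {x y : A.Obj} {n : ℕ} (a : A.Hom x y n) (t : A.Words) :
    A.cap (A.of x y n a ⊗ₜ t) = (TensorAlgebra.ι R (A.of x y n a) * t) ⊗ₜ A.of x x 0 (A.one x) := by
  simp [cap]

/-- Connes' operator on monomials: with `aₚ₊₁ = a`, it sends `[a₁ | ⋯ | aₚ] a` to
`(-1) ^ εₚ ∑ᵢ ± [aᵢ | ⋯ | aₚ₊₁ | a₁ | ⋯ | aᵢ₋₁] id`, where `±` is the Koszul sign of the rotation of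
the suspended letters. -/
def connes : A.Monomials →ₗ[R] A.Monomials :=
  A.cap ∘ₗ rotations A.odd A.even ∘ₗ LinearMap.mul' R A.Words ∘ₗ
    TensorProduct.map A.wsgn (TensorAlgebra.ι R)

/-- Composable words `a₁ ⋯ aₚ` from `x` to `y`, of total degree `n` (with `aᵢ` counted in degree
`|aᵢ| + 1`). -/
inductive IsWord : A.Obj → A.Obj → ℕ → A.Words → Prop
  | nil (x : A.Obj) : IsWord x x 0 1
  | cons {x y z : A.Obj} {m n : ℕ} {t : A.Words} (a : A.Hom x y m) (h : IsWord y z n t) :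
      IsWord x z (m + 1 + n) (TensorAlgebra.ι R (A.of x y m a) * t)

/-- Composable words of which at least one letter is an identity. -/
inductive IsDegWord : A.Obj → A.Obj → ℕ → A.Words → Prop
  | head {x y : A.Obj} {n : ℕ} {t : A.Words} (h : A.IsWord x y n t) :
      IsDegWord x y (0 + 1 + n) (TensorAlgebra.ι R (A.of x x 0 (A.one x)) * t)
  | cons {x y z : A.Obj} {m n : ℕ} {t : A.Words} (a : A.Hom x y m) (h : IsDegWord y z n t) :
      IsDegWord x z (m + 1 + n) (TensorAlgebra.ι R (A.of x y m a) * t)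

/-- The unnormalized Hochschild chains of degree `n`: the span of the cyclically composable
monomials `[a₁ | ⋯ | aₚ] a` of total degree `n`. -/
def chains (n : ℕ) : Submodule R A.Monomials :=
  Submodule.span R {z | ∃ (x y : A.Obj) (i j : ℕ), i + j = n ∧
    ∃ t, A.IsWord x y i t ∧ ∃ a : A.Hom y x j, z = t ⊗ₜ A.of y x j a}

/-- The degenerate Hochschild chains of degree `n`: the span of the cyclically composable
monomials `[a₁ | ⋯ | aₚ] a` of total degree `n` such that some `aᵢ` with `i ≤ p` is an identity. -/
def degenerate (n : ℕ) : Submodule R A.Monomials :=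
  Submodule.span R {z | ∃ (x y : A.Obj) (i j : ℕ), i + j = n ∧
    ∃ t, A.IsDegWord x y i t ∧ ∃ a : A.Hom y x j, z = t ⊗ₜ A.of y x j a}

/-! The operators preserve chains and degenerate chains. -/

variable {A}

theorem even_sub_odd_of {x y : A.Obj} {n : ℕ} (a : A.Hom x y n) :
    A.odd (A.of x y n a) - A.even (A.of x y n a) = (-1 : R) ^ (n + 1) • A.of x y n a := by
  rcases Nat.even_or_odd n with h | h
  · simp [PreDGCat.odd, PreDGCat.even, h, Nat.not_odd_iff_even.2 h, h.add_one.neg_one_pow]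
  · simp [PreDGCat.odd, PreDGCat.even, h, Nat.not_even_iff_odd.2 h, h.add_one.neg_one_pow]

theorem IsDegWord.isWord {x y : A.Obj} {n : ℕ} {t : A.Words} (h : A.IsDegWord x y n t) :
    A.IsWord x y n t := by
  induction h with
  | head h => exact IsWord.cons _ h
  | cons a _ ih => exact IsWord.cons a ih

theorem IsWord.wsgn {x y : A.Obj} {n : ℕ} {t : A.Words} (h : A.IsWord x y n t) :
    A.wsgn t = (-1 : R) ^ n • t := by
  induction h with
  | nil x => simp [DGCat.wsgn]
  | cons a _ ih =>
    simp only [DGCat.wsgn, AlgHom.toLinearMap_apply, map_mul, wordSign_ι] at ih ⊢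
    rw [ih, even_sub_odd_of]
    simp [pow_add, smul_smul, mul_comm]

theorem IsWord.parity {x y : A.Obj} {n : ℕ} {t : A.Words} (h : A.IsWord x y n t) :
    wordEven A.odd A.even t = (if Even n then t else 0) ∧
      wordOdd A.odd A.even t = (if Even n then 0 else t) := by
  induction h with
  | nil x => simp
  | @cons x y z m n t a _ ih =>
    rw [wordEven_cons, wordOdd_cons, ih.1, ih.2]
    by_cases hm : Even m <;> by_cases hn : Even n <;>
      simp [PreDGCat.odd, PreDGCat.even, hm, hn, ← Nat.not_even_iff_odd, Nat.even_add, Nat.even_add_one]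

theorem IsWord.mul {x y z : A.Obj} {m n : ℕ} {s t : A.Words} (hs : A.IsWord x y m s)
    (ht : A.IsWord y z n t) : A.IsWord x z (m + n) (s * t) := by
  induction hs with
  | nil x => simpa using ht
  | cons a _ ih =>
    rw [mul_assoc, add_assoc]
    exact IsWord.cons a (ih ht)

theorem IsDegWord.mul_right {x y z : A.Obj} {m n : ℕ} {s t : A.Words} (hs : A.IsDegWord x y m s)
    (ht : A.IsWord y z n t) : A.IsDegWord x z (m + n) (s * t) := by
  induction hs with
  | head h =>
    rw [mul_assoc, add_assoc]
    exact IsDegWord.head (h.mul ht)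
  | cons a _ ih =>
    rw [mul_assoc, add_assoc]
    exact IsDegWord.cons a (ih ht)

theorem IsDegWord.mul_left {x y z : A.Obj} {m n : ℕ} {s t : A.Words} (hs : A.IsWord x y m s)
    (ht : A.IsDegWord y z n t) : A.IsDegWord x z (m + n) (s * t) := by
  induction hs with
  | nil x => simpa using ht
  | cons a _ ih =>
    rw [mul_assoc, add_assoc]
    exact IsDegWord.cons a (ih ht)

variable (A) in
/-- The span of the composable monomials from `x` to `x'` of total degree `N - 1`. -/
def lower (x x' : A.Obj) (N : ℕ) : Submodule R A.Monomials :=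
  Submodule.span R {z | ∃ (y : A.Obj) (i j : ℕ), i + j + 1 = N ∧
    ∃ t, A.IsWord x y i t ∧ ∃ a : A.Hom y x' j, z = t ⊗ₜ A.of y x' j a}

variable (A) in
/-- The span of the degenerate composable monomials from `x` to `x'` of total degree `N - 1`. -/
def lowerDeg (x x' : A.Obj) (N : ℕ) : Submodule R A.Monomials :=
  Submodule.span R {z | ∃ (y : A.Obj) (i j : ℕ), i + j + 1 = N ∧
    ∃ t, A.IsDegWord x y i t ∧ ∃ a : A.Hom y x' j, z = t ⊗ₜ A.of y x' j a}

theorem mem_lower {x x' y : A.Obj} {N i j : ℕ} (hN : i + j + 1 = N) {t : A.Words}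
    (ht : A.IsWord x y i t) (a : A.Hom y x' j) : t ⊗ₜ A.of y x' j a ∈ A.lower x x' N :=
  Submodule.subset_span ⟨y, i, j, hN, t, ht, a, rfl⟩

theorem mem_lowerDeg {x x' y : A.Obj} {N i j : ℕ} (hN : i + j + 1 = N) {t : A.Words}
    (ht : A.IsDegWord x y i t) (a : A.Hom y x' j) : t ⊗ₜ A.of y x' j a ∈ A.lowerDeg x x' N :=
  Submodule.subset_span ⟨y, i, j, hN, t, ht, a, rfl⟩

theorem cons_lower {x y x' : A.Obj} {m N : ℕ} (b : A.Hom x y m) {z : A.Monomials}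
    (hz : z ∈ A.lower y x' N) : A.cons (A.of x y m b) z ∈ A.lower x x' (m + 1 + N) := by
  suffices h : A.lower y x' N ≤ (A.lower x x' (m + 1 + N)).comap (A.cons (A.of x y m b)) from h hz
  refine Submodule.span_le.2 ?_
  rintro _ ⟨p, i, j, hij, t, ht, a, rfl⟩
  simp only [SetLike.mem_coe, Submodule.mem_comap, cons_tmul]
  exact mem_lower (by omega) (IsWord.cons b ht) a

theorem cons_lowerDeg {x y x' : A.Obj} {m N : ℕ} (b : A.Hom x y m) {z : A.Monomials}
    (hz : z ∈ A.lowerDeg y x' N) :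
    A.cons (A.of x y m b) z ∈ A.lowerDeg x x' (m + 1 + N) := by
  suffices h : A.lowerDeg y x' N ≤
    (A.lowerDeg x x' (m + 1 + N)).comap (A.cons (A.of x y m b)) from h hz
  refine Submodule.span_le.2 ?_
  rintro _ ⟨p, i, j, hij, t, ht, a, rfl⟩
  simp only [SetLike.mem_coe, Submodule.mem_comap, cons_tmul]
  exact mem_lowerDeg (by omega) (IsDegWord.cons b ht) a

theorem cons_one_lower {x x' : A.Obj} {N : ℕ} {z : A.Monomials} (hz : z ∈ A.lower x x' N) :
    A.cons (A.of x x 0 (A.one x)) z ∈ A.lowerDeg x x' (0 + 1 + N) := by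
  suffices h : A.lower x x' N ≤
    (A.lowerDeg x x' (0 + 1 + N)).comap (A.cons (A.of x x 0 (A.one x))) from h hz
  refine Submodule.span_le.2 ?_
  rintro _ ⟨p, i, j, hij, t, ht, a, rfl⟩
  simp only [SetLike.mem_coe, Submodule.mem_comap, cons_tmul]
  exact mem_lowerDeg (by omega) (IsDegWord.head ht) a

theorem barDiff_mem {x y x' : A.Obj} {i j : ℕ} {t : A.Words} (ht : A.IsWord x y i t)
    (a : A.Hom y x' j) : A.barDiff (t ⊗ₜ A.of y x' j a) ∈ A.lower x x' (i + j) := by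
  induction ht with
  | nil y =>
    rw [barDiff_nil]
    cases j with
    | zero => simp
    | succ j =>
      rw [PreDGCat.dTot_of_succ]
      exact mem_lower (by omega) (IsWord.nil y) _
  | @cons x p y m n t b ht ih =>
    rw [← cons_tmul, barDiff_cons, add_assoc]
    refine sub_mem (sub_mem ?_ ?_) ?_
    · cases ht with
      | nil p =>
        rw [mergeFirst_nil, PreDGCat.mul_of_of]
        exact mem_lower (by omega) (IsWord.nil x) _
      | @cons p q y m' n' t' c ht' =>
        rw [mergeFirst_cons, PreDGCat.sgn_of, map_smul, LinearMap.smul_apply,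
          PreDGCat.mul_of_of, map_smul, smul_mul_assoc, ← TensorProduct.smul_tmul']
        exact Submodule.smul_mem _ _ (mem_lower (by omega) (IsWord.cons _ ht') a)
    · cases m with
      | zero => simp [cons]
      | succ m =>
        rw [PreDGCat.dTot_of_succ, cons_tmul]
        exact mem_lower (by omega) (IsWord.cons _ ht) a
    · rw [PreDGCat.sgn_of, cons_smul, LinearMap.smul_apply]
      exact Submodule.smul_mem _ _ (cons_lower b (ih a))

theorem mergeFirst_one {x y x' : A.Obj} {i j : ℕ} {t : A.Words} (ht : A.IsWord x y i t)
    (a : A.Hom y x' j) :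
    A.mergeFirst (A.of x x 0 (A.one x)) (t ⊗ₜ A.of y x' j a) = t ⊗ₜ A.of y x' j a := by
  cases ht with
  | nil y => rw [mergeFirst_nil, A.one_comp]
  | cons c ht' => rw [mergeFirst_cons, PreDGCat.sgn_of, pow_zero, one_smul, A.one_comp]

theorem barDiff_deg {x y x' : A.Obj} {i j : ℕ} {t : A.Words} (ht : A.IsDegWord x y i t)
    (a : A.Hom y x' j) :
    (∃ n s, i = 0 + 1 + n ∧ A.IsWord x y n s ∧ t = TensorAlgebra.ι R (A.of x x 0 (A.one x)) * s ∧
      A.barDiff (t ⊗ₜ A.of y x' j a) - s ⊗ₜ A.of y x' j a ∈ A.lowerDeg x x' (i + j)) ∨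
    (∃ p m n s, ∃ b : A.Hom x p m, i = m + 1 + n ∧ A.IsDegWord p y n s ∧
      t = TensorAlgebra.ι R (A.of x p m b) * s ∧
      A.barDiff (t ⊗ₜ A.of y x' j a) ∈ A.lowerDeg x x' (i + j)) := by
  induction ht with
  | @head x y n t ht =>
    refine Or.inl ⟨n, t, rfl, ht, rfl, ?_⟩
    rw [← cons_tmul, barDiff_cons, mergeFirst_one ht, PreDGCat.dTot_of_zero, PreDGCat.sgn_of]
    have h0 : A.cons 0 = 0 := by
      refine TensorProduct.ext' fun t a => ?_
      simp [cons_tmul]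
    rw [h0, LinearMap.zero_apply, sub_zero, sub_sub_cancel_left, pow_zero, one_smul, add_assoc]
    exact neg_mem (cons_one_lower (barDiff_mem ht a))
  | @cons x p y m n t b ht ih =>
    refine Or.inr ⟨p, m, n, t, b, rfl, ht, rfl, ?_⟩
    rw [← cons_tmul, barDiff_cons, add_assoc]
    have hd : A.cons (A.dTot (A.of x p m b)) (t ⊗ₜ A.of y x' j a) ∈
        A.lowerDeg x x' (m + 1 + (n + j)) := by
      cases m with
      | zero => simp [cons]
      | succ m =>
        rw [PreDGCat.dTot_of_succ, cons_tmul]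
        exact mem_lowerDeg (by omega) (IsDegWord.cons _ ht) a
    have hsub : ∀ a b c : A.Monomials, a - b - c = (a - c) - b := fun a b c => by abel
    rw [hsub]
    refine sub_mem ?_ hd
    rcases ih a with ⟨n', s, hn, hs, rfl, h⟩ | ⟨q, m', n', s, c, hn, hs, rfl, h⟩
    · rw [mergeFirst_cons, PreDGCat.sgn_of, map_smul, LinearMap.smul_apply, A.comp_one, map_smul,
        smul_mul_assoc, ← TensorProduct.smul_tmul', cons_smul, LinearMap.smul_apply]
      have e := smul_sub ((-1 : R) ^ m) ((TensorAlgebra.ι R (A.of x p m b) * s) ⊗ₜ A.of y x' j a)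
        (A.cons (A.of x p m b)
          (A.barDiff ((TensorAlgebra.ι R (A.of p p 0 (A.one p)) * s) ⊗ₜ A.of y x' j a)))
      refine e ▸ Submodule.smul_mem _ _ ?_
      rw [← cons_tmul, ← map_sub, ← neg_sub, map_neg]
      exact neg_mem (cons_lowerDeg b h)
    · refine sub_mem ?_ ?_
      · rw [mergeFirst_cons, PreDGCat.sgn_of, map_smul, LinearMap.smul_apply,
          PreDGCat.mul_of_of, map_smul, smul_mul_assoc, ← TensorProduct.smul_tmul']
        exact Submodule.smul_mem _ _ (mem_lowerDeg (by omega) (IsDegWord.cons _ hs) a)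
      · rw [PreDGCat.sgn_of, cons_smul, LinearMap.smul_apply]
        exact Submodule.smul_mem _ _ (cons_lowerDeg b h)

theorem mem_chains {x y : A.Obj} {n i j : ℕ} (hn : i + j = n) {t : A.Words}
    (ht : A.IsWord x y i t) (a : A.Hom y x j) : t ⊗ₜ A.of y x j a ∈ A.chains n :=
  Submodule.subset_span ⟨x, y, i, j, hn, t, ht, a, rfl⟩

theorem mem_degenerate {x y : A.Obj} {n i j : ℕ} (hn : i + j = n) {t : A.Words}
    (ht : A.IsDegWord x y i t) (a : A.Hom y x j) : t ⊗ₜ A.of y x j a ∈ A.degenerate n :=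
  Submodule.subset_span ⟨x, y, i, j, hn, t, ht, a, rfl⟩

theorem lower_le_chains (x : A.Obj) (n : ℕ) : A.lower x x (n + 1) ≤ A.chains n := by
  refine Submodule.span_le.2 ?_
  rintro _ ⟨y, i, j, hij, t, ht, a, rfl⟩
  exact mem_chains (by omega) ht a

theorem lowerDeg_le_degenerate (x : A.Obj) (n : ℕ) :
    A.lowerDeg x x (n + 1) ≤ A.degenerate n := by
  refine Submodule.span_le.2 ?_
  rintro _ ⟨y, i, j, hij, t, ht, a, rfl⟩
  exact mem_degenerate (by omega) ht a

theorem wrap_word {x y p : A.Obj} {m i j : ℕ} (b : A.Hom x p m) {t : A.Words}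
    (ht : A.IsWord p y i t) (a : A.Hom y x j) :
    ∃ r : R, A.wrap ((TensorAlgebra.ι R (A.of x p m b) * t) ⊗ₜ A.of y x j a) =
      r • (t ⊗ₜ A.of y p (j + m) (A.comp y x p j m a b)) := by
  rw [wrap_cons, ht.wsgn, PreDGCat.sgn_of]
  rcases Nat.even_or_odd m with h | h
  · exact ⟨-1, by
      have e := neg_one_smul R (t ⊗ₜ[R] A.of y p (j + m) (A.comp y x p j m a b))
      refine Eq.trans ?_ e.symm
      simp [PreDGCat.odd, PreDGCat.even, h, Nat.not_odd_iff_even.2 h]⟩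
  · exact ⟨-((-1) ^ j * (-1) ^ i), by
      have e := neg_smul ((-1 : R) ^ j * (-1) ^ i)
        (t ⊗ₜ[R] A.of y p (j + m) (A.comp y x p j m a b))
      refine Eq.trans ?_ e.symm
      simp [PreDGCat.odd, PreDGCat.even, h, Nat.not_even_iff_odd.2 h,
        ← TensorProduct.smul_tmul', smul_smul]⟩

theorem hochDiff_mem (n : ℕ) : ∀ z ∈ A.chains (n + 1), A.hochDiff z ∈ A.chains n := by
  suffices h : A.chains (n + 1) ≤ (A.chains n).comap A.hochDiff from h
  refine Submodule.span_le.2 ?_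
  rintro _ ⟨x, y, i, j, hij, t, ht, a, rfl⟩
  have h1 := barDiff_mem ht a
  rw [hij] at h1
  refine add_mem (lower_le_chains x n h1) ?_
  cases ht with
  | nil x => simp [wrap_nil]
  | @cons x p y m i t b ht =>
    obtain ⟨r, hr⟩ := wrap_word b ht a
    rw [hr]
    exact Submodule.smul_mem _ _ (mem_chains (by omega) ht _)

theorem hochDiff_mem_degenerate (n : ℕ) :
    ∀ z ∈ A.degenerate (n + 1), A.hochDiff z ∈ A.degenerate n := by
  suffices h : A.degenerate (n + 1) ≤ (A.degenerate n).comap A.hochDiff from h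
  refine Submodule.span_le.2 ?_
  rintro _ ⟨x, y, i, j, hij, t, ht, a, rfl⟩
  simp only [SetLike.mem_coe, Submodule.mem_comap, hochDiff, LinearMap.add_apply]
  rcases barDiff_deg ht a with ⟨n', s, hn, hs, rfl, h⟩ | ⟨q, m', n', s, c, hn, hs, rfl, h⟩
  · rw [hij] at h
    have hw : A.wrap ((TensorAlgebra.ι R (A.of x x 0 (A.one x)) * s) ⊗ₜ A.of y x j a) =
        -(s ⊗ₜ A.of y x j a) := by
      have he : A.even (A.of x x 0 (A.one x)) = A.of x x 0 (A.one x) := by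
        simp [PreDGCat.even]
      have ho : A.odd (A.of x x 0 (A.one x)) = 0 := by
        simp [PreDGCat.odd]
      rw [wrap_cons, he, ho, A.comp_one]
      simp
    rw [hw, ← sub_eq_add_neg]
    exact lowerDeg_le_degenerate x n h
  · rw [hij] at h
    obtain ⟨r, hr⟩ := wrap_word c hs.isWord a
    rw [hr]
    exact add_mem (lowerDeg_le_degenerate x n h)
      (Submodule.smul_mem _ _ (mem_degenerate (by omega) hs _))

theorem pick_word {x y : A.Obj} {n : ℕ} {t : A.Words} (ht : A.IsWord x y n t) :
    pick t ∈ Submodule.span R {z | ∃ (p q : A.Obj) (i m k : ℕ), i + (m + 1 + k) = n ∧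
      ∃ u, A.IsWord x p i u ∧ ∃ c : A.Hom p q m, ∃ s, A.IsWord q y k s ∧
        z = u ⊗ₜ (A.of p q m c ⊗ₜ s)} := by
  induction ht with
  | nil x => simp
  | @cons x p y m n t b ht ih =>
    rw [pick_cons]
    refine add_mem ?_ ?_
    · exact Submodule.subset_span ⟨x, p, 0, m, n, by omega, 1, IsWord.nil x, b, t, ht, rfl⟩
    · refine Submodule.span_induction (p := fun z _ => TensorProduct.map
        (LinearMap.mulLeft R (TensorAlgebra.ι R (A.of x p m b))) LinearMap.id z ∈ _)
        ?_ (by simp) ?_ ?_ ih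
      · rintro _ ⟨q, q', i, m', k, hi, u, hu, c, s, hs, rfl⟩
        rw [TensorProduct.map_tmul]
        exact Submodule.subset_span ⟨q, q', m + 1 + i, m', k, by omega, _, IsWord.cons b hu,
          c, s, hs, rfl⟩
      · intro z z' _ _ h h'
        rw [map_add]
        exact add_mem h h'
      · intro r z _ h
        rw [map_smul]
        exact Submodule.smul_mem _ _ h

theorem pick_degWord {x y : A.Obj} {n : ℕ} {t : A.Words} (ht : A.IsDegWord x y n t) :
    pick t ∈ Submodule.span R {z | ∃ (p q : A.Obj) (i m k : ℕ), i + (m + 1 + k) = n ∧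
      ∃ u, A.IsWord x p i u ∧ ∃ c : A.Hom p q m, ∃ s, A.IsWord q y k s ∧
        (A.IsDegWord x p i u ∨ A.IsDegWord p y (m + 1 + k) (TensorAlgebra.ι R (A.of p q m c) * s)) ∧
        z = u ⊗ₜ (A.of p q m c ⊗ₜ s)} := by
  induction ht with
  | @head x y n t ht =>
    rw [pick_cons]
    refine add_mem ?_ ?_
    · exact Submodule.subset_span ⟨x, x, 0, 0, n, by omega, 1, IsWord.nil x, A.one x, t, ht,
        Or.inr (IsDegWord.head ht), rfl⟩
    · refine Submodule.span_induction (p := fun z _ => TensorProduct.map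
        (LinearMap.mulLeft R (TensorAlgebra.ι R (A.of x x 0 (A.one x)))) LinearMap.id z ∈ _)
        ?_ (by simp) ?_ ?_ (pick_word ht)
      · rintro _ ⟨q, q', i, m', k, hi, u, hu, c, s, hs, rfl⟩
        rw [TensorProduct.map_tmul]
        exact Submodule.subset_span ⟨q, q', 0 + 1 + i, m', k, by omega, _, IsWord.cons _ hu,
          c, s, hs, Or.inl (IsDegWord.head hu), rfl⟩
      · intro z z' _ _ h h'
        rw [map_add]
        exact add_mem h h'
      · intro r z _ h
        rw [map_smul]
        exact Submodule.smul_mem _ _ h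
  | @cons x p y m n t b ht ih =>
    rw [pick_cons]
    refine add_mem ?_ ?_
    · exact Submodule.subset_span ⟨x, p, 0, m, n, by omega, 1, IsWord.nil x, b, t, ht.isWord,
        Or.inr (IsDegWord.cons b ht), rfl⟩
    · refine Submodule.span_induction (p := fun z _ => TensorProduct.map
        (LinearMap.mulLeft R (TensorAlgebra.ι R (A.of x p m b))) LinearMap.id z ∈ _)
        ?_ (by simp) ?_ ?_ ih
      · rintro _ ⟨q, q', i, m', k, hi, u, hu, c, s, hs, hd, rfl⟩
        rw [TensorProduct.map_tmul]
        exact Submodule.subset_span ⟨q, q', m + 1 + i, m', k, by omega, _, IsWord.cons b hu,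
          c, s, hs, hd.imp (IsDegWord.cons b) id, rfl⟩
      · intro z z' _ _ h h'
        rw [map_add]
        exact add_mem h h'
      · intro r z _ h
        rw [map_smul]
        exact Submodule.smul_mem _ _ h

theorem moveToEnd_word {x p q y : A.Obj} {i m k : ℕ} {u s : A.Words} (hu : A.IsWord x p i u)
    (c : A.Hom p q m) (hs : A.IsWord q y k s) :
    ∃ r : R, moveToEnd A.odd A.even (u ⊗ₜ (A.of p q m c ⊗ₜ s)) =
      r • (A.of p q m c ⊗ₜ (s * u)) := by
  have h2 : wordSign A.odd A.even s = (-1 : R) ^ k • s := hs.wsgn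
  rw [moveToEnd_tmul, hu.parity.1, hu.parity.2, even_sub_odd_of, h2]
  by_cases h : Even i
  · exact ⟨1, by simp [h]⟩
  · exact ⟨(-1) ^ k * (-1) ^ (m + 1), by simp [h, ← TensorProduct.smul_tmul', smul_smul]⟩

theorem connes_monomial {x y : A.Obj} {i j : ℕ} {t : A.Words} (ht : A.IsWord x y i t)
    (a : A.Hom y x j) : A.connes (t ⊗ₜ A.of y x j a) =
      (-1 : R) ^ i • A.cap (rotations A.odd A.even (t * TensorAlgebra.ι R (A.of y x j a))) := by
  simp only [connes, LinearMap.comp_apply, TensorProduct.map_tmul, LinearMap.mul'_apply, ht.wsgn,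
    smul_mul_assoc, map_smul]

theorem connes_mem (n : ℕ) : ∀ z ∈ A.chains n, A.connes z ∈ A.chains (n + 1) := by
  suffices h : A.chains n ≤ (A.chains (n + 1)).comap A.connes from h
  refine Submodule.span_le.2 ?_
  rintro _ ⟨x, y, i, j, hij, t, ht, a, rfl⟩
  rw [SetLike.mem_coe, Submodule.mem_comap, connes_monomial ht]
  refine Submodule.smul_mem _ _ ?_
  have ha : A.IsWord y x (j + 1 + 0) (TensorAlgebra.ι R (A.of y x j a)) := by
    simpa using IsWord.cons a (IsWord.nil x)
  refine Submodule.span_induction (p := fun z _ => A.cap (moveToEnd A.odd A.even z) ∈ _)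
    ?_ (by simp) ?_ ?_ (pick_word (ht.mul ha))
  · rintro _ ⟨p, q, i', m', k, hi, u, hu, c, s, hs, rfl⟩
    obtain ⟨r, hr⟩ := moveToEnd_word hu c hs
    rw [hr, map_smul, cap_tmul]
    exact Submodule.smul_mem _ _ (mem_chains (by omega) (IsWord.cons c (hs.mul hu)) _)
  · intro z z' _ _ h h'
    rw [map_add, map_add]
    exact add_mem h h'
  · intro r z _ h
    rw [map_smul, map_smul]
    exact Submodule.smul_mem _ _ h

theorem connes_mem_degenerate (n : ℕ) :
    ∀ z ∈ A.degenerate n, A.connes z ∈ A.degenerate (n + 1) := by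
  suffices h : A.degenerate n ≤ (A.degenerate (n + 1)).comap A.connes from h
  refine Submodule.span_le.2 ?_
  rintro _ ⟨x, y, i, j, hij, t, ht, a, rfl⟩
  rw [SetLike.mem_coe, Submodule.mem_comap, connes_monomial ht.isWord]
  refine Submodule.smul_mem _ _ ?_
  have ha : A.IsWord y x (j + 1 + 0) (TensorAlgebra.ι R (A.of y x j a)) := by
    simpa using IsWord.cons a (IsWord.nil x)
  refine Submodule.span_induction (p := fun z _ => A.cap (moveToEnd A.odd A.even z) ∈ _)
    ?_ (by simp) ?_ ?_ (pick_degWord (ht.mul_right ha))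
  · rintro _ ⟨p, q, i', m', k, hi, u, hu, c, s, hs, hd, rfl⟩
    obtain ⟨r, hr⟩ := moveToEnd_word hu c hs
    rw [hr, map_smul, cap_tmul]
    refine Submodule.smul_mem _ _ ?_
    rw [← mul_assoc]
    rcases hd with hd | hd
    · exact mem_degenerate (by omega) (IsDegWord.mul_left (IsWord.cons c hs) hd) _
    · exact mem_degenerate (by omega) (hd.mul_right hu) _
  · intro z z' _ _ h h'
    rw [map_add, map_add]
    exact add_mem h h'
  · intro r z _ h
    rw [map_smul, map_smul]
    exact Submodule.smul_mem _ _ h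

variable (A) in
/-- The normalized Hochschild complex of a dg category with Connes' operator: in degree `n` it is
the quotient of the chains by the degenerate chains. -/
def hoch : PreMixedComplex.{u, max u v w} R where
  X n := Subquotient (A.chains n) (A.degenerate n)
  b n := subquotientMap A.hochDiff (hochDiff_mem n) (hochDiff_mem_degenerate n)
  B n := subquotientMap A.connes (connes_mem n) (connes_mem_degenerate n)

namespace Functor

variable {A' : DGCat.{u, v, w} R} (F : Functor A A')

/-- The map induced by a dg functor on the direct sum of all the morphism modules. -/
def tot : A.Tot →ₗ[R] A'.Tot :=
  A.lift fun x y n => A'.of (F.obj x) (F.obj y) n ∘ₗ F.map x y n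

/-- The map induced by a dg functor on monomials:
`[a₁ | ⋯ | aₚ] a ↦ [F a₁ | ⋯ | F aₚ] F a`. -/
def monomials : A.Monomials →ₗ[R] A'.Monomials :=
  TensorProduct.map (TensorAlgebra.lift R (TensorAlgebra.ι R ∘ₗ F.tot)).toLinearMap F.tot

theorem isWord {x y : A.Obj} {n : ℕ} {t : A.Words} (h : A.IsWord x y n t) :
    A'.IsWord (F.obj x) (F.obj y) n
      (TensorAlgebra.lift R (TensorAlgebra.ι R ∘ₗ F.tot) t) := by
  induction h with
  | nil x => simpa using IsWord.nil _
  | cons a _ ih => simpa [tot] using IsWord.cons _ ih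

theorem isDegWord {x y : A.Obj} {n : ℕ} {t : A.Words} (h : A.IsDegWord x y n t) :
    A'.IsDegWord (F.obj x) (F.obj y) n
      (TensorAlgebra.lift R (TensorAlgebra.ι R ∘ₗ F.tot) t) := by
  induction h with
  | head h => simpa [tot, F.map_one] using IsDegWord.head (F.isWord h)
  | cons a _ ih => simpa [tot] using IsDegWord.cons _ ih

theorem monomials_mem (n : ℕ) : ∀ z ∈ A.chains n, F.monomials z ∈ A'.chains n := by
  suffices h : A.chains n ≤ (A'.chains n).comap F.monomials from h
  refine Submodule.span_le.2 ?_
  rintro _ ⟨x, y, i, j, hij, t, ht, a, rfl⟩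
  simpa [monomials, tot] using mem_chains hij (F.isWord ht) (F.map y x j a)

theorem monomials_mem_degenerate (n : ℕ) :
    ∀ z ∈ A.degenerate n, F.monomials z ∈ A'.degenerate n := by
  suffices h : A.degenerate n ≤ (A'.degenerate n).comap F.monomials from h
  refine Submodule.span_le.2 ?_
  rintro _ ⟨x, y, i, j, hij, t, ht, a, rfl⟩
  simpa [monomials, tot] using mem_degenerate hij (F.isDegWord ht) (F.map y x j a)

/-- The map induced by a dg functor on Hochschild complexes. -/
def hochMap : PreMixedComplex.GradedMap A.hoch A'.hoch := fun n =>
  subquotientMap F.monomials (F.monomials_mem n) (F.monomials_mem_degenerate n)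

end Functor

end DGCat

/-! ### Categorical coalgebras -/

/-- An `R`-categorical coalgebra: a non-negatively graded, flat, coassociative and counital
coalgebra with a coderivation `diff` of degree `-1` and a curvature `curv`, such that the
component of degree zero is freely spanned by the set-like elements. -/
structure CategoricalCoalgebra (R : Type u) [CommRing R] where
  carrier : Type v
  [addCommGroup : AddCommGroup carrier]
  [module : Module R carrier]
  [coalgebra : Coalgebra R carrier]
  [flat : Module.Flat R carrier]
  grading : ℕ → Submodule R carrier
  [decomposition : DirectSum.Decomposition grading]
  comul_mem : ∀ n, ∀ c ∈ grading n, CoalgebraStruct.comul (R := R) c ∈ tensorDegree grading n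
  counit_eq_zero : ∀ n, n ≠ 0 → ∀ c ∈ grading n, CoalgebraStruct.counit (R := R) c = 0
  diff : carrier →ₗ[R] carrier
  diff_mem : ∀ n, ∀ c ∈ grading (n + 1), diff c ∈ grading n
  diff_zero : ∀ c ∈ grading 0, diff c = 0
  coderivation : CoalgebraStruct.comul (R := R) ∘ₗ diff =
    (TensorProduct.map diff LinearMap.id + TensorProduct.map (gradedSign grading) diff) ∘ₗ
      CoalgebraStruct.comul
  curv : carrier →ₗ[R] R
  curv_eq_zero : ∀ n, n ≠ 2 → ∀ c ∈ grading n, curv c = 0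
  curv_diff : curv ∘ₗ diff = 0
  diff_diff : diff ∘ₗ diff =
    (TensorProduct.lid R carrier).toLinearMap ∘ₗ TensorProduct.map curv LinearMap.id ∘ₗ
      (CoalgebraStruct.comul - koszulSwap grading ∘ₗ CoalgebraStruct.comul)
  setLike_nonempty : {x : carrier | x ∈ grading 0 ∧ IsGroupLikeElem R x}.Nonempty
  setLike_linearIndependent : LinearIndependent R
    (Subtype.val : {x : carrier | x ∈ grading 0 ∧ IsGroupLikeElem R x} → carrier)
  setLike_span :
    Submodule.span R {x : carrier | x ∈ grading 0 ∧ IsGroupLikeElem R x} = grading 0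
  projZero_diff : projZero grading ∘ₗ diff = 0

namespace CategoricalCoalgebra

variable {R : Type u} [CommRing R]

attribute [instance] addCommGroup module coalgebra flat decomposition

variable (C : CategoricalCoalgebra.{u, v} R)

/-- The coproduct. -/
abbrev comul : C.carrier →ₗ[R] C.carrier ⊗[R] C.carrier := CoalgebraStruct.comul

/-- The counit. -/
abbrev counit : C.carrier →ₗ[R] R := CoalgebraStruct.counit

/-- The grading involution `c ↦ (-1) ^ |c| c`. -/
abbrev sgn : C.carrier →ₗ[R] C.carrier := gradedSign C.grading

/-- The projection `C → C₀`, viewed as an endomorphism of `C`. -/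
abbrev proj₀ : C.carrier →ₗ[R] C.carrier := projZero C.grading

/-- The projection onto the sum of the components of positive degree. -/
abbrev bar : C.carrier →ₗ[R] C.carrier := projPos C.grading

/-- The set-like elements of `C`. -/
abbrev Ob : Type v := {x : C.carrier // x ∈ C.grading 0 ∧ IsGroupLikeElem R x}

/-- The degree `n` part of `R_x □ C □ R_y`, the cotensor products being taken over `C₀`: the
elements `c` of degree `n` on which the left coaction of `C₀` is `c ↦ x ⊗ c` and the right
coaction is `c ↦ c ⊗ y`. -/
def part (x y : C.Ob) (n : ℕ) : Submodule R C.carrier :=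
  C.grading n ⊓
    (LinearMap.eqLocus (TensorProduct.map C.proj₀ LinearMap.id ∘ₗ C.comul)
      (TensorProduct.mk R C.carrier C.carrier x.1) ⊓
    LinearMap.eqLocus (TensorProduct.map LinearMap.id C.proj₀ ∘ₗ C.comul)
      ((TensorProduct.mk R C.carrier C.carrier).flip y.1))

theorem mem_part {x y : C.Ob} {n : ℕ} {c : C.carrier} : c ∈ C.part x y n ↔
    c ∈ C.grading n ∧ TensorProduct.map C.proj₀ LinearMap.id (C.comul c) = x.1 ⊗ₜ c ∧
      TensorProduct.map LinearMap.id C.proj₀ (C.comul c) = c ⊗ₜ y.1 := Iff.rfl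

theorem ob_mem_part (x : C.Ob) : x.1 ∈ C.part x x 0 := by
  refine C.mem_part.2 ⟨x.2.1, ?_, ?_⟩ <;>
  · rw [comul, x.2.2.comul_eq_tmul_self, TensorProduct.map_tmul, proj₀, projZero,
      gradedScale_mem _ _ x.2.1]
    simp

variable {C}

theorem sgn_of_mem {n : ℕ} {c : C.carrier} (hc : c ∈ C.grading n) : C.sgn c = (-1 : R) ^ n • c :=
  gradedScale_mem _ _ hc

theorem proj_of_mem_zero {c : C.carrier} (hc : c ∈ C.grading 0) : C.proj₀ c = c := by
  simp [proj₀, projZero, gradedScale_mem _ _ hc]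

theorem proj_of_mem {n : ℕ} (hn : n ≠ 0) {c : C.carrier} (hc : c ∈ C.grading n) :
    C.proj₀ c = 0 := by
  simp [proj₀, projZero, gradedScale_mem _ _ hc, hn]

theorem bar_of_mem_zero {c : C.carrier} (hc : c ∈ C.grading 0) : C.bar c = 0 := by
  simp [bar, projPos, gradedScale_mem _ _ hc]

theorem bar_of_mem {n : ℕ} (hn : n ≠ 0) {c : C.carrier} (hc : c ∈ C.grading n) :
    C.bar c = c := by
  simp [bar, projPos, gradedScale_mem _ _ hc, hn]

theorem proj_mem (c : C.carrier) : C.proj₀ c ∈ C.grading 0 := by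
  refine graded_induction C.grading (p := fun c => C.proj₀ c ∈ C.grading 0) (by simp) ?_ ?_ c
  · intro a b ha hb
    simpa using add_mem ha hb
  · intro n c hc
    rcases eq_or_ne n 0 with rfl | hn
    · rwa [proj_of_mem_zero hc]
    · rw [proj_of_mem hn hc]
      exact zero_mem _

theorem proj_add_bar (c : C.carrier) : C.proj₀ c + C.bar c = c := by
  have : C.proj₀ + C.bar = LinearMap.id := by
    refine graded_hom_ext C.grading ?_
    intro n c hc
    rcases eq_or_ne n 0 with rfl | hn
    · simp [proj_of_mem_zero hc, bar_of_mem_zero hc]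
    · simp [proj_of_mem hn hc, bar_of_mem hn hc]
  exact LinearMap.congr_fun this c

theorem comul_ob (x : C.Ob) : C.comul x.1 = x.1 ⊗ₜ x.1 := x.2.2.comul_eq_tmul_self

theorem counit_ob (x : C.Ob) : C.counit x.1 = 1 := x.2.2.counit_eq_one

theorem hom_ext_zero {N : Type w} [AddCommGroup N] [Module R N] {f g : C.carrier →ₗ[R] N}
    (h0 : ∀ x : C.Ob, f x.1 = g x.1) (h : ∀ n, n ≠ 0 → ∀ c ∈ C.grading n, f c = g c) :
    f = g := by
  refine graded_hom_ext C.grading ?_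
  intro n c hc
  rcases eq_or_ne n 0 with rfl | hn
  · rw [← C.setLike_span] at hc
    refine LinearMap.eqOn_span (f := f) (g := g) ?_ hc
    intro x hx
    exact h0 ⟨x, hx⟩
  · exact h n hn c hc

theorem proj_mem_span (c : C.carrier) :
    C.proj₀ c ∈ Submodule.span R (Set.range (Subtype.val :
      {x : C.carrier | x ∈ C.grading 0 ∧ IsGroupLikeElem R x} → C.carrier)) := by
  rw [Subtype.range_val, C.setLike_span]
  exact proj_mem c

/-- The coordinate functional of a set-like element. -/
def coord (z : C.Ob) : C.carrier →ₗ[R] R :=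
  Finsupp.lapply z ∘ₗ C.setLike_linearIndependent.repr ∘ₗ
    LinearMap.codRestrict _ C.proj₀ proj_mem_span

theorem coord_ob (z x : C.Ob) [Decidable (x = z)] : coord z x.1 = if x = z then 1 else 0 := by
  classical
  have : C.setLike_linearIndependent.repr
      (LinearMap.codRestrict _ C.proj₀ proj_mem_span x.1) = Finsupp.single x 1 := by
    apply C.setLike_linearIndependent.repr_eq_single
    simp [proj_of_mem_zero x.2.1]
  rw [coord, LinearMap.comp_apply, LinearMap.comp_apply, this]
  simp [Finsupp.single_apply]

theorem coord_self (z : C.Ob) : coord z z.1 = 1 := by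
  classical
  simp [coord_ob]

theorem coord_ne {z x : C.Ob} (h : x ≠ z) : coord z x.1 = 0 := by
  classical
  simp [coord_ob, h]

theorem coord_of_mem (z : C.Ob) {n : ℕ} (hn : n ≠ 0) {c : C.carrier} (hc : c ∈ C.grading n) :
    coord z c = 0 := by
  have : LinearMap.codRestrict _ C.proj₀ proj_mem_span c = 0 := by
    ext
    simp [proj_of_mem hn hc]
  rw [coord, LinearMap.comp_apply, LinearMap.comp_apply, this]
  simp

theorem coord_proj (z : C.Ob) (c : C.carrier) : coord z (C.proj₀ c) = coord z c := by
  have : coord z ∘ₗ C.proj₀ = coord z := by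
    refine graded_hom_ext C.grading ?_
    intro n c hc
    rcases eq_or_ne n 0 with rfl | hn
    · simp [proj_of_mem_zero hc]
    · simp [proj_of_mem hn hc, coord_of_mem z hn hc]
  exact LinearMap.congr_fun this c

theorem exists_coord_sum (c : C.carrier) : ∃ s : Finset C.Ob, ∀ t, s ⊆ t →
    C.counit c = ∑ z ∈ t, coord z c := by
  classical
  refine graded_induction C.grading (p := fun c => ∃ s : Finset C.Ob, ∀ t, s ⊆ t →
    C.counit c = ∑ z ∈ t, coord z c) ⟨∅, by simp⟩ ?_ ?_ c
  · rintro a b ⟨s, hs⟩ ⟨t, ht⟩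
    refine ⟨s ∪ t, fun r hr => ?_⟩
    simp only [map_add, Finset.sum_add_distrib]
    rw [hs r (Finset.union_subset_left hr), ht r (Finset.union_subset_right hr)]
  · intro n c hc
    rcases eq_or_ne n 0 with rfl | hn
    · rw [← C.setLike_span] at hc
      induction hc using Submodule.span_induction with
      | mem x hx =>
        refine ⟨{⟨x, hx⟩}, fun t ht => ?_⟩
        have h1 : ∀ z : C.Ob, coord z x = if z = ⟨x, hx⟩ then 1 else 0 := by
          intro z
          have := coord_ob z ⟨x, hx⟩
          simpa [eq_comm] using this
        rw [Finset.singleton_subset_iff] at ht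
        simp only [h1, Finset.sum_ite_eq', ht, if_true]
        exact counit_ob ⟨x, hx⟩
      | zero => exact ⟨∅, by simp⟩
      | add a b _ _ ha hb =>
        obtain ⟨s, hs⟩ := ha
        obtain ⟨t, ht⟩ := hb
        refine ⟨s ∪ t, fun r hr => ?_⟩
        simp only [map_add, Finset.sum_add_distrib]
        rw [hs r (Finset.union_subset_left hr), ht r (Finset.union_subset_right hr)]
      | smul r a _ ha =>
        obtain ⟨s, hs⟩ := ha
        refine ⟨s, fun t ht => ?_⟩
        rw [map_smul, hs t ht, Finset.smul_sum]
        simp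
    · exact ⟨∅, fun t _ => by
        rw [counit, C.counit_eq_zero n hn c hc]
        simp [coord_of_mem _ hn hc]⟩

/-! Contracting one tensor factor of the coproduct with a functional. -/

/-- The map `c ↦ ∑ φ(c') c''`. -/
def actL (φ : C.carrier →ₗ[R] R) : C.carrier →ₗ[R] C.carrier :=
  (TensorProduct.lid R C.carrier).toLinearMap ∘ₗ TensorProduct.map φ LinearMap.id ∘ₗ C.comul

/-- The map `c ↦ ∑ c' φ(c'')`. -/
def actR (φ : C.carrier →ₗ[R] R) : C.carrier →ₗ[R] C.carrier :=
  (TensorProduct.rid R C.carrier).toLinearMap ∘ₗ TensorProduct.map LinearMap.id φ ∘ₗ C.comul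

theorem tmap_tmap (f f' g g' : C.carrier →ₗ[R] C.carrier) (t : C.carrier ⊗[R] C.carrier) :
    TensorProduct.map f g (TensorProduct.map f' g' t) =
      TensorProduct.map (f ∘ₗ f') (g ∘ₗ g') t := by
  rw [← LinearMap.comp_apply, ← TensorProduct.map_comp]

theorem coassoc_trilinear {X : Type w} [AddCommGroup X] [Module R X]
    (g : C.carrier ⊗[R] (C.carrier ⊗[R] C.carrier) →ₗ[R] X) (c : C.carrier) :
    g (TensorProduct.assoc R _ _ _ (TensorProduct.map C.comul LinearMap.id (C.comul c))) =
      g (TensorProduct.map LinearMap.id C.comul (C.comul c)) :=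
  congrArg g (Coalgebra.coassoc_apply (R := R) c)

theorem comul_actL (φ : C.carrier →ₗ[R] R) (c : C.carrier) :
    C.comul (actL φ c) = TensorProduct.map (actL φ) LinearMap.id (C.comul c) := by
  have h := coassoc_trilinear ((TensorProduct.lid R (C.carrier ⊗[R] C.carrier)).toLinearMap ∘ₗ
    TensorProduct.map φ LinearMap.id) c
  have h1 : ∀ t : C.carrier ⊗[R] C.carrier, C.comul (TensorProduct.lid R C.carrier
      (TensorProduct.map φ LinearMap.id t)) =
      ((TensorProduct.lid R (C.carrier ⊗[R] C.carrier)).toLinearMap ∘ₗ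
    TensorProduct.map φ LinearMap.id) (TensorProduct.map LinearMap.id C.comul t) := by
    intro t
    induction t with
    | zero => simp
    | tmul a b => simp
    | add a b ha hb => simp only [map_add, ha, hb]
  have h2 : ∀ t : C.carrier ⊗[R] C.carrier, TensorProduct.map (actL φ) LinearMap.id t =
      ((TensorProduct.lid R (C.carrier ⊗[R] C.carrier)).toLinearMap ∘ₗ
    TensorProduct.map φ LinearMap.id) (TensorProduct.assoc R _ _ _
      (TensorProduct.map C.comul LinearMap.id t)) := by
    intro t
    induction t with
    | zero => simp
    | tmul a b =>
      rw [TensorProduct.map_tmul, TensorProduct.map_tmul, actL, LinearMap.comp_apply,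
        LinearMap.comp_apply]
      generalize C.comul a = s
      induction s with
      | zero => simp
      | tmul a' a'' => simp [TensorProduct.smul_tmul']
      | add s t hs ht =>
        simp only [map_add, TensorProduct.add_tmul, hs, ht]
    | add a b ha hb => simp only [map_add, ha, hb]
  rw [h2, h, ← h1]
  rfl

theorem comul_actR (φ : C.carrier →ₗ[R] R) (c : C.carrier) :
    C.comul (actR φ c) = TensorProduct.map LinearMap.id (actR φ) (C.comul c) := by
  have h := coassoc_trilinear (TensorProduct.map LinearMap.id
    ((TensorProduct.rid R C.carrier).toLinearMap ∘ₗ TensorProduct.map LinearMap.id φ)) c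
  have h1 : ∀ t : C.carrier ⊗[R] C.carrier, TensorProduct.map LinearMap.id (actR φ) t =
      (TensorProduct.map LinearMap.id
    ((TensorProduct.rid R C.carrier).toLinearMap ∘ₗ TensorProduct.map LinearMap.id φ))
        (TensorProduct.map LinearMap.id C.comul t) := by
    intro t
    induction t with
    | zero => simp
    | tmul a b => simp [actR]
    | add a b ha hb => simp only [map_add, ha, hb]
  have h2 : ∀ t : C.carrier ⊗[R] C.carrier, C.comul (TensorProduct.rid R C.carrier
      (TensorProduct.map LinearMap.id φ t)) =
      (TensorProduct.map LinearMap.id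
    ((TensorProduct.rid R C.carrier).toLinearMap ∘ₗ TensorProduct.map LinearMap.id φ))
      (TensorProduct.assoc R _ _ _ (TensorProduct.map C.comul LinearMap.id t)) := by
    intro t
    induction t with
    | zero => simp
    | tmul a b =>
      simp only [TensorProduct.map_tmul, TensorProduct.rid_tmul, map_smul, LinearMap.id_apply]
      generalize C.comul a = s
      induction s with
      | zero => simp
      | tmul a' a'' => simp
      | add s t hs ht =>
        simp only [map_add, TensorProduct.add_tmul, smul_add, hs, ht]
    | add a b ha hb => simp only [map_add, ha, hb]
  rw [h1, ← h, ← h2]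
  rfl

theorem map_actR_eq (φ : C.carrier →ₗ[R] R) (c : C.carrier) :
    TensorProduct.map (actR φ) LinearMap.id (C.comul c) =
      TensorProduct.map LinearMap.id (actL φ) (C.comul c) := by
  have h := coassoc_trilinear (TensorProduct.map LinearMap.id
    ((TensorProduct.lid R C.carrier).toLinearMap ∘ₗ TensorProduct.map φ LinearMap.id)) c
  have h1 : ∀ t : C.carrier ⊗[R] C.carrier, TensorProduct.map LinearMap.id (actL φ) t =
      (TensorProduct.map LinearMap.id
    ((TensorProduct.lid R C.carrier).toLinearMap ∘ₗ TensorProduct.map φ LinearMap.id))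
        (TensorProduct.map LinearMap.id C.comul t) := by
    intro t
    induction t with
    | zero => simp
    | tmul a b => simp [actL]
    | add a b ha hb => simp only [map_add, ha, hb]
  have h2 : ∀ t : C.carrier ⊗[R] C.carrier, TensorProduct.map (actR φ) LinearMap.id t =
      (TensorProduct.map LinearMap.id
    ((TensorProduct.lid R C.carrier).toLinearMap ∘ₗ TensorProduct.map φ LinearMap.id))
      (TensorProduct.assoc R _ _ _ (TensorProduct.map C.comul LinearMap.id t)) := by
    intro t
    induction t with
    | zero => simp
    | tmul a b =>
      rw [TensorProduct.map_tmul, TensorProduct.map_tmul, actR, LinearMap.comp_apply,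
        LinearMap.comp_apply]
      generalize C.comul a = s
      induction s with
      | zero => simp
      | tmul a' a'' => simp [TensorProduct.smul_tmul]
      | add s t hs ht =>
        simp only [map_add, TensorProduct.add_tmul, hs, ht]
    | add a b ha hb => simp only [map_add, ha, hb]
  rw [h1, ← h, ← h2]

theorem tensorDegree_le {X : Type w} [AddCommGroup X] [Module R X]
    (f : C.carrier ⊗[R] C.carrier →ₗ[R] X) (P : Submodule R X) {n : ℕ}
    (h : ∀ i j, i + j = n → ∀ a ∈ C.grading i, ∀ b ∈ C.grading j, f (a ⊗ₜ b) ∈ P)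
    {c : C.carrier} (hc : c ∈ C.grading n) : f (C.comul c) ∈ P := by
  have : tensorDegree C.grading n ≤ P.comap f := by
    refine Submodule.span_le.2 ?_
    rintro t ⟨i, j, hij, a, ha, b, hb, rfl⟩
    exact h i j hij a ha b hb
  exact this (C.comul_mem n c hc)

theorem actL_coord_mem (z : C.Ob) {n : ℕ} {c : C.carrier} (hc : c ∈ C.grading n) :
    actL (coord z) c ∈ C.grading n := by
  refine tensorDegree_le ((TensorProduct.lid R C.carrier).toLinearMap ∘ₗ
    TensorProduct.map (coord z) LinearMap.id) _ ?_ hc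
  intro i j hij a ha b hb
  rcases eq_or_ne i 0 with rfl | hi
  · obtain rfl : j = n := by omega
    simpa using Submodule.smul_mem _ _ hb
  · simp [coord_of_mem z hi ha]

theorem actR_coord_mem (z : C.Ob) {n : ℕ} {c : C.carrier} (hc : c ∈ C.grading n) :
    actR (coord z) c ∈ C.grading n := by
  refine tensorDegree_le ((TensorProduct.rid R C.carrier).toLinearMap ∘ₗ
    TensorProduct.map LinearMap.id (coord z)) _ ?_ hc
  intro i j hij a ha b hb
  rcases eq_or_ne j 0 with rfl | hj
  · obtain rfl : i = n := by omega
    simpa using Submodule.smul_mem _ _ ha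
  · simp [coord_of_mem z hj hb]

theorem proj_comp_actL (z : C.Ob) :
    C.proj₀ ∘ₗ actL (coord z) = (coord z).smulRight z.1 := by
  refine hom_ext_zero ?_ ?_
  · intro x
    by_cases h : x = z
    · subst h
      simp [actL, comul_ob, coord_self, proj_of_mem_zero x.2.1]
    · simp [actL, comul_ob, coord_ne h]
  · intro n hn c hc
    simp [proj_of_mem hn (actL_coord_mem z hc), coord_of_mem z hn hc]

theorem proj_comp_actR (z : C.Ob) :
    C.proj₀ ∘ₗ actR (coord z) = (coord z).smulRight z.1 := by
  refine hom_ext_zero ?_ ?_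
  · intro x
    by_cases h : x = z
    · subst h
      simp [actR, comul_ob, coord_self, proj_of_mem_zero x.2.1]
    · simp [actR, comul_ob, coord_ne h]
  · intro n hn c hc
    simp [proj_of_mem hn (actR_coord_mem z hc), coord_of_mem z hn hc]

theorem left_actL (z : C.Ob) (c : C.carrier) :
    TensorProduct.map C.proj₀ LinearMap.id (C.comul (actL (coord z) c)) =
      z.1 ⊗ₜ actL (coord z) c := by
  rw [comul_actL, ← LinearMap.comp_apply, ← TensorProduct.map_comp, proj_comp_actL, actL,
    LinearMap.comp_apply, LinearMap.comp_apply]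
  generalize C.comul c = t
  induction t with
  | zero => simp
  | tmul a b => simp [TensorProduct.smul_tmul]
  | add a b ha hb => simp only [map_add, TensorProduct.tmul_add, ha, hb]

theorem right_actR (z : C.Ob) (c : C.carrier) :
    TensorProduct.map LinearMap.id C.proj₀ (C.comul (actR (coord z) c)) =
      actR (coord z) c ⊗ₜ z.1 := by
  rw [comul_actR, ← LinearMap.comp_apply, ← TensorProduct.map_comp, proj_comp_actR, actR,
    LinearMap.comp_apply, LinearMap.comp_apply]
  generalize C.comul c = t
  induction t with
  | zero => simp
  | tmul a b => simp [TensorProduct.smul_tmul]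
  | add a b ha hb => simp only [map_add, TensorProduct.add_tmul, ha, hb]

theorem left_actR (φ : C.carrier →ₗ[R] R) {x : C.Ob} {c : C.carrier}
    (hc : TensorProduct.map C.proj₀ LinearMap.id (C.comul c) = x.1 ⊗ₜ c) :
    TensorProduct.map C.proj₀ LinearMap.id (C.comul (actR φ c)) = x.1 ⊗ₜ actR φ c := by
  have : TensorProduct.map C.proj₀ LinearMap.id (C.comul (actR φ c)) =
      TensorProduct.map LinearMap.id (actR φ)
        (TensorProduct.map C.proj₀ LinearMap.id (C.comul c)) := by
    rw [comul_actR, tmap_tmap, tmap_tmap]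
    simp
  rw [this, hc]
  simp

theorem right_actL (φ : C.carrier →ₗ[R] R) {y : C.Ob} {c : C.carrier}
    (hc : TensorProduct.map LinearMap.id C.proj₀ (C.comul c) = c ⊗ₜ y.1) :
    TensorProduct.map LinearMap.id C.proj₀ (C.comul (actL φ c)) = actL φ c ⊗ₜ y.1 := by
  have : TensorProduct.map LinearMap.id C.proj₀ (C.comul (actL φ c)) =
      TensorProduct.map (actL φ) LinearMap.id
        (TensorProduct.map LinearMap.id C.proj₀ (C.comul c)) := by
    rw [comul_actL, tmap_tmap, tmap_tmap]
    simp
  rw [this, hc]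
  simp

theorem actL_of_left {x : C.Ob} {c : C.carrier}
    (hc : TensorProduct.map C.proj₀ LinearMap.id (C.comul c) = x.1 ⊗ₜ c) :
    actL (coord x) c = c := by
  have h : coord x = coord x ∘ₗ C.proj₀ := LinearMap.ext fun a => (coord_proj x a).symm
  have h2 : TensorProduct.map (coord x) (LinearMap.id : C.carrier →ₗ[R] C.carrier) =
      TensorProduct.map (coord x) LinearMap.id ∘ₗ TensorProduct.map C.proj₀ LinearMap.id := by
    rw [← TensorProduct.map_comp, ← h]
    simp
  rw [actL, h2]
  simp only [LinearMap.comp_apply, hc]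
  simp [coord_self]

theorem actR_of_right {y : C.Ob} {c : C.carrier}
    (hc : TensorProduct.map LinearMap.id C.proj₀ (C.comul c) = c ⊗ₜ y.1) :
    actR (coord y) c = c := by
  have h : coord y = coord y ∘ₗ C.proj₀ := LinearMap.ext fun a => (coord_proj y a).symm
  have h2 : TensorProduct.map (LinearMap.id : C.carrier →ₗ[R] C.carrier) (coord y) =
      TensorProduct.map LinearMap.id (coord y) ∘ₗ TensorProduct.map LinearMap.id C.proj₀ := by
    rw [← TensorProduct.map_comp, ← h]
    simp
  rw [actR, h2]
  simp only [LinearMap.comp_apply, hc]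
  simp [coord_self]

theorem exists_sum_actL (c : C.carrier) : ∃ s : Finset C.Ob, ∀ t, s ⊆ t →
    c = ∑ z ∈ t, actL (coord z) c := by
  classical
  have key : ∀ τ : C.carrier ⊗[R] C.carrier, ∃ s : Finset C.Ob, ∀ t, s ⊆ t →
      TensorProduct.lid R C.carrier (TensorProduct.map C.counit LinearMap.id τ) =
        ∑ z ∈ t, TensorProduct.lid R C.carrier
          (TensorProduct.map (coord z) LinearMap.id τ) := by
    intro τ
    induction τ with
    | zero => exact ⟨∅, by simp⟩
    | tmul a b =>
      obtain ⟨s, hs⟩ := exists_coord_sum a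
      refine ⟨s, fun t ht => ?_⟩
      simp [hs t ht, Finset.sum_smul]
    | add a b ha hb =>
      obtain ⟨s, hs⟩ := ha
      obtain ⟨t, ht⟩ := hb
      refine ⟨s ∪ t, fun r hr => ?_⟩
      simp only [map_add, Finset.sum_add_distrib]
      rw [hs r (Finset.union_subset_left hr), ht r (Finset.union_subset_right hr)]
  obtain ⟨s, hs⟩ := key (C.comul c)
  refine ⟨s, fun t ht => ?_⟩
  have h2 : TensorProduct.map C.counit LinearMap.id (C.comul c) = (1 : R) ⊗ₜ c :=
    Coalgebra.rTensor_counit_comul c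
  have h1 := hs t ht
  rw [h2] at h1
  rw [TensorProduct.lid_tmul, one_smul] at h1
  exact h1

theorem exists_sum_map_actL (τ : C.carrier ⊗[R] C.carrier) : ∃ s : Finset C.Ob,
    ∀ t, s ⊆ t → τ = ∑ z ∈ t, TensorProduct.map LinearMap.id (actL (coord z)) τ := by
  classical
  induction τ with
  | zero => exact ⟨∅, by simp⟩
  | tmul a b =>
    obtain ⟨s, hs⟩ := exists_sum_actL b
    refine ⟨s, fun t ht => ?_⟩
    simp only [TensorProduct.map_tmul, LinearMap.id_apply]
    rw [← TensorProduct.tmul_sum, ← hs t ht]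
  | add a b ha hb =>
    obtain ⟨s, hs⟩ := ha
    obtain ⟨t, ht⟩ := hb
    refine ⟨s ∪ t, fun r hr => ?_⟩
    simp only [map_add, Finset.sum_add_distrib]
    rw [← hs r (Finset.union_subset_left hr), ← ht r (Finset.union_subset_right hr)]

/-- The coproduct of an element of `C(x, y)` lies in the sum of the `C(x, z) ⊗ C(z, y)`. -/
theorem comul_part_mem {x y : C.Ob} {n : ℕ} {c : C.carrier} (hc : c ∈ C.part x y n) :
    C.comul c ∈ Submodule.span R {t | ∃ (z : C.Ob) (i j : ℕ), i + j = n ∧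
      ∃ a ∈ C.part x z i, ∃ b ∈ C.part z y j, t = a ⊗ₜ[R] b} := by
  obtain ⟨hn, hl, hr⟩ := C.mem_part.1 hc
  have h1 : C.comul c = TensorProduct.map (actL (coord x)) (actR (coord y)) (C.comul c) := by
    conv_lhs => rw [← actL_of_left hl, comul_actL, ← actR_of_right hr, comul_actR]
    rw [← LinearMap.comp_apply, ← TensorProduct.map_comp]
    simp
  obtain ⟨s, hs⟩ := exists_sum_map_actL (C.comul c)
  have h2 := hs s subset_rfl
  rw [h2]
  refine Submodule.sum_mem _ fun z _ => ?_
  have h3 : TensorProduct.map LinearMap.id (actL (coord z)) (C.comul c) =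
      TensorProduct.map (actR (coord z) ∘ₗ actL (coord x)) (actL (coord z) ∘ₗ actR (coord y))
        (C.comul c) := by
    have h4 : (actL (coord z) : C.carrier →ₗ[R] _) = actL (coord z) ∘ₗ actL (coord z) :=
      LinearMap.ext fun a => (actL_of_left (left_actL z a)).symm
    conv_lhs => rw [h4]
    have h5 : TensorProduct.map LinearMap.id (actL (coord z) ∘ₗ actL (coord z)) (C.comul c) =
        TensorProduct.map LinearMap.id (actL (coord z))
          (TensorProduct.map LinearMap.id (actL (coord z)) (C.comul c)) := by
      rw [tmap_tmap]
      simp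
    rw [h5, ← map_actR_eq, tmap_tmap]
    conv_lhs => rw [h1]
    rw [tmap_tmap]
    simp
  rw [h3]
  refine tensorDegree_le (TensorProduct.map (actR (coord z) ∘ₗ actL (coord x))
    (actL (coord z) ∘ₗ actR (coord y))) _ ?_ hn
  intro i j hij a ha b hb
  refine Submodule.subset_span ⟨z, i, j, hij, _, C.mem_part.2 ⟨?_, ?_, ?_⟩, _,
    C.mem_part.2 ⟨?_, ?_, ?_⟩, rfl⟩
  · exact actR_coord_mem z (actL_coord_mem x ha)
  · exact left_actR _ (left_actL x a)
  · exact right_actR z _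
  · exact actL_coord_mem z (actR_coord_mem y hb)
  · exact left_actL z _
  · exact right_actL _ (right_actR y b)

theorem diff_part_mem {x y : C.Ob} {n : ℕ} {c : C.carrier} (hc : c ∈ C.part x y (n + 1)) :
    C.diff c ∈ C.part x y n := by
  obtain ⟨hn, hl, hr⟩ := C.mem_part.1 hc
  have h := LinearMap.congr_fun C.coderivation c
  have hs : C.proj₀ ∘ₗ C.sgn = C.proj₀ := by
    refine graded_hom_ext C.grading fun n c hc => ?_
    rcases eq_or_ne n 0 with rfl | hn
    · simp [sgn_of_mem hc]
    · simp [sgn_of_mem hc, proj_of_mem hn hc]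
  have hd : C.proj₀ ∘ₗ C.diff = 0 := C.projZero_diff
  refine C.mem_part.2 ⟨C.diff_mem n c hn, ?_, ?_⟩
  · have h1 : TensorProduct.map C.proj₀ LinearMap.id (C.comul (C.diff c)) =
        TensorProduct.map LinearMap.id C.diff
          (TensorProduct.map C.proj₀ LinearMap.id (C.comul c)) := by
      rw [← LinearMap.comp_apply (C.comul), C.coderivation]
      simp only [LinearMap.comp_apply, LinearMap.add_apply, map_add]
      simp only [tmap_tmap, hd, hs]
      simp
    rw [h1, hl]
    simp
  · have h1 : TensorProduct.map LinearMap.id C.proj₀ (C.comul (C.diff c)) =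
        TensorProduct.map C.diff LinearMap.id
          (TensorProduct.map LinearMap.id C.proj₀ (C.comul c)) := by
      rw [← LinearMap.comp_apply (C.comul), C.coderivation]
      simp only [LinearMap.comp_apply, LinearMap.add_apply, map_add]
      simp only [tmap_tmap, hd]
      simp
    rw [h1, hr]
    simp

theorem ob_smul_injective {x y : C.Ob} {r : R} (h : r • x.1 = r • y.1) : x = y ∨ r = 0 := by
  by_cases hxy : x = y
  · exact Or.inl hxy
  · right
    have := congrArg (coord x) h
    simpa [coord_self, coord_ne (Ne.symm hxy)] using this

theorem diff_diff_two {c : C.carrier} (hc : c ∈ C.grading 2) : C.diff (C.diff c) = 0 := by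
  have h1 := C.diff_mem 0 _ (C.diff_mem 1 c hc)
  rw [← proj_of_mem_zero h1]
  exact LinearMap.congr_fun C.projZero_diff (C.diff c)

/-- The two contractions of the coproduct with the curvature. -/
theorem diff_diff_apply (c : C.carrier) :
    C.diff (C.diff c) = actL C.curv c - actR C.curv c := by
  have h := LinearMap.congr_fun C.diff_diff c
  rw [LinearMap.comp_apply] at h
  rw [h]
  simp only [LinearMap.comp_apply, LinearMap.sub_apply, map_sub, LinearEquiv.coe_coe]
  refine congrArg₂ (· - ·) rfl ?_
  rw [actR, LinearMap.comp_apply, LinearMap.comp_apply]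
  have key : (TensorProduct.lid R C.carrier).toLinearMap ∘ₗ
      TensorProduct.map C.curv LinearMap.id ∘ₗ koszulSwap C.grading =
      (TensorProduct.rid R C.carrier).toLinearMap ∘ₗ
        TensorProduct.map LinearMap.id C.curv := by
    have he : C.curv = C.curv ∘ₗ C.sgn := graded_hom_ext C.grading fun n c hc => by
      by_cases h : n = 2
      · subst h
        simp [sgn_of_mem hc]
      · simp [sgn_of_mem hc, C.curv_eq_zero n h c hc]
    have hp : evenPart C.grading + oddPart C.grading = LinearMap.id :=
      graded_hom_ext C.grading fun n c hc => by
        rcases Nat.even_or_odd n with h | h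
        · simp [evenPart, oddPart, gradedScale_mem _ _ hc, h, Nat.not_odd_iff_even.2 h]
        · simp [evenPart, oddPart, gradedScale_mem _ _ hc, h, Nat.not_even_iff_odd.2 h]
    refine TensorProduct.ext' fun a b => ?_
    have hp' := LinearMap.congr_fun hp a
    have he' := LinearMap.congr_fun he b
    simp only [LinearMap.comp_apply, LinearMap.add_apply, LinearMap.id_apply] at hp' he'
    simp only [koszulSwap, LinearMap.comp_apply, LinearMap.add_apply, TensorProduct.map_tmul,
      map_add, LinearEquiv.coe_coe, TensorProduct.comm_tmul, TensorProduct.lid_tmul,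
      LinearMap.id_apply, TensorProduct.rid_tmul]
    rw [← he', ← smul_add, hp']
  exact LinearMap.congr_fun key (C.comul c)

theorem curv_part {x y : C.Ob} {c : C.carrier} (hc : c ∈ C.part x y 2) :
    x = y ∨ C.curv c = 0 := by
  obtain ⟨hn, hl, hr⟩ := C.mem_part.1 hc
  have h := diff_diff_apply c
  rw [diff_diff_two hn] at h
  have h1 : actL C.curv c = C.curv c • y.1 := by
    have : TensorProduct.lid R C.carrier (TensorProduct.map C.curv LinearMap.id (C.comul c)) =
        TensorProduct.lid R C.carrier (TensorProduct.map C.curv LinearMap.id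
          (TensorProduct.map LinearMap.id C.proj₀ (C.comul c))) := by
      have := tensorDegree_le ((TensorProduct.lid R C.carrier).toLinearMap ∘ₗ
        TensorProduct.map C.curv LinearMap.id ∘ₗ
        (LinearMap.id - TensorProduct.map LinearMap.id C.proj₀)) ⊥ ?_ hn
      · simpa [sub_eq_zero] using this
      · intro i j hij a ha b hb
        by_cases hi : i = 2
        · obtain rfl : j = 0 := by omega
          simp [proj_of_mem_zero hb]
        · simp [C.curv_eq_zero i hi a ha]
    rw [hr] at this
    simpa [actL] using this
  have h2 : actR C.curv c = C.curv c • x.1 := by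
    have : TensorProduct.rid R C.carrier (TensorProduct.map LinearMap.id C.curv (C.comul c)) =
        TensorProduct.rid R C.carrier (TensorProduct.map LinearMap.id C.curv
          (TensorProduct.map C.proj₀ LinearMap.id (C.comul c))) := by
      have := tensorDegree_le ((TensorProduct.rid R C.carrier).toLinearMap ∘ₗ
        TensorProduct.map LinearMap.id C.curv ∘ₗ
        (LinearMap.id - TensorProduct.map C.proj₀ LinearMap.id)) ⊥ ?_ hn
      · simpa [sub_eq_zero] using this
      · intro i j hij a ha b hb
        by_cases hj : j = 2
        · obtain rfl : i = 0 := by omega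
          simp [proj_of_mem_zero ha]
        · simp [C.curv_eq_zero j hj b hb]
    rw [hl] at this
    simpa [actR] using this
  rw [h1, h2, eq_comm, sub_eq_zero] at h
  exact ob_smul_injective h.symm

/-! ### The cobar construction

A monomial `{c₁ | ⋯ | cₚ}` is represented by the word `c₁ ⋯ cₚ` in the tensor algebra on `C`. The
letters of that word are desuspended, so that `cᵢ` contributes `|cᵢ| - 1` to the degree. -/

variable (C) in
/-- The tensor algebra on the desuspension of `C`. -/
abbrev Words : Type _ := TensorAlgebra R C.carrier

variable (C) in
/-- The grading involution of `Words`. -/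
def wsgn : C.Words →ₐ[R] C.Words := wordSign (oddPart C.grading) (evenPart C.grading)

theorem odd_sub_even (c : C.carrier) :
    oddPart C.grading c - evenPart C.grading c = -C.sgn c := by
  have : oddPart C.grading - evenPart C.grading = -C.sgn := by
    refine graded_hom_ext C.grading fun n c hc => ?_
    rcases Nat.even_or_odd n with h | h
    · simp [evenPart, oddPart, gradedScale_mem _ _ hc, sgn_of_mem hc, h, Nat.not_odd_iff_even.2 h]
    · simp [evenPart, oddPart, gradedScale_mem _ _ hc, sgn_of_mem hc, h, Nat.not_even_iff_odd.2 h]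
  exact LinearMap.congr_fun this c

@[simp]
theorem wsgn_ι (c : C.carrier) :
    C.wsgn (TensorAlgebra.ι R c) = -TensorAlgebra.ι R (C.sgn c) := by
  rw [wsgn, wordSign_ι, odd_sub_even, map_neg]

/-- The convolution product `c ↦ ∑ f(c') g(c'')`. -/
def conv {X : Type w} [Ring X] [Algebra R X] (f g : C.carrier →ₗ[R] X) : C.carrier →ₗ[R] X :=
  LinearMap.mul' R X ∘ₗ TensorProduct.map f g ∘ₗ C.comul

section Conv

variable {X : Type w} [Ring X] [Algebra R X] (f f' g g' k : C.carrier →ₗ[R] X)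

theorem conv_add_left : conv (f + f') g = conv f g + conv f' g := by
  simp only [conv, TensorProduct.map_add_left, LinearMap.add_comp, LinearMap.comp_add]

theorem conv_add_right : conv f (g + g') = conv f g + conv f g' := by
  simp only [conv, TensorProduct.map_add_right, LinearMap.add_comp, LinearMap.comp_add]

theorem conv_neg_left : conv (-f) g = -conv f g := by
  have h : TensorProduct.map (-f) g = -TensorProduct.map f g :=
    TensorProduct.ext' fun a b => by simp [TensorProduct.neg_tmul]
  simp only [conv, h, LinearMap.neg_comp, LinearMap.comp_neg]

theorem conv_neg_right : conv f (-g) = -conv f g := by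
  have h : TensorProduct.map f (-g) = -TensorProduct.map f g :=
    TensorProduct.ext' fun a b => by simp [TensorProduct.tmul_neg]
  simp only [conv, h, LinearMap.neg_comp, LinearMap.comp_neg]

theorem conv_sub_left : conv (f - f') g = conv f g - conv f' g := by
  rw [sub_eq_add_neg, conv_add_left, conv_neg_left, sub_eq_add_neg]

theorem conv_sub_right : conv f (g - g') = conv f g - conv f g' := by
  rw [sub_eq_add_neg, conv_add_right, conv_neg_right, sub_eq_add_neg]

theorem conv_assoc : conv (conv f g) k = conv f (conv g k) := by
  ext c
  have h := coassoc_trilinear (LinearMap.mul' R X ∘ₗ TensorProduct.map f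
    (LinearMap.mul' R X ∘ₗ TensorProduct.map g k)) c
  have h1 : ∀ t : C.carrier ⊗[R] C.carrier, LinearMap.mul' R X (TensorProduct.map f (conv g k) t) =
      (LinearMap.mul' R X ∘ₗ TensorProduct.map f (LinearMap.mul' R X ∘ₗ TensorProduct.map g k))
        (TensorProduct.map LinearMap.id C.comul t) := by
    intro t
    induction t with
    | zero => simp
    | tmul a b => simp [conv]
    | add a b ha hb => simp only [map_add, ha, hb]
  have h2 : ∀ t : C.carrier ⊗[R] C.carrier, LinearMap.mul' R X (TensorProduct.map (conv f g) k t) =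
      (LinearMap.mul' R X ∘ₗ TensorProduct.map f (LinearMap.mul' R X ∘ₗ TensorProduct.map g k))
      (TensorProduct.assoc R _ _ _ (TensorProduct.map C.comul LinearMap.id t)) := by
    intro t
    induction t with
    | zero => simp
    | tmul a b =>
      simp only [TensorProduct.map_tmul, conv, LinearMap.comp_apply, LinearMap.id_apply,
        LinearMap.mul'_apply]
      generalize C.comul a = s
      induction s with
      | zero => simp
      | tmul a' a'' => simp [mul_assoc]
      | add s t hs ht =>
        simp only [map_add, TensorProduct.add_tmul, add_mul, hs, ht]
    | add a b ha hb => simp only [map_add, ha, hb]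
  exact (h2 _).trans (h.trans (h1 _).symm)

end Conv

theorem sgn_sgn : C.sgn ∘ₗ C.sgn = LinearMap.id :=
  graded_hom_ext C.grading fun n c hc => by
    simp [sgn_of_mem hc, smul_smul, ← pow_add, Even.neg_one_pow (Even.add_self n)]

theorem sgn_bar : C.sgn ∘ₗ C.bar = C.bar ∘ₗ C.sgn :=
  graded_hom_ext C.grading fun n c hc => by
    rcases eq_or_ne n 0 with rfl | hn
    · simp [sgn_of_mem hc, bar_of_mem_zero hc]
    · simp [sgn_of_mem hc, bar_of_mem hn hc]

theorem bar_bar : C.bar ∘ₗ C.bar = C.bar :=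
  graded_hom_ext C.grading fun n c hc => by
    rcases eq_or_ne n 0 with rfl | hn
    · simp [bar_of_mem_zero hc]
    · simp [bar_of_mem hn hc]

theorem sgn_diff : C.sgn ∘ₗ C.diff = -(C.diff ∘ₗ C.sgn) :=
  graded_hom_ext C.grading fun n c hc => by
    rcases n with _ | n
    · simp [C.diff_zero c hc, sgn_of_mem hc]
    · simp [sgn_of_mem hc, sgn_of_mem (C.diff_mem n c hc), pow_succ]

theorem bar_diff : C.bar ∘ₗ C.diff = C.diff := by
  ext c
  have h := proj_add_bar (C.diff c)
  have h' : C.proj₀ (C.diff c) = 0 := LinearMap.congr_fun C.projZero_diff c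
  rw [h', zero_add] at h
  exact h

theorem diff_bar : C.diff ∘ₗ C.bar = C.diff :=
  graded_hom_ext C.grading fun n c hc => by
    rcases eq_or_ne n 0 with rfl | hn
    · simp [bar_of_mem_zero hc, C.diff_zero c hc]
    · simp [bar_of_mem hn hc]

theorem curv_sgn : C.curv ∘ₗ C.sgn = C.curv :=
  graded_hom_ext C.grading fun n c hc => by
    by_cases h : n = 2
    · subst h
      simp [sgn_of_mem hc]
    · simp [sgn_of_mem hc, C.curv_eq_zero n h c hc]

theorem curv_bar : C.curv ∘ₗ C.bar = C.curv :=
  graded_hom_ext C.grading fun n c hc => by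
    rcases eq_or_ne n 0 with rfl | hn
    · simp [bar_of_mem_zero hc, C.curv_eq_zero 0 (by decide) c hc]
    · simp [bar_of_mem hn hc]

theorem tensor_eq {X : Type w} [AddCommGroup X] [Module R X]
    {f g : C.carrier ⊗[R] C.carrier →ₗ[R] X} {n : ℕ}
    (h : ∀ i j, i + j = n → ∀ a ∈ C.grading i, ∀ b ∈ C.grading j, f (a ⊗ₜ b) = g (a ⊗ₜ b))
    {c : C.carrier} (hc : c ∈ C.grading n) : f (C.comul c) = g (C.comul c) := by
  have := tensorDegree_le (f - g) ⊥ (fun i j hij a ha b hb => by simp [h i j hij a ha b hb]) hc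
  simpa [sub_eq_zero] using this

theorem comul_sgn : C.comul ∘ₗ C.sgn = TensorProduct.map C.sgn C.sgn ∘ₗ C.comul :=
  graded_hom_ext C.grading fun n c hc => by
    rw [LinearMap.comp_apply, sgn_of_mem hc, map_smul, LinearMap.comp_apply]
    refine tensor_eq (f := ((-1 : R) ^ n) • LinearMap.id) ?_ hc
    rintro i j rfl a ha b hb
    simp only [LinearMap.smul_apply, LinearMap.id_apply, TensorProduct.map_tmul, sgn_of_mem ha,
      sgn_of_mem hb, TensorProduct.smul_tmul_smul, pow_add]

section Conv

variable {X : Type w} [Ring X] [Algebra R X] (f g : C.carrier →ₗ[R] X)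

theorem conv_sgn : conv f g ∘ₗ C.sgn = conv (f ∘ₗ C.sgn) (g ∘ₗ C.sgn) := by
  simp only [conv, LinearMap.comp_assoc, comul_sgn]
  rw [TensorProduct.map_comp, LinearMap.comp_assoc]

theorem conv_diff : conv f g ∘ₗ C.diff =
    conv (f ∘ₗ C.diff) g + conv (f ∘ₗ C.sgn) (g ∘ₗ C.diff) := by
  have h := C.coderivation
  simp only [conv, LinearMap.comp_assoc]
  rw [h, LinearMap.add_comp, LinearMap.comp_add, LinearMap.comp_add]
  congr 1
  · rw [← LinearMap.comp_assoc _ (TensorProduct.map C.diff LinearMap.id),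
      ← TensorProduct.map_comp, LinearMap.comp_id]
  · rw [← LinearMap.comp_assoc _ (TensorProduct.map (gradedSign C.grading) C.diff),
      ← TensorProduct.map_comp]

theorem conv_scalar_left (φ : C.carrier →ₗ[R] R) :
    conv (Algebra.linearMap R X ∘ₗ φ) g = g ∘ₗ actL φ := by
  have h : LinearMap.mul' R X ∘ₗ TensorProduct.map (Algebra.linearMap R X ∘ₗ φ) g =
      g ∘ₗ (TensorProduct.lid R C.carrier).toLinearMap ∘ₗ TensorProduct.map φ LinearMap.id :=
    TensorProduct.ext' fun a b => by simp [Algebra.smul_def]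
  rw [conv, actL, ← LinearMap.comp_assoc, h]
  rfl

theorem conv_scalar_right (φ : C.carrier →ₗ[R] R) :
    conv g (Algebra.linearMap R X ∘ₗ φ) = g ∘ₗ actR φ := by
  have h : LinearMap.mul' R X ∘ₗ TensorProduct.map g (Algebra.linearMap R X ∘ₗ φ) =
      g ∘ₗ (TensorProduct.rid R C.carrier).toLinearMap ∘ₗ TensorProduct.map LinearMap.id φ :=
    TensorProduct.ext' fun a b => by simp [Algebra.smul_def, Algebra.commutes]
  rw [conv, actR, ← LinearMap.comp_assoc, h]
  rfl

end Conv

variable (C) in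
/-- The cobar differential on words of length one: this is the sum of the desuspensions of the
curvature, the differential and the reduced coproduct,
`{c} ↦ h(c) - {∂c} - ∑ (-1) ^ |c'| {c' | c''}`. -/
def cobarLetter : C.carrier →ₗ[R] C.Words :=
  Algebra.linearMap R C.Words ∘ₗ C.curv - TensorAlgebra.ι R ∘ₗ C.diff -
    conv (TensorAlgebra.ι R ∘ₗ C.sgn ∘ₗ C.bar) (TensorAlgebra.ι R ∘ₗ C.bar)

variable (C) in
/-- The recursion step for `cobarDiff`. -/
def cobarStep : C.carrier →ₗ[R] Module.End R (C.Words × C.Words) :=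
  LinearMap.mk₂ R (fun c p => (TensorAlgebra.ι R c * p.1,
      C.cobarLetter c * p.1 - TensorAlgebra.ι R (C.sgn c) * p.2))
    (fun c c' p => by
      ext
      · simp [add_mul]
      · simp only [map_add, add_mul, Prod.snd_add]
        abel)
    (fun r c p => by
      ext
      · simp
      · simp only [map_smul, smul_mul_assoc, Prod.smul_snd, smul_sub])
    (fun c p q => by
      ext
      · simp [mul_add]
      · simp only [mul_add, Prod.fst_add, Prod.snd_add]
        abel)
    (fun r c p => by
      ext
      · simp
      · simp only [mul_smul_comm, Prod.smul_fst, Prod.smul_snd, smul_sub])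

variable (C) in
/-- The differential of the cobar construction: the extension of `cobarLetter` to a
derivation. -/
def cobarDiff : C.Words →ₗ[R] C.Words := LinearMap.snd R _ _ ∘ₗ wordFold C.cobarStep (1, 0)

@[simp]
theorem cobarDiff_one : C.cobarDiff 1 = 0 := by simp [cobarDiff]

theorem cobarStep_apply (c : C.carrier) (p : C.Words × C.Words) :
    C.cobarStep c p = (TensorAlgebra.ι R c * p.1,
      C.cobarLetter c * p.1 - TensorAlgebra.ι R (C.sgn c) * p.2) := rfl

theorem cobarDiff_cons (c : C.carrier) (t : C.Words) :
    C.cobarDiff (TensorAlgebra.ι R c * t) =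
      C.cobarLetter c * t - TensorAlgebra.ι R (C.sgn c) * C.cobarDiff t := by
  have h : ∀ t : C.Words, (wordFold C.cobarStep (1, 0) t).1 = t := by
    intro t
    refine word_induction (p := fun t => (wordFold C.cobarStep (1, 0) t).1 = t) (by simp) ?_ ?_ ?_ t
    · intro a b ha hb
      simp [ha, hb]
    · intro r a ha
      simp [ha]
    · intro v w hw
      simp [cobarStep_apply, hw]
  simp [cobarDiff, cobarStep_apply, h t]

@[simp]
theorem cobarDiff_ι (c : C.carrier) : C.cobarDiff (TensorAlgebra.ι R c) = C.cobarLetter c := by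
  simpa using cobarDiff_cons c 1

theorem cobarDiff_mul (s t : C.Words) :
    C.cobarDiff (s * t) = C.cobarDiff s * t + C.wsgn s * C.cobarDiff t := by
  refine word_induction (p := fun s => C.cobarDiff (s * t) =
    C.cobarDiff s * t + C.wsgn s * C.cobarDiff t) (by simp) ?_ ?_ ?_ s
  · intro a b ha hb
    simp only [add_mul, map_add, ha, hb]
    abel
  · intro r a ha
    simp only [smul_mul_assoc, map_smul, ha, smul_add]
  · intro c s hs
    rw [mul_assoc, cobarDiff_cons, hs, cobarDiff_cons, map_mul, wsgn_ι]
    simp only [mul_add, sub_mul, neg_mul, mul_assoc]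
    abel

theorem wsgn_wsgn (t : C.Words) : C.wsgn (C.wsgn t) = t := by
  have : C.wsgn.comp C.wsgn = AlgHom.id R C.Words := by
    ext c
    have := LinearMap.congr_fun (sgn_sgn (C := C)) c
    simp only [LinearMap.comp_apply, LinearMap.id_apply] at this
    simp [this]
  exact DFunLike.congr_fun this t

theorem alg_conv {X Y : Type*} [Ring X] [Algebra R X] [Ring Y] [Algebra R Y] (F : X →ₐ[R] Y)
    (f g : C.carrier →ₗ[R] X) :
    F.toLinearMap ∘ₗ conv f g = conv (F.toLinearMap ∘ₗ f) (F.toLinearMap ∘ₗ g) := by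
  have h : F.toLinearMap ∘ₗ LinearMap.mul' R X ∘ₗ TensorProduct.map f g =
      LinearMap.mul' R Y ∘ₗ TensorProduct.map (F.toLinearMap ∘ₗ f) (F.toLinearMap ∘ₗ g) :=
    TensorProduct.ext' fun a b => by simp
  exact congrArg (fun k => k ∘ₗ C.comul) h

theorem cobarDiff_conv (f g : C.carrier →ₗ[R] C.Words) :
    C.cobarDiff ∘ₗ conv f g =
      conv (C.cobarDiff ∘ₗ f) g + conv (C.wsgn.toLinearMap ∘ₗ f) (C.cobarDiff ∘ₗ g) := by
  have h : C.cobarDiff ∘ₗ LinearMap.mul' R C.Words ∘ₗ TensorProduct.map f g =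
      LinearMap.mul' R C.Words ∘ₗ TensorProduct.map (C.cobarDiff ∘ₗ f) g +
      LinearMap.mul' R C.Words ∘ₗ TensorProduct.map (C.wsgn.toLinearMap ∘ₗ f) (C.cobarDiff ∘ₗ g) :=
    TensorProduct.ext' fun a b => by simp [cobarDiff_mul]
  exact congrArg (fun k => k ∘ₗ C.comul) h

theorem cobarLetter_bar : C.cobarLetter ∘ₗ C.bar = C.cobarLetter := by
  refine graded_hom_ext C.grading fun n c hc => ?_
  rcases eq_or_ne n 0 with rfl | hn
  · rw [LinearMap.comp_apply, bar_of_mem_zero hc, map_zero]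
    have : conv (TensorAlgebra.ι R ∘ₗ C.sgn ∘ₗ C.bar) (TensorAlgebra.ι R ∘ₗ C.bar) c =
        (0 : C.Words) := by
      refine tensor_eq (f := LinearMap.mul' R C.Words ∘ₗ TensorProduct.map _ _) (g := 0) ?_ hc
      intro i j hij a ha b hb
      obtain ⟨rfl, rfl⟩ : i = 0 ∧ j = 0 := by omega
      simp [bar_of_mem_zero ha]
    simp [cobarLetter, C.diff_zero c hc, C.curv_eq_zero 0 (by decide) c hc, this]
  · rw [LinearMap.comp_apply, bar_of_mem hn hc]

theorem wsgn_ι_comp : C.wsgn.toLinearMap ∘ₗ (TensorAlgebra.ι R : C.carrier →ₗ[R] C.Words) =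
    -(TensorAlgebra.ι R ∘ₗ C.sgn) := by
  refine LinearMap.ext fun c => ?_
  simp

theorem wsgn_cobarLetter (c : C.carrier) :
    C.wsgn (C.cobarLetter c) = C.cobarLetter (C.sgn c) := by
  have h : C.wsgn.toLinearMap ∘ₗ C.cobarLetter = C.cobarLetter ∘ₗ C.sgn := by
    simp only [cobarLetter, LinearMap.comp_sub, LinearMap.sub_comp, alg_conv, conv_sgn]
    simp only [← LinearMap.comp_assoc, wsgn_ι_comp]
    simp only [LinearMap.neg_comp, conv_neg_left, conv_neg_right, neg_neg]
    refine congrArg₂ (· - ·) (congrArg₂ (· - ·) ?_ ?_) ?_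
    · refine LinearMap.ext fun c => ?_
      have := LinearMap.congr_fun (curv_sgn (C := C)) c
      simp only [LinearMap.comp_apply] at this
      simp [this]
    · simp only [LinearMap.comp_assoc, sgn_diff, LinearMap.comp_neg, neg_neg]
    · simp only [LinearMap.comp_assoc]
      rw [sgn_bar]
  exact LinearMap.congr_fun h c

theorem cobarDiff_wsgn (t : C.Words) : C.cobarDiff (C.wsgn t) = -C.wsgn (C.cobarDiff t) := by
  refine word_induction (p := fun t => C.cobarDiff (C.wsgn t) = -C.wsgn (C.cobarDiff t))
    (by simp) ?_ ?_ ?_ t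
  · intro a b ha hb
    simp only [map_add, ha, hb, neg_add]
  · intro r a ha
    simp only [map_smul, ha, smul_neg]
  · intro c t ht
    rw [map_mul, cobarDiff_mul, ht, wsgn_ι, map_neg, cobarDiff_ι, cobarDiff_cons, map_sub, map_mul,
      map_mul, wsgn_cobarLetter, wsgn_ι, map_neg, wsgn_ι]
    simp only [neg_mul, mul_neg, neg_neg, neg_sub]
    abel

theorem cobarDiff_cobarLetter (c : C.carrier) : C.cobarDiff (C.cobarLetter c) = 0 := by
  have hDι : C.cobarDiff ∘ₗ TensorAlgebra.ι R = C.cobarLetter := LinearMap.ext cobarDiff_ι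
  have e1 : C.cobarDiff ∘ₗ TensorAlgebra.ι R ∘ₗ C.sgn ∘ₗ C.bar = C.cobarLetter ∘ₗ C.sgn := by
    rw [← LinearMap.comp_assoc, hDι, sgn_bar, ← LinearMap.comp_assoc, cobarLetter_bar]
  have e2 : C.cobarDiff ∘ₗ TensorAlgebra.ι R ∘ₗ C.bar = C.cobarLetter := by
    rw [← LinearMap.comp_assoc, hDι, cobarLetter_bar]
  have e3 : C.wsgn.toLinearMap ∘ₗ TensorAlgebra.ι R ∘ₗ C.sgn ∘ₗ C.bar =
      -(TensorAlgebra.ι R ∘ₗ C.bar) := by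
    rw [← LinearMap.comp_assoc, wsgn_ι_comp, LinearMap.neg_comp, LinearMap.comp_assoc,
      ← LinearMap.comp_assoc C.bar C.sgn, sgn_sgn, LinearMap.id_comp]
  have e4 : C.cobarDiff ∘ₗ (Algebra.linearMap R C.Words ∘ₗ C.curv) = 0 := by
    refine LinearMap.ext fun c => ?_
    simp [Algebra.algebraMap_eq_smul_one]
  have e5 : C.cobarDiff ∘ₗ TensorAlgebra.ι R ∘ₗ C.diff = C.cobarLetter ∘ₗ C.diff := by
    rw [← LinearMap.comp_assoc, hDι]
  have e6 : TensorAlgebra.ι R ∘ₗ C.bar ∘ₗ actL C.curv - TensorAlgebra.ι R ∘ₗ C.bar ∘ₗ actR C.curv =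
      TensorAlgebra.ι R ∘ₗ C.diff ∘ₗ C.diff := by
    have : C.diff ∘ₗ C.diff = actL C.curv - actR C.curv := LinearMap.ext diff_diff_apply
    rw [← LinearMap.comp_sub, ← LinearMap.comp_sub, ← this, ← LinearMap.comp_assoc _ _ C.bar,
      bar_diff]
  have e7 : C.sgn ∘ₗ C.bar ∘ₗ C.sgn = C.bar := by
    rw [← sgn_bar, ← LinearMap.comp_assoc, sgn_sgn, LinearMap.id_comp]
  have h : C.cobarDiff ∘ₗ C.cobarLetter = 0 := by
    conv_lhs => rw [cobarLetter]
    rw [LinearMap.comp_sub, LinearMap.comp_sub, cobarDiff_conv, e1, e2, e3, e4, e5]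
    simp only [cobarLetter, LinearMap.sub_comp, conv_sub_left, conv_sub_right, conv_neg_left,
      conv_sgn, conv_diff, LinearMap.comp_assoc, curv_sgn, C.curv_diff, LinearMap.comp_zero,
      LinearMap.neg_comp, conv_scalar_left, conv_scalar_right, conv_assoc, bar_diff, e7]
    rw [← e6]
    have e8 : conv (TensorAlgebra.ι R ∘ₗ C.sgn ∘ₗ C.diff) (TensorAlgebra.ι R ∘ₗ C.bar) =
        -conv (TensorAlgebra.ι R ∘ₗ C.diff ∘ₗ C.sgn) (TensorAlgebra.ι R ∘ₗ C.bar) := by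
      rw [sgn_diff, LinearMap.comp_neg, conv_neg_left]
    rw [e8, sgn_bar]
    abel
  exact LinearMap.congr_fun h c

theorem cobarDiff_cobarDiff (t : C.Words) : C.cobarDiff (C.cobarDiff t) = 0 := by
  refine word_induction (p := fun t => C.cobarDiff (C.cobarDiff t) = 0) (by simp) ?_ ?_ ?_ t
  · intro a b ha hb
    simp only [map_add, ha, hb, add_zero]
  · intro r a ha
    simp only [map_smul, ha, smul_zero]
  · intro c t ht
    rw [cobarDiff_mul, map_add, cobarDiff_mul, cobarDiff_mul, ht, cobarDiff_ι,
      cobarDiff_cobarLetter, cobarDiff_wsgn, cobarDiff_ι]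
    simp

variable (C) in
/-- Composable words `{c₁ | ⋯ | cₚ}` from `x` to `y` in the elements of positive degree, of total
degree `n` (with `cᵢ` counted in degree `|cᵢ| - 1`). -/
inductive IsCobarWord : C.Ob → C.Ob → ℕ → C.Words → Prop
  | nil (x : C.Ob) : IsCobarWord x x 0 1
  | cons {x y z : C.Ob} {k n : ℕ} {c : C.carrier} {t : C.Words} (hc : c ∈ C.part x y (k + 1))
      (h : IsCobarWord y z n t) : IsCobarWord x z (k + n) (TensorAlgebra.ι R c * t)

variable (C) in
/-- The degree `n` part of the module of morphisms from `x` to `y` in the cobar construction. -/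
def cobarHom (x y : C.Ob) (n : ℕ) : Submodule R C.Words :=
  Submodule.span R {t | C.IsCobarWord x y n t}

theorem IsCobarWord.mem {x y : C.Ob} {n : ℕ} {t : C.Words} (h : C.IsCobarWord x y n t) :
    t ∈ C.cobarHom x y n := Submodule.subset_span h

theorem IsCobarWord.mul {x y z : C.Ob} {m n : ℕ} {s t : C.Words} (hs : C.IsCobarWord x y m s)
    (ht : C.IsCobarWord y z n t) : C.IsCobarWord x z (m + n) (s * t) := by
  induction hs with
  | nil x => simpa using ht
  | cons hc _ ih =>
    rw [mul_assoc, add_assoc]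
    exact IsCobarWord.cons hc (ih ht)

theorem mul_mem_cobarHom {x y z : C.Ob} {m n : ℕ} {s t : C.Words} (hs : s ∈ C.cobarHom x y m)
    (ht : t ∈ C.cobarHom y z n) : s * t ∈ C.cobarHom x z (m + n) := by
  induction hs using Submodule.span_induction with
  | mem s hs =>
    induction ht using Submodule.span_induction with
    | mem t ht => exact (hs.mul ht).mem
    | zero => simp
    | add a b _ _ ha hb =>
      rw [mul_add]
      exact add_mem ha hb
    | smul r a _ ha =>
      rw [mul_smul_comm]
      exact Submodule.smul_mem _ _ ha
  | zero => simp
  | add a b _ _ ha hb =>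
    rw [add_mul]
    exact add_mem ha hb
  | smul r a _ ha =>
    rw [smul_mul_assoc]
    exact Submodule.smul_mem _ _ ha

theorem one_mem_cobarHom (x : C.Ob) : (1 : C.Words) ∈ C.cobarHom x x 0 := (IsCobarWord.nil x).mem

theorem ι_mem_cobarHom {x y : C.Ob} {k : ℕ} {c : C.carrier} (hc : c ∈ C.part x y (k + 1)) :
    TensorAlgebra.ι R c ∈ C.cobarHom x y k := by
  simpa using (IsCobarWord.cons hc (IsCobarWord.nil y)).mem

theorem wsgn_of_mem {x y : C.Ob} {n : ℕ} {t : C.Words} (ht : t ∈ C.cobarHom x y n) :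
    C.wsgn t = (-1 : R) ^ n • t := by
  induction ht using Submodule.span_induction with
  | mem t ht =>
    induction ht with
    | nil x => simp
    | cons hc _ ih =>
      rw [map_mul, ih, wsgn_ι, sgn_of_mem (C.mem_part.1 hc).1]
      simp [pow_add, smul_smul, mul_comm]
  | zero => simp
  | add a b _ _ ha hb => rw [map_add, ha, hb, smul_add]
  | smul r a _ ha => rw [map_smul, ha, smul_comm]

variable (C) in
/-- The words from `x` to `y` of degree `N - 1`. -/
def cobarLower (x y : C.Ob) (N : ℕ) : Submodule R C.Words :=
  Submodule.span R {t | ∃ n, n + 1 = N ∧ C.IsCobarWord x y n t}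

theorem cobarLower_zero (x y : C.Ob) : C.cobarLower x y 0 = ⊥ := by
  simp [cobarLower]

theorem cobarLower_succ (x y : C.Ob) (n : ℕ) : C.cobarLower x y (n + 1) = C.cobarHom x y n := by
  simp [cobarLower, cobarHom]

theorem mul_mem_cobarLower {x y z : C.Ob} {m n : ℕ} {s t : C.Words} (hs : s ∈ C.cobarLower x y m)
    (ht : t ∈ C.cobarHom y z n) : s * t ∈ C.cobarLower x z (m + n) := by
  rcases m with _ | m
  · rw [cobarLower_zero, Submodule.mem_bot] at hs
    simp [hs]
  · rw [cobarLower_succ] at hs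
    have : m + 1 + n = (m + n) + 1 := by omega
    rw [this, cobarLower_succ]
    exact mul_mem_cobarHom hs ht

theorem mul_mem_cobarLower' {x y z : C.Ob} {m n : ℕ} {s t : C.Words} (hs : s ∈ C.cobarHom x y m)
    (ht : t ∈ C.cobarLower y z n) : s * t ∈ C.cobarLower x z (m + n) := by
  rcases n with _ | n
  · rw [cobarLower_zero, Submodule.mem_bot] at ht
    simp [ht]
  · rw [cobarLower_succ] at ht
    rw [← add_assoc, cobarLower_succ]
    exact mul_mem_cobarHom hs ht

theorem conv_mem {x y : C.Ob} {n : ℕ} {c : C.carrier} (hc : c ∈ C.part x y n)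
    {X : Type w} [Ring X] [Algebra R X] (P : Submodule R X) (f g : C.carrier →ₗ[R] X)
    (h : ∀ z i j, i + j = n → ∀ a ∈ C.part x z i, ∀ b ∈ C.part z y j, f a * g b ∈ P) :
    conv f g c ∈ P := by
  rw [conv, LinearMap.comp_apply, LinearMap.comp_apply]
  have hm := comul_part_mem hc
  generalize C.comul c = t at hm
  induction hm using Submodule.span_induction with
  | mem t ht =>
    obtain ⟨z, i, j, hij, a, ha, b, hb, rfl⟩ := ht
    simpa using h z i j hij a ha b hb
  | zero => simp
  | add a b _ _ ha hb =>
    simp only [map_add]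
    exact add_mem ha hb
  | smul r a _ ha =>
    simp only [map_smul]
    exact Submodule.smul_mem _ _ ha

theorem cobarLetter_mem {x y : C.Ob} {k : ℕ} {c : C.carrier} (hc : c ∈ C.part x y (k + 1)) :
    C.cobarLetter c ∈ C.cobarLower x y k := by
  rw [cobarLetter, LinearMap.sub_apply, LinearMap.sub_apply]
  refine sub_mem (sub_mem ?_ ?_) ?_
  · by_cases hk : k = 1
    · subst hk
      rw [cobarLower_succ]
      rcases curv_part hc with rfl | h
      · simpa [Algebra.algebraMap_eq_smul_one] using Submodule.smul_mem _ _ (one_mem_cobarHom x)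
      · simp [h]
    · simp [C.curv_eq_zero (k + 1) (by omega) c (C.mem_part.1 hc).1]
  · have h := diff_part_mem hc
    rcases k with _ | k
    · have h0 := proj_of_mem_zero (C.mem_part.1 h).1
      have h1 : C.proj₀ (C.diff c) = 0 := LinearMap.congr_fun C.projZero_diff c
      rw [LinearMap.comp_apply, ← h0, h1, map_zero]
      exact zero_mem _
    · rw [cobarLower_succ]
      exact ι_mem_cobarHom h
  · refine conv_mem hc _ _ _ ?_
    intro z i j hij a ha b hb
    rcases i with _ | i
    · simp [bar_of_mem_zero (C.mem_part.1 ha).1]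
    rcases j with _ | j
    · simp [bar_of_mem_zero (C.mem_part.1 hb).1]
    obtain rfl : k = i + j + 1 := by omega
    have ha' := (C.mem_part.1 ha).1
    rw [cobarLower_succ]
    simp only [LinearMap.comp_apply]
    rw [bar_of_mem (by omega) ha', bar_of_mem (by omega) (C.mem_part.1 hb).1, sgn_of_mem ha',
      map_smul, smul_mul_assoc]
    exact Submodule.smul_mem _ _ (mul_mem_cobarHom (ι_mem_cobarHom ha) (ι_mem_cobarHom hb))

theorem cobarDiff_mem_lower {x y : C.Ob} {n : ℕ} {t : C.Words} (ht : t ∈ C.cobarHom x y n) :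
    C.cobarDiff t ∈ C.cobarLower x y n := by
  induction ht using Submodule.span_induction with
  | mem t ht =>
    induction ht with
    | nil x => simp
    | cons hc h ih =>
      rw [cobarDiff_cons]
      refine sub_mem (mul_mem_cobarLower (cobarLetter_mem hc) h.mem) ?_
      rw [sgn_of_mem (C.mem_part.1 hc).1, map_smul, smul_mul_assoc]
      exact Submodule.smul_mem _ _ (mul_mem_cobarLower' (ι_mem_cobarHom hc) ih)
  | zero => simp
  | add a b _ _ ha hb =>
    rw [map_add]
    exact add_mem ha hb
  | smul r a _ ha =>
    rw [map_smul]
    exact Submodule.smul_mem _ _ ha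

theorem cobarDiff_mem {x y : C.Ob} {n : ℕ} {t : C.Words} (ht : t ∈ C.cobarHom x y (n + 1)) :
    C.cobarDiff t ∈ C.cobarHom x y n := by
  rw [← cobarLower_succ]
  exact cobarDiff_mem_lower ht

theorem cobarDiff_zero {x y : C.Ob} {t : C.Words} (ht : t ∈ C.cobarHom x y 0) :
    C.cobarDiff t = 0 := by
  simpa [cobarLower_zero] using cobarDiff_mem_lower ht

variable (C) in
/-- The data underlying the cobar construction. -/
def preCobar : PreDGCat.{u, v, max u v} R where
  Obj := C.Ob
  Hom x y n := C.cobarHom x y n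
  one x := ⟨1, one_mem_cobarHom x⟩
  comp _ _ _ _ _ := LinearMap.mk₂ R (fun s t => ⟨s.1 * t.1, mul_mem_cobarHom s.2 t.2⟩)
    (fun s s' t => Subtype.ext (add_mul s.1 s'.1 t.1))
    (fun r s t => Subtype.ext (smul_mul_assoc r s.1 t.1))
    (fun s t t' => Subtype.ext (mul_add s.1 t.1 t'.1))
    (fun r s t => Subtype.ext (mul_smul_comm r s.1 t.1))
  d _ _ _ := C.cobarDiff.restrict fun _ => cobarDiff_mem

/-- The inclusion of a morphism module of the cobar construction. -/
def cobarOf (x y : C.Ob) (n : ℕ) : C.cobarHom x y n →ₗ[R] C.preCobar.Tot := C.preCobar.of x y n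

theorem cobar_induction {p : C.preCobar.Tot → Prop} (zero : p 0)
    (add : ∀ a b, p a → p b → p (a + b)) (of : ∀ x y n t, p (cobarOf x y n t))
    (a : C.preCobar.Tot) : p a :=
  PreDGCat.tot_induction zero add of a

theorem cobar_of_eq {x y : C.Ob} {m n : ℕ} (h : m = n) {s : C.cobarHom x y m}
    {t : C.cobarHom x y n} (hst : s.1 = t.1) :
    cobarOf x y m s = cobarOf x y n t := by
  subst h
  rw [Subtype.ext hst]

theorem cobar_dTot {x y : C.Ob} {m n : ℕ} (h : n = m + 1) (t : C.cobarHom x y n)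
    (s : C.cobarHom x y m) (hst : s.1 = C.cobarDiff t.1) :
    C.preCobar.dTot (cobarOf x y n t) = cobarOf x y m s := by
  subst h
  exact (PreDGCat.dTot_of_succ (A := C.preCobar) t).trans (congrArg _ (Subtype.ext hst.symm))

theorem cobar_dTot_zero {x y : C.Ob} (t : C.cobarHom x y 0) :
    C.preCobar.dTot (cobarOf x y 0 t) = 0 :=
  PreDGCat.dTot_of_zero (A := C.preCobar) t

theorem cobar_mul {x y z : C.Ob} {m n k : ℕ} (h : m + n = k) (s : C.cobarHom x y m)
    (t : C.cobarHom y z n) (r : C.cobarHom x z k) (hr : r.1 = s.1 * t.1) :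
    C.preCobar.mul (cobarOf x y m s) (cobarOf y z n t) = cobarOf x z k r := by
  subst h
  exact (PreDGCat.mul_of_of (A := C.preCobar) s t).trans (congrArg _ (Subtype.ext hr.symm))

theorem cobar_mul_ne {x y y' z : C.Ob} {m n : ℕ} (h : y ≠ y') (s : C.cobarHom x y m)
    (t : C.cobarHom y' z n) :
    C.preCobar.mul (cobarOf x y m s) (cobarOf y' z n t) = 0 :=
  PreDGCat.mul_of_of_ne (A := C.preCobar) h s t

theorem cobar_sgn {x y : C.Ob} {n : ℕ} (t : C.cobarHom x y n) :
    C.preCobar.sgn (cobarOf x y n t) = (-1 : R) ^ n • cobarOf x y n t :=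
  PreDGCat.sgn_of (A := C.preCobar) t

theorem cobar_assoc (a b c : C.preCobar.Tot) : C.preCobar.mul (C.preCobar.mul a b) c =
    C.preCobar.mul a (C.preCobar.mul b c) := by
  refine cobar_induction (p := fun a => C.preCobar.mul (C.preCobar.mul a b) c =
    C.preCobar.mul a (C.preCobar.mul b c)) (by simp) ?_ ?_ a
  · intro a a' h h'
    simp only [map_add, LinearMap.add_apply, h, h']
  intro x y m s
  refine cobar_induction (p := fun b => C.preCobar.mul (C.preCobar.mul
    (cobarOf x y m s) b) c =
    C.preCobar.mul (cobarOf x y m s) (C.preCobar.mul b c)) (by simp) ?_ ?_ b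
  · intro a a' h h'
    simp only [map_add, LinearMap.add_apply, h, h']
  intro y' z n t
  refine cobar_induction (p := fun c => C.preCobar.mul (C.preCobar.mul
    (cobarOf x y m s) (cobarOf y' z n t)) c =
    C.preCobar.mul (cobarOf x y m s) (C.preCobar.mul (cobarOf y' z n t) c))
    (by simp) ?_ ?_ c
  · intro a a' h h'
    simp only [map_add, h, h']
  intro z' w k r
  by_cases hy : y = y'
  · subst hy
    rw [cobar_mul rfl s t ⟨s.1 * t.1, mul_mem_cobarHom s.2 t.2⟩ rfl]
    by_cases hz : z = z'
    · subst hz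
      rw [cobar_mul rfl t r ⟨t.1 * r.1, mul_mem_cobarHom t.2 r.2⟩ rfl,
        cobar_mul rfl _ r ⟨s.1 * t.1 * r.1, mul_mem_cobarHom (mul_mem_cobarHom s.2 t.2) r.2⟩ rfl]
      exact (cobar_mul (add_assoc m n k).symm s _ _ (mul_assoc s.1 t.1 r.1)).symm
    · rw [cobar_mul_ne hz, cobar_mul_ne hz, map_zero]
  · rw [cobar_mul_ne hy, map_zero, LinearMap.zero_apply]
    by_cases hz : z = z'
    · subst hz
      rw [cobar_mul rfl t r ⟨t.1 * r.1, mul_mem_cobarHom t.2 r.2⟩ rfl, cobar_mul_ne hy]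
    · rw [cobar_mul_ne hz, map_zero]

theorem cobar_dTot_mem {x y : C.Ob} {n : ℕ} (t : C.cobarHom x y n) :
    ∃ (m : ℕ) (s : C.cobarHom x y m), s.1 = C.cobarDiff t.1 ∧
      C.preCobar.dTot (cobarOf x y n t) = cobarOf x y m s := by
  rcases n with _ | n
  · refine ⟨0, 0, (cobarDiff_zero t.2).symm, ?_⟩
    rw [cobar_dTot_zero]
    exact (map_zero _).symm
  · exact ⟨n, ⟨_, cobarDiff_mem t.2⟩, rfl, cobar_dTot rfl t _ rfl⟩

theorem cobar_leibniz (a b : C.preCobar.Tot) : C.preCobar.dTot (C.preCobar.mul a b) =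
    C.preCobar.mul (C.preCobar.dTot a) b +
      C.preCobar.mul (C.preCobar.sgn a) (C.preCobar.dTot b) := by
  refine cobar_induction (p := fun a => C.preCobar.dTot (C.preCobar.mul a b) =
    C.preCobar.mul (C.preCobar.dTot a) b +
      C.preCobar.mul (C.preCobar.sgn a) (C.preCobar.dTot b)) (by simp) ?_ ?_ a
  · intro a a' h h'
    simp only [map_add, LinearMap.add_apply, h, h']
    abel
  intro x y m s
  refine cobar_induction (p := fun b => C.preCobar.dTot (C.preCobar.mul
    (cobarOf x y m s) b) = C.preCobar.mul (C.preCobar.dTot (cobarOf x y m s)) b +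
      C.preCobar.mul (C.preCobar.sgn (cobarOf x y m s)) (C.preCobar.dTot b)) (by simp) ?_ ?_ b
  · intro a a' h h'
    simp only [map_add, h, h']
    abel
  intro y' z n t
  rw [cobar_sgn, map_smul, LinearMap.smul_apply]
  by_cases hy : y = y'
  · subst hy
    rw [cobar_mul rfl s t ⟨s.1 * t.1, mul_mem_cobarHom s.2 t.2⟩ rfl]
    have hD := cobarDiff_mul s.1 t.1
    rw [wsgn_of_mem s.2, smul_mul_assoc] at hD
    rcases m with _ | m
    · rw [cobarDiff_zero s.2, zero_mul, zero_add, pow_zero, one_smul] at hD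
      rw [cobar_dTot_zero, map_zero, LinearMap.zero_apply, zero_add (_ • _), pow_zero, one_smul]
      rcases n with _ | n
      · rw [cobar_dTot_zero t, map_zero]
        exact cobar_dTot_zero _
      · rw [cobar_dTot rfl t ⟨_, cobarDiff_mem t.2⟩ rfl,
          cobar_mul rfl s _ ⟨_, mul_mem_cobarHom s.2 (cobarDiff_mem t.2)⟩ rfl]
        exact cobar_dTot (by omega) _ _ hD.symm
    · rw [cobar_dTot rfl s ⟨_, cobarDiff_mem s.2⟩ rfl,
        cobar_mul rfl _ t ⟨_, mul_mem_cobarHom (cobarDiff_mem s.2) t.2⟩ rfl]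
      rcases n with _ | n
      · rw [cobarDiff_zero t.2, mul_zero, smul_zero, add_zero] at hD
        rw [cobar_dTot_zero, map_zero, smul_zero]
        refine Eq.trans ?_ (add_zero _).symm
        exact cobar_dTot (by omega) _ _ hD.symm
      · have hm := mul_mem_cobarHom s.2 (cobarDiff_mem t.2)
        rw [show m + 1 + n = m + (n + 1) by omega] at hm
        rw [cobar_dTot rfl t ⟨_, cobarDiff_mem t.2⟩ rfl,
          cobar_mul (by omega) s _ (⟨_, hm⟩ : C.cobarHom x z (m + (n + 1))) rfl]
        refine (cobar_dTot (m := m + (n + 1)) (by omega) _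
          (⟨_, mul_mem_cobarHom (cobarDiff_mem s.2) t.2⟩ + (-1 : R) ^ (m + 1) • ⟨_, hm⟩)
          hD.symm).trans ?_
        exact (map_add _ _ _).trans (congrArg _ (map_smul _ _ _))
  · rw [cobar_mul_ne hy, map_zero]
    obtain ⟨i, s', -, hs⟩ := cobar_dTot_mem s
    obtain ⟨j, t', -, ht⟩ := cobar_dTot_mem t
    rw [hs, ht, cobar_mul_ne hy, cobar_mul_ne hy, smul_zero, add_zero]

theorem cobar_d_d : C.preCobar.dTot ∘ₗ C.preCobar.dTot = 0 := by
  refine LinearMap.ext fun t => ?_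
  rw [LinearMap.comp_apply, LinearMap.zero_apply]
  refine cobar_induction (p := fun t => C.preCobar.dTot (C.preCobar.dTot t) = 0) (by simp) ?_ ?_ t
  · intro a b ha hb
    rw [map_add, map_add, ha, hb, add_zero]
  intro x y n t
  rcases n with _ | _ | n
  · rw [cobar_dTot_zero, map_zero]
  · rw [cobar_dTot rfl t ⟨_, cobarDiff_mem t.2⟩ rfl, cobar_dTot_zero]
  · rw [cobar_dTot rfl t ⟨_, cobarDiff_mem t.2⟩ rfl]
    refine (cobar_dTot rfl _ 0 (cobarDiff_cobarDiff t.1).symm).trans ?_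
    exact map_zero _

variable (C) in
/-- The cobar construction of a categorical coalgebra: the dg category whose objects are the
set-like elements, whose morphisms from `x` to `y` are the linear combinations of composable words
from `x` to `y`, and whose composition is the concatenation of words. -/
def cobar : DGCat.{u, v, max u v} R where
  toPreDGCat := C.preCobar
  one_comp _ _ n t := cobar_mul (zero_add n) _ t t (one_mul t.1).symm
  comp_one _ _ n t := cobar_mul (add_zero n) t _ t (mul_one t.1).symm
  comp_assoc := cobar_assoc
  d_d := cobar_d_d
  leibniz := cobar_leibniz

/-! ### The coHochschild complex

A monomial `c₀ {c₁ | ⋯ | cₚ}` is represented by `c₀ ⊗ (c₁ ⋯ cₚ)`. -/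

variable (C) in
/-- The module of all monomials `c₀ {c₁ | ⋯ | cₚ}`, composable or not. -/
abbrev CoMonomials : Type _ := C.carrier ⊗[R] C.Words

variable (C) in
/-- The coHochschild chains of degree `n`: the span of the cyclically composable monomials
`c₀ {c₁ | ⋯ | cₚ}` of total degree `n`, with `c₀` counted in degree `|c₀|`. -/
def coChains (n : ℕ) : Submodule R C.CoMonomials :=
  Submodule.span R {z | ∃ (x y : C.Ob) (i j : ℕ), i + j = n ∧
    ∃ c ∈ C.part x y i, ∃ t, C.IsCobarWord y x j t ∧ z = c ⊗ₜ t}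

variable (C) in
/-- The map `c₀ {w} ↦ ∑ (-1) ^ |c₀'| c₀' {c₀'' | w}`. -/
def splitRight : C.CoMonomials →ₗ[R] C.CoMonomials :=
  TensorProduct.map LinearMap.id (LinearMap.mul' R C.Words) ∘ₗ
    (TensorProduct.assoc R _ _ _).toLinearMap ∘ₗ
    TensorProduct.map (TensorProduct.map C.sgn (TensorAlgebra.ι R ∘ₗ C.bar) ∘ₗ C.comul)
      LinearMap.id

variable (C) in
/-- The map `a ⊗ (c ⊗ w) ↦ (-1) ^ ((|a| - 1) (|c| + |w|)) c {w | a}`. -/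
def appendLast : C.carrier ⊗[R] C.CoMonomials →ₗ[R] C.CoMonomials :=
  (TensorProduct.map LinearMap.id (LinearMap.mul' R C.Words ∘ₗ
        TensorProduct.map LinearMap.id (TensorAlgebra.ι R ∘ₗ C.bar ∘ₗ oddPart C.grading)) +
      TensorProduct.map C.sgn (LinearMap.mul' R C.Words ∘ₗ
        TensorProduct.map C.wsgn.toLinearMap
          (TensorAlgebra.ι R ∘ₗ C.bar ∘ₗ evenPart C.grading))) ∘ₗ
    (TensorProduct.assoc R _ _ _).toLinearMap ∘ₗ (TensorProduct.comm R _ _).toLinearMap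

variable (C) in
/-- The map `c₀ {w} ↦ -∑ (-1) ^ ((|c₀'| - 1) (|c₀''| + |w|)) c₀'' {w | c₀'}`. -/
def splitLeft : C.CoMonomials →ₗ[R] C.CoMonomials :=
  -(C.appendLast ∘ₗ (TensorProduct.assoc R _ _ _).toLinearMap ∘ₗ
    TensorProduct.map C.comul LinearMap.id)

variable (C) in
/-- The coHochschild differential on monomials. -/
def coDiff : C.CoMonomials →ₗ[R] C.CoMonomials :=
  TensorProduct.map C.diff LinearMap.id + TensorProduct.map C.sgn C.cobarDiff +
    C.splitRight + C.splitLeft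

variable (C) in
/-- The operator sending `c₀ {c₁ | ⋯ | cₚ}` to
`∑ᵢ ± ε(c₀) cᵢ {cᵢ₊₁ | ⋯ | cₚ | c₁ | ⋯ | cᵢ₋₁}`, where `±` is the Koszul sign of the rotation of the
desuspended letters. -/
def coConnes : C.CoMonomials →ₗ[R] C.CoMonomials :=
  rotations (oddPart C.grading) (evenPart C.grading) ∘ₗ
    (TensorProduct.lid R C.Words).toLinearMap ∘ₗ TensorProduct.map C.counit LinearMap.id

/-! The operators preserve the coHochschild chains. -/

theorem mem_coChains {x y : C.Ob} {i j n : ℕ} (hn : i + j = n) {c : C.carrier}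
    (hc : c ∈ C.part x y i) {t : C.Words} (ht : t ∈ C.cobarHom y x j) :
    c ⊗ₜ t ∈ C.coChains n := by
  induction ht using Submodule.span_induction with
  | mem t ht => exact Submodule.subset_span ⟨x, y, i, j, hn, c, hc, t, ht, rfl⟩
  | zero => simp
  | add a b _ _ ha hb =>
    rw [TensorProduct.tmul_add]
    exact add_mem ha hb
  | smul r a _ ha =>
    rw [TensorProduct.tmul_smul]
    exact Submodule.smul_mem _ _ ha

theorem mem_coChains_lower {x y : C.Ob} {i j n : ℕ} (hn : i + j = n + 1) {c : C.carrier}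
    (hc : c ∈ C.part x y i) {t : C.Words} (ht : t ∈ C.cobarLower y x j) :
    c ⊗ₜ t ∈ C.coChains n := by
  rcases j with _ | j
  · rw [cobarLower_zero, Submodule.mem_bot] at ht
    simp [ht]
  · rw [cobarLower_succ] at ht
    exact mem_coChains (by omega) hc ht

theorem comul_mem_of_part {x y : C.Ob} {n : ℕ} {c : C.carrier} (hc : c ∈ C.part x y n)
    {X : Type w} [AddCommGroup X] [Module R X] (P : Submodule R X)
    (f : C.carrier ⊗[R] C.carrier →ₗ[R] X)
    (h : ∀ z i j, i + j = n → ∀ a ∈ C.part x z i, ∀ b ∈ C.part z y j, f (a ⊗ₜ b) ∈ P) :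
    f (C.comul c) ∈ P := by
  have hm := comul_part_mem hc
  generalize C.comul c = t at hm
  induction hm using Submodule.span_induction with
  | mem t ht =>
    obtain ⟨z, i, j, hij, a, ha, b, hb, rfl⟩ := ht
    exact h z i j hij a ha b hb
  | zero => simp
  | add a b _ _ ha hb =>
    rw [map_add]
    exact add_mem ha hb
  | smul r a _ ha =>
    rw [map_smul]
    exact Submodule.smul_mem _ _ ha

theorem even_or_odd_of_mem {n : ℕ} {c : C.carrier} (hc : c ∈ C.grading n) :
    (oddPart C.grading c = c ∧ evenPart C.grading c = 0) ∨
      (oddPart C.grading c = 0 ∧ evenPart C.grading c = c) := by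
  rcases Nat.even_or_odd n with h | h
  · right
    simp [evenPart, oddPart, gradedScale_mem _ _ hc, h, Nat.not_odd_iff_even.2 h]
  · left
    simp [evenPart, oddPart, gradedScale_mem _ _ hc, h, Nat.not_even_iff_odd.2 h]

theorem appendLast_tmul (a c : C.carrier) (t : C.Words) : C.appendLast (a ⊗ₜ (c ⊗ₜ t)) =
    c ⊗ₜ (t * TensorAlgebra.ι R (C.bar (oddPart C.grading a))) +
      C.sgn c ⊗ₜ (C.wsgn t * TensorAlgebra.ι R (C.bar (evenPart C.grading a))) := by
  simp [appendLast]

theorem coDiff_mem (n : ℕ) : ∀ z ∈ C.coChains (n + 1), C.coDiff z ∈ C.coChains n := by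
  suffices h : C.coChains (n + 1) ≤ (C.coChains n).comap C.coDiff from h
  refine Submodule.span_le.2 ?_
  rintro _ ⟨x, y, i, j, hij, c, hc, t, ht, rfl⟩
  simp only [SetLike.mem_coe, Submodule.mem_comap, coDiff, LinearMap.add_apply,
    TensorProduct.map_tmul, LinearMap.id_apply]
  refine add_mem (add_mem (add_mem ?_ ?_) ?_) ?_
  · rcases i with _ | i
    · simp [C.diff_zero c (C.mem_part.1 hc).1]
    · exact mem_coChains (by omega) (diff_part_mem hc) ht.mem
  · rw [sgn_of_mem (C.mem_part.1 hc).1, ← TensorProduct.smul_tmul']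
    exact Submodule.smul_mem _ _ (mem_coChains_lower hij hc (cobarDiff_mem_lower ht.mem))
  · refine comul_mem_of_part hc (C.coChains n) (TensorProduct.map LinearMap.id
      (LinearMap.mul' R C.Words) ∘ₗ (TensorProduct.assoc R _ _ _).toLinearMap ∘ₗ
      (TensorProduct.mk R _ _).flip t ∘ₗ
      TensorProduct.map C.sgn (TensorAlgebra.ι R ∘ₗ C.bar)) ?_
    intro z k l hkl a ha b hb
    simp only [LinearMap.comp_apply, TensorProduct.map_tmul, LinearMap.flip_apply,
      TensorProduct.mk_apply, LinearEquiv.coe_coe, TensorProduct.assoc_tmul, LinearMap.id_apply,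
      LinearMap.mul'_apply]
    rcases l with _ | l
    · simp [bar_of_mem_zero (C.mem_part.1 hb).1]
    · rw [sgn_of_mem (C.mem_part.1 ha).1, bar_of_mem (by omega) (C.mem_part.1 hb).1,
        ← TensorProduct.smul_tmul']
      exact Submodule.smul_mem _ _
        (mem_coChains (by omega) ha (mul_mem_cobarHom (ι_mem_cobarHom hb) ht.mem))
  · rw [splitLeft, LinearMap.neg_apply]
    refine neg_mem ?_
    refine comul_mem_of_part hc (C.coChains n) (C.appendLast ∘ₗ
      (TensorProduct.assoc R _ _ _).toLinearMap ∘ₗ (TensorProduct.mk R _ _).flip t) ?_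
    intro z k l hkl a ha b hb
    simp only [LinearMap.comp_apply, LinearMap.flip_apply, TensorProduct.mk_apply,
      LinearEquiv.coe_coe, TensorProduct.assoc_tmul, appendLast_tmul]
    rcases k with _ | k
    · have ha' := (C.mem_part.1 ha).1
      rcases even_or_odd_of_mem ha' with ⟨h1, h2⟩ | ⟨h1, h2⟩ <;>
        simp [h1, h2, bar_of_mem_zero ha']
    · have ha' := (C.mem_part.1 ha).1
      have hm : b ⊗ₜ (t * TensorAlgebra.ι R a) ∈ C.coChains n :=
        mem_coChains (by omega) hb (mul_mem_cobarHom ht.mem (ι_mem_cobarHom ha))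
      rcases even_or_odd_of_mem ha' with ⟨h1, h2⟩ | ⟨h1, h2⟩
      · simpa [h1, h2, bar_of_mem (by omega : k + 1 ≠ 0) ha'] using hm
      · simpa [h1, h2, bar_of_mem (by omega : k + 1 ≠ 0) ha', sgn_of_mem (C.mem_part.1 hb).1,
          wsgn_of_mem ht.mem, ← TensorProduct.smul_tmul'] using
          Submodule.smul_mem _ _ (Submodule.smul_mem _ _ hm)

theorem IsCobarWord.parity {x y : C.Ob} {n : ℕ} {t : C.Words} (h : C.IsCobarWord x y n t) :
    (wordEven (oddPart C.grading) (evenPart C.grading) t = t ∧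
      wordOdd (oddPart C.grading) (evenPart C.grading) t = 0) ∨
    (wordEven (oddPart C.grading) (evenPart C.grading) t = 0 ∧
      wordOdd (oddPart C.grading) (evenPart C.grading) t = t) := by
  induction h with
  | nil x => simp
  | cons hc _ ih =>
    rw [wordEven_cons, wordOdd_cons]
    rcases even_or_odd_of_mem (C.mem_part.1 hc).1 with ⟨h1, h2⟩ | ⟨h1, h2⟩ <;>
      rcases ih with ⟨h3, h4⟩ | ⟨h3, h4⟩ <;> simp [h1, h2, h3, h4]

theorem pick_mem {x y : C.Ob} {n : ℕ} {t : C.Words} (ht : t ∈ C.cobarHom x y n) :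
    pick t ∈ Submodule.span R {z | ∃ (p q : C.Ob) (i m k : ℕ), i + (m + k) = n ∧
      ∃ u, C.IsCobarWord x p i u ∧ ∃ c ∈ C.part p q (m + 1), ∃ s, C.IsCobarWord q y k s ∧
        z = u ⊗ₜ (c ⊗ₜ s)} := by
  induction ht using Submodule.span_induction with
  | mem t ht =>
    induction ht with
    | nil x => simp
    | @cons x p y m n b t hb ht ih =>
      rw [pick_cons]
      refine add_mem ?_ ?_
      · exact Submodule.subset_span ⟨x, p, 0, m, n, by omega, 1, IsCobarWord.nil x, b, hb, t, ht,
          rfl⟩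
      · refine Submodule.span_induction (p := fun z _ => TensorProduct.map
          (LinearMap.mulLeft R (TensorAlgebra.ι R b)) LinearMap.id z ∈ _)
          ?_ (by simp) ?_ ?_ ih
        · rintro _ ⟨q, q', i, m', k, hi, u, hu, c, hc, s, hs, rfl⟩
          rw [TensorProduct.map_tmul]
          exact Submodule.subset_span ⟨q, q', m + i, m', k, by omega, _, IsCobarWord.cons hb hu,
            c, hc, s, hs, rfl⟩
        · intro z z' _ _ h h'
          rw [map_add]
          exact add_mem h h'
        · intro r z _ h
          rw [map_smul]
          exact Submodule.smul_mem _ _ h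
  | zero => simp
  | add a b _ _ ha hb =>
    rw [map_add]
    exact add_mem ha hb
  | smul r a _ ha =>
    rw [map_smul]
    exact Submodule.smul_mem _ _ ha

theorem moveToEnd_mem {x p q : C.Ob} {i m k n : ℕ} {u s : C.Words} (hu : C.IsCobarWord x p i u)
    {c : C.carrier} (hc : c ∈ C.part p q (m + 1)) (hs : s ∈ C.cobarHom q x k)
    (hn : m + 1 + (k + i) = n) :
    moveToEnd (oddPart C.grading) (evenPart C.grading) (u ⊗ₜ (c ⊗ₜ s)) ∈ C.coChains n := by
  have h1 : wordSign (oddPart C.grading) (evenPart C.grading) s = (-1 : R) ^ k • s :=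
    wsgn_of_mem hs
  have hm : c ⊗ₜ (s * u) ∈ C.coChains n := mem_coChains hn hc (mul_mem_cobarHom hs hu.mem)
  rw [moveToEnd_tmul, h1, odd_sub_even, sgn_of_mem (C.mem_part.1 hc).1]
  rcases hu.parity with ⟨h3, h4⟩ | ⟨h3, h4⟩
  · simpa [h3, h4] using hm
  · simpa [h3, h4, TensorProduct.neg_tmul, ← TensorProduct.smul_tmul'] using
      Submodule.smul_mem _ _ (Submodule.smul_mem _ _ hm)

theorem counit_part {x y : C.Ob} {c : C.carrier} (hc : c ∈ C.part x y 0) :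
    x = y ∨ C.counit c = 0 := by
  obtain ⟨h0, hl, hr⟩ := C.mem_part.1 hc
  have hb : ∀ a ∈ C.grading 0, C.proj₀ a = a := fun a => proj_of_mem_zero
  have e1 : TensorProduct.map C.proj₀ LinearMap.id (C.comul c) = C.comul c := by
    refine tensor_eq (f := TensorProduct.map C.proj₀ LinearMap.id) (g := LinearMap.id) ?_ h0
    intro i j hij a ha b hb'
    obtain ⟨rfl, rfl⟩ : i = 0 ∧ j = 0 := by omega
    simp [hb a ha]
  have e2 : TensorProduct.map LinearMap.id C.proj₀ (C.comul c) = C.comul c := by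
    refine tensor_eq (f := TensorProduct.map LinearMap.id C.proj₀) (g := LinearMap.id) ?_ h0
    intro i j hij a ha b hb'
    obtain ⟨rfl, rfl⟩ : i = 0 ∧ j = 0 := by omega
    simp [hb b hb']
  have e3 : TensorProduct.map LinearMap.id C.counit (C.comul c) = c ⊗ₜ[R] (1 : R) :=
    Coalgebra.lTensor_counit_comul c
  have e4 : TensorProduct.map C.counit LinearMap.id (C.comul c) = (1 : R) ⊗ₜ[R] c :=
    Coalgebra.rTensor_counit_comul c
  rw [← e1, hl] at e3
  rw [← e2, hr] at e4
  have h1 := congrArg (TensorProduct.rid R C.carrier) e3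
  have h2 := congrArg (TensorProduct.lid R C.carrier) e4
  simp only [TensorProduct.map_tmul, LinearMap.id_apply, TensorProduct.rid_tmul,
    TensorProduct.lid_tmul, one_smul] at h1 h2
  exact ob_smul_injective (h1.trans h2.symm)

theorem coConnes_mem (n : ℕ) : ∀ z ∈ C.coChains n, C.coConnes z ∈ C.coChains (n + 1) := by
  suffices h : C.coChains n ≤ (C.coChains (n + 1)).comap C.coConnes from h
  refine Submodule.span_le.2 ?_
  rintro _ ⟨x, y, i, j, hij, c, hc, t, ht, rfl⟩
  have hz : C.coConnes (c ⊗ₜ t) = C.counit c • moveToEnd (oddPart C.grading) (evenPart C.grading)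
      (pick t) := by
    simp [coConnes, rotations]
  rw [SetLike.mem_coe, Submodule.mem_comap, hz]
  rcases i with _ | i
  · rcases counit_part hc with rfl | h
    · refine Submodule.smul_mem _ _ ?_
      refine Submodule.span_induction (p := fun z _ => moveToEnd (oddPart C.grading)
        (evenPart C.grading) z ∈ _) ?_ (by simp) ?_ ?_ (pick_mem ht.mem)
      · rintro _ ⟨p, q, i', m', k, hi, u, hu, c, hc, s, hs, rfl⟩
        exact moveToEnd_mem hu hc hs.mem (by omega)
      · intro z z' _ _ h h'
        rw [map_add]
        exact add_mem h h'
      · intro r z _ h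
        rw [map_smul]
        exact Submodule.smul_mem _ _ h
    · rw [h, zero_smul]
      exact zero_mem _
  · have h : C.counit c = 0 := C.counit_eq_zero (i + 1) (by omega) c (C.mem_part.1 hc).1
    rw [h, zero_smul]
    exact zero_mem _

variable (C) in
/-- The coHochschild complex of a categorical coalgebra. -/
def coHoch : PreMixedComplex.{u, max u v} R where
  X n := C.coChains n
  b n := C.coDiff.restrict (coDiff_mem n)
  B n := C.coConnes.restrict (coConnes_mem n)

/-! ### The comparison map -/

variable (C) in
/-- The map sending a morphism of the cobar construction to the underlying word. -/
def toWords : C.cobar.Tot →ₗ[R] C.Words := C.cobar.lift fun x y n => (C.cobarHom x y n).subtype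

variable (C) in
/-- The map sending an endomorphism `b` of `x` to `x ⊗ b`. -/
def piZero : C.cobar.Tot →ₗ[R] C.CoMonomials :=
  C.cobar.lift fun x y n => TensorProduct.mk R C.carrier C.Words x.1 ∘ₗ (C.cobarHom x y n).subtype

variable (C) in
/-- The map sending `{c₁ | ⋯ | c_q} ⊗ b` to
`∑ᵢ ± cᵢ {cᵢ₊₁ | ⋯ | c_q} b {c₁ | ⋯ | cᵢ₋₁}`, where `±` is the Koszul sign of moving the desuspended
letters `c₁, …, cᵢ₋₁` to the end. -/
def piOne : C.cobar.Tot ⊗[R] C.cobar.Tot →ₗ[R] C.CoMonomials :=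
  moveToEnd (oddPart C.grading) (evenPart C.grading) ∘ₗ
    TensorProduct.map LinearMap.id (TensorProduct.map LinearMap.id (LinearMap.mul' R C.Words) ∘ₗ
      (TensorProduct.assoc R _ _ _).toLinearMap) ∘ₗ
    (TensorProduct.assoc R _ _ _).toLinearMap ∘ₗ
    TensorProduct.map (pick ∘ₗ C.toWords) C.toWords

variable (C) in
/-- The comparison map on monomials `[a₁ | ⋯ | aₚ] b`: it is `piZero b` if `p = 0`, it is
`piOne (a₁ ⊗ b)` if `p = 1`, and it is zero if `p > 1`. -/
def piMonomials : C.cobar.Monomials →ₗ[R] C.CoMonomials :=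
  (TensorProduct.lid R C.CoMonomials).toLinearMap ∘ₗ
      TensorProduct.map TensorAlgebra.algebraMapInv.toLinearMap C.piZero +
    C.piOne ∘ₗ TensorProduct.map TensorAlgebra.ιInv LinearMap.id

theorem toWords_of {x y : C.Ob} {n : ℕ} (t : C.cobarHom x y n) :
    C.toWords (C.cobar.of x y n t) = t.1 :=
  PreDGCat.lift_of (A := C.preCobar) _ x y n t

theorem piZero_of {x y : C.Ob} {n : ℕ} (t : C.cobarHom x y n) :
    C.piZero (C.cobar.of x y n t) = x.1 ⊗ₜ t.1 :=
  PreDGCat.lift_of (A := C.preCobar) _ x y n t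

theorem piMonomials_one (b : C.cobar.Tot) :
    C.piMonomials ((1 : C.cobar.Words) ⊗ₜ b) = C.piZero b := by
  simp [piMonomials, ιInv_one]

theorem piMonomials_ι (a b : C.cobar.Tot) :
    C.piMonomials (TensorAlgebra.ι R a ⊗ₜ b) = C.piOne (a ⊗ₜ b) := by
  have : TensorAlgebra.ιInv (TensorAlgebra.ι R a) = a := TensorAlgebra.ι_leftInverse a
  simp [piMonomials, this, TensorAlgebra.algebraMapInv]

theorem piMonomials_cons (a a' b : C.cobar.Tot) (t : C.cobar.Words) :
    C.piMonomials ((TensorAlgebra.ι R a * (TensorAlgebra.ι R a' * t)) ⊗ₜ b) = 0 := by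
  simp [piMonomials, ιInv_cons_cons, TensorAlgebra.algebraMapInv]

theorem piOne_mem {x y : C.Ob} {m j : ℕ} (a : C.cobarHom x y m) (b : C.cobarHom y x j) :
    C.piOne (C.cobar.of x y m a ⊗ₜ C.cobar.of y x j b) ∈ C.coChains (m + 1 + j) := by
  rw [piOne, LinearMap.comp_apply, LinearMap.comp_apply, LinearMap.comp_apply,
    TensorProduct.map_tmul, LinearMap.comp_apply, toWords_of, toWords_of]
  refine Submodule.span_induction (p := fun z _ => moveToEnd (oddPart C.grading)
    (evenPart C.grading) (TensorProduct.map LinearMap.id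
      (TensorProduct.map LinearMap.id (LinearMap.mul' R C.Words) ∘ₗ
      (TensorProduct.assoc R _ _ _).toLinearMap) (TensorProduct.assoc R _ _ _ (z ⊗ₜ b.1))) ∈ _)
    ?_ (by simp) ?_ ?_ (pick_mem a.2)
  · rintro _ ⟨p, q, i', m', k, hi, u, hu, c, hc, s, hs, rfl⟩
    simp only [TensorProduct.assoc_tmul, TensorProduct.map_tmul, LinearMap.comp_apply,
      LinearEquiv.coe_coe, LinearMap.id_apply, LinearMap.mul'_apply]
    exact moveToEnd_mem hu hc (mul_mem_cobarHom hs.mem b.2) (by omega)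
  · intro z z' _ _ h h'
    rw [TensorProduct.add_tmul, map_add, map_add, map_add]
    exact add_mem h h'
  · intro r z _ h
    rw [← TensorProduct.smul_tmul', map_smul, map_smul, map_smul]
    exact Submodule.smul_mem _ _ h

theorem piMonomials_nil_mem {x : C.Ob} {j : ℕ} (b : C.cobarHom x x j) :
    C.piMonomials ((1 : C.cobar.Words) ⊗ₜ C.cobar.of x x j b) ∈ C.coChains j := by
  rw [piMonomials_one, piZero_of]
  exact mem_coChains (zero_add j) (C.ob_mem_part x) b.2

theorem piMonomials_ι_mem {x y : C.Ob} {m j n : ℕ} (a : C.cobarHom x y m) (b : C.cobarHom y x j)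
    (hn : m + 1 + 0 + j = n) :
    C.piMonomials ((TensorAlgebra.ι R (C.cobar.of x y m a) * 1) ⊗ₜ C.cobar.of y x j b) ∈
      C.coChains n := by
  subst hn
  rw [mul_one, piMonomials_ι]
  exact piOne_mem a b

theorem piMonomials_one_ι (x : C.Ob) (b : C.cobar.Tot) :
    C.piMonomials ((TensorAlgebra.ι R (C.cobar.of x x 0 (C.cobar.one x)) * 1) ⊗ₜ b) = 0 := by
  have h : C.toWords (C.cobar.of x x 0 (C.cobar.one x)) = 1 := toWords_of _
  rw [mul_one, piMonomials_ι]
  simp [piOne, h]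

theorem piMonomials_mem (n : ℕ) : ∀ z ∈ C.cobar.chains n, C.piMonomials z ∈ C.coChains n := by
  suffices h : C.cobar.chains n ≤ (C.coChains n).comap C.piMonomials from h
  refine Submodule.span_le.2 ?_
  rintro _ ⟨x, y, i, j, hij, t, ht, b, rfl⟩
  rw [SetLike.mem_coe, Submodule.mem_comap]
  cases ht with
  | nil x =>
    obtain rfl : j = n := by omega
    exact piMonomials_nil_mem b
  | cons a ht =>
    cases ht with
    | nil => exact piMonomials_ι_mem a b hij
    | cons a' ht =>
      rw [piMonomials_cons]
      exact zero_mem _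

theorem piMonomials_degenerate (n : ℕ) :
    ∀ z ∈ C.cobar.degenerate n, C.piMonomials z = 0 := by
  suffices h : C.cobar.degenerate n ≤ LinearMap.ker C.piMonomials from h
  refine Submodule.span_le.2 ?_
  rintro _ ⟨x, y, i, j, hij, t, ht, b, rfl⟩
  rw [SetLike.mem_coe, LinearMap.mem_ker]
  cases ht with
  | head ht =>
    cases ht with
    | nil => exact piMonomials_one_ι _ _
    | cons a' ht => exact piMonomials_cons _ _ _ _
  | cons a ht =>
    cases ht with
    | head ht => exact piMonomials_cons _ _ _ _
    | cons a' ht => exact piMonomials_cons _ _ _ _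

variable (C) in
/-- The comparison map from the Hochschild complex of the cobar construction to the coHochschild
complex. -/
def piBar : PreMixedComplex.GradedMap C.cobar.hoch C.coHoch := fun n =>
  subquotientLift C.piMonomials (piMonomials_mem n) (piMonomials_degenerate n)

/-! ### Morphisms of categorical coalgebras -/

/-- A morphism of categorical coalgebras: a morphism `f₀` of graded coalgebras together with a map
`f₁ : C → C'₀` of `C'₀`-bicomodules of degree `-1`, compatible with the differentials and the
curvatures. The last equation reads `h' (f₀ c) = h c - f (∂ c) + ∑ f c' * f c''`, where `f` is the
composite of `f₁` with the counit. -/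
structure Hom (C C' : CategoricalCoalgebra.{u, v} R) where
  f₀ : C.carrier →ₗc[R] C'.carrier
  f₀_mem : ∀ n, ∀ c ∈ C.grading n, f₀ c ∈ C'.grading n
  f₁ : C.carrier →ₗ[R] C'.carrier
  f₁_mem : ∀ c ∈ C.grading 1, f₁ c ∈ C'.grading 0
  f₁_eq_zero : ∀ n, n ≠ 1 → ∀ c ∈ C.grading n, f₁ c = 0
  f₁_left : C'.comul ∘ₗ f₁ = TensorProduct.map (f₀.toLinearMap ∘ₗ C.proj₀) f₁ ∘ₗ C.comul
  f₁_right : C'.comul ∘ₗ f₁ = TensorProduct.map f₁ (f₀.toLinearMap ∘ₗ C.proj₀) ∘ₗ C.comul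
  f₀_diff : f₀.toLinearMap ∘ₗ C.diff = C'.diff ∘ₗ f₀.toLinearMap +
    (TensorProduct.lid R C'.carrier).toLinearMap ∘ₗ
      TensorProduct.map (C'.counit ∘ₗ f₁) f₀.toLinearMap ∘ₗ
        (C.comul - koszulSwap C.grading ∘ₗ C.comul)
  curv_f₀ : C'.curv ∘ₗ f₀.toLinearMap =
    C.curv - (C'.counit ∘ₗ f₁) ∘ₗ C.diff + conv (C'.counit ∘ₗ f₁) (C'.counit ∘ₗ f₁)

namespace Hom

variable {C' : CategoricalCoalgebra.{u, v} R} (f : Hom C C')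

/-- The underlying linear map of `f₀`. -/
abbrev lin : C.carrier →ₗ[R] C'.carrier := f.f₀.toLinearMap

/-- The composite of `f₁` with the counit. -/
def bar₁ : C.carrier →ₗ[R] R := C'.counit ∘ₗ f.f₁

/-- The map induced on set-like elements. -/
def ob (x : C.Ob) : C'.Ob :=
  ⟨f.f₀ x.1, f.f₀_mem 0 _ x.2.1, x.2.2.map f.f₀⟩

theorem ob_val (x : C.Ob) : (f.ob x).1 = f.lin x.1 := rfl

theorem lin_proj : f.lin ∘ₗ C.proj₀ = C'.proj₀ ∘ₗ f.lin := by
  refine graded_hom_ext C.grading fun n c hc => ?_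
  have h : f.lin c ∈ C'.grading n := f.f₀_mem n c hc
  rcases eq_or_ne n 0 with rfl | hn
  · simp only [LinearMap.comp_apply, proj_of_mem_zero hc, proj_of_mem_zero h]
  · simp only [LinearMap.comp_apply, proj_of_mem hn hc, proj_of_mem hn h, map_zero]

theorem lin_bar : f.lin ∘ₗ C.bar = C'.bar ∘ₗ f.lin := by
  refine graded_hom_ext C.grading fun n c hc => ?_
  have h : f.lin c ∈ C'.grading n := f.f₀_mem n c hc
  rcases eq_or_ne n 0 with rfl | hn
  · simp only [LinearMap.comp_apply, bar_of_mem_zero hc, bar_of_mem_zero h, map_zero]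
  · simp only [LinearMap.comp_apply, bar_of_mem hn hc, bar_of_mem hn h]

theorem lin_sgn : f.lin ∘ₗ C.sgn = C'.sgn ∘ₗ f.lin := by
  refine graded_hom_ext C.grading fun n c hc => ?_
  have h : f.lin c ∈ C'.grading n := f.f₀_mem n c hc
  simp only [LinearMap.comp_apply, sgn_of_mem hc, sgn_of_mem h, map_smul]

theorem comul_lin : C'.comul ∘ₗ f.lin = TensorProduct.map f.lin f.lin ∘ₗ C.comul :=
  f.f₀.map_comp_comul.symm

theorem bar₁_of_mem {n : ℕ} (hn : n ≠ 1) {c : C.carrier} (hc : c ∈ C.grading n) :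
    f.bar₁ c = 0 := by
  simp [bar₁, f.f₁_eq_zero n hn c hc]

theorem bar₁_bar : f.bar₁ ∘ₗ C.bar = f.bar₁ := by
  refine graded_hom_ext C.grading fun n c hc => ?_
  rcases eq_or_ne n 0 with rfl | hn
  · rw [LinearMap.comp_apply, bar_of_mem_zero hc, map_zero,
      f.bar₁_of_mem (by decide : (0 : ℕ) ≠ 1) hc]
  · rw [LinearMap.comp_apply, bar_of_mem hn hc]

theorem bar₁_sgn : f.bar₁ ∘ₗ C.sgn = -f.bar₁ := by
  refine graded_hom_ext C.grading fun n c hc => ?_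
  by_cases hn : n = 1
  · subst hn
    simp [sgn_of_mem hc]
  · rw [LinearMap.comp_apply, sgn_of_mem hc, map_smul, LinearMap.neg_apply, f.bar₁_of_mem hn hc]
    simp

theorem f₁_eq_left (c : C.carrier) : f.f₁ c =
    TensorProduct.rid R C'.carrier (TensorProduct.map (f.lin ∘ₗ C.proj₀) f.bar₁ (C.comul c)) := by
  have e : TensorProduct.map LinearMap.id C'.counit (C'.comul (f.f₁ c)) = f.f₁ c ⊗ₜ[R] (1 : R) :=
    Coalgebra.lTensor_counit_comul _
  have h := LinearMap.congr_fun f.f₁_left c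
  rw [LinearMap.comp_apply, LinearMap.comp_apply] at h
  rw [h, ← LinearMap.comp_apply, ← TensorProduct.map_comp, LinearMap.id_comp] at e
  rw [bar₁, e]
  simp

theorem f₁_eq_right (c : C.carrier) : f.f₁ c =
    TensorProduct.lid R C'.carrier (TensorProduct.map f.bar₁ (f.lin ∘ₗ C.proj₀) (C.comul c)) := by
  have e : TensorProduct.map C'.counit LinearMap.id (C'.comul (f.f₁ c)) = (1 : R) ⊗ₜ[R] f.f₁ c :=
    Coalgebra.rTensor_counit_comul _
  have h := LinearMap.congr_fun f.f₁_right c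
  rw [LinearMap.comp_apply, LinearMap.comp_apply] at h
  rw [h, ← LinearMap.comp_apply, ← TensorProduct.map_comp, LinearMap.id_comp] at e
  rw [bar₁, e]
  simp

theorem part_mem {x y : C.Ob} {n : ℕ} {c : C.carrier} (hc : c ∈ C.part x y n) :
    f.lin c ∈ C'.part (f.ob x) (f.ob y) n := by
  obtain ⟨hn, hl, hr⟩ := C.mem_part.1 hc
  have h : C'.comul (f.lin c) = TensorProduct.map f.lin f.lin (C.comul c) :=
    LinearMap.congr_fun f.comul_lin c
  refine C'.mem_part.2 ⟨f.f₀_mem n c hn, ?_, ?_⟩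
  · rw [h, ← LinearMap.comp_apply, ← TensorProduct.map_comp, ← lin_proj, LinearMap.id_comp,
      ← LinearMap.comp_id f.lin, LinearMap.comp_assoc, LinearMap.id_comp, TensorProduct.map_comp,
      LinearMap.comp_apply, hl]
    rfl
  · rw [h, ← LinearMap.comp_apply, ← TensorProduct.map_comp, ← lin_proj, LinearMap.id_comp,
      ← LinearMap.comp_id f.lin, LinearMap.comp_assoc, LinearMap.id_comp, TensorProduct.map_comp,
      LinearMap.comp_apply, hr]
    rfl

theorem bar₁_part {x y : C.Ob} {n : ℕ} {c : C.carrier} (hc : c ∈ C.part x y n) :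
    f.ob x = f.ob y ∨ f.bar₁ c = 0 := by
  obtain ⟨hn, hl, hr⟩ := C.mem_part.1 hc
  have e1 : f.f₁ c = f.bar₁ c • (f.ob x).1 := by
    rw [f₁_eq_left, ← LinearMap.comp_id f.bar₁, TensorProduct.map_comp, LinearMap.comp_apply, hl]
    simp [ob_val]
  have e2 : f.f₁ c = f.bar₁ c • (f.ob y).1 := by
    rw [f₁_eq_right, ← LinearMap.comp_id f.bar₁, TensorProduct.map_comp, LinearMap.comp_apply, hr]
    simp [ob_val]
  exact ob_smul_injective (e1.symm.trans e2)

/-- The map induced on words, determined by `{c} ↦ {f₀ c} + f c`, where `f` is the composite of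
`f₁` with the counit. -/
def words : C.Words →ₐ[R] C'.Words :=
  TensorAlgebra.lift R (TensorAlgebra.ι R ∘ₗ f.lin + Algebra.linearMap R C'.Words ∘ₗ f.bar₁)

@[simp]
theorem words_ι (c : C.carrier) : f.words (TensorAlgebra.ι R c) =
    TensorAlgebra.ι R (f.lin c) + algebraMap R C'.Words (f.bar₁ c) := by
  simp [words]

theorem words_mem {x y : C.Ob} {n : ℕ} {t : C.Words} (ht : t ∈ C.cobarHom x y n) :
    f.words t ∈ C'.cobarHom (f.ob x) (f.ob y) n := by
  induction ht using Submodule.span_induction with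
  | mem t ht =>
    induction ht with
    | nil x => simpa using one_mem_cobarHom _
    | @cons x p y k n c t hc ht ih =>
      rw [map_mul]
      refine mul_mem_cobarHom ?_ ih
      rw [words_ι]
      refine add_mem (ι_mem_cobarHom (f.part_mem hc)) ?_
      by_cases hk : k = 0
      · subst hk
        rcases f.bar₁_part hc with h | h
        · rw [h, Algebra.algebraMap_eq_smul_one]
          exact Submodule.smul_mem _ _ (one_mem_cobarHom _)
        · rw [h, map_zero]
          exact zero_mem _
      · rw [f.bar₁_of_mem (by omega) (C.mem_part.1 hc).1, map_zero]
        exact zero_mem _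
  | zero => simp
  | add a b _ _ ha hb =>
    rw [map_add]
    exact add_mem ha hb
  | smul r a _ ha =>
    rw [map_smul]
    exact Submodule.smul_mem _ _ ha

theorem conv_lin {X : Type w} [Ring X] [Algebra R X] (g k : C'.carrier →ₗ[R] X) :
    conv g k ∘ₗ f.lin = conv (g ∘ₗ f.lin) (k ∘ₗ f.lin) := by
  simp only [conv, LinearMap.comp_assoc, comul_lin]
  rw [TensorProduct.map_comp, LinearMap.comp_assoc]

theorem lin_diff : TensorAlgebra.ι R ∘ₗ f.lin ∘ₗ C.diff = TensorAlgebra.ι R ∘ₗ C'.diff ∘ₗ f.lin +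
    conv (Algebra.linearMap R C'.Words ∘ₗ f.bar₁) (TensorAlgebra.ι R ∘ₗ f.lin) -
    conv (TensorAlgebra.ι R ∘ₗ f.lin ∘ₗ C.sgn) (Algebra.linearMap R C'.Words ∘ₗ f.bar₁) := by
  have e1 : TensorAlgebra.ι R ∘ₗ (TensorProduct.lid R C'.carrier).toLinearMap ∘ₗ
      TensorProduct.map f.bar₁ f.lin = LinearMap.mul' R C'.Words ∘ₗ
        TensorProduct.map (Algebra.linearMap R C'.Words ∘ₗ f.bar₁) (TensorAlgebra.ι R ∘ₗ f.lin) :=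
    TensorProduct.ext' fun a b => by simp [Algebra.smul_def]
  have e2 : TensorAlgebra.ι R ∘ₗ (TensorProduct.lid R C'.carrier).toLinearMap ∘ₗ
      TensorProduct.map f.bar₁ f.lin ∘ₗ koszulSwap C.grading = LinearMap.mul' R C'.Words ∘ₗ
        TensorProduct.map (TensorAlgebra.ι R ∘ₗ f.lin ∘ₗ C.sgn)
          (Algebra.linearMap R C'.Words ∘ₗ f.bar₁) := by
    refine TensorProduct.ext' fun a b => ?_
    have h1 : f.bar₁ (C.sgn b) = -f.bar₁ b := LinearMap.congr_fun f.bar₁_sgn b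
    have h2 : C.sgn a = evenPart C.grading a - oddPart C.grading a := by
      rw [← neg_sub, odd_sub_even, neg_neg]
    have h3 : koszulSwap C.grading (a ⊗ₜ b) = b ⊗ₜ evenPart C.grading a +
        C.sgn b ⊗ₜ oddPart C.grading a := by
      simp [koszulSwap]
    have h4 : (TensorAlgebra.ι R ∘ₗ (TensorProduct.lid R C'.carrier).toLinearMap ∘ₗ
        TensorProduct.map f.bar₁ f.lin ∘ₗ koszulSwap C.grading) (a ⊗ₜ b) =
        TensorAlgebra.ι R (TensorProduct.lid R C'.carrier (TensorProduct.map f.bar₁ f.lin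
          (koszulSwap C.grading (a ⊗ₜ b)))) := rfl
    have h5 : (LinearMap.mul' R C'.Words ∘ₗ TensorProduct.map (TensorAlgebra.ι R ∘ₗ f.lin ∘ₗ C.sgn)
          (Algebra.linearMap R C'.Words ∘ₗ f.bar₁)) (a ⊗ₜ b) =
        TensorAlgebra.ι R (f.lin (C.sgn a)) * algebraMap R C'.Words (f.bar₁ b) := rfl
    rw [h4, h5, h3, map_add, TensorProduct.map_tmul, TensorProduct.map_tmul, map_add,
      TensorProduct.lid_tmul, TensorProduct.lid_tmul, h1, h2, ← Algebra.commutes,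
      ← Algebra.smul_def, map_sub]
    simp only [map_add, map_smul, smul_add, smul_neg, neg_smul, sub_eq_add_neg, map_neg]
  rw [f.f₀_diff, LinearMap.comp_add, LinearMap.comp_sub, LinearMap.comp_sub, LinearMap.comp_sub,
    ← add_sub_assoc]
  refine congrArg₂ (· - ·) (congrArg₂ (· + ·) rfl ?_) ?_
  · exact congrArg (fun k => k ∘ₗ C.comul) e1
  · exact congrArg (fun k => k ∘ₗ C.comul) e2

theorem conv_proj : conv (Algebra.linearMap R C'.Words ∘ₗ f.bar₁)
      (TensorAlgebra.ι R ∘ₗ f.lin ∘ₗ C.proj₀) =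
    conv (TensorAlgebra.ι R ∘ₗ f.lin ∘ₗ C.proj₀) (Algebra.linearMap R C'.Words ∘ₗ f.bar₁) := by
  have e1 : LinearMap.mul' R C'.Words ∘ₗ TensorProduct.map (Algebra.linearMap R C'.Words ∘ₗ f.bar₁)
      (TensorAlgebra.ι R ∘ₗ f.lin ∘ₗ C.proj₀) = TensorAlgebra.ι R ∘ₗ
      (TensorProduct.lid R C'.carrier).toLinearMap ∘ₗ
        TensorProduct.map f.bar₁ (f.lin ∘ₗ C.proj₀) :=
    TensorProduct.ext' fun a b => by simp [Algebra.smul_def]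
  have e2 : LinearMap.mul' R C'.Words ∘ₗ TensorProduct.map (TensorAlgebra.ι R ∘ₗ f.lin ∘ₗ C.proj₀)
      (Algebra.linearMap R C'.Words ∘ₗ f.bar₁) = TensorAlgebra.ι R ∘ₗ
      (TensorProduct.rid R C'.carrier).toLinearMap ∘ₗ
        TensorProduct.map (f.lin ∘ₗ C.proj₀) f.bar₁ :=
    TensorProduct.ext' fun a b => by simp [Algebra.smul_def, Algebra.commutes]
  have h1 : conv (Algebra.linearMap R C'.Words ∘ₗ f.bar₁)
      (TensorAlgebra.ι R ∘ₗ f.lin ∘ₗ C.proj₀) = TensorAlgebra.ι R ∘ₗ f.f₁ :=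
    (congrArg (fun k => k ∘ₗ C.comul) e1).trans
      (LinearMap.ext fun c => congrArg (TensorAlgebra.ι R) (f.f₁_eq_right c).symm)
  have h2 : conv (TensorAlgebra.ι R ∘ₗ f.lin ∘ₗ C.proj₀)
      (Algebra.linearMap R C'.Words ∘ₗ f.bar₁) = TensorAlgebra.ι R ∘ₗ f.f₁ :=
    (congrArg (fun k => k ∘ₗ C.comul) e2).trans
      (LinearMap.ext fun c => congrArg (TensorAlgebra.ι R) (f.f₁_eq_left c).symm)
  rw [h1, h2]

theorem words_cobarLetter (c : C.carrier) :
    f.words (C.cobarLetter c) = C'.cobarLetter (f.lin c) := by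
  have hι : ∀ g : C.carrier →ₗ[R] C.carrier, f.words.toLinearMap ∘ₗ TensorAlgebra.ι R ∘ₗ g =
      TensorAlgebra.ι R ∘ₗ f.lin ∘ₗ g + Algebra.linearMap R C'.Words ∘ₗ f.bar₁ ∘ₗ g := by
    intro g
    refine LinearMap.ext fun c => ?_
    simp
  have hA : f.words.toLinearMap ∘ₗ Algebra.linearMap R C.Words ∘ₗ C.curv =
      Algebra.linearMap R C'.Words ∘ₗ C.curv := by
    refine LinearMap.ext fun c => ?_
    simp
  have hc : Algebra.linearMap R C'.Words ∘ₗ C'.curv ∘ₗ f.lin =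
      Algebra.linearMap R C'.Words ∘ₗ C.curv - Algebra.linearMap R C'.Words ∘ₗ f.bar₁ ∘ₗ C.diff +
        conv (Algebra.linearMap R C'.Words ∘ₗ f.bar₁) (Algebra.linearMap R C'.Words ∘ₗ f.bar₁) := by
    have : (Algebra.linearMap R C'.Words ∘ₗ conv f.bar₁ f.bar₁ : C.carrier →ₗ[R] C'.Words) =
        conv (Algebra.linearMap R C'.Words ∘ₗ f.bar₁) (Algebra.linearMap R C'.Words ∘ₗ f.bar₁) :=
      alg_conv (Algebra.ofId R C'.Words) _ _
    rw [← this, f.curv_f₀, LinearMap.comp_add, LinearMap.comp_sub]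
    rfl
  have hs : f.bar₁ ∘ₗ C.sgn ∘ₗ C.bar = -f.bar₁ := by
    rw [← LinearMap.comp_assoc, bar₁_sgn, LinearMap.neg_comp, bar₁_bar]
  have hp : f.lin = f.lin ∘ₗ C.proj₀ + f.lin ∘ₗ C.bar := by
    refine LinearMap.ext fun c => ?_
    rw [LinearMap.add_apply, LinearMap.comp_apply, LinearMap.comp_apply, ← map_add, proj_add_bar]
  have hps : f.lin ∘ₗ C.sgn = f.lin ∘ₗ C.proj₀ + f.lin ∘ₗ C.sgn ∘ₗ C.bar := by
    have h : C.sgn = C.proj₀ + C.sgn ∘ₗ C.bar := by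
      refine graded_hom_ext C.grading fun n c hc => ?_
      rcases eq_or_ne n 0 with rfl | hn
      · simp [sgn_of_mem hc, proj_of_mem_zero hc, bar_of_mem_zero hc]
      · simp [proj_of_mem hn hc, bar_of_mem hn hc]
    rw [← LinearMap.comp_add, ← h]
  have hd := f.lin_diff
  have hd1 : conv (Algebra.linearMap R C'.Words ∘ₗ f.bar₁) (TensorAlgebra.ι R ∘ₗ f.lin) =
      conv (Algebra.linearMap R C'.Words ∘ₗ f.bar₁) (TensorAlgebra.ι R ∘ₗ f.lin ∘ₗ C.proj₀) +
      conv (Algebra.linearMap R C'.Words ∘ₗ f.bar₁) (TensorAlgebra.ι R ∘ₗ f.lin ∘ₗ C.bar) := by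
    rw [← conv_add_right, ← LinearMap.comp_add, ← hp]
  rw [hd1, hps, LinearMap.comp_add, conv_add_left, conv_proj] at hd
  have h : f.words.toLinearMap ∘ₗ C.cobarLetter = C'.cobarLetter ∘ₗ f.lin := by
    simp only [cobarLetter, LinearMap.comp_sub, LinearMap.sub_comp, alg_conv, conv_lin,
      LinearMap.comp_assoc, hι, hA, hc, hd]
    rw [bar₁_bar, hs, LinearMap.comp_neg, ← lin_bar]
    have h5 : C'.sgn ∘ₗ f.lin ∘ₗ C.bar = f.lin ∘ₗ C.sgn ∘ₗ C.bar := by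
      rw [← LinearMap.comp_assoc, ← lin_sgn, LinearMap.comp_assoc]
    rw [h5]
    simp only [conv_add_left, conv_add_right, conv_neg_left]
    abel
  exact LinearMap.congr_fun h c

theorem words_cobarDiff (t : C.Words) : f.words (C.cobarDiff t) = C'.cobarDiff (f.words t) := by
  refine word_induction (p := fun t => f.words (C.cobarDiff t) = C'.cobarDiff (f.words t))
    (by simp) ?_ ?_ ?_ t
  · intro a b ha hb
    simp only [map_add, ha, hb]
  · intro r a ha
    simp only [map_smul, ha]
  · intro c t ht
    have h1 : C'.cobarDiff (algebraMap R C'.Words (f.bar₁ c)) = 0 := by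
      rw [Algebra.algebraMap_eq_smul_one, map_smul, cobarDiff_one, smul_zero]
    have h2 : f.lin (C.sgn c) = C'.sgn (f.lin c) := LinearMap.congr_fun f.lin_sgn c
    have h3 : f.bar₁ (C.sgn c) = -f.bar₁ c := LinearMap.congr_fun f.bar₁_sgn c
    rw [cobarDiff_cons, map_sub, map_mul, map_mul, map_mul, words_cobarLetter, ht, cobarDiff_mul,
      words_ι, words_ι, map_add, h1, add_zero, cobarDiff_ι, map_add, wsgn_ι, AlgHom.commutes, h2, h3,
      map_neg]
    simp only [add_mul, neg_mul]
    abel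

/-- The dg functor between cobar constructions induced by a morphism of categorical coalgebras. -/
def cobarMap : DGCat.Functor C.cobar C'.cobar where
  obj := f.ob
  map _ _ _ := f.words.toLinearMap.restrict fun _ => f.words_mem
  map_one _ := Subtype.ext (map_one f.words)
  map_comp _ _ _ _ _ a b := Subtype.ext (map_mul f.words a.1 b.1)
  map_d _ _ _ a := Subtype.ext (f.words_cobarDiff a.1)

/-- The map induced on coHochschild monomials:
`c₀ {w} ↦ (f₀ c₀) {w'}`, where `w'` is the image of `w`. -/
def coMonomials : C.CoMonomials →ₗ[R] C'.CoMonomials :=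
  TensorProduct.map f.lin f.words.toLinearMap

theorem coMonomials_mem (n : ℕ) : ∀ z ∈ C.coChains n, f.coMonomials z ∈ C'.coChains n := by
  suffices h : C.coChains n ≤ (C'.coChains n).comap f.coMonomials from h
  refine Submodule.span_le.2 ?_
  rintro _ ⟨x, y, i, j, hij, c, hc, t, ht, rfl⟩
  exact mem_coChains hij (f.part_mem hc) (f.words_mem ht.mem)

/-- The map induced by a morphism of categorical coalgebras on coHochschild complexes. -/
def coHochMap : PreMixedComplex.GradedMap C.coHoch C'.coHoch := fun n =>
  f.coMonomials.restrict (f.coMonomials_mem n)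

end Hom

end CategoricalCoalgebra

end CobarHoch

end

noncomputable section

namespace CobarHoch

namespace DGCat

variable {R : Type u} [CommRing R] {A : DGCat.{u, v, w} R}

/-! ### The total algebra of a dg category -/

/-! Composable words u from x to y and v from y to x have a signed sum `rotateInto u v` of the terms
c ⊗ u₂ v u₁ over all factorizations u = u₁ c u₂ with c a letter, and the comparison map is [u]b ↦
`rotateInto u b`. It obeys a Leibniz rule, `rotateInto_mul`: the chosen letter of u w lies in u or
in w, and in the second case u is carried behind v. This rule says precisely that the comparison map
annihilates δ[a | a']b. The remaining content of the chain map property is `coDiff_rotateInto`, on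
[a]b. The Leibniz rule reduces it to a one-letter word a, and there `coDiff_letter` is checked on
the coproduct of the letter: the factors of degree zero produce the two terms at the end points, and
the reduced coproduct matches the two splitting terms of the coHochschild differential.
Compatibility with Connes' operator is a count of bracket entries: B[ ]b is a single bracket, while
for p ≥ 1 at least two entries appear on one side, and on the other side the counit kills letters of
positive degree.

On the Hochschild side, δ² = 0 follows from writing the cyclic term as right multiplication on the
coefficient (`wrap_cons'`, `wrap_rmul`). For δB + Bδ = 0, a monomial is regarded as a cyclic word in
suspended letters and B as insertion of an identity after the norm of the signed rotation. Inserting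
the identity commutes with the differentials up to a difference that telescopes over a full turn
(`hochDiff_cap_rotations`). The differential itself is a sum of rotated copies of an operator acting
on the first letters, so the rotations are absorbed by the norm on either side (`spread_norm`,
`norm_spread`). The cyclic term of δ supplies the one position that a linear word does not have
(`suspend_wrap`).

The comparison map is surjective, because x{w} and c{w} are the images of [ ]w and [{c}]w. Hence the
identities of a mixed complex pass from the Hochschild to the coHochschild side, and functoriality
of the coHochschild complex follows from naturality and functoriality of the Hochschild complex
(`IsMixedComplex.of_surjective`, `IsMorphism.of_comp_surjective`).

It remains to see that the kernel is acyclic. The cobar construction is free as a graded category,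
so there is a homotopy H that splits the first letter off the first entry, [c w | ⋯]b ↦ ± [c | w |
⋯]b. Let J be the comparison map followed by the section c{w} ↦ [{c}]w. Then id - (δH + Hδ) - J
lowers a weight, up to degenerate chains (`IsProjection.perturbation`). A bracket entry that is a
product of l letters of total degree n has weight 2n + l: the differential of a letter loses one
degree and creates at most one additional letter, so it strictly lowers the weight. Since H always
produces two bracket entries, the comparison map vanishes on its image. Descending along the weight,
a cycle in the kernel becomes δ of an element H(y), and this again lies in the kernel
(`exists_primitive`). A surjection with acyclic kernel is a quasi-isomorphism
(`IsMorphism.bijective_homologyMap`). -/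

theorem tot_ext {X : Type*} [AddCommMonoid X] [Module R X] {f g : A.Tot →ₗ[R] X}
    (h : ∀ x y n a, f (A.of x y n a) = g (A.of x y n a)) : f = g :=
  PreDGCat.tot_hom_ext h

theorem even_of {x y : A.Obj} {n : ℕ} (a : A.Hom x y n) :
    A.even (A.of x y n a) = if Even n then A.of x y n a else 0 := by
  rw [PreDGCat.even, PreDGCat.lift_of]
  split_ifs <;> rfl

theorem odd_of {x y : A.Obj} {n : ℕ} (a : A.Hom x y n) :
    A.odd (A.of x y n a) = if Even n then 0 else A.of x y n a := by
  rw [PreDGCat.odd, PreDGCat.lift_of]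
  by_cases h : Even n
  · simp [h, Nat.not_odd_iff_even.2 h]
  · simp [h, Nat.not_even_iff_odd.1 h]

theorem even_add_odd (a : A.Tot) : A.even a + A.odd a = a := by
  have : A.even + A.odd = LinearMap.id := tot_ext fun x y n a => by
    rw [LinearMap.add_apply, even_of, odd_of]
    split_ifs <;> simp
  exact LinearMap.congr_fun this a

theorem even_sub_odd (a : A.Tot) : A.even a - A.odd a = A.sgn a := by
  have : A.even - A.odd = A.sgn := tot_ext fun x y n a => by
    rw [LinearMap.sub_apply, even_of, odd_of, PreDGCat.sgn_of]
    split_ifs with h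
    · simp [h.neg_one_pow]
    · simp [(Nat.not_even_iff_odd.1 h).neg_one_pow]
  exact LinearMap.congr_fun this a

theorem sgn_sgn (a : A.Tot) : A.sgn (A.sgn a) = a := by
  have : A.sgn ∘ₗ A.sgn = LinearMap.id := tot_ext fun x y n a => by
    simp [smul_smul, ← mul_pow]
  exact LinearMap.congr_fun this a

theorem even_sgn (a : A.Tot) : A.even (A.sgn a) = A.even a := by
  have : A.even ∘ₗ A.sgn = A.even := tot_ext fun x y n a => by
    rw [LinearMap.comp_apply, PreDGCat.sgn_of, map_smul, even_of]
    split_ifs with h <;> simp [h]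
  exact LinearMap.congr_fun this a

theorem odd_sgn (a : A.Tot) : A.odd (A.sgn a) = -A.odd a := by
  have : A.odd ∘ₗ A.sgn = -A.odd := tot_ext fun x y n a => by
    rw [LinearMap.comp_apply, PreDGCat.sgn_of, map_smul, LinearMap.neg_apply, odd_of]
    split_ifs with h
    · simp
    · simp [(Nat.not_even_iff_odd.1 h).neg_one_pow]
  exact LinearMap.congr_fun this a

theorem dTot_dTot (a : A.Tot) : A.dTot (A.dTot a) = 0 := LinearMap.congr_fun A.d_d a

theorem dTot_even (a : A.Tot) : A.dTot (A.even a) = A.odd (A.dTot a) := by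
  have : A.dTot ∘ₗ A.even = A.odd ∘ₗ A.dTot := tot_ext fun x y n a => by
    rw [LinearMap.comp_apply, LinearMap.comp_apply, even_of]
    cases n with
    | zero => simp
    | succ n =>
      rw [PreDGCat.dTot_of_succ, odd_of]
      by_cases h : Even n <;> simp [h, Nat.even_add_one]
  exact LinearMap.congr_fun this a

theorem dTot_odd (a : A.Tot) : A.dTot (A.odd a) = A.even (A.dTot a) := by
  have h := dTot_even a
  have h1 := congrArg A.dTot (even_add_odd a)
  rw [map_add, ← even_add_odd (A.dTot a), h] at h1
  exact add_left_cancel (h1.trans (add_comm _ _))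

theorem sgn_dTot (a : A.Tot) : A.sgn (A.dTot a) = -A.dTot (A.sgn a) := by
  rw [← even_sub_odd, ← even_sub_odd a, map_sub, dTot_even, dTot_odd]
  abel

theorem even_mul (a b : A.Tot) : A.even (A.mul a b) =
    A.mul (A.even a) (A.even b) + A.mul (A.odd a) (A.odd b) := by
  refine PreDGCat.tot_induction (p := fun a => A.even (A.mul a b) =
    A.mul (A.even a) (A.even b) + A.mul (A.odd a) (A.odd b)) (by simp) ?_ ?_ a
  · intro a a' h h'
    simp only [map_add, LinearMap.add_apply, h, h']
    abel
  intro x y m a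
  refine PreDGCat.tot_induction (p := fun b => A.even (A.mul (A.of x y m a) b) =
    A.mul (A.even (A.of x y m a)) (A.even b) + A.mul (A.odd (A.of x y m a)) (A.odd b))
    (by simp) ?_ ?_ b
  · intro b b' h h'
    simp only [map_add, h, h']
    abel
  intro y' z n b
  by_cases hy : y = y'
  · subst hy
    rw [PreDGCat.mul_of_of, even_of, even_of, even_of, odd_of, odd_of]
    by_cases hm : Even m <;> by_cases hn : Even n <;> simp [hm, hn, Nat.even_add]
  · simp only [even_of, odd_of]
    split_ifs <;> simp [PreDGCat.mul_of_of_ne _ hy]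

theorem odd_mul (a b : A.Tot) : A.odd (A.mul a b) =
    A.mul (A.even a) (A.odd b) + A.mul (A.odd a) (A.even b) := by
  have h1 := even_add_odd (A.mul a b)
  rw [even_mul] at h1
  have h2 : A.mul a b = A.mul (A.even a + A.odd a) (A.even b + A.odd b) := by
    rw [even_add_odd, even_add_odd]
  rw [eq_sub_of_add_eq' h1, h2]
  simp only [map_add, LinearMap.add_apply]
  abel

theorem sgn_mul (a b : A.Tot) : A.sgn (A.mul a b) = A.mul (A.sgn a) (A.sgn b) := by
  rw [← even_sub_odd, even_mul, odd_mul, ← even_sub_odd a, ← even_sub_odd b]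
  simp only [map_sub, LinearMap.sub_apply]
  abel

theorem wsgn_one : A.wsgn 1 = 1 := map_one (wordSign A.odd A.even)

theorem wsgn_cons (b : A.Tot) (t : A.Words) :
    A.wsgn (TensorAlgebra.ι R b * t) = -(TensorAlgebra.ι R (A.sgn b) * A.wsgn t) := by
  rw [wsgn, AlgHom.toLinearMap_apply, map_mul, wordSign_ι, ← even_sub_odd, ← neg_sub, map_neg,
    neg_mul, AlgHom.toLinearMap_apply]

theorem wsgn_wsgn (t : A.Words) : A.wsgn (A.wsgn t) = t := by
  have : A.wsgn ∘ₗ A.wsgn = LinearMap.id := by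
    refine word_hom_ext (by simp [wsgn_one]) fun v w h => ?_
    simp only [LinearMap.comp_apply, LinearMap.id_apply] at h ⊢
    rw [wsgn_cons, map_neg, wsgn_cons, sgn_sgn, h, neg_neg]
  exact LinearMap.congr_fun this t

/-! ### The Hochschild differential squares to zero -/

/-- Scalars are absorbed by the coefficient, so closure under them is not needed. The bar
differential and the merging operator are determined by their values on [ ]a and by how they act
after a letter is prepended, so each identity below costs two checks. -/
theorem monomial_induction {p : A.Monomials → Prop} (zero : p 0)
    (add : ∀ z z', p z → p z' → p (z + z')) (nil : ∀ a, p (1 ⊗ₜ a))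
    (cons : ∀ b z, p z → p (A.cons b z)) (z : A.Monomials) : p z := by
  induction z using TensorProduct.induction_on with
  | zero => exact zero
  | add z z' h h' => exact add z z' h h'
  | tmul t a =>
    revert a
    refine word_induction (p := fun t => ∀ a, p (t ⊗ₜ a)) nil ?_ ?_ ?_ t
    · intro s t hs ht a
      rw [TensorProduct.add_tmul]
      exact add _ _ (hs a) (ht a)
    · intro r t ht a
      rw [TensorProduct.smul_tmul]
      exact ht _
    · intro b t ht a
      rw [← cons_tmul]
      exact cons b _ (ht a)

variable (A) in
/-- The grading involution on monomials. -/
def msgn : A.Monomials →ₗ[R] A.Monomials := TensorProduct.map A.wsgn A.sgn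

variable (A) in
/-- Multiplication of the coefficient from the right. -/
def rmul (b : A.Tot) : A.Monomials →ₗ[R] A.Monomials :=
  TensorProduct.map LinearMap.id (A.mul.flip b)

theorem sgn_even (a : A.Tot) : A.sgn (A.even a) = A.even a := by
  have : A.sgn ∘ₗ A.even = A.even := tot_ext fun x y n a => by
    rw [LinearMap.comp_apply, even_of]
    split_ifs with h
    · simp [h.neg_one_pow]
    · simp
  exact LinearMap.congr_fun this a

theorem sgn_odd (a : A.Tot) : A.sgn (A.odd a) = -A.odd a := by
  have : A.sgn ∘ₗ A.odd = -A.odd := tot_ext fun x y n a => by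
    rw [LinearMap.comp_apply, LinearMap.neg_apply, odd_of]
    split_ifs with h
    · simp
    · simp [(Nat.not_even_iff_odd.1 h).neg_one_pow]
  exact LinearMap.congr_fun this a

theorem msgn_tmul (t : A.Words) (a : A.Tot) : A.msgn (t ⊗ₜ a) = A.wsgn t ⊗ₜ A.sgn a := rfl

theorem rmul_tmul (b : A.Tot) (t : A.Words) (a : A.Tot) :
    A.rmul b (t ⊗ₜ a) = t ⊗ₜ A.mul a b := rfl

theorem msgn_msgn (z : A.Monomials) : A.msgn (A.msgn z) = z := by
  induction z using TensorProduct.induction_on with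
  | zero => simp
  | add z z' h h' => simp only [map_add, h, h']
  | tmul t a => rw [msgn_tmul, msgn_tmul, wsgn_wsgn, sgn_sgn]

theorem msgn_cons (b : A.Tot) (z : A.Monomials) :
    A.msgn (A.cons b z) = -A.cons (A.sgn b) (A.msgn z) := by
  induction z using TensorProduct.induction_on with
  | zero => simp
  | add z z' h h' => simp only [map_add, h, h', neg_add]
  | tmul t a => rw [cons_tmul, msgn_tmul, msgn_tmul, cons_tmul, wsgn_cons, TensorProduct.neg_tmul]

theorem rmul_cons (b c : A.Tot) (z : A.Monomials) :
    A.rmul b (A.cons c z) = A.cons c (A.rmul b z) := by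
  induction z using TensorProduct.induction_on with
  | zero => simp
  | add z z' h h' => simp only [map_add, h, h']
  | tmul t a => rw [cons_tmul, rmul_tmul, rmul_tmul, cons_tmul]

theorem rmul_rmul (b c : A.Tot) (z : A.Monomials) :
    A.rmul c (A.rmul b z) = A.rmul (A.mul b c) z := by
  induction z using TensorProduct.induction_on with
  | zero => simp
  | add z z' h h' => simp only [map_add, h, h']
  | tmul t a => rw [rmul_tmul, rmul_tmul, rmul_tmul, A.comp_assoc]

theorem msgn_rmul (b : A.Tot) (z : A.Monomials) :
    A.msgn (A.rmul b z) = A.rmul (A.sgn b) (A.msgn z) := by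
  induction z using TensorProduct.induction_on with
  | zero => simp
  | add z z' h h' => simp only [map_add, h, h']
  | tmul t a => rw [rmul_tmul, msgn_tmul, msgn_tmul, rmul_tmul, sgn_mul]

theorem mergeFirst_cons' (b c : A.Tot) (z : A.Monomials) :
    A.mergeFirst b (A.cons c z) = A.cons (A.mul (A.sgn b) c) z := by
  induction z using TensorProduct.induction_on with
  | zero => simp
  | add z z' h h' => simp only [map_add, h, h']
  | tmul t a => rw [cons_tmul, cons_tmul, mergeFirst_cons]

theorem rmul_nil (b a : A.Tot) : A.rmul b ((1 : A.Words) ⊗ₜ[R] a) = 1 ⊗ₜ A.mul a b := rfl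

theorem msgn_nil (a : A.Tot) : A.msgn ((1 : A.Words) ⊗ₜ[R] a) = 1 ⊗ₜ A.sgn a := by
  rw [msgn_tmul, wsgn_one]

theorem rmul_mergeFirst (b c : A.Tot) (z : A.Monomials) :
    A.rmul b (A.mergeFirst c z) = A.mergeFirst c (A.rmul b z) := by
  refine monomial_induction (p := fun z => A.rmul b (A.mergeFirst c z) =
    A.mergeFirst c (A.rmul b z)) (by simp) (fun z z' h h' => by simp only [map_add, h, h'])
    (fun a => ?_) (fun d z _ => ?_) z
  · rw [mergeFirst_nil, rmul_nil, rmul_nil, mergeFirst_nil, A.comp_assoc]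
  · rw [mergeFirst_cons', rmul_cons, rmul_cons, mergeFirst_cons']

theorem mergeFirst_mergeFirst (b c : A.Tot) (z : A.Monomials) :
    A.mergeFirst b (A.mergeFirst c z) = A.mergeFirst (A.mul b c) z := by
  refine monomial_induction (p := fun z => A.mergeFirst b (A.mergeFirst c z) =
    A.mergeFirst (A.mul b c) z) (by simp) (fun z z' h h' => by simp only [map_add, h, h'])
    (fun a => ?_) (fun d z _ => ?_) z
  · rw [mergeFirst_nil, mergeFirst_nil, mergeFirst_nil, A.comp_assoc]
  · rw [mergeFirst_cons', mergeFirst_cons', mergeFirst_cons', sgn_mul, A.comp_assoc]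

/-- The Koszul sign of carrying b around depends only on the parity of b. Splitting b into its even
and odd part replaces all exponents by the involution `msgn`, so that the formula holds for
inhomogeneous and non-composable monomials. -/
theorem wrap_cons' (b : A.Tot) (z : A.Monomials) :
    A.wrap (A.cons b z) = -(A.rmul (A.even b) z + A.rmul (A.odd b) (A.msgn z)) := by
  induction z using TensorProduct.induction_on with
  | zero => simp
  | add z z' h h' => simp only [map_add, h, h']; abel
  | tmul t a => rw [cons_tmul, wrap_cons, msgn_tmul, rmul_tmul, rmul_tmul]

theorem msgn_mergeFirst (b : A.Tot) (z : A.Monomials) :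
    A.msgn (A.mergeFirst b z) = A.mergeFirst (A.sgn b) (A.msgn z) := by
  refine monomial_induction (p := fun z => A.msgn (A.mergeFirst b z) =
    A.mergeFirst (A.sgn b) (A.msgn z)) (by simp) (fun z z' h h' => by simp only [map_add, h, h'])
    (fun a => ?_) (fun d z _ => ?_) z
  · rw [mergeFirst_nil, msgn_nil, msgn_nil, mergeFirst_nil, sgn_mul]
  · rw [mergeFirst_cons', msgn_cons, msgn_cons, map_neg, mergeFirst_cons', sgn_mul]

theorem cons_neg (b : A.Tot) : A.cons (-b) = -A.cons b := by
  refine TensorProduct.ext' fun t a => ?_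
  simp [cons_tmul, TensorProduct.neg_tmul]

theorem rmul_neg (b : A.Tot) : A.rmul (-b) = -A.rmul b := by
  refine TensorProduct.ext' fun t a => ?_
  rw [rmul_tmul, map_neg, LinearMap.neg_apply, rmul_tmul, TensorProduct.tmul_neg]

theorem rmul_add (b c : A.Tot) : A.rmul (b + c) = A.rmul b + A.rmul c := by
  refine TensorProduct.ext' fun t a => ?_
  rw [rmul_tmul, map_add, LinearMap.add_apply, rmul_tmul, rmul_tmul, TensorProduct.tmul_add]

theorem barDiff_msgn (z : A.Monomials) : A.barDiff (A.msgn z) = -A.msgn (A.barDiff z) := by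
  refine monomial_induction (p := fun z => A.barDiff (A.msgn z) = -A.msgn (A.barDiff z)) (by simp)
    (fun z z' h h' => by simp only [map_add, h, h', neg_add]) (fun a => ?_) (fun b z h => ?_) z
  · rw [msgn_nil, barDiff_nil, barDiff_nil, msgn_nil, sgn_dTot, TensorProduct.tmul_neg, neg_neg]
  · rw [msgn_cons, map_neg, barDiff_cons, barDiff_cons, map_sub, map_sub, msgn_mergeFirst,
      msgn_cons, msgn_cons, h, sgn_dTot, cons_neg]
    simp only [map_neg, LinearMap.neg_apply]
    abel

/-- The element b sits at the far right of the coefficient, so by the Leibniz rule of `A` the only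
new term is d b, which has passed all of z. -/
theorem barDiff_rmul (b : A.Tot) (z : A.Monomials) :
    A.barDiff (A.rmul b z) = A.rmul b (A.barDiff z) + A.rmul (A.dTot b) (A.msgn z) := by
  refine monomial_induction (p := fun z => A.barDiff (A.rmul b z) =
    A.rmul b (A.barDiff z) + A.rmul (A.dTot b) (A.msgn z)) (by simp)
    (fun z z' h h' => by simp only [map_add, h, h']; abel) (fun a => ?_) (fun c z h => ?_) z
  · rw [rmul_nil, barDiff_nil, barDiff_nil, msgn_nil, rmul_nil, rmul_nil, A.leibniz,
      TensorProduct.tmul_add]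
  · rw [rmul_cons, barDiff_cons, barDiff_cons, msgn_cons, map_neg, map_sub, map_sub, rmul_cons,
      rmul_cons, rmul_cons, rmul_mergeFirst, h, map_add]
    abel

/-- The one-sided bar complex is a left dg module over `A`, with `mergeFirst` as action. -/
theorem barDiff_mergeFirst (b : A.Tot) (z : A.Monomials) :
    A.barDiff (A.mergeFirst b z) =
      A.mergeFirst (A.dTot b) z + A.mergeFirst (A.sgn b) (A.barDiff z) := by
  refine monomial_induction (p := fun z => A.barDiff (A.mergeFirst b z) =
      A.mergeFirst (A.dTot b) z + A.mergeFirst (A.sgn b) (A.barDiff z)) (by simp)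
    (fun z z' h h' => by simp only [map_add, h, h']; abel) (fun a => ?_) (fun c z _ => ?_) z
  · rw [mergeFirst_nil, barDiff_nil, barDiff_nil, mergeFirst_nil, mergeFirst_nil, A.leibniz,
      TensorProduct.tmul_add]
  · rw [mergeFirst_cons', barDiff_cons, barDiff_cons, mergeFirst_cons', map_sub, map_sub,
      mergeFirst_cons', mergeFirst_cons', mergeFirst_mergeFirst, A.leibniz, cons_add, sgn_dTot,
      map_neg, LinearMap.neg_apply, cons_neg, sgn_mul]
    simp only [LinearMap.add_apply, LinearMap.neg_apply]
    abel

theorem cons_zero : A.cons 0 = 0 := by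
  refine TensorProduct.ext' fun t a => ?_
  simp [cons_tmul]

/-- In the recursion for a prepended letter, the merging terms cancel by the Leibniz rule for
`mergeFirst`, and the terms with d b cancel because the involution anticommutes with d. -/
theorem barDiff_barDiff (z : A.Monomials) : A.barDiff (A.barDiff z) = 0 := by
  refine monomial_induction (p := fun z => A.barDiff (A.barDiff z) = 0) (by simp)
    (fun z z' h h' => by simp only [map_add, h, h', add_zero]) (fun a => ?_) (fun b z h => ?_) z
  · rw [barDiff_nil, barDiff_nil, dTot_dTot, TensorProduct.tmul_zero]
  · rw [barDiff_cons, map_sub, map_sub, barDiff_mergeFirst, barDiff_cons, barDiff_cons, h,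
      dTot_dTot, sgn_sgn, map_zero, sgn_dTot, cons_neg, cons_zero]
    simp only [LinearMap.neg_apply, LinearMap.zero_apply]
    abel

/-- On a cycle it makes no difference whether b is multiplied into the first entry from the left or
is first carried around to the end of the coefficient: both give the product of a, b and the first
entry, by associativity. -/
theorem wrap_rmul (b : A.Tot) (z : A.Monomials) :
    A.wrap (A.mergeFirst b z) = A.wrap (A.rmul (A.even b) z + A.rmul (A.odd b) (A.msgn z)) := by
  refine monomial_induction (p := fun z => A.wrap (A.mergeFirst b z) =
    A.wrap (A.rmul (A.even b) z + A.rmul (A.odd b) (A.msgn z))) (by simp)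
    (fun z z' h h' => by simp only [map_add] at h h' ⊢; rw [h, h']; abel)
    (fun a => ?_) (fun c z _ => ?_) z
  · rw [mergeFirst_nil, wrap_nil, msgn_nil, map_add, rmul_nil, rmul_nil, wrap_nil, wrap_nil,
      add_zero]
  · rw [mergeFirst_cons', msgn_cons, map_neg, rmul_cons, rmul_cons, map_add, map_neg, wrap_cons',
      wrap_cons', wrap_cons', even_mul, odd_mul, even_sgn, odd_sgn, msgn_rmul, msgn_rmul, even_sgn,
      odd_sgn, rmul_rmul, rmul_rmul]
    rw [rmul_rmul, rmul_rmul, sgn_even, sgn_odd, msgn_msgn]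
    simp only [map_neg, rmul_add, rmul_neg, LinearMap.add_apply, LinearMap.neg_apply]
    abel

/-- The bar differential squares to zero. Its cross terms with the cyclic term cancel by
`barDiff_rmul`, except for the cyclic term of a merged first entry, and `wrap_rmul` identifies that
with the double cyclic term. Composability plays no role. -/
theorem hochDiff_hochDiff (z : A.Monomials) : A.hochDiff (A.hochDiff z) = 0 := by
  refine monomial_induction (p := fun z => A.hochDiff (A.hochDiff z) = 0) (by simp)
    (fun z z' h h' => by simp only [map_add, h, h', add_zero]) (fun a => ?_) (fun b z h => ?_) z
  · simp only [hochDiff, LinearMap.add_apply, wrap_nil, barDiff_nil, add_zero]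
    rw [dTot_dTot, TensorProduct.tmul_zero]
  · simp only [hochDiff, LinearMap.add_apply, map_add, barDiff_barDiff]
    rw [wrap_cons', barDiff_cons, map_neg, map_neg, map_sub, map_sub, wrap_cons', wrap_cons',
      wrap_rmul, map_add A.barDiff, map_add A.wrap, barDiff_rmul, barDiff_rmul, barDiff_msgn,
      dTot_even, dTot_odd, even_sgn, odd_sgn, rmul_neg, msgn_msgn]
    simp only [map_neg, LinearMap.neg_apply]
    abel

end DGCat
/-! ### Rotations of words -/

section Rotation

variable {R : Type u} [CommRing R] {V : Type v} [AddCommGroup V] [Module R V]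

/-- The distinguished letter of s t lies either in s or in t. -/
theorem pick_mul (s t : TensorAlgebra R V) : pick (s * t) =
    TensorProduct.map LinearMap.id (TensorProduct.map LinearMap.id (LinearMap.mulRight R t))
      (pick s) + TensorProduct.map (LinearMap.mulLeft R s) LinearMap.id (pick t) := by
  refine word_induction (p := fun s => pick (s * t) =
    TensorProduct.map LinearMap.id (TensorProduct.map LinearMap.id (LinearMap.mulRight R t))
      (pick s) + TensorProduct.map (LinearMap.mulLeft R s) LinearMap.id (pick t)) ?_ ?_ ?_ ?_ s
  · rw [one_mul, pick_one, map_zero, zero_add, LinearMap.mulLeft_one, TensorProduct.map_id,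
      LinearMap.id_apply]
  · intro a b ha hb
    have : LinearMap.mulLeft R (a + b) = LinearMap.mulLeft R a + LinearMap.mulLeft R b :=
      LinearMap.ext fun x => add_mul a b x
    rw [add_mul, map_add, map_add, map_add, ha, hb, this, TensorProduct.map_add_left,
      LinearMap.add_apply]
    abel
  · intro r a ha
    have : LinearMap.mulLeft R (r • a) = r • LinearMap.mulLeft R a :=
      LinearMap.ext fun x => smul_mul_assoc r a x
    rw [smul_mul_assoc, map_smul, map_smul, map_smul, ha, this, TensorProduct.map_smul_left,
      LinearMap.smul_apply, smul_add]
  · intro c w hw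
    rw [mul_assoc, pick_cons, hw, pick_cons, map_add, map_add, ← add_assoc,
      TensorProduct.map_tmul, TensorProduct.map_tmul]
    refine congrArg₂ (· + ·) (congrArg₂ (· + ·) rfl ?_) ?_
    · rw [TensorProduct.map_map, TensorProduct.map_map]
      rfl
    · rw [TensorProduct.map_map, LinearMap.mulLeft_mul]
      rfl

@[simp]
theorem pick_ι (c : V) : pick (TensorAlgebra.ι R c) = 1 ⊗ₜ (c ⊗ₜ 1) := by
  simpa using pick_cons c (1 : TensorAlgebra R V)

/-- Since `pick` kills scalars, the hypothesis allows φ to send a letter c to g c plus a scalar.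
This covers letterwise maps as well as the maps c ↦ f₀ c + f̄₁ c between cobar constructions. -/
theorem pick_algHom {V' : Type w} [AddCommGroup V'] [Module R V']
    (φ : TensorAlgebra R V →ₐ[R] TensorAlgebra R V') (g : V →ₗ[R] V')
    (h : ∀ c, pick (φ (TensorAlgebra.ι R c)) = 1 ⊗ₜ (g c ⊗ₜ 1)) (t : TensorAlgebra R V) :
    pick (φ t) = TensorProduct.map φ.toLinearMap (TensorProduct.map g φ.toLinearMap) (pick t) := by
  refine word_induction (p := fun t => pick (φ t) =
    TensorProduct.map φ.toLinearMap (TensorProduct.map g φ.toLinearMap) (pick t)) ?_ ?_ ?_ ?_ t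
  · simp
  · intro a b ha hb
    simp only [map_add, ha, hb]
  · intro r a ha
    simp only [map_smul, ha]
  · intro c w hw
    rw [map_mul, pick_mul, h, hw, pick_cons, map_add, TensorProduct.map_tmul,
      TensorProduct.map_tmul, TensorProduct.map_tmul, TensorProduct.map_tmul]
    refine congrArg₂ (· + ·) (by simp) ?_
    rw [TensorProduct.map_map, TensorProduct.map_map]
    refine congrArg (fun k => TensorProduct.map k _ (pick w)) ?_
    exact LinearMap.ext fun x => (map_mul φ _ _).symm

/-- The sum `∑ ± c ⊗ u₂ v u₁` over all ways of writing `u` as `u₁ c u₂` with `c` a letter. -/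
def rotateInto (e o : V →ₗ[R] V) (u v : TensorAlgebra R V) : V ⊗[R] TensorAlgebra R V :=
  moveToEnd e o (TensorProduct.map LinearMap.id
    (TensorProduct.map LinearMap.id (LinearMap.mulRight R v)) (pick u))

variable (e o : V →ₗ[R] V)

/-- A vector of parity `n` with respect to the projections `e` and `o` onto the even and the odd
part. -/
def IsHomog (n : ℕ) (c : V) : Prop :=
  e c = (if Even n then c else 0) ∧ o c = if Even n then 0 else c

/-- Words in homogeneous letters, with their length and their degree. -/
inductive IsHWord : ℕ → ℕ → TensorAlgebra R V → Prop
  | nil : IsHWord 0 0 1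
  | cons {k m n : ℕ} {c : V} {t : TensorAlgebra R V} (hc : IsHomog e o m c) (h : IsHWord k n t) :
      IsHWord (k + 1) (m + n) (TensorAlgebra.ι R c * t)

variable {e o}

theorem IsHWord.mul {k l m n : ℕ} {s t : TensorAlgebra R V} (hs : IsHWord e o k m s)
    (ht : IsHWord e o l n t) : IsHWord e o (k + l) (m + n) (s * t) := by
  induction hs with
  | nil => simpa using ht
  | cons hc _ ih =>
    rw [mul_assoc, add_assoc (_ : ℕ) (_ : ℕ) n, add_right_comm]
    exact IsHWord.cons hc ih

theorem IsHomog.isHWord {m : ℕ} {c : V} (hc : IsHomog e o m c) :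
    IsHWord e o 1 m (TensorAlgebra.ι R c) := by
  simpa using IsHWord.cons hc IsHWord.nil

theorem IsHomog.sub {m : ℕ} {c : V} (hc : IsHomog e o m c) : e c - o c = (-1 : R) ^ m • c := by
  rw [hc.1, hc.2]
  split_ifs with h
  · simp [h.neg_one_pow]
  · simp [(Nat.not_even_iff_odd.1 h).neg_one_pow]

theorem IsHWord.sign {k m : ℕ} {t : TensorAlgebra R V} (ht : IsHWord e o k m t) :
    wordSign e o t = (-1 : R) ^ m • t := by
  induction ht with
  | nil => simp
  | cons hc _ ih =>
    rw [map_mul, wordSign_ι, hc.sub, ih, map_smul, smul_mul_smul_comm, pow_add]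

theorem wordEven_sign (he : e ∘ₗ e = e) (ho : o ∘ₗ o = o) (heo : e ∘ₗ o = 0) (hoe : o ∘ₗ e = 0)
    (t : TensorAlgebra R V) : wordEven e o (wordSign e o t) = wordEven e o t ∧
      wordOdd e o (wordSign e o t) = -wordOdd e o t := by
  have he' := fun c => LinearMap.congr_fun he c
  have ho' := fun c => LinearMap.congr_fun ho c
  have heo' := fun c => LinearMap.congr_fun heo c
  have hoe' := fun c => LinearMap.congr_fun hoe c
  simp only [LinearMap.comp_apply, LinearMap.zero_apply] at he' ho' heo' hoe'
  refine word_induction (p := fun t => wordEven e o (wordSign e o t) = wordEven e o t ∧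
      wordOdd e o (wordSign e o t) = -wordOdd e o t) (by simp) ?_ ?_ ?_ t
  · intro a b ha hb
    simp only [map_add, ha, hb, neg_add, and_self]
  · intro r a ha
    simp only [map_smul, ha, smul_neg, and_self]
  · intro c t ht
    rw [map_mul, wordSign_ι, wordEven_cons, wordOdd_cons, ht.1, ht.2, wordEven_cons, wordOdd_cons]
    simp only [map_sub, he', ho', heo', hoe', sub_zero, zero_sub, map_neg, neg_mul, mul_neg,
      neg_neg, neg_add, and_self]

/-- The relation between the parity projections. -/
structure IsParity (e o : V →ₗ[R] V) : Prop where
  add : ∀ c, e c + o c = c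
  e_e : ∀ c, e (e c) = e c
  o_o : ∀ c, o (o c) = o c
  e_o : ∀ c, e (o c) = 0
  o_e : ∀ c, o (e c) = 0

/-- To carry c u to the end, carry c first and then u. An odd c passes u, v and t, and the three
involutions record the resulting sign. -/
theorem moveToEnd_cons (h : IsParity e o) (c : V) (u t : TensorAlgebra R V) (v : V) :
    moveToEnd e o ((TensorAlgebra.ι R c * u) ⊗ₜ (v ⊗ₜ t)) =
      moveToEnd e o (u ⊗ₜ (v ⊗ₜ (t * TensorAlgebra.ι R (e c)))) +
      moveToEnd e o (wordSign e o u ⊗ₜ ((e v - o v) ⊗ₜ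
        (wordSign e o t * TensorAlgebra.ι R (o c)))) := by
  have h1 := wordEven_sign (LinearMap.ext h.e_e) (LinearMap.ext h.o_o) (LinearMap.ext h.e_o)
    (LinearMap.ext h.o_e) u
  have h2 : wordSign e o (wordSign e o t) = t := by
    have : (wordSign e o).comp (wordSign e o) = AlgHom.id R _ := by
      ext c
      simp [h.e_e, h.o_o, h.e_o, h.o_e, ← map_add, h.add]
    exact DFunLike.congr_fun this t
  rw [moveToEnd_tmul, moveToEnd_tmul, moveToEnd_tmul, h1.1, h1.2, wordEven_cons, wordOdd_cons,
    map_mul, map_mul, wordSign_ι, wordSign_ι, h2]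
  simp only [h.e_e, h.o_o, h.e_o, h.o_e, map_sub, sub_zero, zero_sub, map_neg, mul_neg, neg_mul,
    neg_neg, mul_add, TensorProduct.tmul_add, mul_assoc, sub_neg_eq_add, h.add]
  abel

theorem wordSign_pick (t : TensorAlgebra R V) : pick (wordSign e o t) =
    TensorProduct.map (wordSign e o).toLinearMap
      (TensorProduct.map (e - o) (wordSign e o).toLinearMap) (pick t) :=
  pick_algHom _ _ (fun c => by simp only [wordSign_ι, pick_ι, LinearMap.sub_apply]) t

theorem rotateInto_one (v : TensorAlgebra R V) : rotateInto e o 1 v = 0 := by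
  simp [rotateInto]

/-- Either c is the chosen letter, or c belongs to the prefix and is carried behind v before the
choice is made in u. -/
theorem rotateInto_cons' (h : IsParity e o) (c : V) (u v : TensorAlgebra R V) :
    rotateInto e o (TensorAlgebra.ι R c * u) v = c ⊗ₜ (u * v) +
      (rotateInto e o u (v * TensorAlgebra.ι R (e c)) +
      rotateInto e o (wordSign e o u) (wordSign e o v * TensorAlgebra.ι R (o c))) := by
  rw [rotateInto, pick_cons, map_add, map_add, TensorProduct.map_tmul, TensorProduct.map_tmul,
    moveToEnd_tmul]
  refine congrArg₂ (· + ·) (by simp) ?_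
  rw [rotateInto, rotateInto, wordSign_pick]
  induction pick u with
  | zero => simp
  | add a b ha hb => simp only [map_add, ha, hb]; abel
  | tmul a b =>
    induction b with
    | zero => simp
    | add b b' hb hb' =>
      simp only [map_add, TensorProduct.tmul_add] at hb hb' ⊢
      rw [hb, hb']
      abel
    | tmul b s =>
      simp only [TensorProduct.map_tmul, LinearMap.id_apply, LinearMap.mulRight_apply,
        LinearMap.mulLeft_apply, AlgHom.toLinearMap_apply, LinearMap.sub_apply]
      rw [moveToEnd_cons h, map_mul, mul_assoc, mul_assoc]

theorem rotateInto_add_left (u u' v : TensorAlgebra R V) :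
    rotateInto e o (u + u') v = rotateInto e o u v + rotateInto e o u' v := by
  simp only [rotateInto, map_add]

theorem rotateInto_smul_left (r : R) (u v : TensorAlgebra R V) :
    rotateInto e o (r • u) v = r • rotateInto e o u v := by
  simp only [rotateInto, map_smul]

theorem rotateInto_add_right (u v v' : TensorAlgebra R V) :
    rotateInto e o u (v + v') = rotateInto e o u v + rotateInto e o u v' := by
  have : LinearMap.mulRight R (v + v') = LinearMap.mulRight R v + LinearMap.mulRight R v' :=
    LinearMap.ext fun x => mul_add x v v'
  simp only [rotateInto, this, TensorProduct.map_add_right, LinearMap.add_apply, map_add]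

theorem rotateInto_smul_right (r : R) (u v : TensorAlgebra R V) :
    rotateInto e o u (r • v) = r • rotateInto e o u v := by
  have : LinearMap.mulRight R (r • v) = r • LinearMap.mulRight R v :=
    LinearMap.ext fun x => mul_smul_comm r x v
  simp only [rotateInto, this, TensorProduct.map_smul_right, LinearMap.smul_apply, map_smul]

theorem rotations_eq (t : TensorAlgebra R V) : rotations e o t = rotateInto e o t 1 := by
  rw [rotateInto, LinearMap.mulRight_one, TensorProduct.map_id, TensorProduct.map_id]
  rfl

theorem rotateInto_cons (h : IsParity e o) {m n p : ℕ} {c : V} (hc : IsHomog e o m c)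
    {u v : TensorAlgebra R V} (hu : wordSign e o u = (-1 : R) ^ n • u)
    (hv : wordSign e o v = (-1 : R) ^ p • v) :
    rotateInto e o (TensorAlgebra.ι R c * u) v = c ⊗ₜ (u * v) +
      (-1 : R) ^ (m * (n + p)) • rotateInto e o u (v * TensorAlgebra.ι R c) := by
  rw [rotateInto_cons' h, hu, hv, hc.1, hc.2, smul_mul_assoc, rotateInto_smul_left,
    rotateInto_smul_right]
  refine congrArg₂ (· + ·) rfl ?_
  split_ifs with hm
  · rw [(hm.mul_right _).neg_one_pow, one_smul, map_zero, mul_zero, ← zero_smul R (0 : _),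
      rotateInto_smul_right]
    simp
  · have h1 : (-1 : R) ^ (m * (n + p)) = (-1) ^ n * (-1) ^ p := by
      rw [pow_mul, (Nat.not_even_iff_odd.1 hm).neg_one_pow, pow_add]
    rw [h1, map_zero, mul_zero, ← zero_smul R (0 : TensorAlgebra R V), rotateInto_smul_right,
      zero_smul, zero_add, smul_smul]

/-- This is the Leibniz rule for the comparison map: the chosen letter lies in u or in w, and in the
second case the whole of u passes w v. -/
theorem rotateInto_mul (h : IsParity e o) {k m n p : ℕ} {u : TensorAlgebra R V}
    (hu : IsHWord e o k m u) {w v : TensorAlgebra R V} (hw : wordSign e o w = (-1 : R) ^ n • w)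
    (hv : wordSign e o v = (-1 : R) ^ p • v) :
    rotateInto e o (u * w) v = rotateInto e o u (w * v) +
      (-1 : R) ^ (m * (n + p)) • rotateInto e o w (v * u) := by
  induction hu generalizing v p with
  | nil => simp [rotateInto_one]
  | @cons k m m' c t hc ht ih =>
    have h1 : wordSign e o (v * TensorAlgebra.ι R c) =
        (-1 : R) ^ (p + m) • (v * TensorAlgebra.ι R c) := by
      rw [map_mul, hv, wordSign_ι, hc.sub, map_smul, smul_mul_smul_comm, pow_add]
    have h2 : wordSign e o (t * w) = (-1 : R) ^ (m' + n) • (t * w) := by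
      rw [map_mul, hw, ht.sign, smul_mul_smul_comm, pow_add]
    have h3 : wordSign e o (w * v) = (-1 : R) ^ (n + p) • (w * v) := by
      rw [map_mul, hw, hv, smul_mul_smul_comm, pow_add]
    rw [mul_assoc, rotateInto_cons h hc h2 hv, ih h1, rotateInto_cons h hc ht.sign h3]
    simp only [mul_assoc, smul_add, smul_smul, ← pow_add, ← add_assoc]
    refine congrArg₂ (· + ·) (congrArg₂ (· + ·) rfl rfl) ?_
    refine congrArg (· • _) ?_
    -- The letter c and the word t pass each other twice, so the exponents differ by the even number
    -- 2 m m'.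
    have : m * (m' + n + p) + m' * (n + (p + m)) = (m + m') * (n + p) + 2 * (m * m') := by ring
    rw [add_assoc n p m, this, pow_add, pow_mul _ 2, neg_one_sq, one_pow, mul_one]

variable (e o) in
/-- The signed rotation moving the first letter of a word to its end. -/
def rot : TensorAlgebra R V →ₗ[R] TensorAlgebra R V :=
  LinearMap.mul' R _ ∘ₗ (TensorProduct.comm R _ _).toLinearMap ∘ₗ
    (TensorProduct.map (TensorAlgebra.ι R ∘ₗ e) LinearMap.id +
      TensorProduct.map (TensorAlgebra.ι R ∘ₗ o) (wordSign e o).toLinearMap) ∘ₗ uncons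

theorem rot_one : rot e o (1 : TensorAlgebra R V) = 0 := by simp [rot]

theorem rot_cons (c : V) (t : TensorAlgebra R V) : rot e o (TensorAlgebra.ι R c * t) =
    t * TensorAlgebra.ι R (e c) + wordSign e o t * TensorAlgebra.ι R (o c) := by
  simp [rot]

theorem rot_cons_of {m n : ℕ} {c : V} (hc : IsHomog e o m c) {t : TensorAlgebra R V}
    (ht : wordSign e o t = (-1 : R) ^ n • t) : rot e o (TensorAlgebra.ι R c * t) =
      (-1 : R) ^ (m * n) • (t * TensorAlgebra.ι R c) := by
  rw [rot_cons, hc.1, hc.2, ht]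
  split_ifs with hm
  · rw [(hm.mul_right _).neg_one_pow]
    simp
  · rw [pow_mul, (Nat.not_even_iff_odd.1 hm).neg_one_pow]
    simp

/-- The letters of u are moved one at a time. Any two of them pass each other twice, so only the
sign of u passing v remains. -/
theorem rot_pow_mul {k m n : ℕ} {u v : TensorAlgebra R V} (hu : IsHWord e o k m u)
    (hv : wordSign e o v = (-1 : R) ^ n • v) :
    (rot e o ^ k) (u * v) = (-1 : R) ^ (m * n) • (v * u) := by
  induction hu generalizing v n with
  | nil => simp
  | @cons k m m' c t hc ht ih =>
    have h1 : wordSign e o (v * TensorAlgebra.ι R c) =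
        (-1 : R) ^ (n + m) • (v * TensorAlgebra.ι R c) := by
      rw [map_mul, hv, wordSign_ι, hc.sub, map_smul, smul_mul_smul_comm, pow_add]
    have h2 : wordSign e o (t * v) = (-1 : R) ^ (m' + n) • (t * v) := by
      rw [map_mul, hv, ht.sign, smul_mul_smul_comm, pow_add]
    rw [pow_succ, Module.End.mul_apply, mul_assoc, rot_cons_of hc h2, map_smul, mul_assoc, ih h1,
      smul_smul, ← pow_add, mul_assoc]
    have : m * (m' + n) + m' * (n + m) = (m + m') * n + 2 * (m * m') := by ring
    rw [this, pow_add, pow_mul _ 2, neg_one_sq, one_pow, mul_one]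

/-- After i rotations the letter of u in position i, counted from zero, is at the front with
everything before it behind v. -/
theorem rotateInto_eq_sum (h : IsParity e o) {k m n : ℕ} {u v : TensorAlgebra R V}
    (hu : IsHWord e o k m u) (hv : wordSign e o v = (-1 : R) ^ n • v) :
    rotateInto e o u v = ∑ i ∈ Finset.range k, uncons ((rot e o ^ i) (u * v)) := by
  induction hu generalizing v n with
  | nil => simp [rotateInto_one]
  | @cons k m m' c t hc ht ih =>
    have h1 : wordSign e o (v * TensorAlgebra.ι R c) =
        (-1 : R) ^ (n + m) • (v * TensorAlgebra.ι R c) := by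
      rw [map_mul, hv, wordSign_ι, hc.sub, map_smul, smul_mul_smul_comm, pow_add]
    have h2 : wordSign e o (t * v) = (-1 : R) ^ (m' + n) • (t * v) := by
      rw [map_mul, hv, ht.sign, smul_mul_smul_comm, pow_add]
    rw [rotateInto_cons h hc ht.sign hv, Finset.sum_range_succ', ih h1, pow_zero,
      Module.End.one_apply, mul_assoc, uncons_cons, add_comm, Finset.smul_sum]
    refine congrArg₂ (· + ·) (Finset.sum_congr rfl fun i _ => ?_) rfl
    rw [pow_succ, Module.End.mul_apply, rot_cons_of hc h2, map_smul, map_smul, mul_assoc]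

variable (e o) in
/-- The span of the words of length `k` in homogeneous letters. -/
def hwords (k : ℕ) : Submodule R (TensorAlgebra R V) :=
  Submodule.span R {t | ∃ m, IsHWord e o k m t}

theorem IsHWord.mem {k m : ℕ} {t : TensorAlgebra R V} (ht : IsHWord e o k m t) :
    t ∈ hwords e o k := Submodule.subset_span ⟨m, ht⟩

theorem hwords_ext {X : Type*} [AddCommGroup X] [Module R X] {k : ℕ}
    {f g : TensorAlgebra R V →ₗ[R] X} (h : ∀ m t, IsHWord e o k m t → f t = g t)
    {t : TensorAlgebra R V} (ht : t ∈ hwords e o k) : f t = g t := by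
  refine LinearMap.eqOn_span (f := f) (g := g) ?_ ht
  rintro _ ⟨m, h'⟩
  exact h m _ h'

theorem hwords_map {k l : ℕ} (f : TensorAlgebra R V →ₗ[R] TensorAlgebra R V)
    (h : ∀ m t, IsHWord e o k m t → f t ∈ hwords e o l) {t : TensorAlgebra R V}
    (ht : t ∈ hwords e o k) : f t ∈ hwords e o l := by
  have : hwords e o k ≤ (hwords e o l).comap f := by
    refine Submodule.span_le.2 ?_
    rintro _ ⟨m, h'⟩
    exact h m _ h'
  exact this ht

theorem rot_mem {k : ℕ} {t : TensorAlgebra R V} (ht : t ∈ hwords e o k) :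
    rot e o t ∈ hwords e o k := by
  refine hwords_map _ (fun m t h => ?_) ht
  cases h with
  | nil => rw [rot_one]; exact zero_mem _
  | cons hc h =>
    rw [rot_cons_of hc h.sign]
    exact Submodule.smul_mem _ _ (h.mul hc.isHWord).mem

theorem rot_pow_mem {k : ℕ} {t : TensorAlgebra R V} (ht : t ∈ hwords e o k) (i : ℕ) :
    (rot e o ^ i) t ∈ hwords e o k := by
  induction i with
  | zero => exact ht
  | succ i ih =>
    rw [pow_succ', Module.End.mul_apply]
    exact rot_mem ih

/-- A full turn carries the word past the empty word, which has degree zero, so the signed cyclic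
action has no residual sign. -/
theorem rot_pow_length {k : ℕ} {t : TensorAlgebra R V} (ht : t ∈ hwords e o k) :
    (rot e o ^ k) t = t := by
  refine hwords_ext (f := rot e o ^ k) (g := LinearMap.id) (fun m t ht => ?_) ht
  have h : wordSign e o (1 : TensorAlgebra R V) = (-1 : R) ^ 0 • 1 := by simp
  have := rot_pow_mul ht h
  simpa using this

variable (e o) in
/-- The sum of the rotations by less than `k` letters. -/
def norm (k : ℕ) : TensorAlgebra R V →ₗ[R] TensorAlgebra R V :=
  ∑ i ∈ Finset.range k, rot e o ^ i

theorem norm_apply (k : ℕ) (t : TensorAlgebra R V) :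
    norm e o k t = ∑ i ∈ Finset.range k, (rot e o ^ i) t := by
  rw [norm, LinearMap.sum_apply]

/-- The two cyclic sums of the theorem, in B and in P, thereby become the norm of a cyclic group
action, and its invariance under rotation can be used. -/
theorem rotations_eq_norm (h : IsParity e o) {k : ℕ} {t : TensorAlgebra R V}
    (ht : t ∈ hwords e o k) : rotations e o t = uncons (norm e o k t) := by
  refine hwords_ext (g := uncons ∘ₗ norm e o k) (fun m t ht => ?_) ht
  have h1 : wordSign e o (1 : TensorAlgebra R V) = (-1 : R) ^ 0 • 1 := by simp
  rw [rotations_eq, rotateInto_eq_sum h ht h1, mul_one, LinearMap.comp_apply, norm_apply, map_sum]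

theorem norm_rot {k : ℕ} {t : TensorAlgebra R V} (ht : t ∈ hwords e o k) :
    norm e o k (rot e o t) = norm e o k t := by
  have h1 := Finset.sum_range_succ (fun i => (rot e o ^ i) t) k
  have h2 := Finset.sum_range_succ' (fun i => (rot e o ^ i) t) k
  rw [h1, rot_pow_length ht, pow_zero, Module.End.one_apply] at h2
  rw [norm_apply, norm_apply, add_right_cancel h2]
  exact Finset.sum_congr rfl fun i _ => by rw [pow_succ, Module.End.mul_apply]

theorem norm_rot_pow {k : ℕ} {t : TensorAlgebra R V} (ht : t ∈ hwords e o k) (i : ℕ) :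
    norm e o k ((rot e o ^ i) t) = norm e o k t := by
  induction i with
  | zero => rfl
  | succ i ih => rw [pow_succ', Module.End.mul_apply, norm_rot (rot_pow_mem ht i), ih]

theorem rot_pow_norm {k : ℕ} {t : TensorAlgebra R V} (ht : t ∈ hwords e o k) (i : ℕ) :
    (rot e o ^ i) (norm e o k t) = norm e o k t := by
  have : (rot e o ^ i) (norm e o k t) = norm e o k ((rot e o ^ i) t) := by
    rw [norm_apply, norm_apply, map_sum]
    refine Finset.sum_congr rfl fun j _ => ?_
    rw [← Module.End.mul_apply, ← Module.End.mul_apply, ← pow_add, ← pow_add, add_comm]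
  rw [this, norm_rot_pow ht]

/-! Sums over all the places in a word of an operator that modifies the first letters. -/

variable (e o) in
/-- The sum `∑ (-1) ^ |u| u X(s)` over all ways of writing a word as `u s` with `s` non-empty. -/
def spread (X : TensorAlgebra R V →ₗ[R] TensorAlgebra R V) :
    TensorAlgebra R V →ₗ[R] TensorAlgebra R V :=
  LinearMap.mul' R _ ∘ₗ TensorProduct.map (wordSign e o).toLinearMap
    (X ∘ₗ consMap LinearMap.id) ∘ₗ pick

theorem spread_one (X : TensorAlgebra R V →ₗ[R] TensorAlgebra R V) : spread e o X 1 = 0 := by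
  simp [spread]

theorem spread_cons (X : TensorAlgebra R V →ₗ[R] TensorAlgebra R V) (c : V)
    (t : TensorAlgebra R V) : spread e o X (TensorAlgebra.ι R c * t) =
      X (TensorAlgebra.ι R c * t) + TensorAlgebra.ι R (e c - o c) * spread e o X t := by
  simp only [spread, LinearMap.comp_apply, pick_cons, map_add, TensorProduct.map_tmul,
    LinearMap.mul'_apply, AlgHom.toLinearMap_apply, map_one, one_mul, consMap_tmul,
    LinearMap.id_apply]
  refine congrArg₂ (· + ·) rfl ?_
  induction pick t with
  | zero => simp
  | add a b ha hb => simp only [map_add, ha, hb, mul_add]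
  | tmul a b => simp [mul_assoc]

variable (e o) in
/-- An odd operator that modifies the first `r` letters of a word and lowers its length by
`r - 1`. -/
structure IsLocal (r : ℕ) (X : TensorAlgebra R V →ₗ[R] TensorAlgebra R V) : Prop where
  pos : 1 ≤ r
  zero : ∀ k m t, IsHWord e o k m t → k < r → X t = 0
  word : ∀ k m t, IsHWord e o k m t → r ≤ k → IsHWord e o (k + 1 - r) (m + 1) (X t)
  mul : ∀ k m t, IsHWord e o k m t → r ≤ k → ∀ s, X (t * s) = X t * s

namespace IsLocal

variable {r : ℕ} {X : TensorAlgebra R V →ₗ[R] TensorAlgebra R V} (hX : IsLocal e o r X)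
include hX

theorem mem {k : ℕ} {t : TensorAlgebra R V} (ht : t ∈ hwords e o k) :
    X t ∈ hwords e o (k + 1 - r) := by
  refine hwords_map _ (fun m t ht => ?_) ht
  by_cases h : r ≤ k
  · exact (hX.word k m t ht h).mem
  · rw [hX.zero k m t ht (by omega)]
    exact zero_mem _

/-- The induction runs over v, while u collects the letters already passed. The summand j turns the
position in question to the front, applies X, and then turns the rest of the shortened word past the
end, so that u is at the front again. -/
theorem mul_spread {k l m n : ℕ} {u v : TensorAlgebra R V} (hu : IsHWord e o k m u)
    (hv : IsHWord e o l n v) : (-1 : R) ^ m • (u * spread e o X v) =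
      ∑ j ∈ Finset.range (l + 1 - r), (-1 : R) ^ (m * n) •
        (rot e o ^ (l + 1 - r - j)) (X ((rot e o ^ j) (v * u))) := by
  have hr := hX.pos
  induction hv generalizing k m u with
  -- The assumption `1 ≤ r` makes the sum over the positions of the empty word empty.
  | nil => simp [spread_one, show 0 + 1 - r = 0 by omega]
  | @cons l n n' c t hc ht ih =>
    have hct := IsHWord.cons hc ht
    have ih' := ih (hu.mul hc.isHWord)
    rw [spread_cons, hc.sub, map_smul, smul_mul_assoc, mul_add, mul_smul_comm, smul_add, smul_smul,
      ← pow_add, ← mul_assoc, ih']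
    by_cases h : r ≤ l + 1
    · rw [show l + 1 + 1 - r = (l + 1 - r) + 1 by omega, Finset.sum_range_succ']
      rw [add_comm]
      refine congrArg₂ (· + ·) (Finset.sum_congr rfl fun j hj => ?_) ?_
      · rw [Finset.mem_range] at hj
        have h2 : wordSign e o (t * u) = (-1 : R) ^ (n' + m) • (t * u) := (ht.mul hu).sign
        rw [pow_succ (rot e o) j, Module.End.mul_apply, mul_assoc _ t u, rot_cons_of hc h2,
          map_smul, map_smul, map_smul, smul_smul, ← pow_add, mul_assoc t u,
          show l + 1 - r + 1 - (j + 1) = l + 1 - r - j by omega]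
        refine congrArg (· • _) ?_
        have : m * (n + n') + n * (n' + m) = (m + n) * n' + 2 * (m * n) := by ring
        rw [this, pow_add, pow_mul _ 2, neg_one_sq, one_pow, mul_one]
      · have hw := hX.word _ _ _ hct h
        rw [pow_zero, Module.End.one_apply, hX.mul _ _ _ hct h, Nat.sub_zero,
          show l + 1 - r + 1 = l + 1 + 1 - r by omega, rot_pow_mul hw hu.sign, smul_smul,
          ← pow_add]
        refine congrArg (· • _) ?_
        have : m * (n + n') + (n + n' + 1) * m = m + 2 * ((n + n') * m) := by ring
        rw [this, pow_add, pow_mul _ 2, neg_one_sq, one_pow, mul_one]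
    · rw [hX.zero _ _ _ hct (by omega), mul_zero, smul_zero, zero_add,
        show l + 1 - r = 0 by omega, show l + 1 + 1 - r = 0 by omega]
      simp

/-- This is `mul_spread` with empty prefix. The positions with fewer than r letters up to the end of
the word do not occur; for r = 2 this leaves out exactly one cyclic position. -/
theorem spread_eq {k : ℕ} {t : TensorAlgebra R V} (ht : t ∈ hwords e o k) :
    spread e o X t = ∑ j ∈ Finset.range (k + 1 - r),
      (rot e o ^ (k + 1 - r - j)) (X ((rot e o ^ j) t)) := by
  have := hwords_ext (e := e) (o := o) (k := k) (f := spread e o X)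
    (X := TensorAlgebra R V)
    (g := ∑ j ∈ Finset.range (k + 1 - r), (rot e o ^ (k + 1 - r - j)) ∘ₗ X ∘ₗ (rot e o ^ j))
    (fun m t ht => ?_) ht
  · simpa only [LinearMap.sum_apply, LinearMap.comp_apply] using this
  · have := hX.mul_spread IsHWord.nil ht
    simpa using this

/-- On a rotation-invariant element the inner rotations of `spread_eq` disappear, and the outer ones
add up to a norm. -/
theorem spread_norm {k : ℕ} {t : TensorAlgebra R V} (ht : t ∈ hwords e o k) :
    spread e o X (norm e o k t) = norm e o (k + 1 - r) (X (norm e o k t)) := by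
  have hn : norm e o k t ∈ hwords e o k := by
    rw [norm_apply]
    exact Submodule.sum_mem _ fun i _ => rot_pow_mem ht i
  have h1 := hX.mem hn
  rw [hX.spread_eq hn]
  simp only [rot_pow_norm ht]
  -- The outer exponents run from 1 to k + 1 - r instead of from 0, which gives the norm of an
  -- element rotated once more. The norm does not notice this rotation.
  have h2 := Finset.sum_range_reflect (fun j => (rot e o ^ j) (rot e o (X (norm e o k t))))
    (k + 1 - r)
  rw [← norm_rot h1, norm_apply _ (rot e o _), ← h2]
  refine Finset.sum_congr rfl fun j hj => ?_
  rw [Finset.mem_range] at hj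
  rw [show k + 1 - r - j = k + 1 - r - 1 - j + 1 by omega, pow_succ, Module.End.mul_apply]

/-- Here it is the outer rotations of `spread_eq` that are absorbed by the norm. -/
theorem norm_spread {k : ℕ} {t : TensorAlgebra R V} (ht : t ∈ hwords e o k) :
    norm e o (k + 1 - r) (spread e o X t) =
      ∑ j ∈ Finset.range (k + 1 - r), norm e o (k + 1 - r) (X ((rot e o ^ j) t)) := by
  rw [hX.spread_eq ht, map_sum]
  exact Finset.sum_congr rfl fun j _ => norm_rot_pow (hX.mem (rot_pow_mem ht j)) _

end IsLocal

end Rotation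

namespace DGCat

variable {R : Type u} [CommRing R] {A : DGCat.{u, v, w} R}

/-! ### Connes' operator anticommutes with the Hochschild differential -/

/-- Letters are suspended, so the letters of even suspended degree are the morphisms of odd degree;
this is why `A.odd` takes the place of the even projection. -/
theorem isParity : IsParity A.odd A.even where
  add c := by rw [add_comm, even_add_odd]
  e_e c := by
    have h := even_add_odd (A.odd c)
    have h1 := even_sub_odd (A.odd c)
    have h2 := congrArg A.odd (even_add_odd c)
    have : A.odd ∘ₗ A.odd = A.odd := tot_ext fun x y n a => by
      rw [LinearMap.comp_apply, odd_of]
      split_ifs with h <;> simp [odd_of, h]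
    exact LinearMap.congr_fun this c
  o_o c := by
    have : A.even ∘ₗ A.even = A.even := tot_ext fun x y n a => by
      rw [LinearMap.comp_apply, even_of]
      split_ifs with h <;> simp [even_of, h]
    exact LinearMap.congr_fun this c
  e_o c := by
    have : A.odd ∘ₗ A.even = 0 := tot_ext fun x y n a => by
      rw [LinearMap.comp_apply, even_of]
      split_ifs with h <;> simp [odd_of, h]
    exact LinearMap.congr_fun this c
  o_e c := by
    have : A.even ∘ₗ A.odd = 0 := tot_ext fun x y n a => by
      rw [LinearMap.comp_apply, odd_of]
      split_ifs with h <;> simp [even_of, h]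
    exact LinearMap.congr_fun this c

theorem isHomog_of {x y : A.Obj} {n : ℕ} (a : A.Hom x y n) :
    IsHomog A.odd A.even (n + 1) (A.of x y n a) := by
  rw [IsHomog, even_of, odd_of]
  by_cases h : Even n <;> simp [h, Nat.even_add_one]

/-- Only the parity of a suspended degree matters. The differential and the multiplication of
suspended letters are both odd, and this is recorded as raising the degree by one, which avoids
subtraction. -/
theorem isHomog_dTot {m : ℕ} {b : A.Tot} (hb : IsHomog A.odd A.even m b) :
    IsHomog A.odd A.even (m + 1) (A.dTot b) := by
  rw [IsHomog, ← dTot_even, ← dTot_odd, hb.1, hb.2]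
  by_cases h : Even m <;> simp [h, Nat.even_add_one]

theorem isHomog_mul {m n : ℕ} {b c : A.Tot} (hb : IsHomog A.odd A.even m b)
    (hc : IsHomog A.odd A.even n c) : IsHomog A.odd A.even (m + n + 1) (A.mul b c) := by
  rw [IsHomog, odd_mul, even_mul, hb.1, hb.2, hc.1, hc.2]
  by_cases hm : Even m <;> by_cases hn : Even n <;> simp [hm, hn, Nat.even_add, Nat.even_add_one]

theorem isHomog_sgn {m : ℕ} {b : A.Tot} (hb : IsHomog A.odd A.even m b) :
    IsHomog A.odd A.even m (A.sgn b) := by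
  rw [IsHomog, odd_sgn, even_sgn, ← even_sub_odd, hb.1, hb.2]
  by_cases hm : Even m <;> simp [hm]

variable (A) in
/-- Composable words, with their length and their degree. -/
inductive IsPath : A.Obj → A.Obj → ℕ → ℕ → A.Words → Prop
  | nil (x : A.Obj) : IsPath x x 0 0 1
  | cons {x y z : A.Obj} {k m n : ℕ} {t : A.Words} (a : A.Hom x y m) (h : IsPath y z k n t) :
      IsPath x z (k + 1) (m + 1 + n) (TensorAlgebra.ι R (A.of x y m a) * t)

theorem IsWord.isPath {x y : A.Obj} {n : ℕ} {t : A.Words} (h : A.IsWord x y n t) :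
    ∃ k, A.IsPath x y k n t := by
  induction h with
  | nil x => exact ⟨0, IsPath.nil x⟩
  | cons a _ ih =>
    obtain ⟨k, hk⟩ := ih
    exact ⟨k + 1, IsPath.cons a hk⟩

theorem IsPath.isHWord {x y : A.Obj} {k n : ℕ} {t : A.Words} (h : A.IsPath x y k n t) :
    IsHWord A.odd A.even k n t := by
  induction h with
  | nil x => exact IsHWord.nil
  | cons a _ ih => exact IsHWord.cons (isHomog_of a) ih

theorem IsPath.snoc {x y z : A.Obj} {k m n : ℕ} {t : A.Words} (h : A.IsPath x y k n t)
    (a : A.Hom y z m) : A.IsPath x z (k + 1) (n + m + 1) (t * TensorAlgebra.ι R (A.of y z m a)) := by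
  induction h with
  | nil x =>
    have := IsPath.cons a (IsPath.nil z)
    rw [mul_one, add_zero] at this
    rw [one_mul, zero_add m]
    exact this
  | cons b _ ih =>
    rw [mul_assoc]
    have := IsPath.cons b (ih a)
    rw [← add_assoc, ← add_assoc] at this
    exact this

variable (A) in
/-- The operator `b w ↦ -(d b) w`. -/
def dFirst : A.Words →ₗ[R] A.Words := -(consMap A.dTot ∘ₗ uncons)

variable (A) in
/-- The operator `b c w ↦ (-1) ^ |b| (b c) w`. -/
def mulFirst : A.Words →ₗ[R] A.Words :=
  TensorProduct.lift (LinearMap.mk₂ R (fun b t => consMap (A.mul (A.sgn b)) (uncons t))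
    (fun b b' t => by rw [map_add, map_add, consMap_add, LinearMap.add_apply])
    (fun r b t => by rw [map_smul, map_smul, consMap_smul, LinearMap.smul_apply])
    (fun b t t' => by rw [map_add, map_add])
    (fun r b t => by rw [map_smul, map_smul])) ∘ₗ uncons

theorem dFirst_one : A.dFirst 1 = 0 := by simp [dFirst]

theorem dFirst_cons (b : A.Tot) (t : A.Words) :
    A.dFirst (TensorAlgebra.ι R b * t) = -(TensorAlgebra.ι R (A.dTot b) * t) := by
  simp [dFirst]

theorem mulFirst_one : A.mulFirst 1 = 0 := by simp [mulFirst]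

theorem mulFirst_cons (b : A.Tot) (t : A.Words) :
    A.mulFirst (TensorAlgebra.ι R b * t) = consMap (A.mul (A.sgn b)) (uncons t) := by
  simp [mulFirst]

theorem mulFirst_ι (b : A.Tot) : A.mulFirst (TensorAlgebra.ι R b) = 0 := by
  rw [← mul_one (TensorAlgebra.ι R b), mulFirst_cons, uncons_one, map_zero]

theorem mulFirst_cons_cons (b c : A.Tot) (t : A.Words) :
    A.mulFirst (TensorAlgebra.ι R b * (TensorAlgebra.ι R c * t)) =
      TensorAlgebra.ι R (A.mul (A.sgn b) c) * t := by
  rw [mulFirst_cons, uncons_cons, consMap_tmul]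

theorem isLocal_dFirst : IsLocal A.odd A.even 1 A.dFirst where
  pos := le_refl 1
  zero k m t ht hk := by
    cases ht with
    | nil => exact dFirst_one
    | cons => omega
  word k m t ht hk := by
    cases ht with
    | nil => omega
    | @cons k m n c t hc ht =>
      have := IsHWord.cons (isHomog_dTot (isHomog_sgn hc)) ht
      have h := IsHWord.cons hc ht
      rw [dFirst_cons]
      have h2 : IsHomog A.odd A.even (m + 1) (-A.dTot c) := by
        have := isHomog_dTot hc
        rw [IsHomog, map_neg, map_neg, this.1, this.2]
        split_ifs <;> simp
      have h3 := IsHWord.cons h2 ht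
      rw [map_neg, neg_mul, add_right_comm] at h3
      exact h3
  mul k m t ht hk s := by
    cases ht with
    | nil => omega
    | cons hc ht => rw [mul_assoc, dFirst_cons, dFirst_cons, neg_mul, mul_assoc]

theorem isLocal_mulFirst : IsLocal A.odd A.even 2 A.mulFirst where
  pos := by omega
  zero k m t ht hk := by
    cases ht with
    | nil => exact mulFirst_one
    | cons hc ht =>
      cases ht with
      | nil => rw [mul_one, mulFirst_ι]
      | cons => omega
  word k m t ht hk := by
    cases ht with
    | nil => omega
    | @cons k m n c t hc ht =>
      cases ht with
      | nil => omega
      | @cons k m' n c' t hc' ht =>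
        rw [mulFirst_cons_cons]
        have h := IsHWord.cons (isHomog_mul (isHomog_sgn hc) hc') ht
        rw [show m + m' + 1 + n = m + (m' + n) + 1 by omega] at h
        exact h
  mul k m t ht hk s := by
    cases ht with
    | nil => omega
    | cons hc ht =>
      cases ht with
      | nil => omega
      | cons hc' ht => rw [mul_assoc, mul_assoc, mulFirst_cons_cons, mulFirst_cons_cons, mul_assoc]

variable (A) in
/-- The differential of the bar construction. -/
def bar : A.Words →ₗ[R] A.Words := spread A.odd A.even A.dFirst + spread A.odd A.even A.mulFirst

theorem bar_one : A.bar 1 = 0 := by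
  rw [bar, LinearMap.add_apply, spread_one, spread_one, add_zero]

theorem bar_cons (b : A.Tot) (t : A.Words) : A.bar (TensorAlgebra.ι R b * t) =
    consMap (A.mul (A.sgn b)) (uncons t) - TensorAlgebra.ι R (A.dTot b) * t -
      TensorAlgebra.ι R (A.sgn b) * A.bar t := by
  rw [bar, LinearMap.add_apply, spread_cons, spread_cons, dFirst_cons, mulFirst_cons,
    LinearMap.add_apply, mul_add, ← neg_sub, even_sub_odd, map_neg, neg_mul, neg_mul]
  abel

variable (A) in
/-- The map sending `w a` to `(-1) ^ |w| w ⊗ a`. -/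
def splitLast : A.Words →ₗ[R] A.Monomials :=
  TensorProduct.map A.wsgn ((TensorProduct.rid R A.Tot).toLinearMap ∘ₗ
    TensorProduct.map LinearMap.id TensorAlgebra.algebraMapInv.toLinearMap) ∘ₗ pick

theorem splitLast_one : A.splitLast 1 = 0 := by simp [splitLast]

theorem splitLast_cons (b : A.Tot) (t : A.Words) : A.splitLast (TensorAlgebra.ι R b * t) =
    TensorAlgebra.algebraMapInv t • ((1 : A.Words) ⊗ₜ[R] b) - A.cons (A.sgn b) (A.splitLast t) := by
  rw [splitLast, LinearMap.comp_apply, LinearMap.comp_apply, pick_cons, map_add,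
    TensorProduct.map_tmul, wsgn_one, sub_eq_add_neg]
  refine congrArg₂ (· + ·) (by simp) ?_
  induction pick t with
  | zero => simp
  | add a b ha hb => simp only [map_add, ha, hb, neg_add]
  | tmul a b =>
    rw [TensorProduct.map_tmul, TensorProduct.map_tmul, TensorProduct.map_tmul, cons_tmul,
      LinearMap.mulLeft_apply, wsgn_cons, TensorProduct.neg_tmul, LinearMap.id_apply]

theorem splitLast_mul_ι (t : A.Words) (a : A.Tot) :
    A.splitLast (t * TensorAlgebra.ι R a) = A.wsgn t ⊗ₜ a := by
  have h0 : ∀ t : A.Words, (TensorAlgebra.algebraMapInv (t * TensorAlgebra.ι R a) : R) = 0 := by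
    intro t
    simp [TensorAlgebra.algebraMapInv]
  refine word_induction (p := fun t => A.splitLast (t * TensorAlgebra.ι R a) = A.wsgn t ⊗ₜ a)
    ?_ ?_ ?_ ?_ t
  · have := splitLast_cons a 1
    rw [mul_one, splitLast_one, map_zero, sub_zero, map_one, one_smul] at this
    rw [one_mul, this, wsgn_one]
  · intro s t hs ht
    rw [add_mul, map_add, hs, ht, map_add, TensorProduct.add_tmul]
  · intro r t ht
    rw [smul_mul_assoc, map_smul, ht, map_smul, TensorProduct.smul_tmul']
  · intro b t ht
    rw [mul_assoc, splitLast_cons, h0, ht, zero_smul, zero_sub, cons_tmul, wsgn_cons,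
      TensorProduct.neg_tmul]

theorem mergeFirst_tmul (b : A.Tot) (t : A.Words) (a : A.Tot) : A.mergeFirst b (t ⊗ₜ a) =
    consMap (A.mul (A.sgn b)) (uncons t) ⊗ₜ a +
      TensorAlgebra.algebraMapInv t • ((1 : A.Words) ⊗ₜ[R] A.mul b a) := by
  simp only [mergeFirst, LinearMap.add_apply, TensorProduct.map_tmul, LinearMap.comp_apply,
    LinearMap.id_apply, AlgHom.toLinearMap_apply, Algebra.linearMap_apply]
  rw [Algebra.algebraMap_eq_smul_one, TensorProduct.smul_tmul']

/-- The terms are sorted by where they act: within the bracket, on the coefficient, or on the last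
bracket entry and the coefficient together. -/
theorem barDiff_tmul (t : A.Words) (a : A.Tot) : A.barDiff (t ⊗ₜ a) =
    A.bar t ⊗ₜ a + A.wsgn t ⊗ₜ A.dTot a + A.rmul a (A.splitLast t) := by
  refine word_induction (p := fun t => A.barDiff (t ⊗ₜ a) =
    A.bar t ⊗ₜ a + A.wsgn t ⊗ₜ A.dTot a + A.rmul a (A.splitLast t)) ?_ ?_ ?_ ?_ t
  · rw [barDiff_nil, bar_one, splitLast_one, wsgn_one, TensorProduct.zero_tmul, map_zero, zero_add,
      add_zero]
  · intro s t hs ht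
    rw [TensorProduct.add_tmul, map_add, hs, ht]
    simp only [map_add, TensorProduct.add_tmul]
    abel
  · intro r t ht
    rw [← TensorProduct.smul_tmul', map_smul, ht]
    simp only [map_smul, smul_add, TensorProduct.smul_tmul']
  · intro b t ht
    rw [← cons_tmul, barDiff_cons, ht, bar_cons, splitLast_cons, mergeFirst_tmul, wsgn_cons,
      map_sub, map_smul, rmul_nil, rmul_cons, map_add, map_add, cons_tmul, cons_tmul, cons_tmul]
    simp only [TensorProduct.sub_tmul, TensorProduct.neg_tmul]
    abel

variable (A) in
/-- The map `[a₁ | ⋯ | aₚ] a ↦ (-1) ^ εₚ a₁ ⋯ aₚ a` from monomials to words. -/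
def suspend : A.Monomials →ₗ[R] A.Words :=
  LinearMap.mul' R A.Words ∘ₗ TensorProduct.map A.wsgn (TensorAlgebra.ι R)

theorem suspend_tmul (t : A.Words) (a : A.Tot) :
    A.suspend (t ⊗ₜ a) = A.wsgn t * TensorAlgebra.ι R a := rfl

theorem suspend_nil (a : A.Tot) : A.suspend ((1 : A.Words) ⊗ₜ[R] a) = TensorAlgebra.ι R a := by
  rw [suspend_tmul, wsgn_one, one_mul]

theorem suspend_cons (b : A.Tot) (z : A.Monomials) :
    A.suspend (A.cons b z) = -(TensorAlgebra.ι R (A.sgn b) * A.suspend z) := by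
  induction z using TensorProduct.induction_on with
  | zero => simp
  | add z z' h h' => simp only [map_add, h, h', mul_add, neg_add]
  | tmul t a => rw [cons_tmul, suspend_tmul, suspend_tmul, wsgn_cons, neg_mul, mul_assoc]

theorem suspend_mergeFirst (b : A.Tot) (z : A.Monomials) :
    A.suspend (A.mergeFirst b z) = consMap (A.mul b) (uncons (A.suspend z)) := by
  refine monomial_induction (p := fun z => A.suspend (A.mergeFirst b z) =
    consMap (A.mul b) (uncons (A.suspend z))) (by simp)
    (fun z z' h h' => by simp only [map_add, h, h']) (fun a => ?_) (fun c z _ => ?_) z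
  · rw [mergeFirst_nil, suspend_nil, suspend_nil, ← mul_one (TensorAlgebra.ι R a), uncons_cons,
      consMap_tmul, mul_one]
  · rw [mergeFirst_cons', suspend_cons, suspend_cons, map_neg, map_neg, uncons_cons, consMap_tmul,
      sgn_mul, sgn_sgn]

/-- Under `suspend` the coefficient becomes one more suspended letter, so its differential and its
product with the last entry are ordinary terms of the bar differential of the longer word. The minus
sign comes from the suspension of the coefficient. -/
theorem suspend_barDiff (z : A.Monomials) : A.suspend (A.barDiff z) = -A.bar (A.suspend z) := by
  refine monomial_induction (p := fun z => A.suspend (A.barDiff z) = -A.bar (A.suspend z)) (by simp)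
    (fun z z' h h' => by simp only [map_add, h, h', neg_add]) (fun a => ?_) (fun b z h => ?_) z
  · have := bar_cons a 1
    rw [mul_one, uncons_one, map_zero, bar_one, mul_one, mul_zero, sub_zero, zero_sub] at this
    rw [barDiff_nil, suspend_nil, suspend_nil, this, neg_neg]
  · rw [barDiff_cons, map_sub, map_sub, suspend_mergeFirst, suspend_cons, suspend_cons, h,
      suspend_cons, map_neg, bar_cons, sgn_sgn, sgn_dTot, map_neg]
    simp only [mul_neg, neg_mul, neg_neg]
    try abel

theorem connes_eq (z : A.Monomials) :
    A.connes z = A.cap (rotations A.odd A.even (A.suspend z)) := rfl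

variable (A) in
/-- Nonempty words that close up to a cycle. -/
def IsCycle (k : ℕ) (t : A.Words) : Prop :=
  ∃ (x y : A.Obj) (m n : ℕ) (a : A.Hom x y m) (s : A.Words), A.IsPath y x k n s ∧
    t = TensorAlgebra.ι R (A.of x y m a) * s

/-- The scalar is the Koszul sign of the rotation. Cyclic composability is what survives rotation,
whereas the base point changes. -/
theorem IsCycle.rot {k : ℕ} {t : A.Words} (ht : A.IsCycle k t) :
    ∃ (r : R) (t' : A.Words), rot A.odd A.even t = r • t' ∧ A.IsCycle k t' := by
  obtain ⟨x, y, m, n, a, s, hs, rfl⟩ := ht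
  refine ⟨_, _, rot_cons_of (isHomog_of a) hs.isHWord.sign, ?_⟩
  cases hs with
  | nil => exact ⟨_, _, _, _, a, _, IsPath.nil _, by rw [one_mul, mul_one]⟩
  | cons b h => exact ⟨_, _, _, _, b, _, h.snoc a, by rw [mul_assoc]⟩

theorem IsCycle.rot_pow {k : ℕ} {t : A.Words} (ht : A.IsCycle k t) (i : ℕ) :
    ∃ (r : R) (t' : A.Words), (CobarHoch.rot A.odd A.even ^ i) t = r • t' ∧ A.IsCycle k t' := by
  induction i with
  | zero => exact ⟨1, t, (one_smul R t).symm, ht⟩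
  | succ i ih =>
    obtain ⟨r, t', h, ht'⟩ := ih
    obtain ⟨r', t'', h', ht''⟩ := ht'.rot
    refine ⟨r * r', t'', ?_, ht''⟩
    rw [pow_succ', Module.End.mul_apply, h, map_smul, h', smul_smul]

theorem IsCycle.isHWord {k : ℕ} {t : A.Words} (ht : A.IsCycle k t) :
    ∃ m, IsHWord A.odd A.even (k + 1) m t := by
  obtain ⟨x, y, m, n, a, s, hs, rfl⟩ := ht
  exact ⟨_, IsHWord.cons (isHomog_of a) hs.isHWord⟩

theorem rmul_one_splitLast {x y : A.Obj} {k n : ℕ} {t : A.Words} (ht : A.IsPath x y k n t) :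
    A.rmul (A.of y y 0 (A.one y)) (A.splitLast t) = A.splitLast t := by
  induction ht with
  | nil x => rw [splitLast_one, map_zero]
  | cons a ht ih =>
    rw [splitLast_cons, map_sub, map_smul, rmul_cons, ih, rmul_nil]
    cases ht with
    | nil => rw [A.comp_one]
    | cons => simp [TensorAlgebra.algebraMapInv]

theorem cap_uncons {x y : A.Obj} {m : ℕ} (a : A.Hom x y m) (t : A.Words) :
    A.cap (uncons (TensorAlgebra.ι R (A.of x y m a) * t)) =
      (TensorAlgebra.ι R (A.of x y m a) * t) ⊗ₜ A.of x x 0 (A.one x) := by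
  rw [uncons_cons, cap_tmul]

/-- All terms of the bar differential still start at the source of the first letter, so the same
identity is inserted in each of them. -/
theorem cap_uncons_bar {x y z : A.Obj} {k m n : ℕ} (a : A.Hom x y m) {t : A.Words}
    (ht : A.IsPath y z k n t) :
    A.cap (uncons (A.bar (TensorAlgebra.ι R (A.of x y m a) * t))) =
      A.bar (TensorAlgebra.ι R (A.of x y m a) * t) ⊗ₜ A.of x x 0 (A.one x) := by
  have h : ∀ s : A.Words, ∀ b : A.Tot, (∃ p l, ∃ c : A.Hom x p l, b = A.of x p l c) →
      A.cap (uncons (TensorAlgebra.ι R b * s)) =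
        (TensorAlgebra.ι R b * s) ⊗ₜ A.of x x 0 (A.one x) := by
    rintro s _ ⟨p, l, c, rfl⟩
    exact cap_uncons c s
  rw [bar_cons, map_sub, map_sub, map_sub, map_sub, TensorProduct.sub_tmul, TensorProduct.sub_tmul]
  refine congrArg₂ (· - ·) (congrArg₂ (· - ·) ?_ (h _ _ ?_)) (h _ _ ?_)
  · cases ht with
    | nil => simp
    | cons b ht =>
      rw [uncons_cons, consMap_tmul]
      refine h _ _ ?_
      rw [PreDGCat.sgn_of, map_smul, LinearMap.smul_apply, PreDGCat.mul_of_of, ← map_smul]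
      exact ⟨_, _, _, rfl⟩
  · cases m with
    | zero => exact ⟨y, 0, 0, by rw [PreDGCat.dTot_of_zero, map_zero]⟩
    | succ m => exact ⟨_, _, _, PreDGCat.dTot_of_succ (A := A.toPreDGCat) a⟩
  · rw [PreDGCat.sgn_of, ← map_smul]
    exact ⟨_, _, _, rfl⟩

/-- When the coefficient is an identity, the terms beyond the bar differential are the product of
the last entry with it and the product of it with the first entry. They remove the identity, and
what is left is the cyclic word cut open at two consecutive places. -/
theorem hochDiff_cap {k : ℕ} {t : A.Words} (ht : A.IsCycle k t) :
    A.hochDiff (A.cap (uncons t)) = A.cap (uncons (A.bar t)) +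
      (A.splitLast t - A.splitLast (rot A.odd A.even t)) := by
  obtain ⟨x, y, m, n, a, s, hs, rfl⟩ := ht
  have h1 : A.even (A.of x x 0 (A.one x)) = A.of x x 0 (A.one x) := by
    rw [even_of, if_pos Even.zero]
  -- The identity is a unit only for morphisms starting at x. Since the first letter is homogeneous,
  -- its even and odd parts are again morphisms out of x or zero.
  have h2 : A.mul (A.of x x 0 (A.one x)) (A.even (A.of x y m a)) = A.even (A.of x y m a) ∧
      A.mul (A.of x x 0 (A.one x)) (A.odd (A.of x y m a)) = A.odd (A.of x y m a) := by
    rw [even_of, odd_of]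
    split_ifs <;> simp [A.one_comp]
  rw [cap_uncons_bar a hs, cap_uncons, hochDiff, LinearMap.add_apply, barDiff_tmul,
    PreDGCat.dTot_of_zero, TensorProduct.tmul_zero, add_zero,
    rmul_one_splitLast (IsPath.cons a hs), wrap_cons, PreDGCat.sgn_of, pow_zero, one_smul,
    h2.1, h2.2, rot_cons, map_add, splitLast_mul_ι, splitLast_mul_ι]
  have h3 : A.wsgn (wordSign A.odd A.even s) = s := wsgn_wsgn s
  rw [h3]
  abel

/-- Over a full turn the differences of cut-open words telescope, and `rot_pow_length` closes the
sum. -/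
theorem hochDiff_cap_rotations {k : ℕ} {t : A.Words} (ht : A.IsCycle k t) :
    A.hochDiff (A.cap (uncons (norm A.odd A.even (k + 1) t))) =
      A.cap (uncons (A.bar (norm A.odd A.even (k + 1) t))) := by
  have h : ∀ i, A.hochDiff (A.cap (uncons ((rot A.odd A.even ^ i) t))) =
      A.cap (uncons (A.bar ((rot A.odd A.even ^ i) t))) +
        (A.splitLast ((rot A.odd A.even ^ i) t) -
          A.splitLast ((rot A.odd A.even ^ (i + 1)) t)) := by
    intro i
    obtain ⟨r, t', h, ht'⟩ := ht.rot_pow i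
    rw [pow_succ', Module.End.mul_apply, h]
    simp only [map_smul, hochDiff_cap ht', smul_add, smul_sub]
  obtain ⟨m, hm⟩ := ht.isHWord
  rw [norm_apply]
  simp only [map_sum, h, Finset.sum_add_distrib]
  rw [Finset.sum_range_sub', rot_pow_length hm.mem, pow_zero, Module.End.one_apply, sub_self,
    add_zero]

/-- In the cyclic term the coefficient is multiplied with the first entry. Rotating the k bracket
entries away puts the coefficient in front of that entry; the product is formed there and is rotated
to the last place, where the new coefficient belongs. This is the position j = k that the spread of
the multiplication leaves out. -/
theorem suspend_wrap {x y : A.Obj} {k n m : ℕ} {t : A.Words} (ht : A.IsPath x y k n t)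
    (a : A.Hom y x m) : A.suspend (A.wrap (t ⊗ₜ A.of y x m a)) =
      -rot A.odd A.even (A.mulFirst ((rot A.odd A.even ^ k) (A.suspend (t ⊗ₜ A.of y x m a)))) := by
  have ha : IsHWord A.odd A.even 1 (m + 1) (TensorAlgebra.ι R (A.of y x m a)) :=
    (isHomog_of a).isHWord
  have hs : A.wsgn t = (-1 : R) ^ n • t := ht.isHWord.sign
  rw [suspend_tmul, hs, smul_mul_assoc, map_smul, rot_pow_mul ht.isHWord ha.sign]
  cases ht with
  | nil =>
    rw [wrap_nil, map_zero, mul_one, map_smul, map_smul, map_smul, mulFirst_ι]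
    simp
  | @cons x p y k l n t b ht =>
    have h2 := isHomog_mul (isHomog_sgn (isHomog_of a)) (isHomog_of b)
    have hs : A.wsgn t = (-1 : R) ^ n • t := ht.isHWord.sign
    rw [← cons_tmul, wrap_cons', map_smul, map_smul, map_smul, mulFirst_cons_cons, map_smul,
      rot_cons_of h2 ht.isHWord.sign, msgn_tmul, rmul_tmul, rmul_tmul, map_neg, map_add,
      suspend_tmul, suspend_tmul, wsgn_wsgn, hs, PreDGCat.sgn_of, even_of, odd_of]
    rcases Nat.even_or_odd l with hl | hl
    · rw [if_pos hl, if_pos hl]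
      simp only [map_zero, mul_zero, add_zero, map_smul, LinearMap.smul_apply, smul_smul,
        smul_mul_assoc, mul_smul_comm]
      refine congrArg (fun r : R => -(r • _)) ?_
      rcases Nat.even_or_odd m with hm | hm <;> rcases Nat.even_or_odd n with hn | hn <;>
        simp [pow_add, pow_mul, hl.neg_one_pow, hm.neg_one_pow, hn.neg_one_pow]
    · rw [if_neg (Nat.not_even_iff_odd.2 hl), if_neg (Nat.not_even_iff_odd.2 hl)]
      simp only [map_zero, mul_zero, zero_add, map_smul, LinearMap.smul_apply, smul_smul,
        mul_smul_comm]
      refine congrArg (fun r : R => -(r • _)) ?_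
      rcases Nat.even_or_odd m with hm | hm <;> rcases Nat.even_or_odd n with hn | hn <;>
        simp [pow_add, pow_mul, hl.neg_one_pow, hm.neg_one_pow, hn.neg_one_pow]

/-- Both composites are norms of the sum of all rotated differentials and products, with opposite
signs. For Bδ the products at the positions j < k come from the bar differential and the one at j =
k comes from the cyclic term. The identity holds on unnormalized chains. -/
theorem hochDiff_connes {x y : A.Obj} {i j : ℕ} {t : A.Words} (ht : A.IsWord x y i t)
    (a : A.Hom y x j) : A.hochDiff (A.connes (t ⊗ₜ A.of y x j a)) +
      A.connes (A.hochDiff (t ⊗ₜ A.of y x j a)) = 0 := by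
  obtain ⟨k, hk⟩ := ht.isPath
  have hcyc : A.IsCycle k (t * TensorAlgebra.ι R (A.of y x j a)) := by
    cases hk with
    | nil => exact ⟨_, _, _, _, a, 1, IsPath.nil _, by rw [one_mul, mul_one]⟩
    | cons b h => exact ⟨_, _, _, _, b, _, h.snoc a, by rw [mul_assoc]⟩
  have hJ : A.suspend (t ⊗ₜ A.of y x j a) = (-1 : R) ^ i • (t * TensorAlgebra.ι R (A.of y x j a)) := by
    rw [suspend_tmul, ht.wsgn, smul_mul_assoc]
  set J := A.suspend (t ⊗ₜ A.of y x j a) with hJdef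
  obtain ⟨m, hm⟩ := hcyc.isHWord
  have hJm : J ∈ hwords A.odd A.even (k + 1) := hJ ▸ Submodule.smul_mem _ _ hm.mem
  have h1 : A.hochDiff (A.cap (uncons (norm A.odd A.even (k + 1) J))) =
      A.cap (uncons (A.bar (norm A.odd A.even (k + 1) J))) := by
    rw [hJ]
    simp only [map_smul, hochDiff_cap_rotations hcyc]
  have hd := isLocal_dFirst (A := A)
  have hm2 := isLocal_mulFirst (A := A)
  have hd1 := hd.spread_norm hJm
  have hm1 := hm2.spread_norm hJm
  have hd3 := hd.norm_spread hJm
  have hm3 := hm2.norm_spread hJm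
  -- The differential keeps the k + 1 cyclic letters and the multiplication leaves k of them, so the
  -- two norms have different lengths.
  rw [Nat.add_sub_cancel] at hd1 hd3
  rw [show k + 1 + 1 - 2 = k by omega] at hm1 hm3
  have hdm : spread A.odd A.even A.dFirst J ∈ hwords A.odd A.even (k + 1) := by
    rw [hd.spread_eq hJm]
    exact Submodule.sum_mem _ fun j _ => rot_pow_mem (hd.mem (rot_pow_mem hJm j)) _
  have hmm : spread A.odd A.even A.mulFirst J ∈ hwords A.odd A.even k := by
    rw [hm2.spread_eq hJm]
    refine Submodule.sum_mem _ fun j _ => ?_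
    have := rot_pow_mem (hm2.mem (rot_pow_mem hJm j)) (k + 1 + 1 - 2 - j)
    rwa [show k + 1 + 1 - 2 = k by omega] at this ⊢
  have hwm : A.mulFirst ((rot A.odd A.even ^ k) J) ∈ hwords A.odd A.even k := by
    have := hm2.mem (rot_pow_mem hJm k)
    rwa [show k + 1 + 1 - 2 = k by omega] at this
  have hJd : A.suspend (A.hochDiff (t ⊗ₜ A.of y x j a)) =
      -(spread A.odd A.even A.dFirst J + spread A.odd A.even A.mulFirst J) -
        rot A.odd A.even (A.mulFirst ((rot A.odd A.even ^ k) J)) := by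
    rw [hochDiff, LinearMap.add_apply, map_add, suspend_barDiff, suspend_wrap hk, sub_eq_add_neg]
    rfl
  rw [connes_eq, connes_eq, hJd, ← hJdef, map_sub, map_neg, map_add,
    rotations_eq_norm isParity hJm, h1, rotations_eq_norm isParity hdm,
    rotations_eq_norm isParity hmm, rotations_eq_norm isParity (rot_mem hwm), norm_rot hwm, hd3,
    hm3, ← map_add A.cap, ← map_add uncons, ← map_neg uncons, ← map_sub uncons, ← map_add uncons]
  suffices h : A.bar (norm A.odd A.even (k + 1) J) + (-(∑ j ∈ Finset.range (k + 1),
      norm A.odd A.even (k + 1) (A.dFirst ((rot A.odd A.even ^ j) J)) +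
      ∑ j ∈ Finset.range k, norm A.odd A.even k (A.mulFirst ((rot A.odd A.even ^ j) J))) -
      norm A.odd A.even k (A.mulFirst ((rot A.odd A.even ^ k) J))) = 0 by
    rw [h, map_zero, map_zero]
  -- Expanding the inner norm gives k + 1 summands for the multiplication; the last of them is the
  -- one contributed by `suspend_wrap`.
  rw [bar, LinearMap.add_apply, hd1, hm1, norm_apply (k + 1) J, map_sum, map_sum, map_sum, map_sum,
    Finset.sum_range_succ (fun j => norm A.odd A.even k (A.mulFirst ((rot A.odd A.even ^ j) J)))]
  abel

end DGCat

/-! ### Classes in a subquotient -/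

section Subquotients

variable {R : Type u} [CommRing R] {X : Type v} [AddCommGroup X] [Module R X] {P Q : Submodule R X}

/-- The class of an element of the larger submodule in a subquotient. -/
def Subquotient.mk (P Q : Submodule R X) : ↥P →ₗ[R] Subquotient P Q :=
  Submodule.mkQ (Q.submoduleOf P)

theorem Subquotient.mk_surjective : Function.Surjective (Subquotient.mk P Q) :=
  Submodule.mkQ_surjective _

theorem Subquotient.mk_eq_zero {z : ↥P} : Subquotient.mk P Q z = 0 ↔ z.1 ∈ Q :=
  Submodule.Quotient.mk_eq_zero _

theorem Subquotient.hom_ext {Y : Type*} [AddCommGroup Y] [Module R Y]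
    {f g : Subquotient P Q →ₗ[R] Y} (h : ∀ z, f (Subquotient.mk P Q z) = g (Subquotient.mk P Q z)) :
    f = g := by
  refine LinearMap.ext fun z => ?_
  obtain ⟨z, rfl⟩ := Subquotient.mk_surjective z
  exact h z

end Subquotients

namespace DGCat

variable {R : Type u} [CommRing R] {A : DGCat.{u, v, w} R}

/-! ### The Hochschild complex is a mixed complex -/

theorem chains_induction {n : ℕ} {p : A.Monomials → Prop} (zero : p 0)
    (add : ∀ a b, p a → p b → p (a + b)) (smul : ∀ (r : R) a, p a → p (r • a))
    (monomial : ∀ x y i j, i + j = n → ∀ t, A.IsWord x y i t → ∀ a : A.Hom y x j,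
      p (t ⊗ₜ A.of y x j a)) {z : A.Monomials} (hz : z ∈ A.chains n) : p z := by
  induction hz using Submodule.span_induction with
  | mem z hz =>
    obtain ⟨x, y, i, j, hij, t, ht, a, rfl⟩ := hz
    exact monomial x y i j hij t ht a
  | zero => exact zero
  | add a b _ _ ha hb => exact add a b ha hb
  | smul r a _ ha => exact smul r a ha

theorem hochDiff_add_connes {n : ℕ} {z : A.Monomials} (hz : z ∈ A.chains n) :
    A.hochDiff (A.connes z) + A.connes (A.hochDiff z) = 0 := by
  refine chains_induction (p := fun z => A.hochDiff (A.connes z) + A.connes (A.hochDiff z) = 0)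
    (by simp) (fun a b ha hb => ?_) (fun r a ha => ?_) (fun x y i j _ t ht a => ?_) hz
  · simp only [map_add]
    rw [add_add_add_comm, ha, hb, add_zero]
  · simp only [map_smul, ← smul_add, ha, smul_zero]
  · exact hochDiff_connes ht a

theorem hochDiff_zero {z : A.Monomials} (hz : z ∈ A.chains 0) : A.hochDiff z = 0 := by
  refine chains_induction (p := fun z => A.hochDiff z = 0)
    (by simp) (fun a b ha hb => ?_) (fun r a ha => ?_) (fun x y i j hij t ht a => ?_) hz
  · rw [map_add, ha, hb, add_zero]
  · rw [map_smul, ha, smul_zero]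
  · obtain ⟨rfl, rfl⟩ : i = 0 ∧ j = 0 := by omega
    obtain ⟨i, hi⟩ : ∃ i, i = 0 := ⟨0, rfl⟩
    rw [← hi] at ht
    cases ht with
    | nil => rw [hochDiff, LinearMap.add_apply, barDiff_nil, wrap_nil, PreDGCat.dTot_of_zero,
        TensorProduct.tmul_zero, add_zero]
    | cons => omega

/-- Connes' operator moves every entry, including the coefficient, into the bracket, so an identity
coefficient becomes an identity bracket entry. -/
theorem connes_cap_mem {x : A.Obj} {n : ℕ} {t : A.Words} (ht : A.IsWord x x n t) :
    A.connes (t ⊗ₜ A.of x x 0 (A.one x)) ∈ A.degenerate (n + 1) := by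
  rw [connes_monomial ht]
  refine Submodule.smul_mem _ _ ?_
  have ha : A.IsDegWord x x (0 + 1 + 0) (TensorAlgebra.ι R (A.of x x 0 (A.one x))) := by
    simpa using IsDegWord.head (IsWord.nil x)
  refine Submodule.span_induction (p := fun z _ => A.cap (moveToEnd A.odd A.even z) ∈ _)
    ?_ (by simp) ?_ ?_ (pick_degWord (IsDegWord.mul_left ht ha))
  · rintro _ ⟨p, q, i', m', k, hi, u, hu, c, s, hs, hd, rfl⟩
    obtain ⟨r, hr⟩ := moveToEnd_word hu c hs
    rw [hr, map_smul, cap_tmul]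
    refine Submodule.smul_mem _ _ ?_
    rw [← mul_assoc]
    rcases hd with hd | hd
    · exact mem_degenerate (by omega) (IsDegWord.mul_left (IsWord.cons c hs) hd) _
    · exact mem_degenerate (by omega) (hd.mul_right hu) _
  · intro z z' _ _ h h'
    rw [map_add, map_add]
    exact add_mem h h'
  · intro r z _ h
    rw [map_smul, map_smul]
    exact Submodule.smul_mem _ _ h

/-- All monomials in the image of Connes' operator have an identity as coefficient. -/
theorem connes_connes_mem {n : ℕ} {z : A.Monomials} (hz : z ∈ A.chains n) :
    A.connes (A.connes z) ∈ A.degenerate (n + 1 + 1) := by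
  refine chains_induction (p := fun z => A.connes (A.connes z) ∈ A.degenerate (n + 1 + 1))
    (by simp) (fun a b ha hb => ?_) (fun r a ha => ?_) (fun x y i j hij t ht a => ?_) hz
  · rw [map_add, map_add]
    exact add_mem ha hb
  · rw [map_smul, map_smul]
    exact Submodule.smul_mem _ _ ha
  · have ha : A.IsWord y x (j + 1 + 0) (TensorAlgebra.ι R (A.of y x j a)) := by
      simpa using IsWord.cons a (IsWord.nil x)
    rw [connes_monomial ht, map_smul]
    refine Submodule.smul_mem _ _ ?_
    refine Submodule.span_induction
      (p := fun z _ => A.connes (A.cap (moveToEnd A.odd A.even z)) ∈ _)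
      ?_ (by simp) ?_ ?_ (pick_word (ht.mul ha))
    · rintro _ ⟨p, q, i', m', k, hi, u, hu, c, s, hs, rfl⟩
      obtain ⟨r, hr⟩ := moveToEnd_word hu c hs
      rw [hr, map_smul, cap_tmul, map_smul]
      refine Submodule.smul_mem _ _ ?_
      have := connes_cap_mem (IsWord.cons c (hs.mul hu))
      rwa [show m' + 1 + (k + i') + 1 = n + 1 + 1 by omega] at this
    · intro z z' _ _ h h'
      rw [map_add, map_add, map_add]
      exact add_mem h h'
    · intro r z _ h
      rw [map_smul, map_smul, map_smul]
      exact Submodule.smul_mem _ _ h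

variable (A) in
-- Only the vanishing of B² needs the normalization. In degree zero, bB = 0 because δ vanishes on
-- chains of degree zero.
theorem hoch_isMixedComplex : A.hoch.IsMixedComplex where
  b_b n := Subquotient.hom_ext fun z => by
    refine (Subquotient.mk_eq_zero (P := A.chains n)).2 ?_
    change A.hochDiff (A.hochDiff z.1) ∈ A.degenerate n
    rw [hochDiff_hochDiff]
    exact zero_mem _
  B_B n := Subquotient.hom_ext fun z => by
    exact (Subquotient.mk_eq_zero (P := A.chains (n + 1 + 1))).2 (connes_connes_mem z.2)
  b_B_zero := Subquotient.hom_ext fun z => by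
    refine (Subquotient.mk_eq_zero (P := A.chains 0)).2 ?_
    have h := hochDiff_add_connes z.2
    rw [hochDiff_zero z.2, map_zero, add_zero] at h
    change A.hochDiff (A.connes z.1) ∈ A.degenerate 0
    rw [h]
    exact zero_mem _
  b_B n := Subquotient.hom_ext fun z => by
    refine (Subquotient.mk_eq_zero (P := A.chains (n + 1)) (z := ⟨_, hochDiff_mem _ _
      (connes_mem _ _ z.2)⟩ + ⟨_, connes_mem _ _ (hochDiff_mem _ _ z.2)⟩)).2 ?_
    change A.hochDiff (A.connes z.1) + A.connes (A.hochDiff z.1) ∈ A.degenerate (n + 1)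
    rw [hochDiff_add_connes z.2]
    exact zero_mem _

/-! ### Functoriality of the Hochschild complex -/

namespace Functor

variable {A' : DGCat.{u, v, w} R} (F : Functor A A')

theorem tot_of {x y : A.Obj} {n : ℕ} (a : A.Hom x y n) :
    F.tot (A.of x y n a) = A'.of (F.obj x) (F.obj y) n (F.map x y n a) := by
  simp [tot]

theorem tot_dTot (a : A.Tot) : F.tot (A.dTot a) = A'.dTot (F.tot a) := by
  have : F.tot ∘ₗ A.dTot = A'.dTot ∘ₗ F.tot := tot_ext fun x y n a => by
    cases n with
    | zero => simp [tot_of]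
    | succ n => simp [tot_of, F.map_d]
  exact LinearMap.congr_fun this a

theorem tot_sgn (a : A.Tot) : F.tot (A.sgn a) = A'.sgn (F.tot a) := by
  have : F.tot ∘ₗ A.sgn = A'.sgn ∘ₗ F.tot := tot_ext fun x y n a => by simp [tot_of]
  exact LinearMap.congr_fun this a

theorem tot_even (a : A.Tot) : F.tot (A.even a) = A'.even (F.tot a) := by
  have : F.tot ∘ₗ A.even = A'.even ∘ₗ F.tot := tot_ext fun x y n a => by
    rw [LinearMap.comp_apply, LinearMap.comp_apply, tot_of, even_of, even_of]
    split_ifs <;> simp [tot_of]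
  exact LinearMap.congr_fun this a

theorem tot_odd (a : A.Tot) : F.tot (A.odd a) = A'.odd (F.tot a) := by
  have : F.tot ∘ₗ A.odd = A'.odd ∘ₗ F.tot := tot_ext fun x y n a => by
    rw [LinearMap.comp_apply, LinearMap.comp_apply, tot_of, odd_of, odd_of]
    split_ifs <;> simp [tot_of]
  exact LinearMap.congr_fun this a

/-- Composability cannot be dropped: a functor may identify objects, so a product that is zero in
`A` may have a nonzero counterpart in `A'`. For this reason compatibility with δ is proved on
composable words only. -/
theorem tot_mul {x y z : A.Obj} {m n : ℕ} (a : A.Hom x y m) (b : A.Hom y z n) :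
    F.tot (A.mul (A.of x y m a) (A.of y z n b)) =
      A'.mul (F.tot (A.of x y m a)) (F.tot (A.of y z n b)) := by
  simp [tot_of, F.map_comp]

/-- The map induced by a dg functor on words. -/
def words : A.Words →ₐ[R] A'.Words := TensorAlgebra.lift R (TensorAlgebra.ι R ∘ₗ F.tot)

theorem words_ι (a : A.Tot) : F.words (TensorAlgebra.ι R a) = TensorAlgebra.ι R (F.tot a) := by
  simp [words]

theorem monomials_tmul (t : A.Words) (a : A.Tot) :
    F.monomials (t ⊗ₜ a) = F.words t ⊗ₜ F.tot a := rfl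

theorem monomials_cons (b : A.Tot) (z : A.Monomials) :
    F.monomials (A.cons b z) = A'.cons (F.tot b) (F.monomials z) := by
  induction z using TensorProduct.induction_on with
  | zero => simp
  | add z z' h h' => simp only [map_add, h, h']
  | tmul t a => rw [cons_tmul, monomials_tmul, monomials_tmul, map_mul, words_ι, cons_tmul]

theorem words_wsgn (t : A.Words) : F.words (A.wsgn t) = A'.wsgn (F.words t) := by
  refine word_induction (p := fun t => F.words (A.wsgn t) = A'.wsgn (F.words t)) ?_ ?_ ?_ ?_ t
  · rw [wsgn_one, _root_.map_one, wsgn_one]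
  · intro a b ha hb
    simp only [map_add, ha, hb]
  · intro r a ha
    simp only [map_smul, ha]
  · intro c t ht
    rw [wsgn_cons, map_neg, map_mul, words_ι, ht, map_mul, words_ι, wsgn_cons, tot_sgn]

theorem monomials_barDiff {x y x' : A.Obj} {i j : ℕ} {t : A.Words} (ht : A.IsWord x y i t)
    (a : A.Hom y x' j) : F.monomials (A.barDiff (t ⊗ₜ A.of y x' j a)) =
      A'.barDiff (F.monomials (t ⊗ₜ A.of y x' j a)) := by
  induction ht with
  | nil x => rw [barDiff_nil, monomials_tmul, monomials_tmul, _root_.map_one, barDiff_nil, tot_dTot]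
  | @cons x p y m n t b ht ih =>
    rw [← cons_tmul, monomials_cons, barDiff_cons, barDiff_cons, map_sub, map_sub, monomials_cons,
      monomials_cons, ih a, tot_dTot, tot_sgn]
    refine congrArg₂ (· - ·) (congrArg₂ (· - ·) ?_ rfl) rfl
    cases ht with
    | nil =>
      rw [mergeFirst_nil, monomials_tmul, _root_.map_one, tot_mul, monomials_tmul, _root_.map_one,
        mergeFirst_nil]
    | cons c ht =>
      rw [mergeFirst_cons, monomials_tmul, monomials_tmul, map_mul, map_mul, words_ι, words_ι,
        mergeFirst_cons, PreDGCat.sgn_of, map_smul, LinearMap.smul_apply, map_smul, tot_mul,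
        ← tot_sgn, PreDGCat.sgn_of, map_smul F.tot, map_smul A'.mul, LinearMap.smul_apply]

/-- The bar part is an induction along the composable word. In the cyclic term the composability of
the coefficient with the first entry is used once more. -/
theorem monomials_hochDiff {x y : A.Obj} {i j : ℕ} {t : A.Words} (ht : A.IsWord x y i t)
    (a : A.Hom y x j) : F.monomials (A.hochDiff (t ⊗ₜ A.of y x j a)) =
      A'.hochDiff (F.monomials (t ⊗ₜ A.of y x j a)) := by
  rw [hochDiff, hochDiff, LinearMap.add_apply, LinearMap.add_apply, map_add, monomials_barDiff F ht]
  refine congrArg₂ (· + ·) rfl ?_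
  have hm : ∀ {p q r : A.Obj} {m n : ℕ} (a : A.Hom p q m) (b : A.Hom q r n),
      F.tot (A.mul (A.of p q m a) (A.even (A.of q r n b))) =
        A'.mul (F.tot (A.of p q m a)) (A'.even (F.tot (A.of q r n b))) ∧
      F.tot (A.mul (A.sgn (A.of p q m a)) (A.odd (A.of q r n b))) =
        A'.mul (A'.sgn (F.tot (A.of p q m a))) (A'.odd (F.tot (A.of q r n b))) := by
    intro p q r m n a b
    rw [← tot_even, ← tot_odd, ← tot_sgn, even_of, odd_of, PreDGCat.sgn_of]
    split_ifs <;> simp only [map_smul, LinearMap.smul_apply, tot_mul, map_zero, and_self]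
  cases ht with
  | nil => rw [wrap_nil, monomials_tmul, _root_.map_one, wrap_nil, map_zero]
  | cons b ht =>
    rw [wrap_cons, monomials_tmul, map_neg, map_add, monomials_tmul, monomials_tmul, map_mul,
      words_ι, wrap_cons, (hm a b).1, (hm a b).2, words_wsgn]

theorem words_parity (t : A.Words) : F.words (wordEven A.odd A.even t) =
      wordEven A'.odd A'.even (F.words t) ∧
    F.words (wordOdd A.odd A.even t) = wordOdd A'.odd A'.even (F.words t) := by
  refine word_induction (p := fun t => F.words (wordEven A.odd A.even t) =
      wordEven A'.odd A'.even (F.words t) ∧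
    F.words (wordOdd A.odd A.even t) = wordOdd A'.odd A'.even (F.words t)) (by simp) ?_ ?_ ?_ t
  · intro a b ha hb
    simp only [map_add, ha, hb, and_self]
  · intro r a ha
    simp only [map_smul, ha, and_self]
  · intro c t ht
    rw [wordEven_cons, wordOdd_cons, map_mul F.words (TensorAlgebra.ι R c), words_ι, wordEven_cons,
      wordOdd_cons]
    simp only [map_add, map_mul, words_ι, ht, tot_even, tot_odd, and_self]

theorem rotations_words (t : A.Words) : rotations A'.odd A'.even (F.words t) =
    TensorProduct.map F.tot F.words.toLinearMap (rotations A.odd A.even t) := by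
  rw [rotations, rotations, LinearMap.comp_apply, LinearMap.comp_apply,
    pick_algHom F.words F.tot fun c => by rw [words_ι, pick_ι]]
  induction pick t with
  | zero => simp
  | add a b ha hb => simp only [map_add, ha, hb]
  | tmul u z =>
    induction z with
    | zero => simp
    | add a b ha hb => simp only [map_add, TensorProduct.tmul_add, ha, hb]
    | tmul c s =>
      have hs : F.words (wordSign A.odd A.even s) = wordSign A'.odd A'.even (F.words s) :=
        F.words_wsgn s
      rw [TensorProduct.map_tmul, TensorProduct.map_tmul, moveToEnd_tmul, moveToEnd_tmul, map_add,
        TensorProduct.map_tmul, TensorProduct.map_tmul]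
      simp only [AlgHom.toLinearMap_apply, map_mul, map_sub, words_parity, tot_even,
        tot_odd, hs]

theorem monomials_cap (z : A.Tot ⊗[R] A.Words) : F.monomials (A.cap z) =
    A'.cap (TensorProduct.map F.tot F.words.toLinearMap z) := by
  induction z with
  | zero => simp
  | add a b ha hb => simp only [map_add, ha, hb]
  | tmul a t =>
    refine PreDGCat.tot_induction (p := fun a => F.monomials (A.cap (a ⊗ₜ t)) =
      A'.cap (TensorProduct.map F.tot F.words.toLinearMap (a ⊗ₜ t))) (by simp) ?_ ?_ a
    · intro a b ha hb
      simp only [TensorProduct.add_tmul, map_add, ha, hb]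
    · intro x y n a
      rw [cap_tmul, monomials_tmul, map_mul, words_ι, TensorProduct.map_tmul, tot_of, tot_of,
        cap_tmul, F.map_one]
      rfl

/-- Connes' operator composes no morphisms, so this holds on all monomials. -/
theorem monomials_connes (z : A.Monomials) :
    F.monomials (A.connes z) = A'.connes (F.monomials z) := by
  have h : F.words (A.suspend z) = A'.suspend (F.monomials z) := by
    induction z using TensorProduct.induction_on with
    | zero => simp
    | add a b ha hb => simp only [map_add, ha, hb]
    | tmul t a => rw [suspend_tmul, map_mul, words_ι, words_wsgn, monomials_tmul, suspend_tmul]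
  rw [connes_eq, connes_eq, monomials_cap, ← rotations_words, h]

theorem hochMap_isMorphism : PreMixedComplex.IsMorphism F.hochMap where
  comm_b n := Subquotient.hom_ext fun z => by
    refine congrArg (Subquotient.mk _ _) (Subtype.ext ?_)
    refine chains_induction
      (p := fun z => F.monomials (A.hochDiff z) = A'.hochDiff (F.monomials z))
      (by simp) (fun a b ha hb => ?_) (fun r a ha => ?_) (fun x y i j hij t ht a => ?_) z.2
    · simp only [map_add, ha, hb]
    · simp only [map_smul, ha]
    · exact F.monomials_hochDiff ht a
  comm_B n := Subquotient.hom_ext fun z =>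
    congrArg (Subquotient.mk _ _) (Subtype.ext (F.monomials_connes z.1))

end Functor

end DGCat
namespace CategoricalCoalgebra

variable {R : Type u} [CommRing R] {C : CategoricalCoalgebra.{u, v} R}

/-! ### The comparison map commutes with the differentials -/

/-- Letters are desuspended, so the elements of odd degree in the coalgebra are the letters of even
degree. -/
theorem isParity : IsParity (oddPart C.grading) (evenPart C.grading) := by
  have h : ∀ n c, c ∈ C.grading n → (oddPart C.grading c = c ∧ evenPart C.grading c = 0) ∨
      (oddPart C.grading c = 0 ∧ evenPart C.grading c = c) := fun n c hc => even_or_odd_of_mem hc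
  have key : ∀ f : C.carrier →ₗ[R] C.carrier, ∀ g : C.carrier →ₗ[R] C.carrier,
      (∀ n c, c ∈ C.grading n → f c = g c) → ∀ c, f c = g c := fun f g h c =>
    LinearMap.congr_fun (graded_hom_ext C.grading h) c
  refine ⟨key (oddPart C.grading + evenPart C.grading) LinearMap.id ?_,
    key (oddPart C.grading ∘ₗ oddPart C.grading) (oddPart C.grading) ?_,
    key (evenPart C.grading ∘ₗ evenPart C.grading) (evenPart C.grading) ?_,
    key (oddPart C.grading ∘ₗ evenPart C.grading) 0 ?_,
    key (evenPart C.grading ∘ₗ oddPart C.grading) 0 ?_⟩ <;>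
  · intro n c hc
    rcases h n c hc with ⟨h1, h2⟩ | ⟨h1, h2⟩ <;> simp [h1, h2]

theorem isHomog {k : ℕ} {c : C.carrier} (hc : c ∈ C.grading (k + 1)) :
    IsHomog (oddPart C.grading) (evenPart C.grading) k c := by
  rw [IsHomog, oddPart, evenPart, gradedScale_mem _ _ hc, gradedScale_mem _ _ hc]
  by_cases h : Even k <;>
    simp [h, Nat.even_add_one, ← Nat.not_even_iff_odd]

theorem IsCobarWord.isHWord {x y : C.Ob} {n : ℕ} {t : C.Words} (h : C.IsCobarWord x y n t) :
    ∃ k, IsHWord (oddPart C.grading) (evenPart C.grading) k n t := by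
  induction h with
  | nil => exact ⟨0, IsHWord.nil⟩
  | cons hc _ ih =>
    obtain ⟨k, hk⟩ := ih
    exact ⟨k + 1, IsHWord.cons (isHomog (C.mem_part.1 hc).1) hk⟩

variable (C) in
/-- The comparison map on monomials `[u] v`, for words `u` and `v` in `C`. -/
abbrev rotateInto (u v : C.Words) : C.CoMonomials :=
  CobarHoch.rotateInto (oddPart C.grading) (evenPart C.grading) u v

theorem rotateInto_zero_left (v : C.Words) : C.rotateInto 0 v = 0 := by
  have := rotateInto_smul_left (e := oddPart C.grading) (o := evenPart C.grading) (0 : R) 0 v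
  rwa [zero_smul, zero_smul] at this

theorem rotateInto_ι (c : C.carrier) (v : C.Words) :
    C.rotateInto (TensorAlgebra.ι R c) v = c ⊗ₜ v := by
  have := rotateInto_cons' (isParity (C := C)) c 1 v
  rw [mul_one, one_mul, rotateInto_one, map_one, rotateInto_one, add_zero, add_zero] at this
  exact this

/-- The general Leibniz rule is extended from words to linear combinations of words of one degree;
the exponents depend only on the degrees, not on the lengths. -/
theorem rotateInto_mul {x y : C.Ob} {m n p : ℕ} {u : C.Words} (hu : u ∈ C.cobarHom x y m)
    {w v : C.Words} (hw : C.wsgn w = (-1 : R) ^ n • w) (hv : C.wsgn v = (-1 : R) ^ p • v) :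
    C.rotateInto (u * w) v = C.rotateInto u (w * v) +
      (-1 : R) ^ (m * (n + p)) • C.rotateInto w (v * u) := by
  induction hu using Submodule.span_induction with
  | mem u hu =>
    obtain ⟨k, hk⟩ := IsCobarWord.isHWord hu
    exact CobarHoch.rotateInto_mul isParity hk hw hv
  | zero =>
    have := rotateInto_smul_right (e := oddPart C.grading) (o := evenPart C.grading) (0 : R) w 0
    rw [zero_smul, zero_smul] at this
    rw [zero_mul, mul_zero, rotateInto_zero_left, rotateInto_zero_left, rotateInto, this, smul_zero,
      add_zero]
  | add a b _ _ ha hb =>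
    rw [add_mul, mul_add v a b]
    simp only [rotateInto, rotateInto_add_left, rotateInto_add_right] at ha hb ⊢
    rw [ha, hb, smul_add]
    abel
  | smul r a _ ha =>
    rw [smul_mul_assoc, mul_smul_comm]
    simp only [rotateInto, rotateInto_smul_left, rotateInto_smul_right] at ha ⊢
    rw [ha, smul_add, smul_comm r]

/-- The degree n - 1 is written as n + 1, which has the same parity; for n = 0 the submodule is
zero. -/
theorem wsgn_cobarLower {x y : C.Ob} {n : ℕ} {t : C.Words} (ht : t ∈ C.cobarLower x y n) :
    C.wsgn t = (-1 : R) ^ (n + 1) • t := by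
  rcases n with _ | n
  · rw [cobarLower_zero, Submodule.mem_bot] at ht
    simp [ht]
  · rw [cobarLower_succ] at ht
    rw [wsgn_of_mem ht, add_assoc, pow_add, one_add_one_eq_two, neg_one_sq, mul_one]

theorem rotateInto_mul_lower {x y : C.Ob} {m n p : ℕ} {u : C.Words} (hu : u ∈ C.cobarLower x y m)
    {w v : C.Words} (hw : C.wsgn w = (-1 : R) ^ n • w) (hv : C.wsgn v = (-1 : R) ^ p • v) :
    C.rotateInto (u * w) v = C.rotateInto u (w * v) +
      (-1 : R) ^ ((m + 1) * (n + p)) • C.rotateInto w (v * u) := by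
  rcases m with _ | m
  · rw [cobarLower_zero, Submodule.mem_bot] at hu
    subst hu
    have := rotateInto_smul_right (e := oddPart C.grading) (o := evenPart C.grading) (0 : R) w 0
    rw [zero_smul, zero_smul] at this
    rw [zero_mul, mul_zero, rotateInto_zero_left, rotateInto_zero_left, rotateInto, this, smul_zero,
      add_zero]
  · rw [cobarLower_succ] at hu
    rw [rotateInto_mul hu hw hv]
    refine congrArg₂ (· + ·) rfl (congrArg (· • _) ?_)
    rw [add_assoc, add_mul, pow_add, pow_mul _ (1 + 1), one_add_one_eq_two, neg_one_sq, one_pow,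
      mul_one]

theorem coDiff_tmul (c : C.carrier) (t : C.Words) : C.coDiff (c ⊗ₜ t) =
    C.diff c ⊗ₜ t + C.sgn c ⊗ₜ C.cobarDiff t + C.splitRight (c ⊗ₜ t) + C.splitLeft (c ⊗ₜ t) := rfl

/-- Both splitting terms would put the set-like element x, which has degree zero, inside the braces.
-/
theorem coDiff_ob (x : C.Ob) (t : C.Words) : C.coDiff (x.1 ⊗ₜ t) = x.1 ⊗ₜ C.cobarDiff t := by
  have h1 : C.comul x.1 = x.1 ⊗ₜ x.1 := comul_ob x
  have h2 : C.bar x.1 = 0 := bar_of_mem_zero x.2.1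
  have h3 : oddPart C.grading x.1 = 0 ∧ evenPart C.grading x.1 = x.1 := by
    constructor <;> simp [oddPart, evenPart, gradedScale_mem _ _ x.2.1]
  have h4 : C.splitRight (x.1 ⊗ₜ t) = 0 := by
    rw [splitRight, LinearMap.comp_apply, LinearMap.comp_apply, TensorProduct.map_tmul,
      LinearMap.comp_apply, h1, TensorProduct.map_tmul, LinearMap.comp_apply, h2]
    simp
  have h5 : C.splitLeft (x.1 ⊗ₜ t) = 0 := by
    rw [splitLeft, LinearMap.neg_apply, LinearMap.comp_apply, LinearMap.comp_apply,
      TensorProduct.map_tmul, h1]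
    simp [appendLast_tmul, h2, h3]
  rw [coDiff_tmul, C.diff_zero _ x.2.1, sgn_of_mem x.2.1, h4, h5]
  simp

/-- This is the chain map identity on [{c}]b, with all terms on one side. It is the only place where
the coHochschild splitting terms are compared with the cobar differential. -/
theorem coDiff_letter {x y : C.Ob} {k j : ℕ} {c : C.carrier} (hc : c ∈ C.part x y (k + 1))
    {b : C.Words} (hb : b ∈ C.cobarHom y x j) :
    C.coDiff (c ⊗ₜ b) + C.rotateInto (C.cobarLetter c) b + (-1 : R) ^ k • (c ⊗ₜ C.cobarDiff b) -
      x.1 ⊗ₜ (TensorAlgebra.ι R c * b) + (-1 : R) ^ (k * j) • (y.1 ⊗ₜ (b * TensorAlgebra.ι R c)) = 0 := by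
  obtain ⟨hn, hl, hr⟩ := C.mem_part.1 hc
  -- The end points x and y are recovered from the coactions, so that the two end point terms become
  -- linear functions of the coproduct of c, as the other terms are.
  have hx : x.1 ⊗ₜ[R] (TensorAlgebra.ι R c * b) = TensorProduct.map LinearMap.id
      (LinearMap.mulRight R b ∘ₗ TensorAlgebra.ι R)
        (TensorProduct.map C.proj₀ LinearMap.id (C.comul c)) := by
    rw [hl]; rfl
  have hy : y.1 ⊗ₜ[R] (b * TensorAlgebra.ι R c) = TensorProduct.comm R _ _ (TensorProduct.map
      (LinearMap.mulLeft R b ∘ₗ TensorAlgebra.ι R) LinearMap.id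
        (TensorProduct.map LinearMap.id C.proj₀ (C.comul c))) := by
    rw [hr]; rfl
  let Q : C.Words →ₗ[R] C.CoMonomials :=
    moveToEnd (oddPart C.grading) (evenPart C.grading) ∘ₗ TensorProduct.map LinearMap.id
    (TensorProduct.map LinearMap.id (LinearMap.mulRight R b)) ∘ₗ pick
  have hQ : ∀ u, Q u = C.rotateInto u b := fun u => rfl
  -- The curvature drops out because the empty word has no letter to choose. The internal
  -- differential of c cancels against the one in `coDiff`, so only the coproduct terms remain.
  have h1 : C.rotateInto (C.cobarLetter c) b = -(C.diff c ⊗ₜ b) -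
      Q (LinearMap.mul' R C.Words (TensorProduct.map (TensorAlgebra.ι R ∘ₗ C.sgn ∘ₗ C.bar)
        (TensorAlgebra.ι R ∘ₗ C.bar) (C.comul c))) := by
    have h2 : (Algebra.linearMap R C.Words ∘ₗ C.curv) c = C.curv c • 1 :=
      Algebra.algebraMap_eq_smul_one (A := C.Words) (C.curv c)
    have h3 : Q 1 = 0 := rotateInto_one b
    have h4 : Q ((TensorAlgebra.ι R ∘ₗ C.diff) c) = C.diff c ⊗ₜ b := rotateInto_ι _ b
    rw [← hQ, cobarLetter, LinearMap.sub_apply, LinearMap.sub_apply, map_sub, map_sub, h2, map_smul,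
      h3, h4, smul_zero, zero_sub]
    rfl
  rw [coDiff_tmul, sgn_of_mem hn, h1, hx, hy]
  suffices h : C.splitRight (c ⊗ₜ b) + C.splitLeft (c ⊗ₜ b) -
      Q (LinearMap.mul' R C.Words (TensorProduct.map (TensorAlgebra.ι R ∘ₗ C.sgn ∘ₗ C.bar)
        (TensorAlgebra.ι R ∘ₗ C.bar) (C.comul c))) - TensorProduct.map LinearMap.id
      (LinearMap.mulRight R b ∘ₗ TensorAlgebra.ι R)
        (TensorProduct.map C.proj₀ LinearMap.id (C.comul c)) +
      (-1 : R) ^ (k * j) • TensorProduct.comm R _ _ (TensorProduct.map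
      (LinearMap.mulLeft R b ∘ₗ TensorAlgebra.ι R) LinearMap.id
        (TensorProduct.map LinearMap.id C.proj₀ (C.comul c))) = 0 by
    rw [← h, ← TensorProduct.smul_tmul', pow_succ, mul_neg_one, neg_smul]
    abel
  have hb' : wordSign (oddPart C.grading) (evenPart C.grading) b = (-1 : R) ^ j • b := wsgn_of_mem hb
  have hsm : ∀ (r : R) (a : C.carrier) (t : C.Words), (r • a) ⊗ₜ[R] t = r • (a ⊗ₜ[R] t) :=
    fun _ _ _ => rfl
  let G : C.carrier ⊗[R] C.carrier →ₗ[R] C.CoMonomials :=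
    TensorProduct.map LinearMap.id (LinearMap.mul' R C.Words) ∘ₗ
      (TensorProduct.assoc R _ _ _).toLinearMap ∘ₗ (TensorProduct.mk R _ _).flip b ∘ₗ
      TensorProduct.map C.sgn (TensorAlgebra.ι R ∘ₗ C.bar) -
    C.appendLast ∘ₗ (TensorProduct.assoc R _ _ _).toLinearMap ∘ₗ (TensorProduct.mk R _ _).flip b -
    Q ∘ₗ LinearMap.mul' R C.Words ∘ₗ TensorProduct.map (TensorAlgebra.ι R ∘ₗ C.sgn ∘ₗ C.bar)
        (TensorAlgebra.ι R ∘ₗ C.bar) -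
    TensorProduct.map LinearMap.id (LinearMap.mulRight R b ∘ₗ TensorAlgebra.ι R) ∘ₗ
        TensorProduct.map C.proj₀ LinearMap.id +
    (-1 : R) ^ (k * j) • (TensorProduct.comm R _ _).toLinearMap ∘ₗ (TensorProduct.map
      (LinearMap.mulLeft R b ∘ₗ TensorAlgebra.ι R) LinearMap.id) ∘ₗ
        TensorProduct.map LinearMap.id C.proj₀
  have key : G (C.comul c) ∈ (⊥ : Submodule R C.CoMonomials) := by
    -- The coproduct of c is a sum of terms a ⊗ b' through an intermediate object z, and the
    -- identity is checked on these according to which factor has degree zero.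
    refine comul_mem_of_part hc ⊥ G fun z i l hil a ha b' hb₂ => ?_
    have ha' := (C.mem_part.1 ha).1
    have hb₂' := (C.mem_part.1 hb₂).1
    have hG : G (a ⊗ₜ b') = C.sgn a ⊗ₜ (TensorAlgebra.ι R (C.bar b') * b) -
        C.appendLast (a ⊗ₜ (b' ⊗ₜ b)) - C.rotateInto (TensorAlgebra.ι R (C.sgn (C.bar a)) *
          TensorAlgebra.ι R (C.bar b')) b - C.proj₀ a ⊗ₜ (TensorAlgebra.ι R b' * b) +
        (-1 : R) ^ (k * j) • (C.proj₀ b' ⊗ₜ (b * TensorAlgebra.ι R a)) := rfl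
    rw [Submodule.mem_bot, hG, appendLast_tmul]
    -- If a has degree zero, only the right splitting term and the end point term at x are nonzero,
    -- and they cancel.
    rcases i with _ | i
    · have hl0 : l ≠ 0 := by omega
      have h3 : oddPart C.grading a = 0 ∧ evenPart C.grading a = a := by
        constructor <;> simp [oddPart, evenPart, gradedScale_mem _ _ ha']
      rw [h3.1, h3.2, bar_of_mem_zero ha', bar_of_mem hl0 hb₂', proj_of_mem_zero ha',
        proj_of_mem hl0 hb₂', sgn_of_mem ha']
      simp [rotateInto_zero_left]
    · rcases l with _ | l
      -- If only b' has degree zero, only the left splitting term and the end point term at y are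
      -- nonzero, and they cancel.
      · obtain rfl : i = k := by omega
        have hi := isHomog ha'
        rw [bar_of_mem_zero hb₂', proj_of_mem_zero hb₂', proj_of_mem (by omega) ha', hi.1, hi.2,
          sgn_of_mem hb₂', show C.wsgn b = (-1 : R) ^ j • b from hb']
        rcases Nat.even_or_odd i with h | h
        · rw [if_pos h, if_pos h, (h.mul_right j).neg_one_pow, bar_of_mem (by omega) ha']
          simp [rotateInto_zero_left]
        · rw [if_neg (Nat.not_even_iff_odd.2 h), if_neg (Nat.not_even_iff_odd.2 h), pow_mul,
            h.neg_one_pow, bar_of_mem (by omega) ha']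
          simp [rotateInto_zero_left]
      -- If both degrees are positive, the two rotations of the word a b' cancel the right and the
      -- left splitting term.
      · have hi := isHomog ha'
        rw [bar_of_mem (by omega) hb₂', bar_of_mem (by omega) ha', proj_of_mem (by omega) hb₂',
          proj_of_mem (by omega) ha', sgn_of_mem ha', sgn_of_mem hb₂', hi.1, hi.2,
          show C.wsgn b = (-1 : R) ^ j • b from hb', map_smul, smul_mul_assoc, smul_mul_assoc, rotateInto,
          rotateInto_smul_left, rotateInto_cons isParity hi (n := l) (p := j)
            (by simpa using (isHomog hb₂').isHWord.sign) hb', ← rotateInto, rotateInto_ι]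
        simp only [hsm, TensorProduct.tmul_smul, smul_smul, smul_add]
        rcases Nat.even_or_odd i with h | h
        · rw [if_pos h, if_pos h, (h.mul_right (l + j)).neg_one_pow, h.add_one.neg_one_pow,
            bar_of_mem (by omega) ha']
          simp only [map_zero, mul_zero, TensorProduct.tmul_zero, TensorProduct.zero_tmul,
            smul_zero, neg_smul, one_smul, mul_one]
          abel
        · rw [if_neg (Nat.not_even_iff_odd.2 h), if_neg (Nat.not_even_iff_odd.2 h), pow_mul,
            h.neg_one_pow, h.add_one.neg_one_pow, bar_of_mem (by omega) ha']
          simp only [map_zero, mul_zero, TensorProduct.tmul_zero, TensorProduct.zero_tmul,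
            smul_zero, one_smul, pow_succ, pow_add, one_mul, neg_mul, mul_neg, neg_smul, mul_one]
          abel
  exact (Submodule.mem_bot R).1 key

end CategoricalCoalgebra
-- Augmentation of the tail of a rotated word
theorem ιInv_cons {R : Type u} [CommRing R] {V : Type v} [AddCommGroup V] [Module R V] (c : V)
    (t : TensorAlgebra R V) : TensorAlgebra.ιInv (TensorAlgebra.ι R c * t) =
      TensorAlgebra.algebraMapInv t • c := by
  refine word_induction (p := fun t => TensorAlgebra.ιInv (TensorAlgebra.ι R c * t) =
      TensorAlgebra.algebraMapInv t • c) ?_ (fun a b ha hb => ?_) (fun r a ha => ?_)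
      (fun c' t _ => ?_) t
  · have h : TensorAlgebra.ιInv (TensorAlgebra.ι R c) = c := TensorAlgebra.ι_leftInverse c
    rw [mul_one, h, map_one, one_smul]
  · rw [mul_add, map_add, map_add, add_smul, ha, hb]
  · rw [mul_smul_comm, map_smul, map_smul, ha, smul_assoc]
  · rw [ιInv_cons_cons, map_mul]
    simp [TensorAlgebra.algebraMapInv]

/-- The augmentation keeps only summands in which nothing remains after the chosen letter, so the
word has to be that letter. In the recursion, every later summand has c in its tail. -/
theorem IsHWord.augment_rotateInto {R : Type u} [CommRing R] {V : Type v} [AddCommGroup V]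
    [Module R V] {e o : V →ₗ[R] V} (he : IsParity e o) {k n : ℕ} {t : TensorAlgebra R V}
    (ht : IsHWord e o k n t) (v : TensorAlgebra R V) :
    TensorProduct.rid R V (TensorProduct.map LinearMap.id
      TensorAlgebra.algebraMapInv.toLinearMap (rotateInto e o t v)) =
      TensorAlgebra.algebraMapInv v • TensorAlgebra.ιInv t := by
  induction ht generalizing v with
  | nil =>
    rw [rotateInto_one, ιInv_one]
    simp
  | @cons k m n c t hc ht h =>
    have e1 : ∀ s : TensorAlgebra R V, ∀ a : V,
        TensorAlgebra.algebraMapInv (s * TensorAlgebra.ι R a) = 0 := fun s a => by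
      simp [TensorAlgebra.algebraMapInv]
    rw [rotateInto_cons' he, ht.sign, rotateInto_smul_left, map_add, map_add, map_add, map_add, map_smul, map_smul, h, h, e1, e1, zero_smul, smul_zero, add_zero,
      add_zero, ιInv_cons, TensorProduct.map_tmul, TensorProduct.rid_tmul, LinearMap.id_apply,
      AlgHom.toLinearMap_apply, map_mul, mul_comm, mul_smul]

theorem IsHWord.augment_rotations {R : Type u} [CommRing R] {V : Type v} [AddCommGroup V]
    [Module R V] {e o : V →ₗ[R] V} (he : IsParity e o) {k n : ℕ} {t : TensorAlgebra R V}
    (ht : IsHWord e o k n t) : TensorProduct.rid R V (TensorProduct.map LinearMap.id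
      TensorAlgebra.algebraMapInv.toLinearMap (rotations e o t)) = TensorAlgebra.ιInv t := by
  rw [rotations_eq, ht.augment_rotateInto he, map_one, one_smul]

/-! ### The chain map identity on monomials with one or more bracket entries -/

namespace CategoricalCoalgebra

variable {R : Type u} [CommRing R] {C : CategoricalCoalgebra.{u, v} R}

/-- Induction on the first letter, a = c w with c from x to p. The one-letter identity for c and w b
is added to the identity for w and b c; the two contributions at the intermediate object p cancel,
and the rest is reassembled by the Leibniz rules for D and for `rotateInto`. -/
theorem coDiff_rotateInto_word {x y : C.Ob} {i j : ℕ} {a : C.Words} (ha : C.IsCobarWord x y i a)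
    {b : C.Words} (hb : b ∈ C.cobarHom y x j) :
    C.coDiff (C.rotateInto a b) + C.rotateInto (C.cobarDiff a) b +
      (-1 : R) ^ i • C.rotateInto a (C.cobarDiff b) - x.1 ⊗ₜ (a * b) +
      (-1 : R) ^ (i * j) • (y.1 ⊗ₜ (b * a)) = 0 := by
  induction ha generalizing b j with
  | nil x =>
    have h : ∀ b : C.Words, C.rotateInto 1 b = 0 := rotateInto_one
    simp [h, rotateInto_zero_left]
  | @cons x p y k n c w hc hw ih =>
    have hι := ι_mem_cobarHom hc
    have hbc := mul_mem_cobarHom hb hι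
    have hwb := mul_mem_cobarHom hw.mem hb
    have sb := wsgn_of_mem hb
    have sw := wsgn_of_mem hw.mem
    have sDb := wsgn_cobarLower (cobarDiff_mem_lower hb)
    have sDw := wsgn_cobarLower (cobarDiff_mem_lower hw.mem)
    have hE := coDiff_letter hc hwb
    have hF := ih hbc
    have e1 := rotateInto_mul hι sw sb
    have e2 := rotateInto_mul_lower (cobarLetter_mem hc) sw sb
    have e3 := rotateInto_mul hι sDw sb
    have e4 := rotateInto_mul hι sw sDb
    have d1 : C.cobarDiff (w * b) = C.cobarDiff w * b + (-1 : R) ^ n • (w * C.cobarDiff b) := by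
      rw [cobarDiff_mul, sw, smul_mul_assoc]
    have d2 : C.cobarDiff (b * TensorAlgebra.ι R c) = C.cobarDiff b * TensorAlgebra.ι R c +
        (-1 : R) ^ j • (b * C.cobarLetter c) := by
      rw [cobarDiff_mul, sb, smul_mul_assoc, cobarDiff_ι]
    have d3 : C.cobarDiff (TensorAlgebra.ι R c * w) = C.cobarLetter c * w +
        (-1 : R) ^ k • (TensorAlgebra.ι R c * C.cobarDiff w) := by
      rw [cobarDiff_mul, cobarDiff_ι, wsgn_of_mem hι, smul_mul_assoc]
    rw [d1] at hE
    rw [d2] at hF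
    rw [d3]
    rw [rotateInto_ι] at e1 e3 e4
    simp only [rotateInto, rotateInto_add_left, rotateInto_smul_left, rotateInto_add_right,
      rotateInto_smul_right] at e1 e2 e3 e4 hE hF ⊢
    rw [e1, e2, e3, e4, map_add, map_smul]
    -- The factor is the sign of carrying c behind w b.
    have hF' := congrArg (fun z => (-1 : R) ^ (k * (n + j)) • z) hF
    simp only [smul_zero, TensorProduct.tmul_add, TensorProduct.tmul_smul, smul_add, smul_sub, smul_smul, mul_assoc] at hE hF' ⊢
    have hsum := congrArg₂ (· + ·) hE hF'
    simp only [add_zero] at hsum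
    rw [← hsum]
    -- The exponents on the two sides of these identities agree modulo two.
    have s1 : (-1 : R) ^ k * (-1) ^ (k * (n + 1 + j)) = (-1) ^ (k * (n + j)) := by
      rw [← pow_add, show k + k * (n + 1 + j) = k * (n + j) + 2 * k by ring, pow_add, pow_mul _ 2]
      simp
    have s2 : (-1 : R) ^ (k + n) * (-1) ^ (k * (n + (j + 1))) = (-1) ^ (k * (n + j)) * (-1) ^ n := by
      rw [← pow_add, ← pow_add, show k + n + k * (n + (j + 1)) = k * (n + j) + n + 2 * k by ring,
        pow_add, pow_mul _ 2]
      simp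
    have s3 : (-1 : R) ^ (k * (n + j)) * ((-1) ^ n * (-1) ^ j) = (-1) ^ ((k + 1) * (n + j)) := by
      rw [← pow_add, ← pow_add]
      congr 1
      ring
    have s4 : (-1 : R) ^ (k * (n + j)) * (-1) ^ (n * (j + k)) = (-1) ^ ((k + n) * j) := by
      rw [← pow_add, show k * (n + j) + n * (j + k) = (k + n) * j + 2 * (k * n) by ring, pow_add,
        pow_mul _ 2]
      simp
    have s5 : (-1 : R) ^ (k + n) = (-1) ^ k * (-1) ^ n := pow_add _ _ _
    rw [s1, s2, s3, s4, s5]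
    abel

/-- On the right stand the images of the terms of δ[a]b: the product a b, the differentials of a and
of b, and the cyclic product b a. -/
theorem coDiff_rotateInto {x y : C.Ob} {i j : ℕ} {a : C.Words} (ha : a ∈ C.cobarHom x y i)
    {b : C.Words} (hb : b ∈ C.cobarHom y x j) :
    C.coDiff (C.rotateInto a b) = x.1 ⊗ₜ (a * b) - C.rotateInto (C.cobarDiff a) b -
      (-1 : R) ^ i • C.rotateInto a (C.cobarDiff b) -
      (-1 : R) ^ (i * j) • (y.1 ⊗ₜ (b * a)) := by
  induction ha using Submodule.span_induction with
  | mem a ha =>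
    rw [← sub_eq_zero, ← coDiff_rotateInto_word ha hb]
    abel
  | zero => simp [rotateInto_zero_left]
  | add a a' _ _ h h' =>
    simp only [rotateInto, map_add, rotateInto_add_left, add_mul, mul_add b,
      TensorProduct.tmul_add, smul_add] at h h' ⊢
    rw [h, h']
    abel
  | smul r a _ h =>
    simp only [rotateInto, map_smul, rotateInto_smul_left, smul_mul_assoc, mul_smul_comm,
      TensorProduct.tmul_smul] at h ⊢
    rw [h]
    simp only [smul_sub, smul_comm r]

/-- The set-like element underlying an object of the cobar construction. -/
def point (x : C.cobar.Obj) : C.carrier := Subtype.val (p := fun x => x ∈ C.grading 0 ∧ IsGroupLikeElem R x) x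

theorem toWords_mem {x y : C.cobar.Obj} {n : ℕ} (a : C.cobar.Hom x y n) :
    C.toWords (C.cobar.of x y n a) ∈ C.cobarHom x y n := by
  have h : C.toWords (C.cobar.of x y n a) = (C.cobarHom x y n).subtype a := toWords_of _
  rw [h]
  exact Subtype.property (p := fun t => t ∈ C.cobarHom x y n) a

theorem toWords_mul {x y z : C.cobar.Obj} {m n : ℕ} (a : C.cobar.Hom x y m)
    (b : C.cobar.Hom y z n) :
    C.toWords (C.cobar.mul (C.cobar.of x y m a) (C.cobar.of y z n b)) =
      C.toWords (C.cobar.of x y m a) * C.toWords (C.cobar.of y z n b) := by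
  rw [PreDGCat.mul_of_of]
  exact (toWords_of _).trans (congrArg₂ (· * ·) (toWords_of _).symm (toWords_of _).symm)

theorem toWords_dTot {x y : C.cobar.Obj} {n : ℕ} (a : C.cobar.Hom x y n) :
    C.toWords (C.cobar.dTot (C.cobar.of x y n a)) =
      C.cobarDiff (C.toWords (C.cobar.of x y n a)) := by
  cases n with
  | zero => rw [PreDGCat.dTot_of_zero, map_zero, cobarDiff_zero (toWords_mem a)]
  | succ n =>
    rw [PreDGCat.dTot_of_succ]
    exact (toWords_of _).trans (congrArg C.cobarDiff (toWords_of _).symm)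

theorem piZero_of' {x : C.cobar.Obj} {n : ℕ} (a : C.cobar.Hom x x n) :
    C.piZero (C.cobar.of x x n a) = point x ⊗ₜ C.toWords (C.cobar.of x x n a) :=
  (piZero_of _).trans (congrArg (point x ⊗ₜ ·) (toWords_of _).symm)

theorem piZero_mul {x y : C.cobar.Obj} {m n : ℕ} (a : C.cobar.Hom x y m)
    (b : C.cobar.Hom y x n) :
    C.piZero (C.cobar.mul (C.cobar.of x y m a) (C.cobar.of y x n b)) =
      point x ⊗ₜ (C.toWords (C.cobar.of x y m a) * C.toWords (C.cobar.of y x n b)) := by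
  rw [← toWords_mul, PreDGCat.mul_of_of, piZero_of']

theorem piZero_dTot {x : C.cobar.Obj} {n : ℕ} (a : C.cobar.Hom x x n) :
    C.piZero (C.cobar.dTot (C.cobar.of x x n a)) =
      point x ⊗ₜ C.cobarDiff (C.toWords (C.cobar.of x x n a)) := by
  rw [← toWords_dTot]
  cases n with
  | zero => rw [PreDGCat.dTot_of_zero, map_zero, map_zero, TensorProduct.tmul_zero]
  | succ n => rw [PreDGCat.dTot_of_succ, piZero_of']

theorem piOne_tmul (a b : C.cobar.Tot) :
    C.piOne (a ⊗ₜ b) = C.rotateInto (C.toWords a) (C.toWords b) := by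
  rw [piOne, LinearMap.comp_apply, LinearMap.comp_apply, LinearMap.comp_apply,
    TensorProduct.map_tmul, LinearMap.comp_apply, rotateInto, CobarHoch.rotateInto]
  refine congrArg _ ?_
  induction pick (C.toWords a) with
  | zero => simp
  | add s t hs ht => simp only [TensorProduct.add_tmul, map_add, hs, ht]
  | tmul s t =>
    induction t with
    | zero => simp
    | add t t' h h' => simp only [TensorProduct.add_tmul, TensorProduct.tmul_add, map_add, h, h']
    | tmul c t => simp

theorem piMonomials_cons_nil (a b : C.cobar.Tot) :
    C.piMonomials (C.cobar.cons a (1 ⊗ₜ b)) = C.rotateInto (C.toWords a) (C.toWords b) := by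
  rw [DGCat.cons_tmul, mul_one, piMonomials_ι, piOne_tmul]

theorem piMonomials_cons_cons (a b : C.cobar.Tot) (z : C.cobar.Monomials) :
    C.piMonomials (C.cobar.cons a (C.cobar.cons b z)) = 0 := by
  induction z using TensorProduct.induction_on with
  | zero => simp
  | add z z' h h' => simp only [map_add, h, h', add_zero]
  | tmul t c => rw [DGCat.cons_tmul, DGCat.cons_tmul, piMonomials_cons]

theorem piMonomials_hochDiff_nil {x : C.cobar.Obj} {j : ℕ} (b : C.cobar.Hom x x j) :
    C.piMonomials (C.cobar.hochDiff ((1 : C.cobar.Words) ⊗ₜ C.cobar.of x x j b)) =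
      C.coDiff (C.piMonomials ((1 : C.cobar.Words) ⊗ₜ C.cobar.of x x j b)) := by
  rw [DGCat.hochDiff, LinearMap.add_apply, DGCat.barDiff_nil, DGCat.wrap_nil, add_zero,
    piMonomials_one, piMonomials_one, piZero_dTot, piZero_of']
  exact (coDiff_ob (C := C) x _).symm

theorem piMonomials_hochDiff_one {x y : C.cobar.Obj} {i j : ℕ} (a : C.cobar.Hom x y i)
    (b : C.cobar.Hom y x j) :
    C.piMonomials (C.cobar.hochDiff (C.cobar.cons (C.cobar.of x y i a) (1 ⊗ₜ C.cobar.of y x j b))) =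
      C.coDiff (C.piMonomials (C.cobar.cons (C.cobar.of x y i a) (1 ⊗ₜ C.cobar.of y x j b))) := by
  have hw : C.piMonomials (C.cobar.wrap (C.cobar.cons (C.cobar.of x y i a)
      (1 ⊗ₜ C.cobar.of y x j b))) = -((-1 : R) ^ (i * j) • (point y ⊗ₜ
        (C.toWords (C.cobar.of y x j b) * C.toWords (C.cobar.of x y i a)))) := by
    rw [DGCat.cons_tmul, DGCat.wrap_cons, DGCat.wsgn_one, PreDGCat.sgn_of, DGCat.even_of,
      DGCat.odd_of, map_neg, map_add, piMonomials_one, piMonomials_one]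
    refine congrArg Neg.neg ?_
    rcases Nat.even_or_odd i with h | h
    · rw [if_pos h, if_pos h, piZero_mul, map_zero, map_zero, add_zero,
        (h.mul_right j).neg_one_pow, one_smul]
    · rw [if_neg (Nat.not_even_iff_odd.2 h), if_neg (Nat.not_even_iff_odd.2 h), map_zero, map_zero,
        zero_add, map_smul, LinearMap.smul_apply, map_smul, piZero_mul, pow_mul, h.neg_one_pow]
  rw [DGCat.hochDiff, LinearMap.add_apply, map_add, hw, DGCat.barDiff_cons, DGCat.barDiff_nil,
    DGCat.mergeFirst_nil, map_sub, map_sub, piMonomials_one, piZero_mul, piMonomials_cons_nil,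
    piMonomials_cons_nil, piMonomials_cons_nil, toWords_dTot, toWords_dTot,
    PreDGCat.sgn_of, map_smul, coDiff_rotateInto (toWords_mem a) (toWords_mem b)]
  simp only [rotateInto, rotateInto_smul_left, point]
  abel

/-- The terms with an inner differential keep two bracket entries and are annihilated. The products
a a', a' b and b a give the three terms of the Leibniz rule for `rotateInto`. -/
theorem piMonomials_hochDiff_two {x y z : C.cobar.Obj} {i k j : ℕ} (a : C.cobar.Hom x y i)
    (a' : C.cobar.Hom y z k) (b : C.cobar.Hom z x j) :
    C.piMonomials (C.cobar.hochDiff (C.cobar.cons (C.cobar.of x y i a)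
      (C.cobar.cons (C.cobar.of y z k a') (1 ⊗ₜ C.cobar.of z x j b)))) = 0 := by
  have hw : C.piMonomials (C.cobar.wrap (C.cobar.cons (C.cobar.of x y i a)
      (C.cobar.cons (C.cobar.of y z k a') (1 ⊗ₜ C.cobar.of z x j b)))) =
      -((-1 : R) ^ (i * (j + k + 1)) • C.rotateInto (C.toWords (C.cobar.of y z k a'))
        (C.toWords (C.cobar.of z x j b) * C.toWords (C.cobar.of x y i a))) := by
    rw [DGCat.cons_tmul, DGCat.cons_tmul, DGCat.wrap_cons, DGCat.wsgn_cons, mul_one,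
      PreDGCat.sgn_of, PreDGCat.sgn_of, DGCat.even_of, DGCat.odd_of, map_neg, map_add]
    refine congrArg Neg.neg ?_
    have hsm : ∀ (r : R) (t : C.cobar.Words) (a : C.cobar.Tot), (r • t) ⊗ₜ[R] a = r • (t ⊗ₜ[R] a) :=
      fun _ _ _ => rfl
    rcases Nat.even_or_odd i with h | h
    · rw [if_pos h, if_pos h, piMonomials_ι, piOne_tmul, map_zero, TensorProduct.tmul_zero, map_zero,
        add_zero, (h.mul_right _).neg_one_pow, one_smul, toWords_mul]
    · rw [if_neg (Nat.not_even_iff_odd.2 h), if_neg (Nat.not_even_iff_odd.2 h), map_zero,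
        TensorProduct.tmul_zero, map_zero, zero_add, DGCat.wsgn_one, mul_one, map_smul, map_smul,
        LinearMap.smul_apply, ← neg_smul, TensorProduct.tmul_smul, map_smul,
        hsm, map_smul, piMonomials_ι, piOne_tmul, toWords_mul, smul_smul, pow_mul, h.neg_one_pow]
      refine congrArg (· • _) ?_
      rw [pow_add, pow_add]
      ring
  rw [DGCat.hochDiff, LinearMap.add_apply, map_add, hw, DGCat.barDiff_cons, DGCat.barDiff_cons,
    DGCat.barDiff_nil, DGCat.mergeFirst_nil, DGCat.mergeFirst_cons', map_sub, map_sub, map_sub,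
    map_sub, map_sub, map_sub, piMonomials_cons_cons, piMonomials_cons_cons, piMonomials_cons_cons,
    piMonomials_cons_nil, piMonomials_cons_nil, PreDGCat.sgn_of, map_smul, LinearMap.smul_apply,
    map_smul, toWords_mul, toWords_mul, map_smul, rotateInto,
    rotateInto_smul_left, rotateInto, rotateInto_smul_left, ← rotateInto,
    rotateInto_mul (toWords_mem a) (wsgn_of_mem (toWords_mem a')) (wsgn_of_mem (toWords_mem b))]
  have s : (-1 : R) ^ (i * (j + k + 1)) = (-1) ^ i * (-1) ^ (i * (k + j)) := by
    rw [← pow_add]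
    congr 1
    ring
  rw [s]
  simp only [smul_add, smul_smul]
  abel

/-- The differential removes at most one of the three bracket entries. -/
theorem piMonomials_hochDiff_three (a a' a'' : C.cobar.Tot) (z : C.cobar.Monomials) :
    C.piMonomials (C.cobar.hochDiff
      (C.cobar.cons a (C.cobar.cons a' (C.cobar.cons a'' z)))) = 0 := by
  rw [DGCat.hochDiff, LinearMap.add_apply, map_add, DGCat.wrap_cons', DGCat.msgn_cons,
    DGCat.msgn_cons, DGCat.barDiff_cons, DGCat.barDiff_cons, DGCat.mergeFirst_cons',
    DGCat.mergeFirst_cons']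
  simp only [map_sub, map_neg, map_add, piMonomials_cons_cons, DGCat.rmul_cons]
  simp

theorem piMonomials_hochDiff {n : ℕ} {z : C.cobar.Monomials} (hz : z ∈ C.cobar.chains n) :
    C.piMonomials (C.cobar.hochDiff z) = C.coDiff (C.piMonomials z) := by
  refine DGCat.chains_induction (p := fun z => C.piMonomials (C.cobar.hochDiff z) =
    C.coDiff (C.piMonomials z)) (by simp) (fun a b ha hb => ?_) (fun r a ha => ?_)
    (fun x y i j _ t ht b => ?_) hz
  · simp only [map_add, ha, hb]
  · simp only [map_smul, ha]
  · cases ht with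
    | nil x => exact piMonomials_hochDiff_nil b
    | cons a ht =>
      rw [← DGCat.cons_tmul]
      cases ht with
      | nil => exact piMonomials_hochDiff_one a b
      | cons a' ht =>
        rw [← DGCat.cons_tmul, piMonomials_cons_cons, map_zero]
        cases ht with
        | nil => exact piMonomials_hochDiff_two a a' b
        | cons a'' ht =>
          rw [← DGCat.cons_tmul, piMonomials_hochDiff_three]

/-! ### Compatibility with Connes' operator -/

theorem counit_rotateInto {x y : C.Ob} {n : ℕ} {t : C.Words} (ht : t ∈ C.cobarHom x y n)
    (v : C.Words) : TensorProduct.map C.counit LinearMap.id (C.rotateInto t v) = 0 := by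
  induction ht using Submodule.span_induction with
  | mem t ht =>
    induction ht generalizing v with
    | nil x =>
      have h : C.rotateInto 1 v = 0 := rotateInto_one v
      rw [h, map_zero]
    | cons hc hw ih =>
      have h := rotateInto_cons' (isParity (C := C))
      -- The head of every summand is a letter of t, hence of positive degree.
      have hε : C.counit _ = 0 := C.counit_eq_zero _ (Nat.succ_ne_zero _) _ (C.mem_part.1 hc).1
      simp only [rotateInto] at ih h ⊢
      rw [h]
      simp only [map_add, ih, TensorProduct.map_tmul]
      have hs : wordSign (oddPart C.grading) (evenPart C.grading) _ = _ := wsgn_of_mem hw.mem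
      rw [hε, hs, rotateInto_smul_left, map_smul, ih]
      simp
  | zero => rw [rotateInto_zero_left, map_zero]
  | add a b _ _ ha hb => 
    rw [rotateInto, rotateInto_add_left, map_add, ← rotateInto, ← rotateInto, ha, hb, add_zero]
  | smul r a _ ha => rw [rotateInto, rotateInto_smul_left, map_smul, ← rotateInto, ha, smul_zero]

/-- The comparison map sees only brackets with one entry, so only the summands with empty tail
matter; these are selected by the augmentation. On them it maps [a]id to the sum of all rotations of
a. -/
theorem piMonomials_cap (z : C.cobar.Tot ⊗[R] C.cobar.Words) :
    C.piMonomials (C.cobar.cap z) =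
      rotations (oddPart C.grading) (evenPart C.grading) (C.toWords (TensorProduct.rid R C.cobar.Tot
        (TensorProduct.map LinearMap.id TensorAlgebra.algebraMapInv.toLinearMap z))) := by
  induction z with
  | zero => simp
  | add a b ha hb => simp only [map_add, ha, hb]
  | tmul a t =>
    refine word_induction (p := fun t => C.piMonomials (C.cobar.cap (a ⊗ₜ t)) = rotations
      (oddPart C.grading) (evenPart C.grading) (C.toWords (TensorProduct.rid R C.cobar.Tot
      (TensorProduct.map LinearMap.id TensorAlgebra.algebraMapInv.toLinearMap (a ⊗ₜ t)))))
      ?_ (fun s t hs ht => ?_) (fun r t ht => ?_) (fun c t _ => ?_) t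
    · refine PreDGCat.tot_induction (p := fun a => C.piMonomials (C.cobar.cap (a ⊗ₜ 1)) = rotations
        (oddPart C.grading) (evenPart C.grading) (C.toWords (TensorProduct.rid R C.cobar.Tot
        (TensorProduct.map LinearMap.id TensorAlgebra.algebraMapInv.toLinearMap (a ⊗ₜ 1)))))
        (by simp) (fun a b ha hb => ?_) (fun x y n a => ?_) a
      · simp only [TensorProduct.add_tmul, map_add, ha, hb]
      · have h1 : C.toWords (C.cobar.of x x 0 (C.cobar.one x)) = 1 := toWords_of _
        rw [DGCat.cap_tmul, ← DGCat.cons_tmul, piMonomials_cons_nil, h1, rotateInto, ← rotations_eq]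
        simp
    · simp only [TensorProduct.tmul_add, map_add, hs, ht]
    · simp only [TensorProduct.tmul_smul, map_smul, ht]
    · refine PreDGCat.tot_induction (p := fun a => C.piMonomials (C.cobar.cap
        (a ⊗ₜ (TensorAlgebra.ι R c * t))) = rotations
        (oddPart C.grading) (evenPart C.grading) (C.toWords (TensorProduct.rid R C.cobar.Tot
        (TensorProduct.map LinearMap.id TensorAlgebra.algebraMapInv.toLinearMap
          (a ⊗ₜ (TensorAlgebra.ι R c * t))))))
        (by simp) (fun a b ha hb => ?_) (fun x y n a => ?_) a
      · simp only [TensorProduct.add_tmul, map_add, ha, hb]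
      · rw [DGCat.cap_tmul, piMonomials_cons]
        simp [TensorAlgebra.algebraMapInv]

/-- For p = 0 both sides are the rotations of b. For p = 1 the left side has two bracket entries,
and on the right the counit vanishes on the heads. For p ≥ 2 both sides are zero for lack of a short
bracket. -/
theorem piMonomials_connes {n : ℕ} {z : C.cobar.Monomials} (hz : z ∈ C.cobar.chains n) :
    C.piMonomials (C.cobar.connes z) = C.coConnes (C.piMonomials z) := by
  refine DGCat.chains_induction (p := fun z => C.piMonomials (C.cobar.connes z) =
    C.coConnes (C.piMonomials z)) (by simp) (fun a b ha hb => ?_) (fun r a ha => ?_)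
    (fun x y i j _ t ht b => ?_) hz
  · simp only [map_add, ha, hb]
  · simp only [map_smul, ha]
  · obtain ⟨k, hk⟩ := ht.isPath
    have hw := (hk.snoc b).isHWord.augment_rotations DGCat.isParity
    rw [DGCat.connes_eq, piMonomials_cap, DGCat.suspend_tmul, ht.wsgn, smul_mul_assoc, map_smul,
      map_smul, map_smul, map_smul, map_smul, hw]
    cases ht with
    | nil x =>
      have h1 : C.counit (point x) = 1 := counit_ob (C := C) x
      rw [one_mul, piMonomials_one, piZero_of', ← mul_one (TensorAlgebra.ι R _), ιInv_cons, coConnes,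
        LinearMap.comp_apply, LinearMap.comp_apply, TensorProduct.map_tmul, h1]
      simp
    | cons a ht =>
      cases ht with
      | nil =>
        rw [mul_one, ← mul_one (TensorAlgebra.ι R (C.cobar.of y x j b)), ιInv_cons_cons,
          map_zero, map_zero, smul_zero, ← mul_one (TensorAlgebra.ι R _), ← DGCat.cons_tmul, 
          piMonomials_cons_nil, coConnes, LinearMap.comp_apply, LinearMap.comp_apply,
          counit_rotateInto (toWords_mem a), map_zero, map_zero]
      | cons a' ht =>
        rw [mul_assoc, mul_assoc, ιInv_cons_cons, map_zero, map_zero, smul_zero, piMonomials_cons,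
          map_zero]

end CategoricalCoalgebra
-- Surjectivity of the comparison map
namespace CategoricalCoalgebra

variable {R : Type u} [CommRing R] {C : CategoricalCoalgebra.{u, v} R}

/-- In degree zero the left coaction is the whole coproduct, and applying the counit to the second
factor of x ⊗ c gives back c. -/
theorem part_zero_eq {x y : C.Ob} {c : C.carrier} (hc : c ∈ C.part x y 0) :
    c = C.counit c • x.1 := by
  obtain ⟨h0, hl, hr⟩ := C.mem_part.1 hc
  have e1 : TensorProduct.map C.proj₀ LinearMap.id (C.comul c) = C.comul c := by
    refine tensor_eq (f := TensorProduct.map C.proj₀ LinearMap.id) (g := LinearMap.id) ?_ h0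
    intro i j hij a ha b hb'
    obtain ⟨rfl, rfl⟩ : i = 0 ∧ j = 0 := by omega
    have h : C.proj₀ a = a := proj_of_mem_zero ha
    simp [h]
  have e3 : TensorProduct.map LinearMap.id C.counit (C.comul c) = c ⊗ₜ[R] (1 : R) :=
    Coalgebra.lTensor_counit_comul c
  rw [← e1, hl] at e3
  have h1 := congrArg (TensorProduct.rid R C.carrier) e3
  simp only [TensorProduct.map_tmul, LinearMap.id_apply, TensorProduct.rid_tmul, one_smul] at h1
  exact h1.symm

theorem exists_toWords_eq {x y : C.cobar.Obj} {n : ℕ} {t : C.Words} (ht : t ∈ C.cobarHom x y n) :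
    ∃ a : C.cobar.Hom x y n, C.toWords (C.cobar.of x y n a) = t :=
  ⟨(⟨t, ht⟩ : C.cobarHom x y n), toWords_of _⟩

theorem exists_piMonomials_eq_ob {x : C.cobar.Obj} {n : ℕ} {t : C.Words}
    (ht : t ∈ C.cobarHom x x n) : ∃ z ∈ C.cobar.chains n, C.piMonomials z = point x ⊗ₜ t := by
  obtain ⟨b, rfl⟩ := exists_toWords_eq ht
  exact ⟨1 ⊗ₜ C.cobar.of x x n b, DGCat.mem_chains (zero_add n) (DGCat.IsWord.nil x) b, by
    rw [piMonomials_one, piZero_of']⟩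

theorem exists_piMonomials_eq_letter {x y : C.cobar.Obj} {k n : ℕ} {c : C.carrier} {t : C.Words}
    (hc : c ∈ C.part x y (k + 1)) (ht : t ∈ C.cobarHom y x n) :
    ∃ z ∈ C.cobar.chains (k + 1 + n), C.piMonomials z = c ⊗ₜ t := by
  obtain ⟨a, ha⟩ := exists_toWords_eq (ι_mem_cobarHom hc)
  obtain ⟨b, rfl⟩ := exists_toWords_eq ht
  refine ⟨C.cobar.cons (C.cobar.of x y k a) (1 ⊗ₜ C.cobar.of y x n b), ?_, ?_⟩
  · rw [DGCat.cons_tmul]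
    exact DGCat.mem_chains rfl (DGCat.IsWord.cons a (DGCat.IsWord.nil y)) b
  · rw [piMonomials_cons_nil, ha, rotateInto_ι]

/-- A head of positive degree is hit by a one-letter bracket. A head of degree zero is a multiple of
a set-like element, and is zero unless its two end points agree; it is hit by an empty bracket. -/
theorem piMonomials_surjective {n : ℕ} {z : C.CoMonomials} (hz : z ∈ C.coChains n) :
    ∃ t ∈ C.cobar.chains n, C.piMonomials t = z := by
  induction hz using Submodule.span_induction with
  | mem z hz =>
    obtain ⟨x, y, i, j, rfl, c, hc, t, ht, rfl⟩ := hz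
    cases i with
    | zero =>
      rw [part_zero_eq hc]
      rcases counit_part hc with rfl | h
      · obtain ⟨z, hz, h⟩ := exists_piMonomials_eq_ob ht.mem
        rw [zero_add]
        exact ⟨C.counit c • z, Submodule.smul_mem _ _ hz, by rw [map_smul, h]; rfl⟩
      · exact ⟨0, zero_mem _, by simp [h]⟩
    | succ k => exact exists_piMonomials_eq_letter hc ht.mem
  | zero => exact ⟨0, zero_mem _, map_zero _⟩
  | add a b _ _ ha hb =>
    obtain ⟨s, hs, rfl⟩ := ha
    obtain ⟨t, ht, rfl⟩ := hb
    exact ⟨s + t, add_mem hs ht, map_add _ _ _⟩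
  | smul r a _ ha =>
    obtain ⟨s, hs, rfl⟩ := ha
    exact ⟨r • s, Submodule.smul_mem _ _ hs, map_smul _ _ _⟩

theorem piBar_surjective (n : ℕ) : Function.Surjective (C.piBar n) := by
  rintro ⟨z, hz⟩
  obtain ⟨t, ht, h⟩ := piMonomials_surjective hz
  exact ⟨Subquotient.mk _ _ ⟨t, ht⟩, Subtype.ext h⟩

theorem piBar_isMorphism : PreMixedComplex.IsMorphism C.piBar where
  comm_b _ := Subquotient.hom_ext fun z => Subtype.ext (piMonomials_hochDiff z.2)
  comm_B _ := Subquotient.hom_ext fun z => Subtype.ext (piMonomials_connes z.2)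

end CategoricalCoalgebra

/-! ### Transport along surjective morphisms -/

namespace PreMixedComplex

variable {R : Type u} [CommRing R] {L : PreMixedComplex.{u, w} R} {M : PreMixedComplex.{u, v} R}

/-- Every element of N has the form f z, and the value of an operator identity at f z is the image
of its value at z. Thus the identities for d and P on the coHochschild side need no computation of
their own. -/
theorem IsMixedComplex.of_surjective (hM : M.IsMixedComplex) {N : PreMixedComplex.{u, v} R}
    {f : GradedMap M N} (hf : IsMorphism f) (h : ∀ n, Function.Surjective (f n)) :
    N.IsMixedComplex := by
  have hb : ∀ n z, f n (M.b n z) = N.b n (f (n + 1) z) := fun n z =>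
    LinearMap.congr_fun (hf.comm_b n) z
  have hB : ∀ n z, f (n + 1) (M.B n z) = N.B n (f n z) := fun n z =>
    LinearMap.congr_fun (hf.comm_B n) z
  refine ⟨fun n => ?_, fun n => ?_, ?_, fun n => ?_⟩ <;> refine LinearMap.ext fun z => ?_ <;>
    obtain ⟨z, rfl⟩ := h _ z
  · rw [LinearMap.comp_apply, ← hb, ← hb]
    exact (congrArg _ (LinearMap.congr_fun (hM.b_b n) z)).trans (map_zero _)
  · rw [LinearMap.comp_apply, ← hB, ← hB]
    exact (congrArg _ (LinearMap.congr_fun (hM.B_B n) z)).trans (map_zero _)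
  · rw [LinearMap.comp_apply, ← hB, ← hb]
    exact (congrArg _ (LinearMap.congr_fun hM.b_B_zero z)).trans (map_zero _)
  · rw [LinearMap.add_apply, LinearMap.comp_apply, LinearMap.comp_apply, ← hB, ← hb, ← hb, ← hB,
      ← map_add]
    exact (congrArg _ (LinearMap.congr_fun (hM.b_B n) z)).trans (map_zero _)

/-- A map that becomes a morphism after precomposition with a surjective morphism is a morphism. -/
theorem IsMorphism.of_comp_surjective {L M N : PreMixedComplex.{u, v} R} {f : GradedMap L M}
    (hf : IsMorphism f) (h : ∀ n, Function.Surjective (f n)) {g : GradedMap M N}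
    (hg : IsMorphism fun n => g n ∘ₗ f n) : IsMorphism g where
  comm_b n := by
    refine LinearMap.ext fun z => ?_
    obtain ⟨z, rfl⟩ := h _ z
    have h1 := LinearMap.congr_fun (hg.comm_b n) z
    have h2 := LinearMap.congr_fun (hf.comm_b n) z
    simp only [LinearMap.comp_apply] at h1 h2 ⊢
    rw [← h2, h1]
  comm_B n := by
    refine LinearMap.ext fun z => ?_
    obtain ⟨z, rfl⟩ := h _ z
    have h1 := LinearMap.congr_fun (hg.comm_B n) z
    have h2 := LinearMap.congr_fun (hf.comm_B n) z
    simp only [LinearMap.comp_apply] at h1 h2 ⊢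
    rw [← h2, h1]

theorem IsMorphism.comp {L M N : PreMixedComplex.{u, v} R} {f : GradedMap L M} {g : GradedMap M N}
    (hg : IsMorphism g) (hf : IsMorphism f) : IsMorphism fun n => g n ∘ₗ f n where
  comm_b n := by rw [LinearMap.comp_assoc, hf.comm_b, ← LinearMap.comp_assoc, hg.comm_b]; rfl
  comm_B n := by rw [LinearMap.comp_assoc, hf.comm_B, ← LinearMap.comp_assoc, hg.comm_B]; rfl

end PreMixedComplex

/-! ### Naturality of the comparison map -/

namespace CategoricalCoalgebra

variable {R : Type u} [CommRing R] {C C' : CategoricalCoalgebra.{u, v} R}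

theorem coHoch_isMixedComplex (C : CategoricalCoalgebra.{u, v} R) : C.coHoch.IsMixedComplex :=
  (DGCat.hoch_isMixedComplex C.cobar).of_surjective piBar_isMorphism piBar_surjective

namespace Hom

variable (f : Hom C C')

/-- The scalar f̄₁ c contributes no letter that could be chosen. -/
theorem pick_words (t : C.Words) : pick (f.words t) =
    TensorProduct.map f.words.toLinearMap (TensorProduct.map f.lin f.words.toLinearMap) (pick t) :=
  pick_algHom f.words f.lin (fun c => by
    rw [words_ι, map_add, pick_ι, Algebra.algebraMap_eq_smul_one, map_smul, pick_one, smul_zero,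
      add_zero]) t

theorem toWords_cobarMap (a : C.cobar.Tot) :
    C'.toWords (f.cobarMap.tot a) = f.words (C.toWords a) := by
  refine PreDGCat.tot_induction (p := fun a => C'.toWords (f.cobarMap.tot a) =
    f.words (C.toWords a)) (by simp) (fun a b ha hb => by simp only [map_add, ha, hb])
    (fun x y n a => ?_) a
  rw [DGCat.Functor.tot_of]
  exact (toWords_of _).trans (congrArg f.words (toWords_of _).symm)

theorem piZero_cobarMap (a : C.cobar.Tot) :
    C'.piZero (f.cobarMap.tot a) = f.coMonomials (C.piZero a) := by
  refine PreDGCat.tot_induction (p := fun a => C'.piZero (f.cobarMap.tot a) =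
    f.coMonomials (C.piZero a)) (by simp) (fun a b ha hb => by simp only [map_add, ha, hb])
    (fun x y n a => ?_) a
  rw [DGCat.Functor.tot_of]
  exact (piZero_of _).trans (congrArg f.coMonomials (piZero_of _)).symm

theorem lin_odd (c : C.carrier) :
    f.lin (oddPart C.grading c) = oddPart C'.grading (f.lin c) := by
  refine LinearMap.congr_fun (graded_hom_ext C.grading (f := f.lin ∘ₗ oddPart C.grading)
    (g := oddPart C'.grading ∘ₗ f.lin) fun n c hc => ?_) c
  have h : f.lin c ∈ C'.grading n := f.f₀_mem n c hc
  rw [LinearMap.comp_apply, LinearMap.comp_apply, oddPart, oddPart, gradedScale_mem _ _ hc,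
    gradedScale_mem _ _ h, map_smul]

theorem lin_even (c : C.carrier) :
    f.lin (evenPart C.grading c) = evenPart C'.grading (f.lin c) := by
  refine LinearMap.congr_fun (graded_hom_ext C.grading (f := f.lin ∘ₗ evenPart C.grading)
    (g := evenPart C'.grading ∘ₗ f.lin) fun n c hc => ?_) c
  have h : f.lin c ∈ C'.grading n := f.f₀_mem n c hc
  rw [LinearMap.comp_apply, LinearMap.comp_apply, evenPart, evenPart, gradedScale_mem _ _ hc,
    gradedScale_mem _ _ h, map_smul]

/-- The functional f̄₁ is supported in degree one. -/
theorem bar₁_odd (c : C.carrier) : f.bar₁ (oddPart C.grading c) = f.bar₁ c := by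
  refine LinearMap.congr_fun (graded_hom_ext C.grading (f := f.bar₁ ∘ₗ oddPart C.grading)
    (g := f.bar₁) fun n c hc => ?_) c
  rw [LinearMap.comp_apply, oddPart, gradedScale_mem _ _ hc, map_smul]
  by_cases h : n = 1
  · subst h
    simp
  · rw [f.bar₁_of_mem h hc, smul_zero]

theorem bar₁_even (c : C.carrier) : f.bar₁ (evenPart C.grading c) = 0 := by
  have h := congrArg f.bar₁ ((isParity (C := C)).add c)
  rw [map_add, bar₁_odd] at h
  simpa using h

theorem words_wsgn (t : C.Words) : f.words (C.wsgn t) = C'.wsgn (f.words t) := by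
  refine word_induction (p := fun t => f.words (C.wsgn t) = C'.wsgn (f.words t)) (by simp)
    (fun a b ha hb => by simp only [map_add, ha, hb]) (fun r a ha => by simp only [map_smul, ha])
    (fun c t ht => ?_) t
  have h2 : f.lin (C.sgn c) = C'.sgn (f.lin c) := LinearMap.congr_fun f.lin_sgn c
  have h3 : f.bar₁ (C.sgn c) = -f.bar₁ c := LinearMap.congr_fun f.bar₁_sgn c
  rw [map_mul, map_mul, ht, map_mul, map_mul, words_ι, map_add, wsgn_ι, wsgn_ι, AlgHom.commutes,
    map_neg, words_ι, h2, h3, map_neg, neg_add, neg_neg]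

/-- Since f̄₁ lives in desuspended degree zero, replacing a letter by a scalar does not change the
parity of a word. -/
theorem words_parity (t : C.Words) :
    f.words (wordEven (oddPart C.grading) (evenPart C.grading) t) =
      wordEven (oddPart C'.grading) (evenPart C'.grading) (f.words t) ∧
    f.words (wordOdd (oddPart C.grading) (evenPart C.grading) t) =
      wordOdd (oddPart C'.grading) (evenPart C'.grading) (f.words t) := by
  refine word_induction (p := fun t =>
    f.words (wordEven (oddPart C.grading) (evenPart C.grading) t) =
      wordEven (oddPart C'.grading) (evenPart C'.grading) (f.words t) ∧
    f.words (wordOdd (oddPart C.grading) (evenPart C.grading) t) =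
      wordOdd (oddPart C'.grading) (evenPart C'.grading) (f.words t)) (by simp)
    (fun a b ha hb => by simp only [map_add, ha, hb, and_self])
    (fun r a ha => by simp only [map_smul, ha, and_self])
    (fun c t ht => ?_) t
  have hs : ∀ (r : R) (s : C'.Words), algebraMap R C'.Words r * s = r • s := fun r s =>
    (Algebra.smul_def r s).symm
  have e1 : f.words (TensorAlgebra.ι R c * t) =
      TensorAlgebra.ι R (f.lin c) * f.words t + f.bar₁ c • f.words t := by
    rw [map_mul, words_ι, add_mul, hs]
  have e2 : ∀ s, f.words (TensorAlgebra.ι R (oddPart C.grading c) * s) =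
      TensorAlgebra.ι R (oddPart C'.grading (f.lin c)) * f.words s + f.bar₁ c • f.words s := by
    intro s
    rw [map_mul, words_ι, add_mul, hs, bar₁_odd, lin_odd]
  have e3 : ∀ s, f.words (TensorAlgebra.ι R (evenPart C.grading c) * s) =
      TensorAlgebra.ι R (evenPart C'.grading (f.lin c)) * f.words s := by
    intro s
    rw [map_mul, words_ι, bar₁_even, map_zero, add_zero, lin_even]
  simp only [wordEven_cons, wordOdd_cons, map_add, map_smul, e1, e2, e3, ht.1, ht.2]
  constructor <;> abel

theorem coMonomials_moveToEnd (z : C.Words ⊗[R] (C.carrier ⊗[R] C.Words)) :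
    f.coMonomials (moveToEnd (oddPart C.grading) (evenPart C.grading) z) =
      moveToEnd (oddPart C'.grading) (evenPart C'.grading) (TensorProduct.map f.words.toLinearMap
        (TensorProduct.map f.lin f.words.toLinearMap) z) := by
  induction z with
  | zero => simp
  | add a b ha hb => simp only [map_add, ha, hb]
  | tmul u z =>
    induction z with
    | zero => simp
    | add a b ha hb => simp only [map_add, TensorProduct.tmul_add, ha, hb]
    | tmul c s =>
      have hs : f.words (wordSign (oddPart C.grading) (evenPart C.grading) s) =
        wordSign (oddPart C'.grading) (evenPart C'.grading) (f.words s) := f.words_wsgn s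
      rw [TensorProduct.map_tmul, TensorProduct.map_tmul, moveToEnd_tmul, moveToEnd_tmul, map_add,
        coMonomials, TensorProduct.map_tmul, TensorProduct.map_tmul]
      simp only [AlgHom.toLinearMap_apply, map_mul, map_sub, (f.words_parity u).1,
        (f.words_parity u).2, lin_odd, lin_even, hs]

theorem rotateInto_words (u v : C.Words) :
    C'.rotateInto (f.words u) (f.words v) = f.coMonomials (C.rotateInto u v) := by
  rw [rotateInto, rotateInto, CobarHoch.rotateInto, CobarHoch.rotateInto, coMonomials_moveToEnd,
    pick_words]
  refine congrArg _ ?_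
  induction pick u with
  | zero => simp
  | add a b ha hb => simp only [map_add, ha, hb]
  | tmul u z =>
    induction z with
    | zero => simp
    | add a b ha hb => simp only [map_add, TensorProduct.tmul_add, ha, hb]
    | tmul c s => simp

/-- On monomials the comparison map only concatenates words and never tests composability, so
naturality can be checked on all monomials, by the number of bracket entries. -/
theorem coHochMap_piBar (n : ℕ) :
    f.coHochMap n ∘ₗ C.piBar n = C'.piBar n ∘ₗ f.cobarMap.hochMap n :=
  Subquotient.hom_ext fun z => Subtype.ext (by
    change f.coMonomials (C.piMonomials z.1) = C'.piMonomials (f.cobarMap.monomials z.1)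
    generalize z.1 = z
    induction z using TensorProduct.induction_on with
    | zero => simp
    | add a b ha hb => simp only [map_add, ha, hb]
    | tmul t b =>
      refine word_induction (p := fun t => f.coMonomials (C.piMonomials (t ⊗ₜ b)) =
        C'.piMonomials (f.cobarMap.monomials (t ⊗ₜ b))) ?_
        (fun a b ha hb => by simp only [TensorProduct.add_tmul, map_add, ha, hb])
        (fun r a ha => ?_) (fun c t _ => ?_) t
      · rw [DGCat.Functor.monomials_tmul, piMonomials_one, _root_.map_one, piMonomials_one,
          piZero_cobarMap]
      · rw [← TensorProduct.smul_tmul', map_smul, map_smul, map_smul, map_smul, ha]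
      · refine word_induction (p := fun t => f.coMonomials (C.piMonomials
          ((TensorAlgebra.ι R c * t) ⊗ₜ b)) = C'.piMonomials (f.cobarMap.monomials
          ((TensorAlgebra.ι R c * t) ⊗ₜ b))) ?_
          (fun a b ha hb => by simp only [mul_add, TensorProduct.add_tmul, map_add, ha, hb])
          (fun r a ha => ?_) (fun c' t _ => ?_) t
        · rw [← DGCat.cons_tmul, DGCat.Functor.monomials_cons, DGCat.Functor.monomials_tmul,
            _root_.map_one, piMonomials_cons_nil, piMonomials_cons_nil, toWords_cobarMap,
            toWords_cobarMap, rotateInto_words]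
        · rw [mul_smul_comm, ← TensorProduct.smul_tmul', map_smul, map_smul, map_smul, map_smul, ha]
        · rw [← DGCat.cons_tmul, ← DGCat.cons_tmul, DGCat.Functor.monomials_cons,
            DGCat.Functor.monomials_cons, piMonomials_cons_cons, piMonomials_cons_cons, map_zero])

/-- By naturality, precomposing with the surjective comparison map gives the composite of two
morphisms. -/
theorem coHochMap_isMorphism : PreMixedComplex.IsMorphism f.coHochMap := by
  refine piBar_isMorphism.of_comp_surjective piBar_surjective ?_
  have h := piBar_isMorphism.comp f.cobarMap.hochMap_isMorphism
  have e : (fun n => f.coHochMap n ∘ₗ C.piBar n) =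
    fun n => C'.piBar n ∘ₗ f.cobarMap.hochMap n := funext f.coHochMap_piBar
  rw [e]
  exact h

end Hom
end CategoricalCoalgebra
namespace DGCat

/-! ### A contraction of the Hochschild complex of a dg category freely generated by letters -/

variable {R : Type u} [CommRing R] {A : DGCat.{u, v, w} R}

section Letters

variable (L : ∀ x y n, Set (A.Hom x y n))

/-- Composites of `l` letters from `x` to `y`, of total degree `n`. -/
inductive IsLetterWord : A.Obj → A.Obj → ℕ → ℕ → A.Tot → Prop
  | one (x : A.Obj) : IsLetterWord x x 0 0 (A.of x x 0 (A.one x))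
  | cons {x y z : A.Obj} {m n l : ℕ} {c : A.Hom x y m} {a : A.Tot} (hc : c ∈ L x y m)
      (h : IsLetterWord y z n l a) :
      IsLetterWord x z (m + n) (l + 1) (A.mul (A.of x y m c) a)

/-- Composable words `a₁ ⋯ aₚ` in composites of letters. The first number is the degree, with `aᵢ`
counted in degree `|aᵢ| + 1`. The second number is the weight: a composite of `l` letters of degree
`n` has weight `2 n + l`. -/
inductive IsLetterBar : A.Obj → A.Obj → ℕ → ℕ → A.Words → Prop
  | nil (x : A.Obj) : IsLetterBar x x 0 0 1
  | cons {x y z : A.Obj} {n l i m : ℕ} {a : A.Tot} {t : A.Words} (ha : IsLetterWord L x y n l a)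
      (h : IsLetterBar y z i m t) :
      IsLetterBar x z (n + 1 + i) (2 * n + l + m) (TensorAlgebra.ι R a * t)

/-- Linear combinations of composites of letters of weight at most `N`. -/
def letterSpan (x y : A.Obj) (n N : ℕ) : Submodule R A.Tot :=
  Submodule.span R {a | ∃ l, IsLetterWord L x y n l a ∧ 2 * n + l ≤ N}

/-- The chains of degree `n` that are linear combinations of monomials of weight less than `N`. -/
def chainFil (n N : ℕ) : Submodule R A.Monomials :=
  Submodule.span R {z | ∃ (x y : A.Obj) (i j m : ℕ) (t : A.Words) (b : A.Hom y x j),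
    IsLetterBar L x y i m t ∧ i + j = n ∧ m < N ∧ z = t ⊗ₜ A.of y x j b}

end Letters

variable (A) in
/-- Data exhibiting a dg category as freely generated, as a graded category, by sets of letters: the
linear map that splits the first letter off a composite of letters. -/
structure LetterSplitting where
  letter : ∀ x y n, Set (A.Hom x y n)
  split : A.Tot →ₗ[R] A.Tot ⊗[R] A.Tot
  split_one : ∀ x, split (A.of x x 0 (A.one x)) = 0
  split_mul : ∀ {x y z : A.Obj} {m n : ℕ} {c : A.Hom x y m}, c ∈ letter x y m →
    ∀ a : A.Hom y z n, split (A.mul (A.of x y m c) (A.of y z n a)) =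
      (-1 : R) ^ m • (A.of x y m c ⊗ₜ A.of y z n a)
  mem_span : ∀ {x y : A.Obj} {n : ℕ} (a : A.Hom x y n),
    A.of x y n a ∈ Submodule.span R {a | ∃ l, IsLetterWord letter x y n l a}
  -- The letter has weight 2(n + 1) + 1, so the bound says that its differential strictly lowers the
  -- weight.
  d_letter : ∀ {x y : A.Obj} {n : ℕ} {c : A.Hom x y (n + 1)}, c ∈ letter x y (n + 1) →
    A.dTot (A.of x y (n + 1) c) ∈ letterSpan letter x y n (2 * n + 2)

section Letters

variable {L : ∀ x y n, Set (A.Hom x y n)}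

theorem IsLetterWord.exists_of {x y : A.Obj} {n l : ℕ} {a : A.Tot}
    (h : IsLetterWord L x y n l a) : ∃ b, a = A.of x y n b := by
  induction h with
  | one x => exact ⟨_, rfl⟩
  | cons _ _ ih =>
    obtain ⟨b, rfl⟩ := ih
    exact ⟨_, PreDGCat.mul_of_of _ _ _⟩

theorem IsLetterWord.letter {x y : A.Obj} {m : ℕ} {c : A.Hom x y m} (hc : c ∈ L x y m) :
    IsLetterWord L x y m 1 (A.of x y m c) := by
  have h := IsLetterWord.cons hc (IsLetterWord.one y)
  rwa [A.comp_one] at h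

theorem IsLetterWord.mul {x y z : A.Obj} {m n k l : ℕ} {a b : A.Tot}
    (ha : IsLetterWord L x y m k a) (hb : IsLetterWord L y z n l b) :
    IsLetterWord L x z (m + n) (k + l) (A.mul a b) := by
  induction ha with
  | one x =>
    obtain ⟨b, rfl⟩ := hb.exists_of
    rw [A.one_comp]
    simpa using hb
  | cons hc _ ih =>
    rw [A.comp_assoc, add_assoc, add_right_comm]
    exact IsLetterWord.cons hc (ih hb)

theorem IsLetterWord.mem {x y : A.Obj} {n l N : ℕ} {a : A.Tot} (h : IsLetterWord L x y n l a)
    (hN : 2 * n + l ≤ N) : a ∈ letterSpan L x y n N :=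
  Submodule.subset_span ⟨l, h, hN⟩

theorem IsLetterWord.mul_mem {x y z : A.Obj} {m n l N M : ℕ} {a b : A.Tot}
    (ha : a ∈ letterSpan L x y m N) (hb : IsLetterWord L y z n l b) (hM : N + (2 * n + l) ≤ M) :
    A.mul a b ∈ letterSpan L x z (m + n) M := by
  induction ha using Submodule.span_induction with
  | mem a ha =>
    obtain ⟨k, ha, hk⟩ := ha
    exact (ha.mul hb).mem (by omega)
  | zero => simp
  | add a a' _ _ h h' =>
    rw [map_add, LinearMap.add_apply]
    exact add_mem h h'
  | smul r a _ h =>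
    rw [map_smul, LinearMap.smul_apply]
    exact Submodule.smul_mem _ _ h

theorem IsLetterBar.isWord {x y : A.Obj} {i m : ℕ} {t : A.Words} (h : IsLetterBar L x y i m t) :
    A.IsWord x y i t := by
  induction h with
  | nil x => exact IsWord.nil x
  | cons ha _ ih =>
    obtain ⟨b, rfl⟩ := ha.exists_of
    exact IsWord.cons b ih

theorem IsLetterBar.mem {x y : A.Obj} {i j m n N : ℕ} {t : A.Words} (h : IsLetterBar L x y i m t)
    (b : A.Hom y x j) (hn : i + j = n) (hN : m < N) : t ⊗ₜ A.of y x j b ∈ chainFil L n N :=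
  Submodule.subset_span ⟨x, y, i, j, m, t, b, h, hn, hN, rfl⟩

theorem chainFil_mono {n N N' : ℕ} (h : N ≤ N') : chainFil L n N ≤ chainFil L n N' := by
  refine Submodule.span_mono ?_
  rintro _ ⟨x, y, i, j, m, t, b, ht, hn, hN, rfl⟩
  exact ⟨x, y, i, j, m, t, b, ht, hn, hN.trans_le h, rfl⟩

theorem chainFil_le_chains (n N : ℕ) : chainFil L n N ≤ A.chains n := by
  refine Submodule.span_le.2 ?_
  rintro _ ⟨x, y, i, j, m, t, b, ht, hn, hN, rfl⟩
  exact mem_chains hn ht.isWord b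

theorem chainFil_zero (n : ℕ) : chainFil L n 0 = ⊥ := by
  refine Submodule.span_eq_bot.2 ?_
  rintro _ ⟨x, y, i, j, m, t, b, ht, hn, hN, rfl⟩
  exact absurd hN (Nat.not_lt_zero _)

theorem IsLetterBar.cons_mem {x y p : A.Obj} {i j k m n M N : ℕ} {a : A.Tot} {t : A.Words}
    (ha : a ∈ letterSpan L x p k M) (ht : IsLetterBar L p y i m t) (b : A.Hom y x j)
    (hn : k + 1 + i + j = n) (hN : M + m < N) :
    A.cons a (t ⊗ₜ A.of y x j b) ∈ chainFil L n N := by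
  induction ha using Submodule.span_induction with
  | mem a ha =>
    obtain ⟨l, ha, hl⟩ := ha
    rw [cons_tmul]
    exact (IsLetterBar.cons ha ht).mem b hn (by omega)
  | zero =>
    rw [cons_zero, LinearMap.zero_apply]
    exact zero_mem _
  | add a a' _ _ h h' =>
    rw [cons_add]
    exact add_mem h h'
  | smul r a _ h =>
    rw [cons_smul]
    exact Submodule.smul_mem _ _ h

end Letters

/-! ### The homotopy that splits off the first letter -/

namespace LetterSplitting

variable (S : A.LetterSplitting)

/-- The map `[c w | a₂ | ⋯ ] b ↦ (-1) ^ |c| [c | w | a₂ | ⋯ ] b`, where `c` is a letter. -/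
def homotopy : A.Monomials →ₗ[R] A.Monomials :=
  TensorProduct.map (LinearMap.mul' R A.Words ∘ₗ TensorProduct.map (LinearMap.mul' R A.Words ∘ₗ
    TensorProduct.map (TensorAlgebra.ι R) (TensorAlgebra.ι R) ∘ₗ S.split) LinearMap.id ∘ₗ uncons)
    LinearMap.id

theorem homotopy_nil (b : A.Tot) : S.homotopy ((1 : A.Words) ⊗ₜ b) = 0 := by
  simp [homotopy]

theorem homotopy_cons_of_split {a b c : A.Tot} {r : R} (h : S.split a = r • (c ⊗ₜ b))
    (z : A.Monomials) : S.homotopy (A.cons a z) = r • A.cons c (A.cons b z) := by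
  induction z using TensorProduct.induction_on with
  | zero => simp
  | add z z' hz hz' => simp only [map_add, smul_add, hz, hz']
  | tmul t d =>
    rw [cons_tmul, cons_tmul, cons_tmul, homotopy, TensorProduct.map_tmul, LinearMap.comp_apply,
      LinearMap.comp_apply, uncons_cons, TensorProduct.map_tmul, LinearMap.comp_apply,
      LinearMap.comp_apply, h, map_smul, map_smul, TensorProduct.map_tmul, LinearMap.mul'_apply,
      LinearMap.mul'_apply, smul_mul_assoc, mul_assoc]
    rfl

theorem homotopy_cons_one (x : A.Obj) (z : A.Monomials) :
    S.homotopy (A.cons (A.of x x 0 (A.one x)) z) = 0 := by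
  have h : S.split (A.of x x 0 (A.one x)) = (0 : R) • ((0 : A.Tot) ⊗ₜ (0 : A.Tot)) := by
    rw [S.split_one, zero_smul]
  rw [S.homotopy_cons_of_split h, zero_smul]

theorem homotopy_cons_mul {x y z : A.Obj} {m n : ℕ} {c : A.Hom x y m} (hc : c ∈ S.letter x y m)
    (a : A.Hom y z n) (w : A.Monomials) :
    S.homotopy (A.cons (A.mul (A.of x y m c) (A.of y z n a)) w) =
      (-1 : R) ^ m • A.cons (A.of x y m c) (A.cons (A.of y z n a) w) :=
  S.homotopy_cons_of_split (S.split_mul hc a) w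

theorem homotopy_cons_mul_dTot {x y z : A.Obj} {m n : ℕ} {c : A.Hom x y m}
    (hc : c ∈ S.letter x y m) (a : A.Hom y z n) (w : A.Monomials) :
    S.homotopy (A.cons (A.mul (A.of x y m c) (A.dTot (A.of y z n a))) w) =
      (-1 : R) ^ m • A.cons (A.of x y m c) (A.cons (A.dTot (A.of y z n a)) w) := by
  cases n with
  | zero => simp [PreDGCat.dTot_of_zero, cons_zero]
  | succ n => rw [PreDGCat.dTot_of_succ, S.homotopy_cons_mul hc]

/-- Merging the two entries of [c | a | ⋯] gives back [c a | ⋯]. The terms with the differential of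
a or of the remainder w cancel between the two composites. What is left are the terms with d c, and
the products with the entry after c a. -/
theorem barDiff_homotopy_add {x y z : A.Obj} {m n : ℕ} {c : A.Hom x y m}
    (hc : c ∈ S.letter x y m) (a : A.Hom y z n) (w : A.Monomials) :
    A.barDiff (S.homotopy (A.cons (A.mul (A.of x y m c) (A.of y z n a)) w)) +
      S.homotopy (A.barDiff (A.cons (A.mul (A.of x y m c) (A.of y z n a)) w)) =
    A.cons (A.mul (A.of x y m c) (A.of y z n a)) w -
      (-1 : R) ^ m • A.cons (A.dTot (A.of x y m c)) (A.cons (A.of y z n a) w) -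
      S.homotopy (A.cons (A.mul (A.dTot (A.of x y m c)) (A.of y z n a)) w) +
      S.homotopy (A.mergeFirst (A.mul (A.of x y m c) (A.of y z n a)) w) -
      A.cons (A.of x y m c) (A.mergeFirst (A.of y z n a) w) := by
  have s : (-1 : R) ^ m * (-1) ^ m = 1 := by rw [← pow_add, ← two_mul, pow_mul]; simp
  rw [S.homotopy_cons_mul hc, map_smul, barDiff_cons, barDiff_cons, barDiff_cons, mergeFirst_cons',
    A.leibniz, sgn_mul, PreDGCat.sgn_of, PreDGCat.sgn_of]
  simp only [map_smul, map_add, map_sub, LinearMap.smul_apply, LinearMap.add_apply, cons_add,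
    cons_smul, S.homotopy_cons_mul hc, S.homotopy_cons_mul_dTot hc, smul_sub, smul_smul]
  simp only [s, one_smul, ← mul_assoc, mul_comm _ ((-1 : R) ^ m)]
  abel

/-- The product c a b is again split after c. Hence, if a further bracket entry follows, the last
two terms in `barDiff_homotopy_add` cancel; only a bracket with one entry leaves a contribution. -/
theorem homotopy_mergeFirst_cons {x y z p : A.Obj} {m n k : ℕ} {c : A.Hom x y m}
    (hc : c ∈ S.letter x y m) (a : A.Hom y z n) (b : A.Hom z p k) (w : A.Monomials) :
    S.homotopy (A.mergeFirst (A.mul (A.of x y m c) (A.of y z n a)) (A.cons (A.of z p k b) w)) =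
      A.cons (A.of x y m c) (A.mergeFirst (A.of y z n a) (A.cons (A.of z p k b) w)) := by
  have s : (-1 : R) ^ m * (-1) ^ m = 1 := by rw [← pow_add, ← two_mul, pow_mul]; simp
  rw [mergeFirst_cons', mergeFirst_cons', sgn_mul, PreDGCat.sgn_of, PreDGCat.sgn_of]
  simp only [map_smul, LinearMap.smul_apply, cons_smul]
  rw [A.comp_assoc, PreDGCat.mul_of_of _ a b, S.homotopy_cons_mul hc]
  simp only [smul_smul]
  rw [s, mul_one]

end LetterSplitting

end DGCat
-- The weight filtration and projections
namespace DGCat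

variable {R : Type u} [CommRing R] {A : DGCat.{u, v, w} R}

namespace LetterSplitting

variable (S : A.LetterSplitting)

/-- Splitting an entry changes neither the total degree nor the number of the letters, so the weight
is unchanged. -/
theorem homotopy_letterBar {x y : A.Obj} {i j m n N : ℕ} {t : A.Words}
    (ht : IsLetterBar S.letter x y i m t) (b : A.Hom y x j) (hn : i + j + 1 = n) (hN : m < N) :
    S.homotopy (t ⊗ₜ A.of y x j b) ∈ chainFil S.letter n N := by
  cases ht with
  | nil x =>
    rw [S.homotopy_nil]
    exact zero_mem _
  | cons ha ht =>
    rw [← cons_tmul]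
    cases ha with
    | one x =>
      rw [S.homotopy_cons_one]
      exact zero_mem _
    | cons hc ha =>
      obtain ⟨a, rfl⟩ := ha.exists_of
      rw [S.homotopy_cons_mul hc, cons_tmul, cons_tmul]
      exact Submodule.smul_mem _ _ ((IsLetterBar.cons (.letter hc) (.cons ha ht)).mem b
        (by omega) (by omega))

theorem homotopy_mem_chainFil {n N : ℕ} {z : A.Monomials} (hz : z ∈ chainFil S.letter n N) :
    S.homotopy z ∈ chainFil S.letter (n + 1) N := by
  induction hz using Submodule.span_induction with
  | mem z hz =>
    obtain ⟨x, y, i, j, m, t, b, ht, hn, hN, rfl⟩ := hz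
    exact S.homotopy_letterBar ht b (by omega) hN
  | zero => simp
  | add a b _ _ ha hb =>
    rw [map_add]
    exact add_mem ha hb
  | smul r a _ ha =>
    rw [map_smul]
    exact Submodule.smul_mem _ _ ha

/-- An identity in the first place is killed by the homotopy, and one further behind is not touched.
In the latter case the first entry is expanded into products of letters. -/
theorem homotopy_mem_degenerate {n : ℕ} {z : A.Monomials} (hz : z ∈ A.degenerate n) :
    S.homotopy z ∈ A.degenerate (n + 1) := by
  induction hz using Submodule.span_induction with
  | mem z hz =>
    obtain ⟨x, y, i, j, hn, t, ht, b, rfl⟩ := hz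
    cases ht with
    | head ht =>
      rw [← cons_tmul, S.homotopy_cons_one]
      exact zero_mem _
    | @cons x p y k n' t a ht =>
      rw [← cons_tmul]
      refine Submodule.span_induction (p := fun a _ => S.homotopy (A.cons a (t ⊗ₜ A.of y x j b)) ∈
        A.degenerate (n + 1)) ?_ ?_ ?_ ?_ (S.mem_span a)
      · rintro _ ⟨l, ha⟩
        cases ha with
        | one x =>
          rw [S.homotopy_cons_one]
          exact zero_mem _
        | cons hc ha =>
          obtain ⟨a, rfl⟩ := ha.exists_of
          rw [S.homotopy_cons_mul hc, cons_tmul, cons_tmul]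
          exact Submodule.smul_mem _ _ (mem_degenerate (by omega) (.cons _ (.cons _ ht)) b)
      · simp [cons_zero]
      · intro a a' _ _ h h'
        rw [cons_add, LinearMap.add_apply, map_add]
        exact add_mem h h'
      · intro r a _ h
        rw [cons_smul, LinearMap.smul_apply, map_smul]
        exact Submodule.smul_mem _ _ h
  | zero => simp
  | add a b _ _ ha hb =>
    rw [map_add]
    exact add_mem ha hb
  | smul r a _ ha =>
    rw [map_smul]
    exact Submodule.smul_mem _ _ ha

/-- Words in arbitrary morphisms are linear combinations of words in composites of letters. -/
theorem isWord_mem_span {x y : A.Obj} {i : ℕ} {t : A.Words} (ht : A.IsWord x y i t) :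
    t ∈ Submodule.span R {t | ∃ m, IsLetterBar S.letter x y i m t} := by
  induction ht with
  | nil x => exact Submodule.subset_span ⟨0, .nil x⟩
  | @cons x y z n i t a _ ih =>
    refine Submodule.span_induction (p := fun a _ => TensorAlgebra.ι R a * t ∈ _) ?_ ?_ ?_ ?_
      (S.mem_span a)
    · rintro a ⟨l, ha⟩
      refine Submodule.span_induction (p := fun t _ => TensorAlgebra.ι R a * t ∈ _) ?_ ?_ ?_ ?_ ih
      · rintro t ⟨m, ht⟩
        exact Submodule.subset_span ⟨_, .cons ha ht⟩
      · rw [mul_zero]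
        exact zero_mem _
      · intro s t _ _ hs ht
        rw [mul_add]
        exact add_mem hs ht
      · intro r t _ ht
        rw [mul_smul_comm]
        exact Submodule.smul_mem _ _ ht
    · rw [map_zero, zero_mul]
      exact zero_mem _
    · intro a a' _ _ h h'
      rw [map_add, add_mul]
      exact add_mem h h'
    · intro r a _ h
      rw [map_smul, smul_mul_assoc]
      exact Submodule.smul_mem _ _ h

/-- The weight filtration is exhaustive, because the letters generate. -/
theorem exists_mem_chainFil {n : ℕ} {z : A.Monomials} (hz : z ∈ A.chains n) :
    ∃ N, z ∈ chainFil S.letter n N := by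
  have hadd : ∀ z z', (∃ N, z ∈ chainFil S.letter n N) → (∃ N, z' ∈ chainFil S.letter n N) →
      ∃ N, z + z' ∈ chainFil S.letter n N := by
    rintro z z' ⟨N, hN⟩ ⟨N', hN'⟩
    exact ⟨max N N', add_mem (chainFil_mono (le_max_left _ _) hN)
      (chainFil_mono (le_max_right _ _) hN')⟩
  have hsmul : ∀ (r : R) z, (∃ N, z ∈ chainFil S.letter n N) →
      ∃ N, r • z ∈ chainFil S.letter n N := by
    rintro r z ⟨N, hN⟩
    exact ⟨N, Submodule.smul_mem _ _ hN⟩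
  refine chains_induction (p := fun z => ∃ N, z ∈ chainFil S.letter n N) ⟨0, zero_mem _⟩ hadd hsmul
    (fun x y i j hij t ht b => ?_) hz
  refine Submodule.span_induction (p := fun t _ => ∃ N, t ⊗ₜ A.of y x j b ∈ chainFil S.letter n N)
    ?_ ?_ ?_ ?_ (S.isWord_mem_span ht)
  · rintro t ⟨m, ht⟩
    exact ⟨m + 1, ht.mem b hij (Nat.lt_succ_self m)⟩
  · exact ⟨0, by simp⟩
  · intro s t _ _ hs ht
    rw [TensorProduct.add_tmul]
    exact hadd _ _ hs ht
  · intro r t _ ht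
    exact hsmul r _ ht

theorem homotopy_mem_chains {n : ℕ} {z : A.Monomials} (hz : z ∈ A.chains n) :
    S.homotopy z ∈ A.chains (n + 1) := by
  obtain ⟨N, hN⟩ := S.exists_mem_chainFil hz
  exact chainFil_le_chains _ _ (S.homotopy_mem_chainFil hN)

/-- A projection of the Hochschild complex onto the span of the monomials `[ ] b` and `[c] b`, where
`c` is a letter, that vanishes on the image of the commutator of the homotopy with the
differential. -/
structure IsProjection (J : A.Monomials →ₗ[R] A.Monomials) : Prop where
  nil : ∀ {x : A.Obj} {n : ℕ} (b : A.Hom x x n), J (1 ⊗ₜ A.of x x n b) = 1 ⊗ₜ A.of x x n b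
  cons_one : ∀ {x : A.Obj} {n : ℕ} (b : A.Hom x x n),
    J (A.cons (A.of x x 0 (A.one x)) (1 ⊗ₜ A.of x x n b)) = 0
  cons_mul : ∀ {x y z : A.Obj} {m n j : ℕ} {c : A.Hom x y m}, c ∈ S.letter x y m →
    ∀ (a : A.Hom y z n) (b : A.Hom z x j),
    J (A.cons (A.mul (A.of x y m c) (A.of y z n a)) (1 ⊗ₜ A.of z x j b)) =
      A.cons (A.of x y m c) (1 ⊗ₜ A.mul (A.of y z n a) (A.of z x j b)) +
        (-1 : R) ^ (m * (n + j)) • J (A.cons (A.of y z n a) (1 ⊗ₜ A.mul (A.of z x j b) (A.of x y m c)))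
  cons_cons : ∀ a b z, J (A.cons a (A.cons b z)) = 0
  hochDiff_homotopy : ∀ {n : ℕ} {z : A.Monomials}, z ∈ A.chains n →
    J (A.hochDiff (S.homotopy z)) = 0

variable {S}

/-- Unfolding the recursion, J turns [a]b into a sum of brackets with a single letter of a as entry,
so the weight does not increase. -/
theorem IsProjection.mem_chainFil {J : A.Monomials →ₗ[R] A.Monomials} (hJ : S.IsProjection J)
    {x y : A.Obj} {n l j k N : ℕ} {a : A.Tot} (ha : IsLetterWord S.letter x y n l a)
    (b : A.Hom y x j) (hk : n + 1 + j = k) (hN : 2 * n + l < N) :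
    J (A.cons a (1 ⊗ₜ A.of y x j b)) ∈ chainFil S.letter k N := by
  induction ha generalizing j k N with
  | one x =>
    rw [hJ.cons_one]
    exact zero_mem _
  | cons hc ha ih =>
    obtain ⟨a, rfl⟩ := ha.exists_of
    rw [hJ.cons_mul hc, PreDGCat.mul_of_of, PreDGCat.mul_of_of]
    refine add_mem (IsLetterBar.cons_mem (IsLetterWord.mem (.letter hc) le_rfl) (.nil _) _ (by omega)
      (by omega)) (Submodule.smul_mem _ _ (ih _ (by omega) (by omega)))

theorem IsProjection.degenerate {J : A.Monomials →ₗ[R] A.Monomials} (hJ : S.IsProjection J)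
    {n : ℕ} {z : A.Monomials} (hz : z ∈ A.degenerate n) : J z = 0 := by
  induction hz using Submodule.span_induction with
  | mem z hz =>
    obtain ⟨x, y, i, j, hn, t, ht, b, rfl⟩ := hz
    cases ht with
    | head ht =>
      cases ht with
      | nil => rw [← cons_tmul, hJ.cons_one]
      | cons a ht => rw [← cons_tmul, ← cons_tmul, hJ.cons_cons]
    | cons a ht =>
      cases ht with
      | head ht => rw [← cons_tmul, ← cons_tmul, hJ.cons_cons]
      | cons a ht => rw [← cons_tmul, ← cons_tmul, hJ.cons_cons]
  | zero => exact map_zero _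
  | add a b _ _ ha hb => rw [map_add, ha, hb, add_zero]
  | smul r a _ ha => rw [map_smul, ha, smul_zero]

end LetterSplitting

variable (A) in
/-- The degenerate chains of degree `n - 1`. -/
def lowerDegenerate : ℕ → Submodule R A.Monomials
  | 0 => ⊥
  | n + 1 => A.degenerate n

theorem degenerate_zero : A.degenerate 0 = ⊥ := by
  refine Submodule.span_eq_bot.2 ?_
  rintro _ ⟨x, y, i, j, hn, t, ht, b, rfl⟩
  cases ht <;> omega

theorem hochDiff_mem_lowerDegenerate {n : ℕ} {z : A.Monomials} (hz : z ∈ A.degenerate n) :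
    A.hochDiff z ∈ A.lowerDegenerate n := by
  cases n with
  | zero =>
    rw [degenerate_zero, Submodule.mem_bot] at hz
    rw [hz, map_zero]
    exact zero_mem _
  | succ n => exact hochDiff_mem_degenerate n z hz

namespace LetterSplitting

variable {S : A.LetterSplitting}

theorem homotopy_lowerDegenerate {n : ℕ} {z : A.Monomials} (hz : z ∈ A.lowerDegenerate n) :
    S.homotopy z ∈ A.degenerate n := by
  cases n with
  | zero =>
    have h : z = 0 := hz
    rw [h, map_zero]
    exact zero_mem _
  | succ n => exact S.homotopy_mem_degenerate hz

/-- Applied with a' the differential of a letter, this disposes of the second term with d c in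
`barDiff_homotopy_add`. -/
theorem homotopy_mul_dTot_mem {x y z p : A.Obj} {m n l i j k M N : ℕ} {a' a : A.Tot} {t : A.Words}
    (ha' : a' ∈ letterSpan S.letter x y m M) (ha : IsLetterWord S.letter y z n l a)
    (ht : IsLetterBar S.letter z p i k t) (b : A.Hom p x j) {q : ℕ} (hq : m + n + 2 + i + j = q)
    (hN : M + (2 * n + l) + k < N) :
    S.homotopy (A.cons (A.mul a' a) (t ⊗ₜ A.of p x j b)) ∈ chainFil S.letter q N := by
  have h := IsLetterBar.cons_mem (IsLetterWord.mul_mem ha' ha le_rfl) ht b rfl hN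
  have h' := S.homotopy_mem_chainFil h
  rwa [show m + n + 1 + i + j + 1 = q by omega] at h'

/-- The first entry of [c | a]b is carried around. The result, up to sign, is the argument of J in
the recursive term of `IsProjection.cons_mul`. -/
theorem wrap_homotopy_one {x y z : A.Obj} {m n j : ℕ} {c : A.Hom x y m}
    (hc : c ∈ S.letter x y m) (a : A.Hom y z n) (b : A.Hom z x j) :
    A.wrap (S.homotopy (A.cons (A.mul (A.of x y m c) (A.of y z n a)) (1 ⊗ₜ A.of z x j b))) =
      -((-1 : R) ^ (m * (n + j)) • A.cons (A.of y z n a)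
        (1 ⊗ₜ A.mul (A.of z x j b) (A.of x y m c))) := by
  rw [S.homotopy_cons_mul hc, map_smul, wrap_cons', msgn_cons, msgn_nil, PreDGCat.sgn_of,
    PreDGCat.sgn_of, even_of, odd_of, cons_smul, LinearMap.smul_apply, TensorProduct.tmul_smul,
    map_smul]
  rcases Nat.even_or_odd m with h | h
  · have h0 : A.rmul (0 : A.Tot) = 0 := by simp [rmul]
    rw [if_pos h, if_pos h, h0, LinearMap.zero_apply, add_zero, h.neg_one_pow,
      (h.mul_right _).neg_one_pow, one_smul, one_smul, rmul_cons, rmul_nil]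
  · have h0 : A.rmul (0 : A.Tot) = 0 := by simp [rmul]
    rw [if_neg (Nat.not_even_iff_odd.2 h), if_neg (Nat.not_even_iff_odd.2 h), h0,
      LinearMap.zero_apply, zero_add, pow_mul, h.neg_one_pow, map_neg, map_smul, map_smul, rmul_cons,
      rmul_nil, pow_add]
    simp only [smul_smul, neg_one_mul, neg_smul, neg_neg]

/-- The homotopy contracts a monomial onto its projection, up to monomials of smaller weight. -/
theorem IsProjection.perturbation {J : A.Monomials →ₗ[R] A.Monomials} (hJ : S.IsProjection J)
    {x y : A.Obj} {i j k n : ℕ} {t : A.Words} (ht : IsLetterBar S.letter x y i k t)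
    (b : A.Hom y x j) (hn : i + j = n) :
    t ⊗ₜ A.of y x j b - (A.hochDiff (S.homotopy (t ⊗ₜ A.of y x j b)) +
      S.homotopy (A.hochDiff (t ⊗ₜ A.of y x j b))) - J (t ⊗ₜ A.of y x j b) ∈
      chainFil S.letter n k ⊔ A.degenerate n := by
  cases ht with
  | nil x =>
    rw [S.homotopy_nil, hochDiff, map_zero, zero_add, LinearMap.add_apply, barDiff_nil, wrap_nil,
      add_zero, S.homotopy_nil, sub_zero, hJ.nil, sub_self]
    exact zero_mem _
  | @cons x p y q l i' m a t ha ht =>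
    cases ha with
    | one x =>
      -- A leading identity makes the monomial degenerate, and then every term is degenerate or
      -- zero.
      have hz : (TensorAlgebra.ι R (A.of x x 0 (A.one x)) * t) ⊗ₜ[R] A.of y x j b ∈
        A.degenerate n := mem_degenerate hn (.head ht.isWord) b
      have h0 : S.homotopy ((TensorAlgebra.ι R (A.of x x 0 (A.one x)) * t) ⊗ₜ[R] A.of y x j b) = 0 := by
        rw [← cons_tmul, S.homotopy_cons_one]
      rw [hJ.degenerate hz, h0, map_zero, zero_add, sub_zero]
      exact Submodule.mem_sup_right (sub_mem hz
        (homotopy_lowerDegenerate (hochDiff_mem_lowerDegenerate hz)))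
    | @cons _ r _ u s l c a hc ha =>
      refine Submodule.mem_sup_left ?_
      obtain ⟨a, rfl⟩ := ha.exists_of
      rw [← cons_tmul]
      have key := S.barDiff_homotopy_add hc a (t ⊗ₜ A.of y x j b)
      -- Both terms with d c have smaller weight, since the differential of a letter lowers the
      -- weight.
      have h1 : (-1 : R) ^ u • A.cons (A.dTot (A.of x r u c)) (A.cons (A.of r p s a)
          (t ⊗ₜ A.of y x j b)) ∈ chainFil S.letter n (2 * (u + s) + (l + 1) + m) := by
        refine Submodule.smul_mem _ _ ?_
        cases u with
        | zero =>
          rw [PreDGCat.dTot_of_zero, cons_zero]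
          exact zero_mem _
        | succ u =>
          rw [cons_tmul]
          exact IsLetterBar.cons_mem (S.d_letter hc) (.cons ha ht) b (by omega) (by omega)
      have h2 : S.homotopy (A.cons (A.mul (A.dTot (A.of x r u c)) (A.of r p s a))
          (t ⊗ₜ A.of y x j b)) ∈ chainFil S.letter n (2 * (u + s) + (l + 1) + m) := by
        cases u with
        | zero =>
          rw [PreDGCat.dTot_of_zero, map_zero, LinearMap.zero_apply, cons_zero,
            LinearMap.zero_apply, map_zero]
          exact zero_mem _
        | succ u => exact homotopy_mul_dTot_mem (S.d_letter hc) ha ht b (by omega) (by omega)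
      -- Apart from the terms with d c there remain the products with the following entry, the two
      -- cyclic terms and the projection.
      suffices h : A.cons (A.of x r u c) (A.mergeFirst (A.of r p s a) (t ⊗ₜ A.of y x j b)) -
          S.homotopy (A.mergeFirst (A.mul (A.of x r u c) (A.of r p s a)) (t ⊗ₜ A.of y x j b)) -
          A.wrap (S.homotopy (A.cons (A.mul (A.of x r u c) (A.of r p s a)) (t ⊗ₜ A.of y x j b))) -
          S.homotopy (A.wrap (A.cons (A.mul (A.of x r u c) (A.of r p s a)) (t ⊗ₜ A.of y x j b))) -
          J (A.cons (A.mul (A.of x r u c) (A.of r p s a)) (t ⊗ₜ A.of y x j b)) ∈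
          chainFil S.letter n (2 * (u + s) + (l + 1) + m) by
        convert add_mem (add_mem h1 h2) h using 1
        rw [hochDiff, LinearMap.add_apply, LinearMap.add_apply, map_add, add_add_add_comm, key]
        abel
      cases ht with
      | nil =>
        -- For a bracket with one entry, the cyclic term of the differential has an empty bracket,
        -- on which the homotopy is zero.
        have hw : S.homotopy (A.wrap (A.cons (A.mul (A.of x r u c) (A.of r y s a))
            (1 ⊗ₜ A.of y x j b))) = 0 := by
          rw [PreDGCat.mul_of_of, cons_tmul]
          obtain ⟨q, hq⟩ := wrap_word (A.comp x r y u s c a) (IsWord.nil y) b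
          rw [hq, map_smul, S.homotopy_nil, smul_zero]
        -- The term [c]ab cancels against the first term of J. There remains the difference of [a]bc
        -- and its projection, up to a common sign; as c has left the bracket, the weight is
        -- smaller.
        rw [hw, mergeFirst_nil, mergeFirst_nil, S.homotopy_nil, wrap_homotopy_one hc, hJ.cons_mul hc,
          sub_zero, sub_zero, sub_neg_eq_add, add_sub_add_left_eq_sub,
          PreDGCat.mul_of_of]
        exact sub_mem (Submodule.smul_mem _ _
          (IsLetterBar.cons_mem (ha.mem le_rfl) (.nil _) _ (by omega) (by omega)))
          (Submodule.smul_mem _ _ (hJ.mem_chainFil ha _ (by omega) (by omega)))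
      | @cons _ p' _ s' l' i'' m' a' t ha' ht =>
        obtain ⟨a', rfl⟩ := ha'.exists_of
        have hw : A.IsWord p y _ (TensorAlgebra.ι R (A.of p p' s' a') * t) := .cons a' ht.isWord
        -- Here c has moved from the bracket into the coefficient, which does not count for the
        -- weight.
        have e1 : A.wrap (S.homotopy (A.cons (A.mul (A.of x r u c) (A.of r p s a))
            ((TensorAlgebra.ι R (A.of p p' s' a') * t) ⊗ₜ A.of y x j b))) ∈
            chainFil S.letter n (2 * (u + s) + (l + 1) + (2 * s' + l' + m')) := by
          rw [S.homotopy_cons_mul hc, map_smul, cons_tmul, cons_tmul]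
          obtain ⟨q, hq⟩ := wrap_word c (IsWord.cons a hw) b
          rw [hq]
          exact Submodule.smul_mem _ _ (Submodule.smul_mem _ _ (IsLetterBar.mem
            (.cons ha (.cons ha' ht)) _ (by omega) (by omega)))
        -- Here the whole entry c a has left the bracket before the homotopy is applied.
        have e2 : S.homotopy (A.wrap (A.cons (A.mul (A.of x r u c) (A.of r p s a))
            ((TensorAlgebra.ι R (A.of p p' s' a') * t) ⊗ₜ A.of y x j b))) ∈
            chainFil S.letter n (2 * (u + s) + (l + 1) + (2 * s' + l' + m')) := by
          rw [PreDGCat.mul_of_of, cons_tmul]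
          obtain ⟨q, hq⟩ := wrap_word (A.comp x r p u s c a) hw b
          rw [hq, map_smul]
          exact Submodule.smul_mem _ _ (homotopy_letterBar _ (.cons ha' ht) _ (by omega) (by omega))
        rw [← cons_tmul] at e1 e2 ⊢
        rw [S.homotopy_mergeFirst_cons hc, hJ.cons_cons, sub_self, zero_sub, sub_zero]
        exact sub_mem (neg_mem e1) e2

theorem IsProjection.perturbation_mem {J : A.Monomials →ₗ[R] A.Monomials} (hJ : S.IsProjection J)
    {n N : ℕ} {z : A.Monomials} (hz : z ∈ chainFil S.letter n (N + 1)) :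
    z - (A.hochDiff (S.homotopy z) + S.homotopy (A.hochDiff z)) - J z ∈
      chainFil S.letter n N ⊔ A.degenerate n := by
  induction hz using Submodule.span_induction with
  | mem z hz =>
    obtain ⟨x, y, i, j, m, t, b, ht, hn, hN, rfl⟩ := hz
    have h : chainFil S.letter n m ≤ chainFil S.letter n N := chainFil_mono (Nat.le_of_lt_succ hN)
    exact sup_le_sup_right h _ (hJ.perturbation ht b hn)
  | zero => simp
  | add a b _ _ ha hb =>
    convert add_mem ha hb using 1
    simp only [map_add]
    abel
  | smul r a _ ha =>
    convert Submodule.smul_mem _ r ha using 1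
    simp only [map_smul, smul_sub, smul_add]

/-- Subtracting δHz from z leaves a chain of smaller weight, up to degenerate chains. It is still a
cycle modulo degenerate chains and is still annihilated by J, as JδH = 0, so the induction on the
weight applies to it. -/
theorem IsProjection.exists_chainFil {J : A.Monomials →ₗ[R] A.Monomials} (hJ : S.IsProjection J)
    (n N : ℕ) : ∀ z ∈ chainFil S.letter n N, A.hochDiff z ∈ A.lowerDegenerate n → J z = 0 →
    ∃ y ∈ A.chains n, z - A.hochDiff (S.homotopy y) ∈ A.degenerate n := by
  induction N with
  | zero =>
    intro z hz _ _
    rw [chainFil_zero, Submodule.mem_bot] at hz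
    exact ⟨0, zero_mem _, by simp [hz]⟩
  | succ N ih =>
    intro z hz hd hJz
    have h := hJ.perturbation_mem hz
    rw [hJz, sub_zero] at h
    obtain ⟨z₁, hz₁, e, he, h⟩ := Submodule.mem_sup.1 h
    have hH := homotopy_lowerDegenerate (S := S) hd
    have hzc := chainFil_le_chains _ _ hz
    -- Up to sign this is z - δHz, corrected only by degenerate chains: Hδz is degenerate because δz
    -- is.
    have h1 : z₁ = z - A.hochDiff (S.homotopy z) - (S.homotopy (A.hochDiff z) + e) := by
      rw [eq_sub_iff_add_eq.2 h]
      abel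
    obtain ⟨y, hy, hy'⟩ := ih z₁ hz₁
      (by
        rw [h1, map_sub, map_sub, hochDiff_hochDiff, sub_zero]
        exact sub_mem hd (hochDiff_mem_lowerDegenerate (add_mem hH he)))
      (by rw [h1, map_sub, map_sub, hJz, hJ.hochDiff_homotopy hzc, hJ.degenerate (add_mem hH he),
        sub_zero, sub_zero])
    -- The primitive collects H of the chains of all stages: z at this stage, y for the remaining
    -- weights.
    refine ⟨z + y, add_mem hzc hy, ?_⟩
    convert add_mem hy' (add_mem hH he) using 1
    rw [h1, map_add, map_add]
    abel

/-- A chain that is a cycle modulo degenerate chains and is annihilated by the projection is a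
boundary modulo degenerate chains. -/
theorem IsProjection.exists_hochDiff_homotopy {J : A.Monomials →ₗ[R] A.Monomials}
    (hJ : S.IsProjection J) {n : ℕ} {z : A.Monomials} (hz : z ∈ A.chains n)
    (hd : A.hochDiff z ∈ A.lowerDegenerate n) (hJz : J z = 0) :
    ∃ y ∈ A.chains n, z - A.hochDiff (S.homotopy y) ∈ A.degenerate n := by
  obtain ⟨N, hN⟩ := S.exists_mem_chainFil hz
  exact hJ.exists_chainFil n N z hN hd hJz

end LetterSplitting

end DGCat
namespace DGCat.LetterSplitting

variable {R : Type u} [CommRing R] {A : DGCat.{u, v, w} R} (S : A.LetterSplitting)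

/-- Every term in the image of the homotopy has at least two bracket entries, whatever the splitting
map does. -/
theorem comp_homotopy_eq_zero {X : Type*} [AddCommGroup X] [Module R X] {f : A.Monomials →ₗ[R] X}
    (hf : ∀ a b z, f (A.cons a (A.cons b z)) = 0) (z : A.Monomials) : f (S.homotopy z) = 0 := by
  refine monomial_induction (p := fun z => f (S.homotopy z) = 0) (by simp)
    (fun z z' h h' => by rw [map_add, map_add, h, h', add_zero])
    (fun a => by rw [S.homotopy_nil, map_zero]) (fun a z h => ?_) z
  clear h
  induction z using TensorProduct.induction_on with
  | zero => simp
  | add z z' h h' => rw [map_add, map_add, map_add, h, h', add_zero]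
  | tmul t d =>
    rw [cons_tmul, homotopy, TensorProduct.map_tmul, LinearMap.comp_apply, LinearMap.comp_apply,
      uncons_cons, TensorProduct.map_tmul, LinearMap.comp_apply, LinearMap.comp_apply,
      LinearMap.mul'_apply]
    induction S.split a with
    | zero => simp
    | add s s' h h' => simp only [map_add, add_mul, TensorProduct.add_tmul, h, h', add_zero]
    | tmul b c =>
      have h := hf b c (t ⊗ₜ d)
      rw [cons_tmul, cons_tmul, ← mul_assoc] at h
      exact h

end DGCat.LetterSplitting

namespace CategoricalCoalgebra

variable {R : Type u} [CommRing R] {C : CategoricalCoalgebra.{u, v} R}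

/-! ### The decomposition of a categorical coalgebra into its components -/

/-- The functional φ depends only on the component of degree zero, so contracting with it is
determined by the right coaction. -/
theorem actR_of_right_eq (φ : C.carrier →ₗ[R] R) (hφ : φ ∘ₗ C.proj₀ = φ) {y : C.Ob} {c : C.carrier}
    (hc : TensorProduct.map LinearMap.id C.proj₀ (C.comul c) = c ⊗ₜ y.1) :
    actR φ c = φ y.1 • c := by
  have h2 : TensorProduct.map (LinearMap.id : C.carrier →ₗ[R] C.carrier) φ =
      TensorProduct.map LinearMap.id φ ∘ₗ TensorProduct.map LinearMap.id C.proj₀ := by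
    rw [← TensorProduct.map_comp, hφ]
    simp
  rw [actR, h2]
  simp only [LinearMap.comp_apply, hc]
  simp

theorem actL_of_left_eq (φ : C.carrier →ₗ[R] R) (hφ : φ ∘ₗ C.proj₀ = φ) {x : C.Ob} {c : C.carrier}
    (hc : TensorProduct.map C.proj₀ LinearMap.id (C.comul c) = x.1 ⊗ₜ c) :
    actL φ c = φ x.1 • c := by
  have h2 : TensorProduct.map φ (LinearMap.id : C.carrier →ₗ[R] C.carrier) =
      TensorProduct.map φ LinearMap.id ∘ₗ TensorProduct.map C.proj₀ LinearMap.id := by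
    rw [← TensorProduct.map_comp, hφ]
    simp
  rw [actL, h2]
  simp only [LinearMap.comp_apply, hc]
  simp

theorem coord_comp_proj (z : C.Ob) : coord z ∘ₗ C.proj₀ = coord z :=
  LinearMap.ext fun c => coord_proj z c

/-- The counit is the sum of the coordinate functionals, and the sum is finite on each element. The
set s may be enlarged, so that finitely many elements can be treated together. -/
theorem exists_eq_sum_actR (c : C.carrier) :
    ∃ s : Finset C.Ob, ∀ t, s ⊆ t → c = ∑ z ∈ t, actR (coord z) c := by
  classical
  have key : ∀ τ : C.carrier ⊗[R] C.carrier, ∃ s : Finset C.Ob, ∀ t, s ⊆ t →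
      TensorProduct.rid R C.carrier (TensorProduct.map LinearMap.id C.counit τ) =
        ∑ z ∈ t, TensorProduct.rid R C.carrier
          (TensorProduct.map LinearMap.id (coord z) τ) := by
    intro τ
    induction τ with
    | zero => exact ⟨∅, by simp⟩
    | tmul a b =>
      obtain ⟨s, hs⟩ := exists_coord_sum b
      refine ⟨s, fun t ht => ?_⟩
      simp [hs t ht, Finset.sum_smul]
    | add a b ha hb =>
      obtain ⟨s, hs⟩ := ha
      obtain ⟨t, ht⟩ := hb
      refine ⟨s ∪ t, fun r hr => ?_⟩
      simp only [map_add, Finset.sum_add_distrib]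
      rw [hs r (Finset.union_subset_left hr), ht r (Finset.union_subset_right hr)]
  obtain ⟨s, hs⟩ := key (C.comul c)
  refine ⟨s, fun t ht => ?_⟩
  have h2 : TensorProduct.map LinearMap.id C.counit (C.comul c) = c ⊗ₜ (1 : R) :=
    Coalgebra.lTensor_counit_comul c
  have h1 := hs t ht
  rw [h2, TensorProduct.rid_tmul, one_smul] at h1
  exact h1

theorem actL_actR_coord_mem (x y : C.Ob) {n : ℕ} {c : C.carrier} (hc : c ∈ C.grading n) :
    actL (coord x) (actR (coord y) c) ∈ C.part x y n :=
  C.mem_part.2 ⟨actL_coord_mem x (actR_coord_mem y hc), left_actL x _,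
    right_actL _ (right_actR y c)⟩

variable (C) in
/-- The direct sum of the components of a categorical coalgebra. -/
abbrev PartSum : Type v := ⨁ i : C.Ob × C.Ob × ℕ, C.part i.1 i.2.1 i.2.2

open Classical in
variable (C) in
/-- The canonical map from the direct sum of the components. -/
def partSum : C.PartSum →ₗ[R] C.carrier :=
  DirectSum.coeLinearMap fun i : C.Ob × C.Ob × ℕ => C.part i.1 i.2.1 i.2.2

open Classical in
theorem partSum_lof (i : C.Ob × C.Ob × ℕ) (c : C.part i.1 i.2.1 i.2.2) :
    C.partSum (DirectSum.lof R _ (fun i : C.Ob × C.Ob × ℕ => C.part i.1 i.2.1 i.2.2) i c) = c.1 :=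
  DirectSum.coeLinearMap_lof _ _ _

/-- The projection onto a component. -/
def partProj (i : C.Ob × C.Ob × ℕ) : C.carrier →ₗ[R] C.carrier :=
  gradedScale C.grading (fun n => if n = i.2.2 then 1 else 0) ∘ₗ actL (coord i.1) ∘ₗ
    actR (coord i.2.1)

open Classical in
-- On a component the two contractions are multiplication by the coordinates of its end points,
-- hence by zero or one.
theorem partProj_of_mem (i j : C.Ob × C.Ob × ℕ) {c : C.carrier} (hc : c ∈ C.part j.1 j.2.1 j.2.2) :
    partProj i c = if j = i then c else 0 := by
  obtain ⟨hn, hl, hr⟩ := C.mem_part.1 hc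
  rw [partProj, LinearMap.comp_apply, LinearMap.comp_apply, actR_of_right_eq _ (coord_comp_proj _) hr,
    map_smul, actL_of_left_eq _ (coord_comp_proj _) hl, map_smul, map_smul, gradedScale_mem _ _ hn]
  by_cases h1 : j.1 = i.1
  · by_cases h2 : j.2.1 = i.2.1
    · by_cases h3 : j.2.2 = i.2.2
      · have h : j = i := Prod.ext h1 (Prod.ext h2 h3)
        subst h
        simp [coord_self]
      · have h : j ≠ i := fun h => h3 (by rw [h])
        simp [h3, h]
    · have h : j ≠ i := fun h => h2 (by rw [h])
      simp [coord_ne h2, h]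
  · have h : j ≠ i := fun h => h1 (by rw [h])
    simp [coord_ne h1, h]

/-- The projections `partProj` recover each coordinate of an element of the direct sum. -/
theorem partSum_injective : Function.Injective C.partSum := by
  classical
  refine (injective_iff_map_eq_zero _).2 fun v hv => ?_
  have key : ∀ (v : C.PartSum) i, partProj i (C.partSum v) = (v i).1 := by
    intro v i
    induction v using DirectSum.induction_on with
    | zero => simp
    | add a b ha hb => 
      rw [map_add, map_add, ha, hb]
      rfl
    | of j c =>
      have h := partSum_lof j c
      rw [DirectSum.lof_eq_of] at h
      rw [h, partProj_of_mem i j c.2]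
      split_ifs with hji
      · subst hji
        rw [DirectSum.of_eq_same]
      · rw [DirectSum.of_eq_of_ne _ _ _ (Ne.symm hji)]
        rfl
  refine DirectSum.ext_component R fun i => Subtype.ext ?_
  refine (key v i).symm.trans ?_
  rw [hv, map_zero]
  rfl

/-- An element is decomposed by degree, then by the right coaction, then by the left one. -/
theorem partSum_surjective : Function.Surjective C.partSum := by
  classical
  rw [← LinearMap.range_eq_top, eq_top_iff]
  rintro c -
  refine graded_induction C.grading (p := fun c => c ∈ LinearMap.range C.partSum) (zero_mem _)
    (fun a b => add_mem) (fun n c hc => ?_) c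
  obtain ⟨s, hs⟩ := exists_eq_sum_actR c
  rw [hs s subset_rfl]
  refine Submodule.sum_mem _ fun y _ => ?_
  obtain ⟨t, ht⟩ := exists_sum_actL (actR (coord y) c)
  rw [ht t subset_rfl]
  refine Submodule.sum_mem _ fun x _ => ?_
  exact ⟨_, partSum_lof (x, y, n) ⟨_, actL_actR_coord_mem x y hc⟩⟩

variable (C) in
/-- A categorical coalgebra is the direct sum of its components. -/
def partEquiv : C.PartSum ≃ₗ[R] C.carrier :=
  LinearEquiv.ofBijective C.partSum ⟨partSum_injective, partSum_surjective⟩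

/-- The linear map with prescribed restrictions to the components. -/
def partLift {X : Type*} [AddCommGroup X] [Module R X] (f : ∀ x y n, C.part x y n →ₗ[R] X) :
    C.carrier →ₗ[R] X :=
  open Classical in
  DirectSum.toModule R (C.Ob × C.Ob × ℕ) X (fun i => f i.1 i.2.1 i.2.2) ∘ₗ
    (partEquiv C).symm.toLinearMap

theorem partLift_of_mem {X : Type*} [AddCommGroup X] [Module R X]
    (f : ∀ x y n, C.part x y n →ₗ[R] X) {x y : C.Ob} {n : ℕ} {c : C.carrier}
    (hc : c ∈ C.part x y n) : partLift f c = f x y n ⟨c, hc⟩ := by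
  classical
  have h : (partEquiv C).symm c = DirectSum.lof R _
      (fun i : C.Ob × C.Ob × ℕ => C.part i.1 i.2.1 i.2.2) (x, y, n) ⟨c, hc⟩ := by
    rw [LinearEquiv.symm_apply_eq]
    exact (partSum_lof (x, y, n) ⟨c, hc⟩).symm
  rw [partLift, LinearMap.comp_apply, LinearEquiv.coe_coe, h, DirectSum.toModule_lof]

/-! ### Splitting the first letter off a word -/

theorem toWords_of_injective {x y : C.cobar.Obj} {n : ℕ} {a b : C.cobar.Hom x y n}
    (h : C.toWords (C.cobar.of x y n a) = C.toWords (C.cobar.of x y n b)) : a = b :=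
  Subtype.ext ((toWords_of _).symm.trans (h.trans (toWords_of _)))

/-- The morphism of the cobar construction given by a single letter. -/
def letterOf (x y : C.Ob) (k : ℕ) : C.part x y (k + 1) →ₗ[R] C.cobar.Tot :=
  (cobarOf x y k ∘ₗ (TensorAlgebra.ι R).restrict fun _ => ι_mem_cobarHom :
    C.part x y (k + 1) →ₗ[R] C.preCobar.Tot)

theorem letterOf_eq {x y : C.cobar.Obj} {k : ℕ} {c : C.carrier} (hc : c ∈ C.part x y (k + 1))
    {a : C.cobar.Hom x y k} (h : C.toWords (C.cobar.of x y k a) = TensorAlgebra.ι R c) :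
    letterOf x y k ⟨c, hc⟩ = C.cobar.of x y k a := by
  refine congrArg (C.cobar.of x y k) (toWords_of_injective ?_)
  rw [h]
  exact toWords_of _

variable (C) in
/-- The map sending an element of the coalgebra to the corresponding word of length one, elements of
degree zero being sent to zero. -/
def letters : C.carrier →ₗ[R] C.cobar.Tot :=
  partLift fun x y n => match n with
    | 0 => 0
    | k + 1 => letterOf x y k

theorem letters_eq {x y : C.cobar.Obj} {k : ℕ} {c : C.carrier} (hc : c ∈ C.part x y (k + 1))
    {a : C.cobar.Hom x y k} (h : C.toWords (C.cobar.of x y k a) = TensorAlgebra.ι R c) :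
    C.letters c = C.cobar.of x y k a :=
  (partLift_of_mem _ hc).trans (letterOf_eq hc h)

/-- The map sending a composable word ending at `y` to the corresponding morphism. -/
def ofWords (y : C.cobar.Obj) : C.Words →ₗ[R] C.cobar.Tot :=
  wordFold (C.cobar.mul ∘ₗ C.letters) (C.cobar.of y y 0 (C.cobar.one y))

theorem toWords_one (x : C.cobar.Obj) : C.toWords (C.cobar.of x x 0 (C.cobar.one x)) = 1 :=
  toWords_of _

/-- Induction on the morphisms of the cobar construction. -/
theorem cobarHom_induction {p : C.cobar.Obj → C.cobar.Obj → ℕ → C.cobar.Tot → Prop}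
    (zero : ∀ x y n, p x y n 0) (add : ∀ x y n a b, p x y n a → p x y n b → p x y n (a + b))
    (smul : ∀ x y n (r : R) a, p x y n a → p x y n (r • a))
    (one : ∀ x, p x x 0 (C.cobar.of x x 0 (C.cobar.one x)))
    (mul : ∀ (x y z : C.cobar.Obj) (k n : ℕ) (c : C.carrier) (_ : c ∈ C.part x y (k + 1))
      (a : C.cobar.Hom x y k) (_ : C.toWords (C.cobar.of x y k a) = TensorAlgebra.ι R c)
      (b : C.cobar.Hom y z n), p y z n (C.cobar.of y z n b) →
      p x z (k + n) (C.cobar.mul (C.cobar.of x y k a) (C.cobar.of y z n b)))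
    {x y : C.cobar.Obj} {n : ℕ} (a : C.cobar.Hom x y n) : p x y n (C.cobar.of x y n a) := by
  -- The induction takes place on the words in the tensor algebra. It finds some morphism with the
  -- given word, and a morphism is determined by its word.
  have key : ∀ t ∈ C.cobarHom x y n, ∃ a : C.cobar.Hom x y n,
      C.toWords (C.cobar.of x y n a) = t ∧ p x y n (C.cobar.of x y n a) := by
    clear a
    have hm : ∀ (x y z : C.cobar.Obj) (k n : ℕ) (c : C.carrier) (_ : c ∈ C.part x y (k + 1))
        (b : C.cobar.Hom y z n) (_ : p y z n (C.cobar.of y z n b)), ∃ a : C.cobar.Hom x z (k + n),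
        C.toWords (C.cobar.of x z (k + n) a) = TensorAlgebra.ι R c *
          C.toWords (C.cobar.of y z n b) ∧ p x z (k + n) (C.cobar.of x z (k + n) a) := by
      intro x y z k n c hc b hb
      obtain ⟨a, ha⟩ := exists_toWords_eq (ι_mem_cobarHom hc)
      have h := mul x y z k n c hc a ha b hb
      have h' := toWords_mul a b
      rw [PreDGCat.mul_of_of] at h h'
      exact ⟨_, by rw [h', ha], h⟩
    intro t ht
    induction ht using Submodule.span_induction with
    | mem t ht =>
      induction ht with
      | nil x => exact ⟨C.cobar.one x, toWords_one x, one x⟩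
      | @cons x y z k n c t hc _ ih =>
        obtain ⟨b, rfl, hb⟩ := ih
        exact hm x y z k n c hc b hb
    | zero => exact ⟨0, by rw [map_zero, map_zero], by rw [map_zero]; exact zero x y n⟩
    | add s t _ _ hs ht =>
      obtain ⟨a, rfl, ha⟩ := hs
      obtain ⟨b, rfl, hb⟩ := ht
      exact ⟨a + b, by rw [map_add, map_add], by rw [map_add]; exact add x y n _ _ ha hb⟩
    | smul r t _ ht =>
      obtain ⟨a, rfl, ha⟩ := ht
      exact ⟨r • a, by rw [map_smul, map_smul], by rw [map_smul]; exact smul x y n r _ ha⟩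
  obtain ⟨b, hb, h⟩ := key _ (toWords_mem a)
  rwa [toWords_of_injective hb] at h

/-- The target y has to be prescribed, because the empty word does not remember its object; the
sources are then read off from the letters. -/
theorem ofWords_toWords {x y : C.cobar.Obj} {n : ℕ} (a : C.cobar.Hom x y n) :
    ofWords y (C.toWords (C.cobar.of x y n a)) = C.cobar.of x y n a := by
  refine cobarHom_induction (p := fun x y n a => ofWords y (C.toWords a) = a) ?_ ?_ ?_ ?_ ?_ a
  · simp
  · intro x y n a b ha hb
    rw [map_add, map_add, ha, hb]
  · intro x y n r a ha
    rw [map_smul, map_smul, ha]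
  · intro x
    rw [toWords_one, ofWords, wordFold_one]
  · intro x y z k n c hc a ha b hb
    rw [toWords_mul, ha, ofWords, wordFold_cons, ← ofWords, hb, LinearMap.comp_apply,
      letters_eq hc ha]

variable (C) in
/-- The map splitting the first letter off a word, up to sign. -/
def splitFirst : C.cobar.Tot →ₗ[R] C.cobar.Tot ⊗[R] C.cobar.Tot :=
  C.cobar.lift fun x y n =>
    TensorProduct.map (C.cobar.sgn ∘ₗ C.letters) (ofWords y) ∘ₗ uncons ∘ₗ C.toWords ∘ₗ C.cobar.of x y n

theorem splitFirst_of {x y : C.cobar.Obj} {n : ℕ} (a : C.cobar.Hom x y n) :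
    C.splitFirst (C.cobar.of x y n a) = TensorProduct.map (C.cobar.sgn ∘ₗ C.letters) (ofWords y)
      (uncons (C.toWords (C.cobar.of x y n a))) :=
  PreDGCat.lift_of _ x y n a

/-- The morphisms of the cobar construction given by words of length one. -/
def IsLetter (x y : C.cobar.Obj) (n : ℕ) (a : C.cobar.Hom x y n) : Prop :=
  ∃ c ∈ C.part x y (n + 1), C.toWords (C.cobar.of x y n a) = TensorAlgebra.ι R c

/-- Concatenation in the tensor algebra is free, so the first letter is well defined even for linear
combinations. The involution in `splitFirst` yields the sign. -/
theorem splitFirst_mul {x y z : C.cobar.Obj} {m n : ℕ} {c : C.cobar.Hom x y m}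
    (hc : IsLetter x y m c) (a : C.cobar.Hom y z n) :
    C.splitFirst (C.cobar.mul (C.cobar.of x y m c) (C.cobar.of y z n a)) =
      (-1 : R) ^ m • (C.cobar.of x y m c ⊗ₜ C.cobar.of y z n a) := by
  obtain ⟨c', hc', h⟩ := hc
  have h' := toWords_mul c a
  rw [PreDGCat.mul_of_of] at h' ⊢
  rw [splitFirst_of, h', h, uncons_cons, TensorProduct.map_tmul, ofWords_toWords,
    LinearMap.comp_apply, letters_eq hc' h, PreDGCat.sgn_of]
  rfl

end CategoricalCoalgebra
-- Cycles and boundaries in the normalized complex, on representatives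
namespace DGCat

variable {R : Type u} [CommRing R] {A : DGCat.{u, v, w} R}

theorem hochDiff_mem_of_mem_cycles {n : ℕ} {z : A.Monomials} (hz : z ∈ A.chains n)
    (h : Subquotient.mk (A.chains n) (A.degenerate n) ⟨z, hz⟩ ∈ A.hoch.cycles n) :
    A.hochDiff z ∈ A.lowerDegenerate n := by
  cases n with
  | zero =>
    rw [hochDiff_zero hz]
    exact zero_mem _
  | succ n => exact (Subquotient.mk_eq_zero (P := A.chains n)).1 h

theorem hoch_b_mk_eq {n : ℕ} {y z : A.Monomials} (hy : y ∈ A.chains (n + 1)) (hz : z ∈ A.chains n)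
    (h : z - A.hochDiff y ∈ A.degenerate n) :
    A.hoch.b n (Subquotient.mk (A.chains (n + 1)) (A.degenerate (n + 1)) ⟨y, hy⟩) =
      Subquotient.mk (A.chains n) (A.degenerate n) ⟨z, hz⟩ := by
  refine (sub_eq_zero.1 ?_).symm
  exact (Subquotient.mk_eq_zero (P := A.chains n)
    (z := ⟨z, hz⟩ - ⟨_, hochDiff_mem n _ hy⟩)).2 h

end DGCat

/-! ### Letters and weights in the cobar construction -/

namespace CategoricalCoalgebra

variable {R : Type u} [CommRing R] {C : CategoricalCoalgebra.{u, v} R}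

theorem of_mem_span_letterWords {x y : C.cobar.Obj} {n : ℕ} (a : C.cobar.Hom x y n) :
    C.cobar.of x y n a ∈ Submodule.span R {a | ∃ l, DGCat.IsLetterWord (A := C.cobar)
      (fun x y n => {a | IsLetter x y n a}) x y n l a} := by
  refine cobarHom_induction (p := fun x y n a => a ∈ Submodule.span R {a | ∃ l,
    DGCat.IsLetterWord (A := C.cobar) (fun x y n => {a | IsLetter x y n a}) x y n l a})
    (fun _ _ _ => zero_mem _) (fun _ _ _ _ _ => add_mem)
    (fun _ _ _ r _ => Submodule.smul_mem _ r)
    (fun x => Submodule.subset_span ⟨0, .one x⟩) (fun x y z k n c hc a ha b hb => ?_) a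
  refine Submodule.span_induction (p := fun b _ => C.cobar.mul (C.cobar.of x y k a) b ∈
    Submodule.span R {a | ∃ l, DGCat.IsLetterWord (A := C.cobar)
      (fun x y n => {a | IsLetter x y n a}) x z (k + n) l a}) ?_ ?_ ?_ ?_ hb
  · rintro b ⟨l, hb⟩
    exact Submodule.subset_span ⟨l + 1, .cons ⟨c, hc, ha⟩ hb⟩
  · rw [map_zero]
    exact zero_mem _
  · intro b b' _ _ h h'
    rw [map_add]
    exact add_mem h h'
  · intro r b _ h
    rw [map_smul]
    exact Submodule.smul_mem _ _ h

variable (C) in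
/-- The words that are linear combinations of composites of letters of weight at most `N`. -/
def wordSpan (x y : C.cobar.Obj) (n N : ℕ) : Submodule R C.Words :=
  ((DGCat.letterSpan (A := C.cobar) (fun x y n => {a | IsLetter x y n a}) x y n N).comap
    (C.cobar.of x y n)).map (C.toWords ∘ₗ C.cobar.of x y n)

theorem IsLetterWord.mem_wordSpan {x y : C.cobar.Obj} {n l N : ℕ} {a : C.cobar.Tot}
    (h : DGCat.IsLetterWord (A := C.cobar) (fun x y n => {a | IsLetter x y n a}) x y n l a)
    (hN : 2 * n + l ≤ N) : C.toWords a ∈ C.wordSpan x y n N := by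
  obtain ⟨b, rfl⟩ := h.exists_of
  exact ⟨b, h.mem hN, rfl⟩

theorem mem_letterSpan {x y : C.cobar.Obj} {n N : ℕ} {a : C.cobar.Hom x y n}
    (h : C.toWords (C.cobar.of x y n a) ∈ C.wordSpan x y n N) :
    C.cobar.of x y n a ∈
      DGCat.letterSpan (A := C.cobar) (fun x y n => {a | IsLetter x y n a}) x y n N := by
  obtain ⟨b, hb, h⟩ := h
  have e := toWords_of_injective h
  subst e
  exact hb

theorem isLetterWord_ι {x y : C.cobar.Obj} {n : ℕ} {c : C.carrier} (hc : c ∈ C.part x y (n + 1)) :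
    ∃ a : C.cobar.Tot, C.toWords a = TensorAlgebra.ι R c ∧ DGCat.IsLetterWord (A := C.cobar)
      (fun x y n => {a | IsLetter x y n a}) x y n 1 a := by
  obtain ⟨a, ha⟩ := exists_toWords_eq (ι_mem_cobarHom hc)
  exact ⟨_, ha, .letter ⟨c, hc, ha⟩⟩

theorem ι_mul_ι_mem_wordSpan {x y z : C.cobar.Obj} {m n N : ℕ} {a b : C.carrier}
    (ha : a ∈ C.part x y (m + 1)) (hb : b ∈ C.part y z (n + 1)) (hN : 2 * (m + n) + 2 ≤ N) :
    TensorAlgebra.ι R a * TensorAlgebra.ι R b ∈ C.wordSpan x z (m + n) N := by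
  obtain ⟨a, h, ha⟩ := isLetterWord_ι ha
  obtain ⟨b, h', hb⟩ := isLetterWord_ι hb
  have hab := ha.mul hb
  obtain ⟨a, rfl⟩ := ha.exists_of
  obtain ⟨b, rfl⟩ := hb.exists_of
  rw [← h, ← h', ← toWords_mul]
  exact IsLetterWord.mem_wordSpan hab hN

/-- The curvature, the internal differential and the reduced coproduct give words with zero, one and
two letters, all of degree n, so their weight is at most 2n + 2. -/
theorem cobarLetter_mem_wordSpan {x y : C.cobar.Obj} {n : ℕ} {c : C.carrier}
    (hc : c ∈ C.part x y (n + 2)) : C.cobarLetter c ∈ C.wordSpan x y n (2 * n + 2) := by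
  have hι : ∀ {n N : ℕ} {c : C.carrier}, c ∈ C.part x y (n + 1) → 2 * n + 1 ≤ N →
      TensorAlgebra.ι R c ∈ C.wordSpan x y n N := by
    intro n N c hc hN
    obtain ⟨a, ha, h⟩ := isLetterWord_ι hc
    rw [← ha]
    exact IsLetterWord.mem_wordSpan h hN
  rw [cobarLetter, LinearMap.sub_apply, LinearMap.sub_apply]
  refine sub_mem (sub_mem ?_ (hι (diff_part_mem hc) (by omega))) ?_
  -- The curvature contributes only in degree two, and only if the two end points agree; it is then
  -- a multiple of the empty word.
  · by_cases hn : n = 0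
    · subst hn
      rcases curv_part hc with h | h
      · subst h
        rw [LinearMap.comp_apply, Algebra.linearMap_apply, Algebra.algebraMap_eq_smul_one]
        refine Submodule.smul_mem _ _ ?_
        rw [← toWords_one x]
        exact IsLetterWord.mem_wordSpan (.one x) (by omega)
      · rw [LinearMap.comp_apply, h, map_zero]
        exact zero_mem _
    · rw [LinearMap.comp_apply, C.curv_eq_zero (n + 2) (by omega) c (C.mem_part.1 hc).1, map_zero]
      exact zero_mem _
  · refine conv_mem hc _ _ _ ?_
    intro z i j hij a ha b hb
    rcases i with _ | i
    · rw [LinearMap.comp_apply, LinearMap.comp_apply, bar_of_mem_zero (C.mem_part.1 ha).1, map_zero,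
        map_zero, zero_mul]
      exact zero_mem _
    rcases j with _ | j
    · rw [LinearMap.comp_apply (g := C.bar), bar_of_mem_zero (C.mem_part.1 hb).1, map_zero, mul_zero]
      exact zero_mem _
    obtain rfl : n = i + j := by omega
    have ha' := (C.mem_part.1 ha).1
    simp only [LinearMap.comp_apply]
    rw [bar_of_mem (by omega) ha', bar_of_mem (by omega) (C.mem_part.1 hb).1, sgn_of_mem ha',
      map_smul, smul_mul_assoc]
    refine Submodule.smul_mem _ _ ?_
    exact ι_mul_ι_mem_wordSpan ha hb (by omega)

variable (C) in
/-- The cobar construction is freely generated by the words of length one. -/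
def letterSplitting : C.cobar.LetterSplitting where
  letter x y n := {a | IsLetter x y n a}
  split := C.splitFirst
  split_one x := by rw [splitFirst_of, toWords_one, uncons_one, map_zero]
  split_mul hc a := splitFirst_mul hc a
  mem_span := of_mem_span_letterWords
  d_letter := by
    rintro x y n c ⟨c', hc', h⟩
    have h' := toWords_dTot c
    rw [h, cobarDiff_ι] at h'
    rw [PreDGCat.dTot_of_succ] at h' ⊢
    refine mem_letterSpan ?_
    rw [h']
    exact cobarLetter_mem_wordSpan hc'

/-! ### A section of the comparison map -/

variable (C) in
/-- The section `c {w} ↦ [{c}] w`, `x {w} ↦ [ ] w` of the comparison map. -/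
def piSection : C.CoMonomials →ₗ[R] C.cobar.Monomials :=
  TensorProduct.lift (partLift fun x y n => match n with
    | 0 => (C.counit.domRestrict (C.part x y 0)).smulRight
        (TensorProduct.mk R C.cobar.Words C.cobar.Tot 1 ∘ₗ ofWords x)
    | k + 1 => (TensorProduct.mk R C.cobar.Words C.cobar.Tot ∘ₗ TensorAlgebra.ι R ∘ₗ
        letterOf x y k).compl₂ (ofWords x))

theorem piSection_ob {x : C.cobar.Obj} {n : ℕ} (b : C.cobar.Hom x x n) :
    C.piSection (point x ⊗ₜ C.toWords (C.cobar.of x x n b)) = 1 ⊗ₜ C.cobar.of x x n b := by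
  have h : point x ∈ C.part x x 0 := C.ob_mem_part x
  have h1 : C.counit (point x) = 1 := counit_ob (C := C) x
  rw [piSection, TensorProduct.lift.tmul, partLift_of_mem _ h]
  change (C.counit (point x) • (TensorProduct.mk R C.cobar.Words C.cobar.Tot 1 ∘ₗ ofWords x) :
    C.Words →ₗ[R] C.cobar.Monomials) _ = _
  rw [h1, one_smul, LinearMap.comp_apply, ofWords_toWords]
  rfl

theorem piSection_letter {x y : C.cobar.Obj} {k n : ℕ} {c : C.carrier}
    (hc : c ∈ C.part x y (k + 1)) {a : C.cobar.Hom x y k}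
    (h : C.toWords (C.cobar.of x y k a) = TensorAlgebra.ι R c) (b : C.cobar.Hom y x n) :
    C.piSection (c ⊗ₜ C.toWords (C.cobar.of y x n b)) =
      C.cobar.cons (C.cobar.of x y k a) (1 ⊗ₜ C.cobar.of y x n b) := by
  rw [piSection, TensorProduct.lift.tmul, partLift_of_mem _ hc]
  change TensorAlgebra.ι R (letterOf x y k ⟨c, hc⟩) ⊗ₜ ofWords x _ = _
  rw [letterOf_eq hc h, ofWords_toWords, DGCat.cons_tmul, mul_one]

/-- The recursion for products is the Leibniz rule for `rotateInto` with a single letter as first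
factor. The last condition holds because the comparison map commutes with the differentials and
vanishes on the image of the homotopy. -/
theorem isProjection_piSection :
    C.letterSplitting.IsProjection (C.piSection ∘ₗ C.piMonomials) where
  nil b := by rw [LinearMap.comp_apply, piMonomials_one, piZero_of', piSection_ob]
  cons_one {x n} b := by
    have h : C.rotateInto 1 (C.toWords (C.cobar.of x x n b)) = 0 := rotateInto_one _
    rw [LinearMap.comp_apply, piMonomials_cons_nil, toWords_one, h, map_zero]
  cons_mul {x y z m n j c} hc a b := by
    obtain ⟨c', hc', h⟩ := hc
    rw [LinearMap.comp_apply, LinearMap.comp_apply, piMonomials_cons_nil, piMonomials_cons_nil,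
      toWords_mul, toWords_mul, rotateInto_mul (toWords_mem c) (wsgn_of_mem (toWords_mem a))
        (wsgn_of_mem (toWords_mem b)), h, rotateInto_ι, map_add, map_smul, ← toWords_mul,
      PreDGCat.mul_of_of, piSection_letter hc' h]
  cons_cons a b z := by rw [LinearMap.comp_apply, piMonomials_cons_cons, map_zero]
  hochDiff_homotopy hz := by
    rw [LinearMap.comp_apply, piMonomials_hochDiff (C.letterSplitting.homotopy_mem_chains hz),
      C.letterSplitting.comp_homotopy_eq_zero piMonomials_cons_cons, map_zero, map_zero]

/-! ### The comparison map is a quasi-isomorphism -/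

theorem piBar_mk {n : ℕ} {z : C.cobar.Monomials} (hz : z ∈ C.cobar.chains n) :
    C.piBar n (Subquotient.mk (C.cobar.chains n) (C.cobar.degenerate n) ⟨z, hz⟩) =
      ⟨C.piMonomials z, piMonomials_mem n z hz⟩ := rfl

theorem piBar_mk_eq_zero {n : ℕ} {z : C.cobar.Monomials} (hz : z ∈ C.cobar.chains n) :
    C.piBar n (Subquotient.mk (C.cobar.chains n) (C.cobar.degenerate n) ⟨z, hz⟩) = 0 ↔
      C.piMonomials z = 0 := by
  rw [piBar_mk]
  exact Submodule.mk_eq_zero _ _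

theorem exists_isProjection : ∃ (S : C.cobar.LetterSplitting)
    (J : C.cobar.Monomials →ₗ[R] C.cobar.Monomials),
    S.IsProjection J ∧ ∀ z, C.piMonomials z = 0 → J z = 0 :=
  ⟨_, _, isProjection_piSection, fun z h => by rw [LinearMap.comp_apply, h, map_zero]⟩

/-- The primitive is the homotopy of some chain, so it automatically lies in the kernel of the
comparison map. -/
theorem exists_primitive {n : ℕ} {z : C.cobar.Monomials} (hz : z ∈ C.cobar.chains n)
    (hd : C.cobar.hochDiff z ∈ C.cobar.lowerDegenerate n) (h : C.piMonomials z = 0) :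
    ∃ w ∈ C.cobar.chains (n + 1), C.piMonomials w = 0 ∧
      z - C.cobar.hochDiff w ∈ C.cobar.degenerate n := by
  obtain ⟨S, J, hJ, hπ⟩ := exists_isProjection (C := C)
  obtain ⟨y, hy, h⟩ := hJ.exists_hochDiff_homotopy hz hd (hπ z h)
  exact ⟨S.homotopy y, S.homotopy_mem_chains hy,
    S.comp_homotopy_eq_zero (f := C.piMonomials) piMonomials_cons_cons y, h⟩

theorem piBar_acyclic (n : ℕ) (z : C.cobar.hoch.X n) (hz : z ∈ C.cobar.hoch.cycles n)
    (h : C.piBar n z = 0) : ∃ y, C.piBar (n + 1) y = 0 ∧ C.cobar.hoch.b n y = z := by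
  obtain ⟨⟨z, hc⟩, rfl⟩ := Subquotient.mk_surjective (P := C.cobar.chains n)
    (Q := C.cobar.degenerate n) z
  obtain ⟨w, hw, hπ, h⟩ := exists_primitive hc (DGCat.hochDiff_mem_of_mem_cycles hc hz)
    ((piBar_mk_eq_zero hc).1 h)
  exact ⟨_, (piBar_mk_eq_zero hw).2 hπ, DGCat.hoch_b_mk_eq hw hc h⟩

end CategoricalCoalgebra

/-! ### Surjections with acyclic kernel -/

namespace PreMixedComplex

variable {R : Type u} [CommRing R] {M N : PreMixedComplex.{u, v} R}

/-- A surjective morphism with acyclic kernel induces an isomorphism on homology. -/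
theorem IsMorphism.bijective_homologyMap {f : GradedMap M N} (hf : IsMorphism f)
    (hM : ∀ n, M.b n ∘ₗ M.b (n + 1) = 0) (hs : ∀ n, Function.Surjective (f n))
    (h : ∀ n z, z ∈ M.cycles n → f n z = 0 → ∃ y, f (n + 1) y = 0 ∧ M.b n y = z) (n : ℕ) :
    Function.Bijective (homologyMap f hf n) := by
  have hb : ∀ n z, f n (M.b n z) = N.b n (f (n + 1) z) := fun n z =>
    LinearMap.congr_fun (hf.comm_b n) z
  have hcyc : ∀ n y, M.b n y ∈ M.cycles n := by
    intro n y
    cases n with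
    | zero => exact Submodule.mem_top
    | succ n => exact LinearMap.congr_fun (hM n) y
  constructor
  · refine (injective_iff_map_eq_zero _).2 fun z hz => ?_
    obtain ⟨⟨z, hc⟩, rfl⟩ := Submodule.mkQ_surjective _ z
    obtain ⟨w, hw⟩ : f n z ∈ N.boundaries n :=
      (Submodule.Quotient.mk_eq_zero ((N.boundaries n).submoduleOf (N.cycles n))).1 hz
    -- Subtracting the boundary of a lift y of w moves z into the kernel without changing its class.
    obtain ⟨y, rfl⟩ := hs _ w
    obtain ⟨y', -, hy'⟩ := h n (z - M.b n y) (sub_mem hc (hcyc n y))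
      (by rw [map_sub, hb, hw, sub_self])
    refine (Submodule.Quotient.mk_eq_zero ((M.boundaries n).submoduleOf (M.cycles n))).2 ?_
    exact ⟨y' + y, by rw [map_add, hy', sub_add_cancel]; rfl⟩
  · intro c
    obtain ⟨⟨c, hc⟩, rfl⟩ := Submodule.mkQ_surjective _ c
    obtain ⟨z, rfl⟩ := hs n c
    have key : ∃ z' ∈ M.cycles n, f n z' = f n z := by
      cases n with
      | zero => exact ⟨z, Submodule.mem_top, rfl⟩
      | succ n =>
        have hc' : N.b n (f (n + 1) z) = 0 := hc
        -- The boundary of a lift z of the cycle is a cycle in the kernel, hence the boundary of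
        -- some y in the kernel. Then z - y is a cycle with the same image as z.
        obtain ⟨y, hy, hy'⟩ := h n (M.b n z) (hcyc n z) (by rw [hb, hc'])
        exact ⟨z - y, by
          change M.b n (z - y) = 0
          rw [map_sub, hy', sub_self], by rw [map_sub, hy, sub_zero]⟩
    obtain ⟨z', hz', e⟩ := key
    exact ⟨Submodule.mkQ _ ⟨z', hz'⟩, congrArg (Submodule.mkQ _) (Subtype.ext e)⟩

end PreMixedComplex

/-! ### The quasi-isomorphism -/

namespace CategoricalCoalgebra

variable {R : Type u} [CommRing R]

theorem piBar_isQuasiIso (C : CategoricalCoalgebra.{u, v} R) :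
    PreMixedComplex.IsQuasiIso C.piBar :=
  ⟨piBar_isMorphism, piBar_isMorphism.bijective_homologyMap
    (DGCat.hoch_isMixedComplex C.cobar).b_b piBar_surjective piBar_acyclic⟩

end CategoricalCoalgebra
end CobarHoch
end

theorem mainTheorem5 {R : Type u} [CommRing R] :
    (∀ C : CobarHoch.CategoricalCoalgebra.{u, v} R,
      C.cobar.hoch.IsMixedComplex ∧ C.coHoch.IsMixedComplex ∧
        CobarHoch.PreMixedComplex.IsQuasiIso C.piBar) ∧
    (∀ (C C' : CobarHoch.CategoricalCoalgebra.{u, v} R)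
      (f : CobarHoch.CategoricalCoalgebra.Hom C C'),
      CobarHoch.PreMixedComplex.IsMorphism f.cobarMap.hochMap ∧
        CobarHoch.PreMixedComplex.IsMorphism f.coHochMap ∧
        ∀ n, f.coHochMap n ∘ₗ C.piBar n = C'.piBar n ∘ₗ f.cobarMap.hochMap n) :=
  ⟨fun C => ⟨CobarHoch.DGCat.hoch_isMixedComplex _,
    CobarHoch.CategoricalCoalgebra.coHoch_isMixedComplex C,
    CobarHoch.CategoricalCoalgebra.piBar_isQuasiIso C⟩,
  fun _ _ f => ⟨f.cobarMap.hochMap_isMorphism, f.coHochMap_isMorphism, f.coHochMap_piBar⟩⟩
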